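/- **Scalar-tensor theories.** Fields are a Lorentzian metric $g_{ab}$ (signature $-+++$) and a scalar $\phi$ on four-dimensional spacetime. A *second-order scalar-tensor theory* is an action $S=\int\mathcal L\,d^4x$ whose Lagrangian density $\mathcal L$ is a smooth local function of $g_{ab},\phi$ and finitely many of their derivatives, is diffeomorphism-covariant (transforms as a scalar density), and is such that $E^{[g]}_{ab}=(-g)^{-1/2}\delta S/\delta g^{ab}$ and $E^{[\phi]}=(-g)^{-1/2}\delta S/\delta\phi$ are smooth local differential operators of second order in $(g_{ab},\phi)$. *Einstein–scalar theory* is $\mathcal L=\sqrt{-g}\,(R-2g^{ab}\nabla_a\phi\nabla_b\phi)$, with $E^{[g]}_{ab}=G_{ab}-2(\nabla_a\phi\nabla_b\phi-\tfrac12g_{ab}g^{cd}\nabla_c\phi\nabla_d\phi)$ and $E^{[\phi]}=4g^{ab}\nabla_a\nabla_b\phi$. **Shrinking-body families.** Let $U\subseteq\mathbb R^4$ be an open range of coordinates $(t,x^i)$, $r=|x|$, and $\bar R,\Lambda>0$. For $0\le\lambda<\Lambda$ let $(g_{\mu\nu}(\lambda),\phi(\lambda))$ be given in these coordinates such that: (i)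 for $r>\lambda\bar R$ the $g_{\mu\nu}(\lambda)$ are Lorentzian metrics, $g_{\mu\nu},\phi$ are smooth in $(\lambda,t,x^i)$ and satisfy $E^{[g]}_{ab}=0$, $E^{[\phi]}=0$; at $\lambda=0$ the fields $(g^{(0)},\phi^{(0)})$ are smooth, and $g^{(0)}$ Lorentzian, on all of $U$ including $r=0$; the worldline $\gamma=\{\lambda=0,x^i=0\}$ is timelike; (ii) for each $t_0$ on the worldline, the components of $\bar g=\lambda^{-2}g$, $\bar\phi=\phi$ in the scaled coordinates $\bar t=(t-t_0)/\lambda$, $\bar x^i=x^i/\lambda$ extend to smooth functions of $(\lambda,\bar t,\bar x^i)$ for $\bar r=|\bar x|>\bar R$, including $\lambda=0$; their limits $\lambda\to0$ at fixed scaled coordinates are the *body exterior fields* $\bar g^{(0)}(t_0),\bar\phi^{(0)}(t_0)$; (iii) as functions of $\alpha=r$, $\beta=\lambda/r$, $t$ and the direction $x/r$, the fields are (extend to) smooth functions at $\alpha=\beta=0$. Let $g^{(1)},\phi^{(1)}$ be the $\lambda$-derivatives at $\lambda=0^+$ (for $r>0$), regarded as distributions on $U$, and let $E^{[g](1)}_{ab},E^{[\phi](1)}$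 be the linearizations of $E^{[g]}_{ab},E^{[\phi]}$ off $(g^{(0)},\phi^{(0)})$, extended to distributions by their formal adjoints. Let $u^a$ be the four-velocity, $\tau$ the proper time and $z(\tau)$ the parametrization of $\gamma$ in $g^{(0)}$; $\nabla$ is the derivative operator of $g^{(0)}$. **Theorem.** 1. Einstein–scalar theory, with the $E^{[g]}_{ab},E^{[\phi]}$ displayed above, is a second-order scalar-tensor theory. 2. For every second-order scalar-tensor theory and every shrinking-body family of it there are functions $M$ (differentiable) and $q$ (continuous) on $\gamma$ such that, distributionally on $U$, $$E^{[g](1)}_{ab}[g^{(1)},\phi^{(1)}]=8\pi\int_\gamma M u_au_b\,\delta_4(x,z(\tau))\,d\tau,\qquad E^{[\phi](1)}[g^{(1)},\phi^{(1)}]=-16\pi\int_\gamma q\,\delta_4(x,z(\tau))\,d\tau,$$ and on $\gamma$ $$M u^b\nabla_bu^a=q\,(g^{ab}+u^au^b)\nabla_b\phi^{(0)},\qquad u^a\nabla_aM=-q\,u^a\nabla_a\phi^{(0)}.$$ 3. In Einstein–scalar theory, moreover, $M$ and $q$ at each time $t_0$ are the ADM mass and scalar monopole charge of the body exterior fields at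 $t_0$: after any linear change of the scaled coordinates that keeps the direction of the time axis and makes the constant metric $g^{(0)}_{\mu\nu}|_{\gamma(t_0)}$ Minkowskian, $\bar g^{(0)}$ is asymptotically flat with $$M=\frac1{16\pi}\lim_{\rho\to\infty}\oint_{r=\rho}(\partial_jh_{ij}-\partial_ih_{jj})n^i\,dS,\qquad h_{ij}=\bar g^{(0)}_{ij},$$ and $\bar\phi^{(0)}=\phi^{(0)}|_{\gamma(t_0)}+q/r+O(1/r^2)$. 4. The laws of motion leave $q$ unconstrained: for any smooth Lorentzian metric $g$ and smooth scalar $\phi$ on an open set of $\mathbb R^4$, any continuous function $q$ of proper time, any initial point, any initial unit timelike four-velocity and any initial mass $M_0\neq0$ there is, on some interval of proper time about $0$, a worldline with a mass function $M$ that has these initial data and satisfies $Mu^b\nabla_bu^a=q(g^{ab}+u^au^b)\nabla_b\phi$ and $u^a\nabla_aM=-q\,u^a\nabla_a\phi$. -/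

import Mathlib

open MeasureTheory Filter Topology Set
open scoped ContDiff BigOperators Matrix

namespace SmallBody

noncomputable section

/-! ### Points, fields, jets -/

/-- Coordinates `(t, x¹, x², x³)`; the index `0` is time. -/
abbrev STPoint : Type := Fin 4 → ℝ

/-- Euclidean three-space of the spatial coordinates. -/
abbrev E3 : Type := EuclideanSpace ℝ (Fin 3)

/-- The point with time `t` and spatial coordinates `x`. -/
def pt (t : ℝ) (x : E3) : STPoint := ![t, x 0, x 1, x 2]

/-- The curve `xⁱ = 0`. -/
def worldline (t : ℝ) : STPoint := pt t 0

/-- `r = √(x¹² + x²² + x³²)`. -/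
def rad (x : STPoint) : ℝ := √((x 1) ^ 2 + (x 2) ^ 2 + (x 3) ^ 2)

/-- Values of a pair (rank-two tensor, scalar). A configuration of a scalar-tensor theory is a map
`STPoint → Val` with values `(g_{μν}, φ)`; test fields are maps with values `(f^{μν}, ω)`. -/
abbrev Val : Type := (Fin 4 → Fin 4 → ℝ) × ℝ

/-- Indices of the partial derivatives of order at most `k`. -/
abbrev JetIdx (k : ℕ) : Type := Σ m : Fin (k + 1), (Fin (m : ℕ) → Fin 4)

/-- Values of a configuration and of its partial derivatives of order at most `k` at a point. -/
abbrev Jet (k : ℕ) : Type := JetIdx k → Val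

/-- First partial derivative `∂_μ f`. -/
def pd {W : Type*} [NormedAddCommGroup W] [NormedSpace ℝ W] (μ : Fin 4) (f : STPoint → W) (x : STPoint) : W :=
  fderiv ℝ f x (Pi.single μ 1)

/-- Iterated partial derivative `∂_{I₁} ⋯ ∂_{I_m} f`. -/
def pdI {W : Type*} [NormedAddCommGroup W] [NormedSpace ℝ W] {k : ℕ} (I : JetIdx k)
    (f : STPoint → W) (x : STPoint) : W :=
  iteratedFDeriv ℝ (I.1 : ℕ) f x (fun a => Pi.single (I.2 a) 1)

/-- The `k`-jet of a configuration at `x`. -/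
def jet (k : ℕ) (Φ : STPoint → Val) (x : STPoint) : Jet k := fun I => pdI I Φ x

/-- The zeroth-order index. -/
def idx0 (k : ℕ) : JetIdx k := ⟨0, fun _ => 0⟩

/-- The index of `∂_α`. -/
def idx1 (α : Fin 4) : JetIdx 2 := ⟨1, fun _ => α⟩

/-- The index of `∂_α ∂_β`. -/
def idx2 (α β : Fin 4) : JetIdx 2 := ⟨2, fun a => if (a : ℕ) = 0 then α else β⟩

/-- A symmetric matrix of signature `(-,+,+,+)`. -/
def IsLorentzian (g : Fin 4 → Fin 4 → ℝ) : Prop :=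
  ∃ P : Matrix (Fin 4) (Fin 4) ℝ, IsUnit P.det ∧
    Pᵀ * Matrix.of g * P = Matrix.diagonal ![-1, 1, 1, 1]

/-- The inverse metric `g^{μν}`. -/
def invMetric (g : Fin 4 → Fin 4 → ℝ) : Matrix (Fin 4) (Fin 4) ℝ := (Matrix.of g)⁻¹

/-- `√(-g)`. -/
def sqrtNegDet (g : Fin 4 → Fin 4 → ℝ) : ℝ := √(-(Matrix.of g).det)

/-- The contraction `f^{ab} e_{ab} + ω e`. -/
def pair (f e : Val) : ℝ := (∑ a, ∑ b, f.1 a b * e.1 a b) + f.2 * e.2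

/-- Pullback of (covariant rank-two tensor, scalar) along `ψ`. -/
def pullback (ψ : STPoint → STPoint) (Φ : STPoint → Val) (x : STPoint) : Val :=
  (fun μ ν => ∑ ρ, ∑ σ, pd μ ψ x ρ * pd ν ψ x σ * (Φ (ψ x)).1 ρ σ, (Φ (ψ x)).2)

/-- The Jacobian determinant of `ψ`. -/
def jacobian (ψ : STPoint → STPoint) (x : STPoint) : ℝ :=
  (Matrix.of fun μ ρ => pd μ ψ x ρ : Matrix (Fin 4) (Fin 4) ℝ).det

/-- Smooth field (or variation) with compact support in `W`. -/
def IsTest {X : Type*} [NormedAddCommGroup X] [NormedSpace ℝ X] (W : Set STPoint) (f : STPoint → X) : Prop :=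
  ContDiff ℝ ∞ f ∧ HasCompactSupport f ∧ tsupport f ⊆ W

/-! ### Scalar-tensor theories -/

/-- The local Lagrangian density `L` (a function of the fields and of their derivatives of order
at most `k`) is diffeomorphism-covariant: it transforms as a scalar density. Here `ψ` is a smooth
map that is an orientation-preserving diffeomorphism from a neighbourhood of `x` onto a
neighbourhood of `ψ x`. -/
def IsCovariantDensity (k : ℕ) (L : Jet k → ℝ) : Prop :=
  ∀ (ψ : STPoint → STPoint) (Φ : STPoint → Val) (x : STPoint), ContDiffAt ℝ ∞ ψ x → 0 < jacobian ψ x →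
    ContDiffAt ℝ ∞ Φ (ψ x) → (∀ᶠ y in 𝓝 (ψ x), IsLorentzian (Φ y).1) →
      L (jet k (pullback ψ Φ) x) = jacobian ψ x * L (jet k Φ (ψ x))

/-- `E = (E^{[g]}_{ab}, E^{[φ]})` is the functional derivative of the action `S = ∫ L d⁴x`, i.e.
`E^{[g]}_{ab} = (-g)^{-1/2} δS/δg^{ab}` and `E^{[φ]} = (-g)^{-1/2} δS/δφ`: for a variation
`η = (δg_{ab}, δφ)` of compact support, with `δg^{ab} = - g^{ac} δg_{cd} g^{db}`,
`δS = ∫ √(-g) (E^{[g]}_{ab} δg^{ab} + E^{[φ]} δφ) d⁴x`. -/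
def IsFunctionalDerivative (k : ℕ) (L : Jet k → ℝ) (E : Jet 2 → Val) : Prop :=
  (∀ (Φ : STPoint → Val) (x : STPoint), ContDiffAt ℝ ∞ Φ x → (∀ᶠ y in 𝓝 x, IsLorentzian (Φ y).1) →
    ∀ a b, (E (jet 2 Φ x)).1 a b = (E (jet 2 Φ x)).1 b a) ∧
  ∀ (W : Set STPoint) (Φ η : STPoint → Val), IsOpen W → ContDiffOn ℝ ∞ Φ W →
    (∀ x ∈ W, IsLorentzian (Φ x).1) → IsTest W η → (∀ x a b, (η x).1 a b = (η x).1 b a) →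
    HasDerivAt
      (fun s : ℝ => ∫ x in W, (L (jet k (fun y => Φ y + s • η y) x) - L (jet k Φ x)))
      (∫ x in W, sqrtNegDet (Φ x).1 *
        pair (fun a b => -(invMetric (Φ x).1 * Matrix.of (η x).1 * invMetric (Φ x).1) a b, (η x).2)
          (E (jet 2 Φ x)))
      0

/-- `L` is a diffeomorphism-covariant local Lagrangian density for a metric and a scalar field
whose field-equation operator `E` is a (local) second-order differential operator. -/
structure IsScalarTensorTheory (k : ℕ) (L : Jet k → ℝ) (E : Jet 2 → Val) : Prop where
  smooth_lagrangian : ∀ j : Jet k, IsLorentzian (j (idx0 k)).1 → ContDiffAt ℝ ∞ L j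
  covariant : IsCovariantDensity k L
  smooth_operator : ∀ j : Jet 2, IsLorentzian (j (idx0 2)).1 → ContDiffAt ℝ ∞ E j
  functional_derivative : IsFunctionalDerivative k L E

/-! ### Curvature and Einstein-scalar theory -/

section Curvature

variable (j : Jet 2)

/-- `g_{μν}`. -/
def jg (μ ν : Fin 4) : ℝ := (j (idx0 2)).1 μ ν

/-- `g^{μν}`. -/
def jinv (μ ν : Fin 4) : ℝ := invMetric (jg j) μ ν

/-- `∂_α g_{μν}`. -/
def jdg (α μ ν : Fin 4) : ℝ := (j (idx1 α)).1 μ ν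

/-- `∂_α ∂_β g_{μν}`. -/
def jddg (α β μ ν : Fin 4) : ℝ := (j (idx2 α β)).1 μ ν

/-- `∂_α φ`. -/
def jdphi (α : Fin 4) : ℝ := (j (idx1 α)).2

/-- `∂_α ∂_β φ`. -/
def jddphi (α β : Fin 4) : ℝ := (j (idx2 α β)).2

/-- `Γ^μ_{αβ}`. -/
def christoffel (μ α β : Fin 4) : ℝ :=
  (1 / 2) * ∑ σ, jinv j μ σ * (jdg j α σ β + jdg j β σ α - jdg j σ α β)

/-- `∂_ρ g^{μν}`. -/
def jdinv (ρ μ ν : Fin 4) : ℝ := -∑ a, ∑ b, jinv j μ a * jdg j ρ a b * jinv j b ν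

/-- `∂_ρ Γ^μ_{αβ}`. -/
def dchristoffel (ρ μ α β : Fin 4) : ℝ :=
  (1 / 2) * ∑ σ, (jdinv j ρ μ σ * (jdg j α σ β + jdg j β σ α - jdg j σ α β) +
    jinv j μ σ * (jddg j ρ α σ β + jddg j ρ β σ α - jddg j ρ σ α β))

/-- The Ricci tensor. -/
def ricci (α β : Fin 4) : ℝ :=
  ∑ μ, (dchristoffel j μ μ α β - dchristoffel j β μ μ α) +
    ∑ μ, ∑ ν, (christoffel j μ μ ν * christoffel j ν α β -
      christoffel j μ β ν * christoffel j ν μ α)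

/-- The Ricci scalar. -/
def scalarCurv : ℝ := ∑ α, ∑ β, jinv j α β * ricci j α β

/-- `g^{cd} ∇_c φ ∇_d φ`. -/
def gradSq : ℝ := ∑ c, ∑ d, jinv j c d * jdphi j c * jdphi j d

/-- The Einstein-scalar Lagrangian density `√(-g) (R - 2 g^{ab} ∇_a φ ∇_b φ)`. -/
def esLagrangian : ℝ := sqrtNegDet (jg j) * (scalarCurv j - 2 * gradSq j)

/-- The Einstein-scalar operators
`E^{[g]}_{ab} = G_{ab} - 2 (∇_a φ ∇_b φ - ½ g_{ab} g^{cd} ∇_c φ ∇_d φ)` and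
`E^{[φ]} = 4 g^{ab} ∇_a ∇_b φ`. -/
def esOperator : Val :=
  (fun a b => (ricci j a b - (1 / 2) * scalarCurv j * jg j a b) -
      2 * (jdphi j a * jdphi j b - (1 / 2) * jg j a b * gradSq j),
    4 * ∑ a, ∑ b, jinv j a b * (jddphi j a b - ∑ c, christoffel j c a b * jdphi j c))

end Curvature

/-! ### One-parameter families containing a shrinking body -/

/-- The scaled coordinates `(t̄, x̄ⁱ)` at `(t₀, l)` label the point `(t₀ + l t̄, l x̄ⁱ)`. -/
def scaleMap (t₀ l : ℝ) (x : STPoint) : STPoint := fun μ => worldline t₀ μ + l * x μ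

/-- The components, in the scaled coordinates, of the scaled fields `ḡ = l⁻² g` and `φ̄ = φ`. -/
def scaledField (Φ : ℝ → STPoint → Val) (t₀ l : ℝ) (x : STPoint) : Val :=
  (fun μ ν => (l ^ 2)⁻¹ * (pullback (scaleMap t₀ l) (Φ l) x).1 μ ν,
    (pullback (scaleMap t₀ l) (Φ l) x).2)

/-- The assumptions on a one-parameter family `Φ l = (g_{μν}(l), φ(l))`, `0 ≤ l < Λ`, given in
coordinates that range over the open set `U`. -/
structure IsSmallBodyFamily (E : Jet 2 → Val) (U : Set STPoint) (R Λ : ℝ) (Φ : ℝ → STPoint → Val) :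
    Prop where
  isOpen : IsOpen U
  R_pos : 0 < R
  Λ_pos : 0 < Λ
  lorentzian : ∀ l x, 0 ≤ l → l < Λ → x ∈ U → l * R < rad x → IsLorentzian (Φ l x).1
  lorentzian_zero : ∀ x ∈ U, IsLorentzian (Φ 0 x).1
  /-- Ordinary limit: smoothness in `(l, t, xⁱ)` outside the body. -/
  smooth : ContDiffOn ℝ ∞ (fun p : ℝ × STPoint => Φ p.1 p.2)
    {p | 0 ≤ p.1 ∧ p.1 < Λ ∧ p.2 ∈ U ∧ p.1 * R < rad p.2}
  /-- The background `l = 0` is smooth, at `r = 0` too. -/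
  smooth_zero : ContDiffOn ℝ ∞ (Φ 0) U
  field_eq : ∀ l x, 0 ≤ l → l < Λ → x ∈ U → l * R < rad x → E (jet 2 (Φ l) x) = 0
  timelike : ∀ t, worldline t ∈ U → (Φ 0 (worldline t)).1 0 0 < 0
  /-- Scaled limit: the scaled fields are (extend to) smooth functions of `(l, t̄, x̄ⁱ)`, also at
  `l = 0`, outside the body. -/
  scaled : ∀ t₀, worldline t₀ ∈ U → ∃ Ψ : ℝ → STPoint → Val,
    ContDiffOn ℝ ∞ (fun p : ℝ × STPoint => Ψ p.1 p.2)
      {p | 0 ≤ p.1 ∧ p.1 < Λ ∧ R < rad p.2 ∧ scaleMap t₀ p.1 p.2 ∈ U} ∧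
    ∀ l x, 0 < l → l < Λ → R < rad x → scaleMap t₀ l x ∈ U → Ψ l x = scaledField Φ t₀ l x
  /-- Uniformity: the fields are smooth functions of `α = r` and `β = l / r` (and of the time `t`
  and the direction `n` of `xⁱ`) at `(α, β) = (0, 0)`. -/
  uniform : ∀ t₀, worldline t₀ ∈ U → ∀ n₀ : E3, ‖n₀‖ = 1 →
    ∃ F : ℝ × E3 × ℝ × ℝ → Val, ContDiffAt ℝ ∞ F (t₀, n₀, 0, 0) ∧
      ∀ᶠ p : ℝ × E3 × ℝ × ℝ in 𝓝 (t₀, n₀, 0, 0),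
        ‖p.2.1‖ = 1 → 0 < p.2.2.1 → 0 ≤ p.2.2.2 →
          Φ (p.2.2.1 * p.2.2.2) (pt p.1 (p.2.2.1 • p.2.1)) = F p

/-- The perturbation `∂_l Φ` at `l = 0⁺`. -/
def perturbation (Φ : ℝ → STPoint → Val) (x : STPoint) : Val :=
  derivWithin (fun l => Φ l x) (Ici 0) 0

/-! ### The linearized operator on distributions -/

/-- The formal adjoint, with respect to `√(-g) d⁴x`, of the linearization
`h ↦ DE(jet Φ) (jet h)` of `E` off the background `Φ`, applied to the test field `f`; the result
is a linear form in `v`. -/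
def adjointLin (E : Jet 2 → Val) (Φ : STPoint → Val) (f : STPoint → Val) (x : STPoint) (v : Val) : ℝ :=
  (sqrtNegDet (Φ x).1)⁻¹ * ∑ I : JetIdx 2, (-1 : ℝ) ^ (I.1 : ℕ) *
    pdI I (fun y => sqrtNegDet (Φ y).1 *
      pair (f y) (fderiv ℝ E (jet 2 Φ y) (Pi.single I v))) x

/-- The integrand of the distribution `E^{(1)}[h]` on the test field `f`. -/
def linIntegrand (E : Jet 2 → Val) (Φ h f : STPoint → Val) (x : STPoint) : ℝ :=
  sqrtNegDet (Φ x).1 * adjointLin E Φ f x (h x)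

/-! ### Kinematics of a curve `z` in the background `Φ = (g, φ)` -/

/-- `dτ/ds`. -/
def speed (Φ : STPoint → Val) (z : ℝ → STPoint) (s : ℝ) : ℝ :=
  √(-∑ a, ∑ b, (Φ (z s)).1 a b * deriv z s a * deriv z s b)

/-- The four-velocity `u^a`. -/
def fourVel (Φ : STPoint → Val) (z : ℝ → STPoint) (s : ℝ) (a : Fin 4) : ℝ := deriv z s a / speed Φ z s

/-- `u_a`. -/
def fourVelLow (Φ : STPoint → Val) (z : ℝ → STPoint) (s : ℝ) (a : Fin 4) : ℝ :=
  ∑ b, (Φ (z s)).1 a b * fourVel Φ z s b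

/-- The four-acceleration `u^b ∇_b u^a`. -/
def fourAcc (Φ : STPoint → Val) (z : ℝ → STPoint) (s : ℝ) (a : Fin 4) : ℝ :=
  deriv (fun s' => fourVel Φ z s' a) s / speed Φ z s +
    ∑ b, ∑ c, christoffel (jet 2 Φ (z s)) a b c * fourVel Φ z s b * fourVel Φ z s c

/-- `∇_a φ` on the curve. -/
def gradPhi (Φ : STPoint → Val) (z : ℝ → STPoint) (s : ℝ) (a : Fin 4) : ℝ := pd a (fun y => (Φ y).2) (z s)

/-- `M u^b ∇_b u^a = q (g^{ab} + u^a u^b) ∇_b φ` and `u^a ∇_a M = - q u^a ∇_a φ`. -/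
def ObeysMotionLaw (Φ : STPoint → Val) (z : ℝ → STPoint) (M q : ℝ → ℝ) (s : ℝ) : Prop :=
  (∀ a, M s * fourAcc Φ z s a =
    q s * ∑ b, (invMetric (Φ (z s)).1 a b + fourVel Φ z s a * fourVel Φ z s b) *
      gradPhi Φ z s b) ∧
  deriv M s / speed Φ z s = -q s * ∑ a, fourVel Φ z s a * gradPhi Φ z s a

/-- `h` is a distribution on `U` with
`E^{[g](1)}_{ab}[h] = 8π ∫ M u_a u_b δ₄(x, z(τ)) dτ` and `E^{[φ](1)}[h] = -16π ∫ q δ₄(x, z(τ)) dτ`,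
the curve being `xⁱ = 0`. -/
def HasPointSource (E : Jet 2 → Val) (U : Set STPoint) (Φ h : STPoint → Val) (M q : ℝ → ℝ) : Prop :=
  (∀ f : STPoint → Val, IsTest U f → Integrable (linIntegrand E Φ h f)) ∧
  (∀ f : STPoint → Fin 4 → Fin 4 → ℝ, IsTest U f →
    ∫ x, linIntegrand E Φ h (fun y => (f y, 0)) x =
      8 * Real.pi * ∫ t, M t * (∑ a, ∑ b, fourVelLow Φ worldline t a * fourVelLow Φ worldline t b *
        f (worldline t) a b) * speed Φ worldline t) ∧
  (∀ w : STPoint → ℝ, IsTest U w →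
    ∫ x, linIntegrand E Φ h (fun y => (0, w y)) x =
      -16 * Real.pi * ∫ t, q t * w (worldline t) * speed Φ worldline t)

/-- The small-body law for the family `Φ`, with mass `M` and charge `q` as functions of the time
`t` along the worldline. -/
def ObeysSmallBodyLaw (E : Jet 2 → Val) (U : Set STPoint) (Φ : ℝ → STPoint → Val) (M q : ℝ → ℝ) : Prop :=
  DifferentiableOn ℝ M {t | worldline t ∈ U} ∧ ContinuousOn q {t | worldline t ∈ U} ∧
  HasPointSource E U (Φ 0) (perturbation Φ) M q ∧
  ∀ t, worldline t ∈ U → ObeysMotionLaw (Φ 0) worldline M q t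

/-! ### Body exterior fields, ADM mass, scalar charge -/

/-- `Ψ` is the pair of body exterior fields at time `t₀`: the limit of the scaled fields as
`l → 0` at fixed scaled coordinates. -/
def IsBodyExterior (R : ℝ) (Φ : ℝ → STPoint → Val) (t₀ : ℝ) (Ψ : STPoint → Val) : Prop :=
  ∀ x, R < rad x → Tendsto (fun l => scaledField Φ t₀ l x) (𝓝[>] 0) (𝓝 (Ψ x))

/-- `A` is the matrix of a linear change of coordinates that makes the constant metric `b`
Minkowskian and keeps the direction of the time axis. -/
def IsInertialFrame (b : Fin 4 → Fin 4 → ℝ) (A : Matrix (Fin 4) (Fin 4) ℝ) : Prop :=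
  Aᵀ * Matrix.of b * A = Matrix.diagonal ![-1, 1, 1, 1] ∧ ∀ i : Fin 4, i ≠ 0 → A i 0 = 0

/-- `g` is asymptotically flat in the given coordinates, and the slice `t = 0` has ADM mass
`m = (1/16π) lim ∮ (∂_j g_{ij} - ∂_i g_{jj}) n^i dS`. -/
def HasADMMass (g : STPoint → Fin 4 → Fin 4 → ℝ) (m : ℝ) : Prop :=
  (∀ μ ν, (fun x : E3 => g (pt 0 x) μ ν -
      (Matrix.diagonal ![-1, 1, 1, 1] : Matrix (Fin 4) (Fin 4) ℝ) μ ν)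
    =O[Bornology.cobounded E3] fun x => ‖x‖⁻¹) ∧
  (∀ α μ ν, (fun x : E3 => pd α (fun y => g y μ ν) (pt 0 x))
    =O[Bornology.cobounded E3] fun x => (‖x‖ ^ 2)⁻¹) ∧
  Tendsto (fun ρ : ℝ => (1 / (16 * Real.pi)) *
      ∫ n : Metric.sphere (0 : E3) 1, (ρ ^ 2 * ∑ i : Fin 3, ∑ k : Fin 3,
        (pd k.succ (fun y => g y i.succ k.succ) (pt 0 (ρ • (n : E3))) -
          pd i.succ (fun y => g y k.succ k.succ) (pt 0 (ρ • (n : E3)))) * (n : E3) i)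
        ∂((volume : Measure E3).toSphere))
    atTop (𝓝 m)

/-- The scalar field `φ` is `φ∞ + q / r + O(1 / r²)` on the slice `t = 0`: its monopole is `q`. -/
def HasScalarCharge (φ : STPoint → ℝ) (φinf q : ℝ) : Prop :=
  (fun x : E3 => φ (pt 0 x) - φinf - q / ‖x‖) =O[Bornology.cobounded E3] fun x => (‖x‖ ^ 2)⁻¹

end

end SmallBody

open SmallBody

namespace SmallBody

open Finset (sum_congr sum_comm mul_sum sum_mul sum_add_distrib sum_sub_distrib
  sum_eq_single sum_neg_distrib sum_eq_zero sum_eq_single_of_mem)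
open Matrix (of mul_apply of_apply transpose_apply transpose_mul mul_nonsing_inv
  nonsing_inv_mul det_mul det_transpose)

open Function (uncurry)
open Real (norm_of_nonneg)
local notation "SmoothAt" => ContDiffAt ℝ ∞
local notation "DiffAt" => DifferentiableAt ℝ
local notation "Smooth" => ContDiff ℝ ∞
local notation "𝒟" => fderiv ℝ
local notation "wl" => worldline

noncomputable section

/-! ### Partial derivatives and jets -/

theorem two_le_infty : (2 : WithTop ℕ∞) ≤ ∞ := by
  have h : ((2 : ℕ∞) : WithTop ℕ∞) ≤ ((⊤ : ℕ∞) : WithTop ℕ∞) := WithTop.coe_le_coe.2 le_top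
  exact h

/-- The components of a rank-two tensor. -/
abbrev Tensor : Type := Fin 4 → Fin 4 → ℝ

abbrev Mat4 : Type := Matrix (Fin 4) (Fin 4) ℝ

/-- The basis vectors of three-space. -/
abbrev axis (i : Fin 3) : E3 := EuclideanSpace.single i 1

/-- A smooth function of the jets with Lorentzian metric. -/
abbrev SmoothOnLorentzian {k : ℕ} {X : Type*} [NormedAddCommGroup X] [NormedSpace ℝ X]
    (E : Jet k → X) : Prop :=
  ∀ j : Jet k, IsLorentzian (j (idx0 k)).1 → SmoothAt E j

theorem sum_congr₂ {ι κ M : Type*} [AddCommMonoid M] {s : Finset ι} {t : Finset κ} {f g : ι → κ → M}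
    (h : ∀ i j, f i j = g i j := by intro _ _; ring) : ∑ i ∈ s, ∑ j ∈ t, f i j = ∑ i ∈ s, ∑ j ∈ t, g i j :=
  sum_congr rfl fun i _ => sum_congr rfl fun j _ => h i j

theorem integral_congr {X W : Type*} [MeasurableSpace X] [NormedAddCommGroup W] [NormedSpace ℝ W]
    {μ : Measure X} {f g : X → W} (h : ∀ x, f x = g x) : ∫ x, f x ∂μ = ∫ x, g x ∂μ :=
  integral_congr_ae (.of_forall h)

theorem _root_.ContDiffAt.near {X Y : Type*} [NormedAddCommGroup X] [NormedSpace ℝ X]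
    [NormedAddCommGroup Y] [NormedSpace ℝ Y] {f : X → Y} {x : X} (h : SmoothAt f x) :
    ∀ᶠ y in 𝓝 x, ContDiffAt ℝ 1 f y :=
  (h.of_le (by exact_mod_cast le_top)).eventually (by simp)

theorem eq_zero_off {X Y : Type*} [TopologicalSpace X] [Zero Y] {f : X → Y} {x : X}
    (h : x ∉ tsupport f) : f x = 0 :=
  image_eq_zero_of_notMem_tsupport h

theorem _root_.ContDiffAt.diff {X Y : Type*} [NormedAddCommGroup X] [NormedSpace ℝ X]
    [NormedAddCommGroup Y] [NormedSpace ℝ Y] {f : X → Y} {x : X} {n : WithTop ℕ∞}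
    (h : ContDiffAt ℝ n f x) (hn : n ≠ 0 := by simp) : DiffAt f x :=
  h.differentiableAt hn

section Calculus

variable {X Y : Type*} [NormedAddCommGroup X] [NormedSpace ℝ X] [NormedAddCommGroup Y]
  [NormedSpace ℝ Y] {f g : STPoint → X} {x : STPoint} {μ α β : Fin 4}

theorem contDiffAt_pd (hf : SmoothAt f x) : SmoothAt (pd μ f) x :=
  (hf.fderiv_right (m := ∞) (by simp)).clm_apply contDiffAt_const

theorem pd_congr (h : f =ᶠ[𝓝 x] g) : pd μ f x = pd μ g x := by simp only [pd, h.fderiv_eq]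

theorem pd_const (c : X) : pd μ (fun _ => c) x = 0 := by simp [pd]

theorem pd_add (hf : DiffAt f x) (hg : DiffAt g x) :
    pd μ (fun y => f y + g y) x = pd μ f x + pd μ g x := by
  simp [pd, fderiv_fun_add hf hg]

theorem pd_sub (hf : DiffAt f x) (hg : DiffAt g x) :
    pd μ (fun y => f y - g y) x = pd μ f x - pd μ g x := by
  simp [pd, fderiv_fun_sub hf hg]

theorem pd_const_smul (c : ℝ) (hf : DiffAt f x) : pd μ (fun y => c • f y) x = c • pd μ f x := by
  simp [pd, fderiv_fun_const_smul hf]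

theorem pd_smul {a : STPoint → ℝ} (ha : DiffAt a x) (hf : DiffAt f x) :
    pd μ (fun y => a y • f y) x = a x • pd μ f x + pd μ a x • f x := by
  simp [pd, fderiv_fun_smul ha hf]

theorem pd_mul {a b : STPoint → ℝ} (ha : DiffAt a x) (hb : DiffAt b x) :
    pd μ (fun y => a y * b y) x = a x * pd μ b x + pd μ a x * b x := by
  simpa using pd_smul (μ := μ) ha hb

theorem pd_const_mul {a : STPoint → ℝ} (c : ℝ) (ha : DiffAt a x) :
    pd μ (fun y => c * a y) x = c * pd μ a x := by
  simpa using pd_const_smul (μ := μ) c ha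

theorem pd_sum {ι : Type*} (s : Finset ι) {F : ι → STPoint → X} (h : ∀ i ∈ s, DiffAt (F i) x) :
    pd μ (fun y => ∑ i ∈ s, F i y) x = ∑ i ∈ s, pd μ (F i) x := by
  simp [pd, fderiv_fun_sum h]

theorem pd_clm (L : X →L[ℝ] Y) (hf : DiffAt f x) : pd μ (fun y => L (f y)) x = L (pd μ f x) := by
  have := (L.hasFDerivAt.comp x hf.hasFDerivAt).fderiv
  simp only [pd]
  rw [show (fun y => L (f y)) = L ∘ f from rfl, this]
  rfl

theorem pd_clm_apply {a : STPoint → X →L[ℝ] Y} (ha : DiffAt a x) (v : X) :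
    pd μ (fun y => a y v) x = pd μ a x v :=
  pd_clm (ContinuousLinearMap.apply ℝ Y v) ha

theorem pd_fst {f : STPoint → X × Y} (hf : DiffAt f x) :
    pd μ (fun y => (f y).1) x = (pd μ f x).1 := pd_clm (ContinuousLinearMap.fst ℝ X Y) hf

theorem pd_snd {f : STPoint → X × Y} (hf : DiffAt f x) :
    pd μ (fun y => (f y).2) x = (pd μ f x).2 := pd_clm (ContinuousLinearMap.snd ℝ X Y) hf

theorem pd_pi {ι : Type*} [Fintype ι] {f : STPoint → ι → X} (hf : DiffAt f x) (i : ι) :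
    pd μ (fun y => f y i) x = pd μ f x i :=
  pd_clm (ContinuousLinearMap.proj (R := ℝ) (φ := fun _ : ι => X) i) hf

theorem fderiv_eq_sum_pd (v : STPoint) : 𝒟 f x v = ∑ μ, v μ • pd μ f x := by
  have : v = ∑ μ, v μ • (Pi.single μ (1 : ℝ) : STPoint) := by
    ext i; simp [Finset.sum_apply, Pi.single_apply]
  conv_lhs => rw [this]
  simp [pd]

theorem pd_comp {a : X → Y} (ha : DiffAt a (f x)) (hf : DiffAt f x) :
    pd μ (fun y => a (f y)) x = 𝒟 a (f x) (pd μ f x) := by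
  simp only [pd]
  rw [show (fun y => a (f y)) = a ∘ f from rfl, fderiv_comp x ha hf]
  rfl

theorem pd_comm (hf : SmoothAt f x) : pd α (pd β f) x = pd β (pd α f) x := by
  have h1 : DiffAt (𝒟 f) x := (hf.fderiv_right (m := ∞) (by simp)).diff
  have hs := (hf.isSymmSndFDerivAt (by simpa using two_le_infty)) (Pi.single α 1) (Pi.single β 1)
  have e : ∀ γ δ : Fin 4, pd γ (pd δ f) x = 𝒟 (𝒟 f) x (Pi.single γ 1) (Pi.single δ 1) := fun γ δ =>
    pd_clm_apply (a := 𝒟 f) h1 (Pi.single δ 1)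
  rw [e, e, hs]

theorem tsupport_pd_subset : tsupport (pd μ f) ⊆ tsupport f := by
  refine (closure_minimal ?_ (isClosed_tsupport f))
  intro y hy
  by_contra h
  apply hy
  have : f =ᶠ[𝓝 y] fun _ => 0 := notMem_tsupport_iff_eventuallyEq.1 h
  rw [pd_congr this, pd_const]

theorem hasCompactSupport_pd (hf : HasCompactSupport f) : HasCompactSupport (pd μ f) :=
  IsCompact.of_isClosed_subset hf (isClosed_tsupport _) tsupport_pd_subset

theorem contDiff_of_tsupport_subset {W : Set STPoint} (h : ∀ y ∈ W, SmoothAt f y)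
    (hs : tsupport f ⊆ W) : Smooth f :=
  contDiff_iff_contDiffAt.2 fun y => by
    by_cases hy : y ∈ tsupport f
    · exact h y (hs hy)
    · exact contDiffAt_const.congr_of_eventuallyEq (notMem_tsupport_iff_eventuallyEq.1 hy)

theorem IsTest.contDiffAt {W : Set STPoint} (h : IsTest W f) : SmoothAt f x := h.1.contDiffAt

theorem IsTest.pd {W : Set STPoint} (h : IsTest W f) : IsTest W (pd μ f) :=
  ⟨contDiff_iff_contDiffAt.2 fun _ => contDiffAt_pd h.contDiffAt, hasCompactSupport_pd h.2.1,
    tsupport_pd_subset.trans h.2.2⟩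

theorem IsTest.of_zero {W K : Set STPoint} (hW : ∀ y ∈ W, SmoothAt f y) (hK : IsCompact K)
    (hKW : K ⊆ W) (h0 : ∀ y, y ∉ K → f y = 0) : IsTest W f := by
  have hs : tsupport f ⊆ K := closure_minimal (fun y hy => by
    by_contra h; exact hy (h0 y h)) hK.isClosed
  exact ⟨contDiff_of_tsupport_subset hW (hs.trans hKW), HasCompactSupport.intro hK h0, hs.trans hKW⟩

theorem pd_eq_zero_of_notMem (h : x ∉ tsupport f) : pd μ f x = 0 := by
  rw [pd_congr (notMem_tsupport_iff_eventuallyEq.1 h)]; exact pd_const 0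

theorem integral_pd_eq_zero {W : Set STPoint} (h : IsTest W f) : ∫ y, pd μ f y = 0 := by
  have := integral_bilinear_hasFDerivAt_right_eq_neg_left_of_integrable (μ := volume)
    (f := fun _ : STPoint => (1 : ℝ)) (f' := fun _ => 0) (g := f) (g' := 𝒟 f)
    (v := Pi.single μ 1) (B := ContinuousLinearMap.lsmul ℝ ℝ) (by simp)
    (by
      simp only [ContinuousLinearMap.lsmul_apply, one_smul]
      exact (h.pd (μ := μ)).1.continuous.integrable_of_hasCompactSupport h.pd.2.1)
    (by
      simp only [ContinuousLinearMap.lsmul_apply, one_smul]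
      exact h.1.continuous.integrable_of_hasCompactSupport h.2.1)
    (fun y _ => hasFDerivAt_const _ _) (fun y _ => h.contDiffAt.diff.hasFDerivAt)
  simpa [pd] using this

end Calculus

section Jets

variable {X Y : Type*} [NormedAddCommGroup X] [NormedSpace ℝ X] [NormedAddCommGroup Y]
  [NormedSpace ℝ Y] {f g : STPoint → X} {x : STPoint} {k : ℕ}

theorem contDiffAt_pdI (I : JetIdx k) (hf : SmoothAt f x) : SmoothAt (pdI I f) x := by
  have h : SmoothAt (iteratedFDeriv ℝ (I.1 : ℕ) f) x :=
    hf.iteratedFDeriv_right (m := ∞) (by exact_mod_cast le_top)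
  exact (ContinuousMultilinearMap.apply ℝ (fun _ : Fin (I.1 : ℕ) => STPoint) X
    (fun a => Pi.single (I.2 a) 1)).contDiff.contDiffAt.comp x h

theorem contDiffAt_jet {Φ : STPoint → Val} (h : SmoothAt Φ x) : SmoothAt (jet k Φ) x :=
  contDiffAt_pi.2 fun I => contDiffAt_pdI I h

theorem pdI_congr (I : JetIdx k) (h : f =ᶠ[𝓝 x] g) : pdI I f x = pdI I g x := by
  simp only [pdI, (h.iteratedFDeriv ℝ (I.1 : ℕ)).eq_of_nhds]

theorem jet_congr {Φ Ψ : STPoint → Val} (h : Φ =ᶠ[𝓝 x] Ψ) : jet k Φ x = jet k Ψ x :=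
  funext fun I => pdI_congr I h

theorem pdI_add (I : JetIdx k) (hf : SmoothAt f x) (hg : SmoothAt g x) :
    pdI I (fun y => f y + g y) x = pdI I f x + pdI I g x := by
  simp only [pdI]
  rw [fun_iteratedFDeriv_add_apply (hf.of_le (by exact_mod_cast le_top))
    (hg.of_le (by exact_mod_cast le_top))]
  rfl

theorem pdI_const_smul (I : JetIdx k) (c : ℝ) (hf : SmoothAt f x) :
    pdI I (fun y => c • f y) x = c • pdI I f x := by
  simp only [pdI]
  rw [iteratedFDeriv_const_smul_apply' (hf.of_le (by exact_mod_cast le_top))]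
  rfl

theorem pdI_zero_fun (I : JetIdx k) : pdI I (fun _ => (0 : X)) x = 0 := by
  have := pdI_const_smul (x := x) (f := fun _ => (0 : X)) I 0 contDiffAt_const
  simpa using this

theorem jet_zero_fun : jet k (fun _ => (0 : Val)) x = 0 := funext fun I => pdI_zero_fun I

theorem jet_add_smul {Φ η : STPoint → Val} (hf : SmoothAt Φ x) (hg : SmoothAt η x)
    (s : ℝ) : jet k (fun y => Φ y + s • η y) x = jet k Φ x + s • jet k η x := by
  funext I
  simp only [jet, Pi.add_apply, Pi.smul_apply]
  have hg' : SmoothAt (fun y => s • η y) x := hg.const_smul s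
  rw [pdI_add I hf hg', pdI_const_smul I s hg]

theorem pdI_idx0 : pdI (idx0 k) f x = f x := by
  simp only [pdI, idx0]
  exact iteratedFDeriv_zero_apply _

theorem jet_idx0 {Φ : STPoint → Val} : jet k Φ x (idx0 k) = Φ x := pdI_idx0

theorem pdI_idx1 (α : Fin 4) : pdI (idx1 α) f x = pd α f x := iteratedFDeriv_one_apply _

theorem pdI_idx2 (α β : Fin 4) (hf : SmoothAt f x) : pdI (idx2 α β) f x = pd α (pd β f) x := by
  have h1 : DiffAt (𝒟 f) x := (hf.fderiv_right (m := ∞) (by simp)).diff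
  refine (iteratedFDeriv_two_apply f x _).trans ?_
  exact (pd_clm_apply (a := 𝒟 f) h1 (Pi.single β 1)).symm

theorem sum_jetIdx_two {M : Type*} [AddCommMonoid M] (F : JetIdx 2 → M) :
    ∑ I, F I = F (idx0 2) + ∑ α, F (idx1 α) + ∑ α, ∑ β, F (idx2 α β) := by
  rw [Fintype.sum_sigma, Fin.sum_univ_three]
  congr 1
  · congr 1
    · rw [Fintype.sum_eq_single (fun _ => 0)]
      · rfl
      · intro b hb
        exact absurd (funext fun i => Fin.elim0 i) hb
    · exact (Equiv.sum_comp (Equiv.funUnique (Fin 1) (Fin 4)).symm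
        (fun I : Fin 1 → Fin 4 => F ⟨1, I⟩)).symm
  · rw [← Fintype.sum_prod_type']
    refine (Equiv.sum_comp (finTwoArrowEquiv (Fin 4)).symm
        (fun I : Fin 2 → Fin 4 => F ⟨2, I⟩)).symm.trans (Fintype.sum_congr _ _ fun p => ?_)
    congr 2
    funext a
    fin_cases a <;> rfl

theorem jetIdx_two_cases (I : JetIdx 2) : I = idx0 2 ∨ (∃ α, I = idx1 α) ∨ ∃ α β, I = idx2 α β := by
  obtain ⟨m, I⟩ := I
  fin_cases m
  · left; exact congrArg (Sigma.mk 0) (funext fun i => Fin.elim0 i)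
  · right; left
    refine ⟨I (0 : Fin 1), congrArg (Sigma.mk 1) (funext fun i => ?_)⟩
    exact congrArg I (Subsingleton.elim (α := Fin 1) i 0)
  · right; right
    refine ⟨I (0 : Fin 2), I (1 : Fin 2), congrArg (Sigma.mk 2) (funext fun i => ?_)⟩
    change Fin 2 at i
    fin_cases i <;> rfl

/-- The derivative in a parameter of the derivatives of a function depending on it. -/
theorem hasDerivAt_iteratedFDeriv (m : ℕ) : ∀ {F : ℝ × STPoint → X} (v : Fin m → STPoint),
    SmoothAt F (0, x) →
    HasDerivAt (fun s : ℝ => iteratedFDeriv ℝ m (fun y => F (s, y)) x v)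
      (iteratedFDeriv ℝ m (fun y => 𝒟 F (0, y) (1, 0)) x v) 0 := by
  induction m with
  | zero =>
    intro F v hF
    simp only [iteratedFDeriv_zero_apply]
    have h1 : HasFDerivAt F (𝒟 F (0, x)) ((0 : ℝ), x) := hF.diff.hasFDerivAt
    have h2 : HasDerivAt (fun s : ℝ => (s, x)) ((1 : ℝ), (0 : STPoint)) 0 :=
      (hasDerivAt_id _).prodMk (hasDerivAt_const _ _)
    exact h1.comp_hasDerivAt (f := fun s : ℝ => (s, x)) 0 h2
  | succ m ih =>
    intro F v hF
    have hG : SmoothAt (fun p => 𝒟 F p (0, v (Fin.last m))) (0, x) :=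
      (hF.fderiv_right (m := ∞) (by simp)).clm_apply contDiffAt_const
    have h2 : ∀ᶠ p in 𝓝 ((0 : ℝ), x), ContDiffAt ℝ 2 F p :=
      (hF.of_le two_le_infty).eventually (by simp)
    have hslice : ∀ {Z : Type _} [NormedAddCommGroup Z] [NormedSpace ℝ Z] {G : ℝ × STPoint → Z}
        {s : ℝ} {y : STPoint} (w : STPoint), DiffAt G (s, y) →
        𝒟 (fun y => G (s, y)) y w = 𝒟 G (s, y) (0, w) := by
      intro Z _ _ G s y w hG
      have h2 : HasFDerivAt (fun y : STPoint => (s, y)) (ContinuousLinearMap.inr ℝ ℝ STPoint) y :=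
        hasFDerivAt_prodMk_right s y
      rw [show (fun y => G (s, y)) = G ∘ fun y => (s, y) from rfl,
        (hG.hasFDerivAt.comp y h2).fderiv]
      simp
    have red : ∀ f : STPoint → X, ContDiffAt ℝ (m + 1 : ℕ) f x → iteratedFDeriv ℝ (m + 1) f x v =
          iteratedFDeriv ℝ m (fun y => 𝒟 f y (v (Fin.last m))) x (Fin.init v) := by
      intro f hf
      rw [iteratedFDeriv_succ_apply_right]
      have := ContinuousLinearMap.iteratedFDeriv_comp_left
        (ContinuousLinearMap.apply ℝ X (v (Fin.last m)))
        (hf.fderiv_right (m := m) (by simp)) (i := m) le_rfl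
      exact (congrArg (fun T => T (Fin.init v)) this).symm
    have hs0 : ∀ᶠ s in 𝓝 (0 : ℝ), ContDiffAt ℝ (m + 1 : ℕ) F (s, x) := by
      have hc' : Continuous fun s : ℝ => (s, x) := by fun_prop
      exact hc'.continuousAt.eventually
        ((hF.of_le (m := (m + 1 : ℕ)) (by exact_mod_cast le_top)).eventually (by simp))
    have hs1 : ∀ᶠ s in 𝓝 (0 : ℝ), ∀ᶠ y in 𝓝 x, ContDiffAt ℝ 2 F (s, y) := by
      rw [nhds_prod_eq] at h2
      exact h2.curry
    have e1 : (fun s : ℝ => iteratedFDeriv ℝ (m + 1) (fun y => F (s, y)) x v) =ᶠ[𝓝 0]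
        fun s => iteratedFDeriv ℝ m (fun y => 𝒟 F (s, y) (0, v (Fin.last m))) x
          (Fin.init v) := by
      filter_upwards [hs0, hs1] with s ha hb
      rw [red (fun y => F (s, y)) (ha.comp x (contDiffAt_const.prodMk contDiffAt_id))]
      have : (fun y => 𝒟 (fun y => F (s, y)) y (v (Fin.last m))) =ᶠ[𝓝 x]
          fun y => 𝒟 F (s, y) (0, v (Fin.last m)) := by
        filter_upwards [hb] with y hy
        exact hslice _ hy.diff
      rw [(this.iteratedFDeriv ℝ m).eq_of_nhds]
    refine (HasDerivAt.congr_of_eventuallyEq ?_ e1)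
    convert ih (Fin.init v) hG using 1
    have hd : SmoothAt (fun p => 𝒟 F p (1, 0)) (0, x) :=
      (hF.fderiv_right (m := ∞) (by simp)).clm_apply contDiffAt_const
    rw [red (fun y => 𝒟 F (0, y) (1, 0)) ((hd.comp x
      (contDiffAt_const.prodMk contDiffAt_id)).of_le (by exact_mod_cast le_top))]
    have : (fun y => 𝒟 (fun y => 𝒟 F (0, y) (1, 0)) y (v (Fin.last m))) =ᶠ[𝓝 x]
        fun y => 𝒟 (fun p => 𝒟 F p (0, v (Fin.last m))) (0, y) (1, 0) := by
      filter_upwards [hs1.self_of_nhds] with y hy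
      have hdd : DiffAt (𝒟 F) (0, y) := (hy.fderiv_right (m := 1) (by norm_num)).diff
      rw [hslice (G := fun p => 𝒟 F p (1, 0)) _ (hdd.clm_apply (differentiableAt_const _))]
      have hsymm := (hy.isSymmSndFDerivAt (by simp)) (1, 0) (0, v (Fin.last m))
      have ev : ∀ a b : ℝ × STPoint, 𝒟 (fun p => 𝒟 F p a) (0, y) b = 𝒟 (𝒟 F) (0, y) b a := by
        intro a b
        rw [fderiv_clm_apply hdd (differentiableAt_const _)]
        simp
      rw [ev, ev, hsymm]
    rw [(this.iteratedFDeriv ℝ m).eq_of_nhds]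

theorem hasDerivAt_jet {F : ℝ × STPoint → Val} (hF : SmoothAt F (0, x)) :
    HasDerivAt (fun s : ℝ => jet k (fun y => F (s, y)) x)
      (jet k (fun y => 𝒟 F (0, y) (1, 0)) x) 0 :=
  hasDerivAt_pi.2 fun _ => hasDerivAt_iteratedFDeriv _ _ hF

end Jets

/-! ### Lorentzian metrics -/

section Lorentz

theorem det_minkowski : (Matrix.diagonal ![-1, 1, 1, 1] : Mat4).det = -1 := by
  simp [Matrix.det_diagonal, Fin.prod_univ_four]

theorem IsLorentzian.symm {g : Tensor} (h : IsLorentzian g) (a b : Fin 4) : g a b = g b a := by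
  obtain ⟨P, hP, h⟩ := h
  have h1 : Pᵀ * (of g)ᵀ * P = Pᵀ * of g * P := by
    have := congrArg Matrix.transpose h
    rw [transpose_mul, transpose_mul, Matrix.transpose_transpose,
      Matrix.diagonal_transpose, ← Matrix.mul_assoc] at this
    rw [this, h]
  have hPt : IsUnit Pᵀ.det := by rwa [det_transpose]
  have h2 : (of g)ᵀ = of g := by
    have h3 := congrArg (fun X => Pᵀ⁻¹ * X * P⁻¹) h1
    simpa [Matrix.mul_assoc, Matrix.nonsing_inv_mul_cancel_left _ _ hPt,
      mul_nonsing_inv _ hP] using h3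
  exact congrFun (congrFun h2 b) a

theorem IsLorentzian.det_neg {g : Tensor} (h : IsLorentzian g) : (of g).det < 0 := by
  obtain ⟨P, hP, h⟩ := h
  have := congrArg Matrix.det h
  rw [det_mul, det_mul, det_transpose, det_minkowski] at this
  by_contra hc
  push Not at hc
  nlinarith [mul_nonneg (mul_self_nonneg P.det) hc]

theorem IsLorentzian.isUnit_det {g : Tensor} (h : IsLorentzian g) :
    IsUnit (of g).det := h.det_neg.ne.isUnit

theorem IsLorentzian.sqrtNegDet_pos {g : Tensor} (h : IsLorentzian g) :
    0 < sqrtNegDet g := Real.sqrt_pos.2 (neg_pos.2 h.det_neg)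

theorem contDiff_det : Smooth fun g : Tensor => (of g).det := by
  simp only [Matrix.det_apply', of_apply]
  refine ContDiff.sum fun σ _ => contDiff_const.mul (contDiff_prod fun i _ => ?_)
  fun_prop

theorem contDiffAt_sqrtNegDet {g : Tensor} (h : IsLorentzian g) : SmoothAt sqrtNegDet g :=
  (contDiff_det.neg.contDiffAt).sqrt (neg_pos.2 h.det_neg).ne'

theorem contDiffAt_invMetric {g : Tensor} (h : IsLorentzian g) (a b : Fin 4) :
    SmoothAt (fun g => invMetric g a b) g := by
  have e : (fun g : Tensor => invMetric g a b) = fun g =>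
      ((of g).det)⁻¹ * (of (Function.update g b (Pi.single a 1))).det := by
    funext g
    simp only [invMetric, Matrix.inv_def, Ring.inverse_eq_inv', Matrix.smul_apply, smul_eq_mul,
      Matrix.adjugate_apply]
    rfl
  rw [e]
  refine (contDiff_det.contDiffAt.inv h.det_neg.ne).mul (contDiff_det.contDiffAt.comp g ?_)
  rw [contDiffAt_pi]
  intro i
  by_cases hi : i = b
  · subst hi; simp only [Function.update_self]; exact contDiffAt_const
  · simp only [Function.update_of_ne hi]; fun_prop

theorem minkowski_mul_self :
    (Matrix.diagonal ![-1, 1, 1, 1] : Mat4) * Matrix.diagonal ![-1, 1, 1, 1] = 1 := by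
  rw [Matrix.diagonal_mul_diagonal, ← Matrix.diagonal_one]
  congr 1; funext i; fin_cases i <;> simp

attribute [local instance] Matrix.linftyOpNormedRing Matrix.linftyOpNormedAlgebra in
theorem exists_sqrt_near_one : ∀ᶠ X : Mat4 in 𝓝 1,
    (Matrix.diagonal ![-1, 1, 1, 1] * X)ᵀ = Matrix.diagonal ![-1, 1, 1, 1] * X →
    ∃ Y : Mat4, IsUnit Y.det ∧
      Yᵀ * Matrix.diagonal ![-1, 1, 1, 1] * Y = Matrix.diagonal ![-1, 1, 1, 1] * X := by
  set η : Mat4 := Matrix.diagonal ![-1, 1, 1, 1] with hη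
  have hηη : η * η = 1 := minkowski_mul_self
  have hηt : ηᵀ = η := Matrix.diagonal_transpose _
  have : CompleteSpace Mat4 := FiniteDimensional.complete ℝ _
  let f : Mat4 → Mat4 := fun X => X * X
  let e : Mat4 ≃L[ℝ] Mat4 := ContinuousLinearEquiv.smulLeft (Units.mk0 (2 : ℝ) two_ne_zero)
  have hf : HasStrictFDerivAt f (e : Mat4 →L[ℝ] Mat4) 1 := by
    have := (hasStrictFDerivAt_id (𝕜 := ℝ) (1 : Mat4)).mul'
      (hasStrictFDerivAt_id (𝕜 := ℝ) (1 : Mat4))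
    have e2 : (e : Mat4 →L[ℝ] Mat4) = id (1 : Mat4) • ContinuousLinearMap.id ℝ Mat4 +
        MulOpposite.op (id (1 : Mat4)) • ContinuousLinearMap.id ℝ Mat4 := by
      refine ContinuousLinearMap.ext fun Z => ?_
      simp [e, two_smul, Units.smul_def]
    rw [e2]
    exact this
  have hr := hf.eventually_right_inverse
  have hl := hf.eventually_left_inverse
  have h11 : f 1 = 1 := by simp [f]
  rw [h11] at hr
  set ψ := hf.localInverse f e 1
  have hψ1 : ψ 1 = 1 := by
    have := hf.localInverse_apply_image
    rwa [h11] at this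
  have hψc : ContinuousAt ψ 1 := by
    have := hf.localInverse_continuousAt
    rwa [h11] at this
  let c : Mat4 → Mat4 := fun X => η * Xᵀ * η
  have hc : Continuous c := by
    have : Continuous fun X : Mat4 => Xᵀ := continuous_id.matrix_transpose
    exact (continuous_const.mul this).mul continuous_const
  have hc1 : c 1 = 1 := by simp [c, hηη]
  have hl2 : ∀ᶠ X in 𝓝 (1 : Mat4), ψ (f (c (ψ X))) = c (ψ X) := by
    have ht : Tendsto (fun X => c (ψ X)) (𝓝 1) (𝓝 1) := by
      have := (hc.continuousAt (x := ψ 1)).comp hψc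
      simpa [ContinuousAt, hψ1, hc1, Function.comp_def] using this
    exact ht.eventually hl
  have hdet : ∀ᶠ X in 𝓝 (1 : Mat4), (ψ X).det ≠ 0 := by
    have hd : Continuous fun X : Mat4 => X.det := continuous_id.matrix_det
    have := (hd.continuousAt (x := ψ 1)).comp hψc
    exact this.eventually_ne (by simp [hψ1])
  filter_upwards [hr, hl2, hdet] with X h1 h2 h3 hX
  refine ⟨ψ X, h3.isUnit, ?_⟩
  have hXc : c X = X := by
    have : Xᵀ * η = η * X := by rw [← hX, transpose_mul, hηt]
    simp only [c]
    rw [Matrix.mul_assoc, this, ← Matrix.mul_assoc, hηη, Matrix.one_mul]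
  have hmul : f (c (ψ X)) = X := by
    have : f (c (ψ X)) = c (f (ψ X)) := by
      simp only [f, c, transpose_mul]
      calc η * (ψ X)ᵀ * η * (η * (ψ X)ᵀ * η) = η * (ψ X)ᵀ * (η * η) * (ψ X)ᵀ * η := by
            simp only [Matrix.mul_assoc]
        _ = _ := by rw [hηη]; simp only [Matrix.mul_assoc, Matrix.one_mul]
    rw [this, show f (ψ X) = X from h1, hXc]
  rw [hmul] at h2
  have h4 : (ψ X)ᵀ * η = η * ψ X := by
    have : η * (η * (ψ X)ᵀ * η) = η * ψ X := by rw [← show c (ψ X) = η * (ψ X)ᵀ * η from rfl, ← h2]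
    rw [← this]
    simp only [← Matrix.mul_assoc, hηη, Matrix.one_mul]
  rw [h4, Matrix.mul_assoc, show ψ X * ψ X = X from h1]

theorem IsLorentzian.eventually {g₀ : Tensor} (h : IsLorentzian g₀) :
    ∀ᶠ g in 𝓝 g₀, (∀ a b, g a b = g b a) → IsLorentzian g := by
  obtain ⟨P, hP, h⟩ := h
  set η : Mat4 := Matrix.diagonal ![-1, 1, 1, 1] with hη
  have hηη : η * η = 1 := minkowski_mul_self
  have hηt : ηᵀ = η := Matrix.diagonal_transpose _
  have hcont : Continuous fun g : Tensor => η * (Pᵀ * of g * P) := by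
    have : Continuous fun g : Tensor => of g := continuous_id
    fun_prop
  have ht : Tendsto (fun g : Tensor => η * (Pᵀ * of g * P)) (𝓝 g₀) (𝓝 1) := by
    have := hcont.tendsto g₀
    rwa [h, hηη] at this
  filter_upwards [ht.eventually exists_sqrt_near_one] with g hg hs
  have hgt : (of g)ᵀ = of g := by ext a b; exact hs b a
  have e1 : η * (η * (Pᵀ * of g * P)) = Pᵀ * of g * P := by
    rw [← Matrix.mul_assoc, hηη, Matrix.one_mul]
  obtain ⟨Y, hY, hYe⟩ := hg (by
    rw [← hη, e1]; simp [transpose_mul, hgt, Matrix.mul_assoc])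
  rw [← hη, e1] at hYe
  have hYi : Y * Y⁻¹ = 1 := mul_nonsing_inv _ hY
  refine ⟨P * Y⁻¹, ?_, ?_⟩
  · rw [det_mul]
    exact hP.mul (by simpa [Matrix.det_nonsing_inv] using hY)
  · calc (P * Y⁻¹)ᵀ * of g * (P * Y⁻¹)
        = (Y⁻¹)ᵀ * (Pᵀ * of g * P) * Y⁻¹ := by simp only [transpose_mul, Matrix.mul_assoc]
      _ = (Y * Y⁻¹)ᵀ * η * (Y * Y⁻¹) := by
          rw [← hYe]; simp only [transpose_mul, Matrix.mul_assoc]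
      _ = η := by rw [hYi]; simp

end Lorentz

/-! ### Differentiation under the integral sign -/

theorem hasDerivAt_integral_of_compact {G : ℝ → STPoint → ℝ} {G' : STPoint → ℝ} {K : Set STPoint}
    (hK : IsCompact K) (h0 : ∀ s, ∀ y, y ∉ K → G s y = 0) (h0' : ∀ y, y ∉ K → G' y = 0)
    (hG : ∀ y ∈ K, ContDiffAt ℝ 1 (uncurry G) (0, y))
    (hd : ∀ y ∈ K, HasDerivAt (fun s => G s y) (G' y) 0) :
    HasDerivAt (fun s => ∫ y, G s y) (∫ y, G' y) 0 := by
  have hP : ∃ C : ℝ, ∀ᶠ s in 𝓝 (0 : ℝ), ∀ y ∈ K, ContDiffAt ℝ 1 (uncurry G) (s, y) ∧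
      ‖𝒟 (uncurry G) (s, y)‖ ≤ C := by
    refine hK.induction_on (p := fun S => ∃ C : ℝ, ∀ᶠ s in 𝓝 (0 : ℝ), ∀ y ∈ S,
      ContDiffAt ℝ 1 (uncurry G) (s, y) ∧
      ‖𝒟 (uncurry G) (s, y)‖ ≤ C) ⟨0, by simp⟩ ?_ ?_ ?_
    · rintro S T hST ⟨C, hC⟩
      exact ⟨C, hC.mono fun s hs y hy => hs y (hST hy)⟩
    · rintro S T ⟨C, hC⟩ ⟨D, hD⟩
      refine ⟨max C D, ?_⟩
      filter_upwards [hC, hD] with s h1 h2 y hy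
      rcases hy with hy | hy
      · exact ⟨(h1 y hy).1, (h1 y hy).2.trans (le_max_left _ _)⟩
      · exact ⟨(h2 y hy).1, (h2 y hy).2.trans (le_max_right _ _)⟩
    · intro y hy
      have hc : ContinuousAt (𝒟 (uncurry G)) (0, y) :=
        ((hG y hy).fderiv_right (m := 0) (by norm_num)).continuousAt
      have h1 : ∀ᶠ p in 𝓝 ((0 : ℝ), y), ContDiffAt ℝ 1 (uncurry G) p ∧
          ‖𝒟 (uncurry G) p‖ ≤ ‖𝒟 (uncurry G) (0, y)‖ + 1 :=
        ((hG y hy).eventually (by simp)).and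
          ((hc.norm.eventually_lt_const (lt_add_one _)).mono fun _ h => h.le)
      rw [nhds_prod_eq, eventually_prod_iff] at h1
      obtain ⟨pa, ha, pb, hb, hab⟩ := h1
      exact ⟨{y | pb y}, mem_nhdsWithin_of_mem_nhds hb, _, ha.mono fun s hs z hz => hab hs hz⟩
  obtain ⟨C, hC⟩ := hP
  have hmem : {s | ∀ y ∈ K, ContDiffAt ℝ 1 (uncurry G) (s, y) ∧
      ‖𝒟 (uncurry G) (s, y)‖ ≤ C} ∈ 𝓝 (0 : ℝ) := hC
  have hder : ∀ s y, ContDiffAt ℝ 1 (uncurry G) (s, y) →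
      HasDerivAt (fun s => G s y) (𝒟 (uncurry G) (s, y) (1, 0)) s := by
    intro s y h
    have h2 : HasDerivAt (fun s : ℝ => (s, y)) ((1 : ℝ), (0 : STPoint)) s :=
      (hasDerivAt_id _).prodMk (hasDerivAt_const _ _)
    exact h.diff.hasFDerivAt.comp_hasDerivAt (f := fun s : ℝ => (s, y)) s h2
  have hcont : ∀ s, (∀ y ∈ K, ContDiffAt ℝ 1 (uncurry G) (s, y)) →
      ContinuousOn (G s) K := fun s h y hy =>
    (((h y hy).continuousAt.comp (f := fun y : STPoint => (s, y))
      (by fun_prop : Continuous fun y : STPoint => (s, y)).continuousAt)).continuousWithinAt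
  have hKm : MeasurableSet K := hK.isClosed.measurableSet
  have hres : ∀ F : STPoint → ℝ, (∀ y, y ∉ K → F y = 0) → ∫ y, F y = ∫ y in K, F y := fun F hF =>
    (setIntegral_eq_integral_of_forall_compl_eq_zero fun y hy => hF y hy).symm
  have e1 : (fun s => ∫ y, G s y) = fun s => ∫ y in K, G s y := funext fun s => hres _ (h0 s)
  have hG'e : ∀ y ∈ K, G' y = 𝒟 (uncurry G) (0, y) (1, 0) := fun y hy =>
    (hd y hy).unique (hder 0 y (hG y hy))
  rw [e1, hres G' h0', setIntegral_congr_fun hKm hG'e]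
  refine (hasDerivAt_integral_of_dominated_loc_of_deriv_le (μ := volume.restrict K)
    (F := G) (F' := fun s y => 𝒟 (uncurry G) (s, y) (1, 0)) (bound := fun _ => C)
    hmem ?_ ?_ ?_ ?_ ?_ ?_).2
  · filter_upwards [hC] with s hs
    exact (hcont s fun y hy => (hs y hy).1).aestronglyMeasurable hKm
  · exact (hcont 0 hG).integrableOn_compact hK
  · refine ContinuousOn.aestronglyMeasurable (fun y hy => ContinuousAt.continuousWithinAt ?_) hKm
    have hc : ContinuousAt (𝒟 (uncurry G)) (0, y) :=
      ((hG y hy).fderiv_right (m := 0) (by norm_num)).continuousAt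
    have h2 : ContinuousAt (fun z : STPoint => 𝒟 (uncurry G) (0, z)) y :=
      hc.comp (f := fun y : STPoint => ((0 : ℝ), y))
        (by fun_prop : Continuous fun y : STPoint => ((0 : ℝ), y)).continuousAt
    exact h2.clm_apply continuousAt_const
  · refine (ae_restrict_iff' hKm).2 (.of_forall fun y hy s hs => ?_)
    refine ((𝒟 (uncurry G) (s, y)).le_opNorm _).trans ?_
    have : ‖((1 : ℝ), (0 : STPoint))‖ = 1 := by simp [Prod.norm_def]
    rw [this, mul_one]
    exact (hs y hy).2
  · exact integrableOn_const hK.measure_lt_top.ne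
  · exact (ae_restrict_iff' hKm).2 (.of_forall fun y hy s hs => hder s y (hs y hy).1)

/-! ### Variations of the action and the Bianchi identity -/

section Bianchi

variable {k : ℕ} {L : Jet k → ℝ} {E : Jet 2 → Val} {W : Set STPoint} {Φ η : STPoint → Val}

theorem hasDerivAt_action (hL : SmoothOnLorentzian L)
    (hW : IsOpen W) (hΦ : ContDiffOn ℝ ∞ Φ W) (hlor : ∀ x ∈ W, IsLorentzian (Φ x).1)
    (hη : IsTest W η) :
    HasDerivAt (fun s : ℝ => ∫ x in W, (L (jet k (fun y => Φ y + s • η y) x) - L (jet k Φ x)))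
      (∫ x, 𝒟 L (jet k Φ x) (jet k η x)) 0 := by
  have hΦ' : ∀ y ∈ W, SmoothAt Φ y := fun y hy => hΦ.contDiffAt (hW.mem_nhds hy)
  have hout : ∀ (s : ℝ) y, y ∉ tsupport η →
      L (jet k (fun y => Φ y + s • η y) y) - L (jet k Φ y) = 0 := by
    intro s y hy
    have h0 := notMem_tsupport_iff_eventuallyEq.1 hy
    have : (fun y => Φ y + s • η y) =ᶠ[𝓝 y] Φ := by
      filter_upwards [h0] with z hz
      simp [hz]
    rw [jet_congr this, sub_self]
  have hin : ∀ y ∈ W, ∀ s : ℝ, jet k (fun y => Φ y + s • η y) y = jet k Φ y + s • jet k η y :=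
    fun y hy s => jet_add_smul (hΦ' y hy) hη.contDiffAt s
  have hLj : ∀ y ∈ W, SmoothAt L (jet k Φ y) := fun y hy => hL _ (by rw [jet_idx0]; exact hlor y hy)
  have e : (fun s : ℝ => ∫ x in W, (L (jet k (fun y => Φ y + s • η y) x) - L (jet k Φ x))) =
      fun s => ∫ x, (L (jet k (fun y => Φ y + s • η y) x) - L (jet k Φ x)) := by
    funext s
    exact setIntegral_eq_integral_of_forall_compl_eq_zero fun y hy =>
      hout s y fun h => hy (hη.2.2 h)
  rw [e]
  refine hasDerivAt_integral_of_compact (K := tsupport η) hη.2.1 (fun s y hy => hout s y hy) ?_ ?_ ?_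
  · intro y hy
    rw [jet_congr (notMem_tsupport_iff_eventuallyEq.1 hy)]
    have : jet k (0 : STPoint → Val) y = 0 := jet_zero_fun
    simp [this]
  · intro y hy
    have hyW := hη.2.2 hy
    have hev : uncurry (fun (s : ℝ) y => L (jet k (fun y => Φ y + s • η y) y) - L (jet k Φ y))
        =ᶠ[𝓝 ((0 : ℝ), y)] fun p => L (jet k Φ p.2 + p.1 • jet k η p.2) - L (jet k Φ p.2) := by
      have : ∀ᶠ p in 𝓝 ((0 : ℝ), y), p.2 ∈ W :=
        continuous_snd.continuousAt.eventually (hW.mem_nhds hyW)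
      filter_upwards [this] with p hp
      simp only [uncurry]
      rw [hin _ hp]
    refine ContDiffAt.congr_of_eventuallyEq ?_ hev
    have hj : SmoothAt (fun p : ℝ × STPoint => jet k Φ p.2) (0, y) :=
      (contDiffAt_jet (hΦ' y hyW)).comp ((0 : ℝ), y) contDiffAt_snd
    have hj' : SmoothAt (fun p : ℝ × STPoint => jet k η p.2) (0, y) :=
      (contDiffAt_jet hη.contDiffAt).comp ((0 : ℝ), y) contDiffAt_snd
    refine ContDiffAt.of_le (n := ∞) ?_ (by exact_mod_cast le_top)
    refine ContDiffAt.sub ?_ ?_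
    · refine ContDiffAt.comp (g := L) ((0 : ℝ), y) ?_ (hj.add (contDiffAt_fst.smul hj'))
      simpa using hLj y hyW
    · exact ContDiffAt.comp (g := L) ((0 : ℝ), y) (hLj y hyW) hj
  · intro y hy
    have hyW := hη.2.2 hy
    simp only [hin y hyW]
    have h1 : HasDerivAt (fun s : ℝ => jet k Φ y + s • jet k η y) (jet k η y) 0 := by
      simpa using ((hasDerivAt_id (0 : ℝ)).smul_const (jet k η y)).const_add (jet k Φ y)
    have h2 : HasFDerivAt L (𝒟 L (jet k Φ y)) (jet k Φ y + (0 : ℝ) • jet k η y) := by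
      simpa using (hLj y hyW).diff.hasFDerivAt
    exact (h2.comp_hasDerivAt (f := fun s : ℝ => jet k Φ y + s • jet k η y) 0 h1).sub_const _

/-- The Lie derivative of `Φ = (g_{μν}, φ)` along `ξ`. -/
def lieD (ξ : STPoint → STPoint) (Φ : STPoint → Val) (x : STPoint) : Val :=
  (fun μ ν => ∑ e, (ξ x e * (pd e Φ x).1 μ ν + pd μ ξ x e * (Φ x).1 e ν +
    pd ν ξ x e * (Φ x).1 μ e), ∑ e, ξ x e * (pd e Φ x).2)

/-- The variation `(δg^{ab}, δφ)` belonging to `η = (δg_{ab}, δφ)`. -/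
def raise (Φ η : STPoint → Val) (x : STPoint) : Val :=
  (fun a b => -(invMetric (Φ x).1 * of (η x).1 * invMetric (Φ x).1) a b, (η x).2)

theorem contDiffAt_lieD {ξ : STPoint → STPoint} {x : STPoint} (hξ : SmoothAt ξ x)
    (hΦ : SmoothAt Φ x) : SmoothAt (lieD ξ Φ) x := by
  have h1 : ∀ μ, SmoothAt (pd μ ξ) x := fun μ => contDiffAt_pd hξ
  have h2 : ∀ μ, SmoothAt (pd μ Φ) x := fun μ => contDiffAt_pd hΦ
  have a1 : ∀ e, SmoothAt (fun y => ξ y e) x := contDiffAt_pi.1 hξ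
  have a2 : ∀ μ e, SmoothAt (fun y => pd μ ξ y e) x := fun μ => contDiffAt_pi.1 (h1 μ)
  have a3 : ∀ μ ν, SmoothAt (fun y => (Φ y).1 μ ν) x := fun μ =>
    contDiffAt_pi.1 (contDiffAt_pi.1 hΦ.fst μ)
  have a4 : ∀ e μ ν, SmoothAt (fun y => (pd e Φ y).1 μ ν) x := fun e μ =>
    contDiffAt_pi.1 (contDiffAt_pi.1 (h2 e).fst μ)
  refine ContDiffAt.prodMk (contDiffAt_pi.2 fun μ => contDiffAt_pi.2 fun ν => ?_) ?_
  · exact ContDiffAt.sum fun e _ => (((a1 e).mul (a4 e μ ν)).add ((a2 μ e).mul (a3 e ν))).add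
      ((a2 ν e).mul (a3 μ e))
  · exact ContDiffAt.sum fun e _ => (a1 e).mul (h2 e).snd

theorem lieD_eq_zero {ξ : STPoint → STPoint} {x : STPoint} (hx : x ∉ tsupport ξ) :
    lieD ξ Φ x = 0 := by
  have h0 : ξ x = 0 := eq_zero_off hx
  have h1 : ∀ μ, pd μ ξ x = 0 := fun μ => pd_eq_zero_of_notMem hx
  simp only [lieD, h0, h1]
  simp
  rfl

theorem isTest_lieD {ξ : STPoint → STPoint} (hW : IsOpen W) (hΦ : ContDiffOn ℝ ∞ Φ W)
    (hξ : IsTest W ξ) : IsTest W (lieD ξ Φ) :=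
  IsTest.of_zero (fun y hy => contDiffAt_lieD hξ.contDiffAt (hΦ.contDiffAt (hW.mem_nhds hy)))
    hξ.2.1 hξ.2.2 fun _ hy => lieD_eq_zero hy

theorem pd_id_add_smul {ξ : STPoint → STPoint} {x : STPoint} (hξ : DiffAt ξ x) (s : ℝ)
    (μ : Fin 4) : pd μ (fun z => z + s • ξ z) x = Pi.single μ 1 + s • pd μ ξ x := by
  have h := hξ.const_smul s
  rw [pd_add (f := fun z => z) (g := fun z => s • ξ z) differentiableAt_id h, pd_const_smul s hξ]
  simp [pd]

/-- Covariance under `id + s ξ`, differentiated at `s = 0`. -/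
theorem covariance_infinitesimal (hL : SmoothOnLorentzian L)
    (hcov : IsCovariantDensity k L) (hW : IsOpen W) (hΦ : ContDiffOn ℝ ∞ Φ W)
    (hlor : ∀ x ∈ W, IsLorentzian (Φ x).1) {ξ : STPoint → STPoint} (hξ : Smooth ξ)
    {x : STPoint} (hx : x ∈ W) :
    𝒟 L (jet k Φ x) (jet k (lieD ξ Φ) x) = ∑ e, pd e (fun y => ξ y e * L (jet k Φ y)) x := by
  have hΦ' : ∀ y ∈ W, SmoothAt Φ y := fun y hy => hΦ.contDiffAt (hW.mem_nhds hy)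
  have hξd : ∀ y, DiffAt ξ y := fun y => hξ.contDiffAt.diff
  have hLj : SmoothAt L (jet k Φ x) := hL _ (by rw [jet_idx0]; exact hlor x hx)
  let F : ℝ × STPoint → Val := fun p => pullback (fun z => z + p.1 • ξ z) Φ p.2
  have hF : F = fun p => (fun μ ν => ∑ ρ, ∑ σ, ((Pi.single μ 1 : STPoint) ρ + p.1 * pd μ ξ p.2 ρ) *
      ((Pi.single ν 1 : STPoint) σ + p.1 * pd ν ξ p.2 σ) * (Φ (p.2 + p.1 • ξ p.2)).1 ρ σ,
      (Φ (p.2 + p.1 • ξ p.2)).2) := by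
    funext p
    simp only [F, pullback, pd_id_add_smul (hξd _), Pi.add_apply, Pi.smul_apply, smul_eq_mul]
  have hΦc : ∀ y ∈ W, SmoothAt (fun p : ℝ × STPoint => Φ (p.2 + p.1 • ξ p.2)) (0, y) := by
    intro y hy
    refine ContDiffAt.comp (g := Φ) ((0 : ℝ), y) (by simpa using hΦ' y hy) ?_
    exact contDiffAt_snd.add (contDiffAt_fst.smul (hξ.contDiffAt.comp _ contDiffAt_snd))
  have hFc : ∀ y ∈ W, SmoothAt F (0, y) := by
    intro y hy
    rw [hF]
    have h1 : ∀ μ ρ, SmoothAt (fun p : ℝ × STPoint => pd μ ξ p.2 ρ) (0, y) := fun μ ρ =>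
      (contDiffAt_pi.1 (contDiffAt_pd hξ.contDiffAt) ρ).comp ((0 : ℝ), y) contDiffAt_snd
    refine ContDiffAt.prodMk (contDiffAt_pi.2 fun μ => contDiffAt_pi.2 fun ν => ?_) (hΦc y hy).snd
    refine ContDiffAt.sum fun ρ _ => ContDiffAt.sum fun σ _ => ContDiffAt.mul (ContDiffAt.mul ?_ ?_) ?_
    · exact contDiffAt_const.add (contDiffAt_fst.mul (h1 μ ρ))
    · exact contDiffAt_const.add (contDiffAt_fst.mul (h1 ν σ))
    · exact contDiffAt_pi.1 (contDiffAt_pi.1 (hΦc y hy).fst ρ) σ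
  have hline : ∀ y, HasDerivAt (fun s : ℝ => y + s • ξ y) (ξ y) 0 := fun y => by
    simpa using ((hasDerivAt_id (0 : ℝ)).smul_const (ξ y)).const_add y
  have hΦs : ∀ y ∈ W, HasDerivAt (fun s : ℝ => Φ (y + s • ξ y)) (∑ e, ξ y e • pd e Φ y) 0 := by
    intro y hy
    have h2 : HasFDerivAt Φ (𝒟 Φ y) (y + (0 : ℝ) • ξ y) := by
      simpa using (hΦ' y hy).diff.hasFDerivAt
    have := h2.comp_hasDerivAt (f := fun s : ℝ => y + s • ξ y) 0 (hline y)
    rwa [fderiv_eq_sum_pd] at this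
  have hsF : ∀ y ∈ W, 𝒟 F (0, y) (1, 0) = lieD ξ Φ y := by
    intro y hy
    have h2 : HasDerivAt (fun s : ℝ => (s, y)) ((1 : ℝ), (0 : STPoint)) 0 :=
      (hasDerivAt_id _).prodMk (hasDerivAt_const _ _)
    have h3 := (hFc y hy).diff.hasFDerivAt.comp_hasDerivAt
      (f := fun s : ℝ => (s, y)) 0 h2
    refine h3.unique ?_
    rw [hF]
    simp only [Function.comp_def]
    have d1 : ∀ μ ρ, HasDerivAt (fun s : ℝ => (Pi.single μ 1 : STPoint) ρ + s * pd μ ξ y ρ)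
        (pd μ ξ y ρ) 0 := fun μ ρ => by
      simpa using ((hasDerivAt_id (0 : ℝ)).mul_const (pd μ ξ y ρ)).const_add
        ((Pi.single μ 1 : STPoint) ρ)
    have d2 : ∀ ρ σ, HasDerivAt (fun s : ℝ => (Φ (y + s • ξ y)).1 ρ σ)
        (∑ e, ξ y e * (pd e Φ y).1 ρ σ) 0 := by
      intro ρ σ
      have := hasDerivAt_pi.1 (hasDerivAt_pi.1 ((hΦs y hy).fst) ρ) σ
      simpa [Prod.fst_sum, Finset.sum_apply] using this
    have d3 : HasDerivAt (fun s : ℝ => (Φ (y + s • ξ y)).2) (∑ e, ξ y e * (pd e Φ y).2) 0 := by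
      have : HasDerivAt (fun s : ℝ => (Φ (y + s • ξ y)).2) (∑ e, ξ y e • pd e Φ y).2 0 :=
        (hΦs y hy).snd
      simpa [Prod.snd_sum] using this
    refine HasDerivAt.prodMk (hasDerivAt_pi.2 fun μ => hasDerivAt_pi.2 fun ν => ?_) d3
    have d4 := HasDerivAt.fun_sum (u := Finset.univ) fun ρ _ => HasDerivAt.fun_sum (u := Finset.univ)
      fun σ _ => ((d1 μ ρ).mul (d1 ν σ)).mul (d2 ρ σ)
    refine d4.congr_deriv ?_
    simp only [zero_mul, add_zero, zero_smul, Pi.mul_apply, Pi.single_apply, ite_mul, one_mul,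
      mul_ite, mul_one, mul_zero, sum_add_distrib, add_mul,
      Finset.sum_ite_eq', Finset.mem_univ, if_true]
    simp [Finset.sum_ite_eq']
    ring
  have hF0 : ∀ y, F (0, y) = Φ y := by
    intro y
    rw [hF]
    simp [Pi.single_apply]
  have hleft : HasDerivAt (fun s : ℝ => L (jet k (fun y => F (s, y)) x))
      (𝒟 L (jet k Φ x) (jet k (lieD ξ Φ) x)) 0 := by
    have h1 := hasDerivAt_jet (k := k) (hFc x hx)
    have h2 : jet k (fun y => 𝒟 F (0, y) (1, 0)) x = jet k (lieD ξ Φ) x :=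
      jet_congr (by filter_upwards [hW.mem_nhds hx] with y hy using hsF y hy)
    rw [h2] at h1
    have h3 : HasFDerivAt L (𝒟 L (jet k Φ x)) (jet k (fun y => F (0, y)) x) := by
      simp only [hF0]
      exact hLj.diff.hasFDerivAt
    exact h3.comp_hasDerivAt (f := fun s : ℝ => jet k (fun y => F (s, y)) x) 0 h1
  have hjm : ∀ s : ℝ, jacobian (fun z => z + s • ξ z) x =
      (1 + s • (of fun μ ρ => pd μ ξ x ρ : Mat4)).det := by
    intro s
    simp only [jacobian, pd_id_add_smul (hξd _)]
    congr 1
    ext μ ρ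
    simp [Matrix.one_apply, Pi.single_apply, eq_comm]
  have hjac : HasDerivAt (fun s : ℝ => jacobian (fun z => z + s • ξ z) x) (∑ e, pd e ξ x e) 0 := by
    set M : Mat4 := of fun μ ρ => pd μ ξ x ρ
    set p := ((1 + (Polynomial.X : Polynomial ℝ) • M.map Polynomial.C).det.divX.divX)
    have he : (fun s : ℝ => jacobian (fun z => z + s • ξ z) x) = fun s =>
        1 + M.trace * s + p.eval s * s ^ 2 :=
      funext fun s => by rw [hjm, Matrix.det_one_add_smul]
    rw [he]
    have h1 := ((hasDerivAt_id (0 : ℝ)).const_mul M.trace).const_add 1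
    have h2 := (p.hasDerivAt 0).mul ((hasDerivAt_id (0 : ℝ)).pow 2)
    refine (h1.add h2).congr_deriv ?_
    simp [Matrix.trace, M]
  have hj0 : jacobian (fun z => z + (0 : ℝ) • ξ z) x = 1 := by rw [hjm]; simp
  have hLd : DiffAt (fun y => L (jet k Φ y)) x := (hLj.comp x (contDiffAt_jet (hΦ' x hx))).diff
  have hright : HasDerivAt (fun s : ℝ => jacobian (fun z => z + s • ξ z) x *
      L (jet k Φ (x + s • ξ x))) ((∑ e, pd e ξ x e) * L (jet k Φ x) +
        ∑ e, ξ x e * pd e (fun y => L (jet k Φ y)) x) 0 := by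
    have h2 : HasFDerivAt (fun y => L (jet k Φ y)) (𝒟 (fun y => L (jet k Φ y)) x)
        (x + (0 : ℝ) • ξ x) := by
      simpa using hLd.hasFDerivAt
    have h3 := h2.comp_hasDerivAt (f := fun s : ℝ => x + s • ξ x) 0 (hline x)
    rw [fderiv_eq_sum_pd] at h3
    have h4 := hjac.mul h3
    refine h4.congr_deriv ?_
    rw [hj0]
    simp
  have hmem : ∀ᶠ s in 𝓝 (0 : ℝ), x + s • ξ x ∈ W := by
    refine (hline x).continuousAt.eventually ?_
    simpa using hW.mem_nhds hx
  have hev : (fun s : ℝ => L (jet k (fun y => F (s, y)) x)) =ᶠ[𝓝 0] fun s =>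
      jacobian (fun z => z + s • ξ z) x * L (jet k Φ (x + s • ξ x)) := by
    have hp : ∀ᶠ s in 𝓝 (0 : ℝ), 0 < jacobian (fun z => z + s • ξ z) x :=
      hjac.continuousAt.eventually (by simp only [hj0]; exact lt_mem_nhds one_pos)
    filter_upwards [hmem, hp] with s hs hps
    refine hcov (fun z => z + s • ξ z) Φ x ?_ hps (hΦ' _ hs) ?_
    · exact contDiffAt_id.add (hξ.contDiffAt.const_smul s)
    · filter_upwards [hW.mem_nhds hs] with y hy using hlor y hy
  rw [hleft.unique (hright.congr_of_eventuallyEq hev), sum_mul, ← sum_add_distrib]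
  refine sum_congr rfl fun e _ => ?_
  have hξe : DiffAt (fun y => ξ y e) x := differentiableAt_pi.1 (hξd x) e
  rw [pd_mul hξe hLd, pd_pi (hξd x), add_comm]

theorem lieD_symm {ξ : STPoint → STPoint} (hW : IsOpen W)  (hΦ : ContDiffOn ℝ ∞ Φ W)
    (hlor : ∀ x ∈ W, IsLorentzian (Φ x).1) (hξ : tsupport ξ ⊆ W) (x : STPoint) (a b : Fin 4) :
    (lieD ξ Φ x).1 a b = (lieD ξ Φ x).1 b a := by
  by_cases hx : x ∈ W
  · have h1 : ∀ e, (pd e Φ x).1 a b = (pd e Φ x).1 b a := by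
      intro e
      have hd : DiffAt Φ x := (hΦ.contDiffAt (hW.mem_nhds hx)).diff
      have e1 : ∀ c d, (pd e Φ x).1 c d = pd e (fun y => (Φ y).1 c d) x := fun c d => by
        rw [← pd_fst hd, ← pd_pi hd.fst, ← pd_pi (differentiableAt_pi.1 hd.fst c)]
      rw [e1, e1]
      refine pd_congr ?_
      filter_upwards [hW.mem_nhds hx] with y hy using (hlor y hy).symm a b
    simp only [lieD]
    refine sum_congr rfl fun e _ => ?_
    rw [h1, (hlor x hx).symm e b, (hlor x hx).symm a e]
    ring
  · rw [lieD_eq_zero fun h => hx (hξ h)]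
    rfl

/-- The generalized Bianchi identity, in integrated form. -/
theorem IsScalarTensorTheory.bianchi (hT : IsScalarTensorTheory k L E) (hW : IsOpen W)
    (hΦ : ContDiffOn ℝ ∞ Φ W) (hlor : ∀ x ∈ W, IsLorentzian (Φ x).1) {ξ : STPoint → STPoint}
    (hξ : IsTest W ξ) :
    ∫ x in W, sqrtNegDet (Φ x).1 * pair (raise Φ (lieD ξ Φ) x) (E (jet 2 Φ x)) = 0 := by
  have hη := isTest_lieD hW hΦ hξ
  have h1 := hT.functional_derivative.2 W Φ (lieD ξ Φ) hW hΦ hlor hη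
    (fun x a b => lieD_symm hW hΦ hlor hξ.2.2 x a b)
  have h2 := h1.unique (hasDerivAt_action hT.smooth_lagrangian hW hΦ hlor hη)
  have htest : ∀ e, IsTest W fun y => ξ y e * L (jet k Φ y) := fun e => by
    refine IsTest.of_zero (fun y hy => ?_) hξ.2.1 hξ.2.2 fun y hy => ?_
    · refine (contDiffAt_pi.1 hξ.contDiffAt e).mul (ContDiffAt.comp (g := L) y ?_
        (contDiffAt_jet (hΦ.contDiffAt (hW.mem_nhds hy))))
      exact hT.smooth_lagrangian _ (by rw [jet_idx0]; exact hlor y hy)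
    · rw [eq_zero_off hy]; simp
  have h3 : ∀ x, 𝒟 L (jet k Φ x) (jet k (lieD ξ Φ) x) =
      ∑ e, pd e (fun y => ξ y e * L (jet k Φ y)) x := by
    intro x
    by_cases hx : x ∈ W
    · exact covariance_infinitesimal hT.smooth_lagrangian hT.covariant hW hΦ hlor hξ.1 hx
    · have hz : ∀ e, x ∉ tsupport fun y => ξ y e * L (jet k Φ y) := fun e h => hx ((htest e).2.2 h)
      rw [sum_eq_zero fun e _ => pd_eq_zero_of_notMem (hz e),
        jet_congr (notMem_tsupport_iff_eventuallyEq.1 fun h => hx (hη.2.2 h))]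
      have : jet k (0 : STPoint → Val) x = 0 := jet_zero_fun
      rw [this, map_zero]
  refine (show _ = _ from h2).trans ?_
  simp only [h3]
  rw [integral_finsetSum]
  · exact sum_eq_zero fun e _ => integral_pd_eq_zero (htest e)
  · exact fun e _ => (htest e).pd.1.continuous.integrable_of_hasCompactSupport (htest e).pd.2.1

end Bianchi

/-! ### The adjoint of the linearized operator -/

section Adjoint

variable {k : ℕ} {L : Jet k → ℝ} {E : Jet 2 → Val} {U : Set STPoint} {Φ h f : STPoint → Val}

/-- The contraction `pair` as a continuous bilinear map. -/
def pairL : Val →L[ℝ] Val →L[ℝ] ℝ := LinearMap.toContinuousLinearMap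
    ((LinearMap.toContinuousLinearMap : (Val →ₗ[ℝ] ℝ) ≃ₗ[ℝ] (Val →L[ℝ] ℝ)).toLinearMap ∘ₗ
      LinearMap.mk₂ ℝ pair
        (fun a b c => by simp [pair, add_mul, sum_add_distrib]; ring)
        (fun r a b => by simp [pair, mul_sum, mul_assoc, mul_add])
        (fun a b c => by simp [pair, mul_add, sum_add_distrib]; ring)
        (fun r a b => by simp [pair, mul_sum, mul_left_comm, mul_add]))

@[simp] theorem pairL_apply (a b : Val) : pairL a b = pair a b := rfl

/-- The coefficient of `∂_I` in the linearization of `E`, contracted with `√(-g) f`. -/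
def coef (E : Jet 2 → Val) (Φ f : STPoint → Val) (I : JetIdx 2) (x : STPoint) : Val →L[ℝ] ℝ :=
  sqrtNegDet (Φ x).1 • (pairL (f x) ∘L 𝒟 E (jet 2 Φ x) ∘L
    ContinuousLinearMap.single ℝ (fun _ : JetIdx 2 => Val) I)

theorem coef_apply (I : JetIdx 2) (x : STPoint) (v : Val) : coef E Φ f I x v =
    sqrtNegDet (Φ x).1 * pair (f x) (𝒟 E (jet 2 Φ x) (Pi.single I v)) := rfl

/-- The adjoint of the linearized operator as a one-form density. -/
def adjSum (E : Jet 2 → Val) (Φ f : STPoint → Val) (x : STPoint) : Val →L[ℝ] ℝ :=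
  ∑ I : JetIdx 2, (-1 : ℝ) ^ (I.1 : ℕ) • pdI I (coef E Φ f I) x

/-- A smooth configuration on `U` at whose jets the operator `E` is smooth. -/
structure IsBackground (E : Jet 2 → Val) (U : Set STPoint) (Φ : STPoint → Val) : Prop where
  isOpen : IsOpen U
  smooth : ContDiffOn ℝ ∞ Φ U
  lorentzian : ∀ x ∈ U, IsLorentzian (Φ x).1
  smooth_operator : SmoothOnLorentzian E

namespace IsBackground

variable (hB : IsBackground E U Φ) {x : STPoint}
include hB

theorem contDiffAt (hx : x ∈ U) : SmoothAt Φ x := hB.smooth.contDiffAt (hB.isOpen.mem_nhds hx)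

theorem contDiffAt_operator (hx : x ∈ U) : SmoothAt E (jet 2 Φ x) :=
  hB.smooth_operator _ (by rw [jet_idx0]; exact hB.lorentzian x hx)

theorem contDiffAt_fderiv (hx : x ∈ U) : SmoothAt (fun y => 𝒟 E (jet 2 Φ y)) x :=
  ContDiffAt.comp (g := 𝒟 E) x ((hB.contDiffAt_operator hx).fderiv_right (m := ∞) (by simp))
    (contDiffAt_jet (hB.contDiffAt hx))

theorem contDiffAt_sqrt (hx : x ∈ U) : SmoothAt (fun y => sqrtNegDet (Φ y).1) x :=
  ContDiffAt.comp (g := sqrtNegDet) x (contDiffAt_sqrtNegDet (hB.lorentzian x hx))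
    (hB.contDiffAt hx).fst

theorem contDiffAt_coef (I : JetIdx 2) (hx : x ∈ U) (hf : SmoothAt f x) :
    SmoothAt (coef E Φ f I) x := by
  have h1 : SmoothAt (fun y => pairL (f y)) x := pairL.contDiff.contDiffAt.comp x hf
  exact (hB.contDiffAt_sqrt hx).smul
    (h1.clm_comp ((hB.contDiffAt_fderiv hx).clm_comp contDiffAt_const))

theorem isTest_coef (I : JetIdx 2) (hf : IsTest U f) : IsTest U (coef E Φ f I) :=
  IsTest.of_zero (fun y hy => hB.contDiffAt_coef I hy hf.contDiffAt) hf.2.1 hf.2.2 fun y hy => by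
    simp [coef, eq_zero_off hy]

end IsBackground

theorem IsTest.pdI' {X : Type*} [NormedAddCommGroup X] [NormedSpace ℝ X] {f : STPoint → X}
    {W : Set STPoint} {k : ℕ} (I : JetIdx k) (hf : IsTest W f) : IsTest W (SmallBody.pdI I f) :=
  IsTest.of_zero (fun _ _ => contDiffAt_pdI I hf.contDiffAt) hf.2.1 hf.2.2 fun y hy => by
    rw [pdI_congr I (notMem_tsupport_iff_eventuallyEq.1 hy)]
    exact pdI_zero_fun I

theorem IsTest.sum {X ι : Type*} [NormedAddCommGroup X] [NormedSpace ℝ X] {F : ι → STPoint → X}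
    {W : Set STPoint} (s : Finset ι) (hf : ∀ i ∈ s, IsTest W (F i)) :
    IsTest W fun x => ∑ i ∈ s, F i x := by
  classical
  refine IsTest.of_zero (K := ⋃ i ∈ s, tsupport (F i))
    (fun y _ => ContDiffAt.sum fun i hi => (hf i hi).contDiffAt)
    (s.isCompact_biUnion fun i hi => (hf i hi).2.1) (iUnion₂_subset fun i hi => (hf i hi).2.2)
    fun y hy => sum_eq_zero fun i hi => ?_
  refine eq_zero_off fun h => hy ?_
  exact mem_iUnion₂.2 ⟨i, hi, h⟩

theorem IsTest.const_smul {X : Type*} [NormedAddCommGroup X] [NormedSpace ℝ X] {f : STPoint → X}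
    {W : Set STPoint} (c : ℝ) (hf : IsTest W f) : IsTest W fun x => c • f x :=
  IsTest.of_zero (fun _ _ => hf.contDiffAt.const_smul c) hf.2.1 hf.2.2 fun y hy => by
    simp [eq_zero_off hy]

theorem IsTest.integrable {X : Type*} [NormedAddCommGroup X] [NormedSpace ℝ X] {f : STPoint → X}
    {W : Set STPoint} (hf : IsTest W f) : Integrable f :=
  hf.1.continuous.integrable_of_hasCompactSupport hf.2.1

theorem IsBackground.isTest_adjSum (hB : IsBackground E U Φ) (hf : IsTest U f) :
    IsTest U (adjSum E Φ f) :=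
  IsTest.sum _ fun I _ => ((hB.isTest_coef I hf).pdI' I).const_smul _

theorem linIntegrand_eq (hB : IsBackground E U Φ) (hf : IsTest U f) (x : STPoint) :
    linIntegrand E Φ h f x = adjSum E Φ f x (h x) := by
  simp only [linIntegrand, adjointLin, adjSum]
  have key : ∀ I : JetIdx 2, pdI I (fun y => sqrtNegDet (Φ y).1 *
      pair (f y) (𝒟 E (jet 2 Φ y) (Pi.single I (h x)))) x = pdI I (coef E Φ f I) x (h x) := by
    intro I
    have h1 : ContDiffAt ℝ (I.1 : ℕ) (coef E Φ f I) x :=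
      (hB.isTest_coef I hf).contDiffAt.of_le (by exact_mod_cast le_top)
    have := (ContinuousLinearMap.apply ℝ ℝ (h x)).iteratedFDeriv_comp_left h1 (i := I.1) le_rfl
    exact congrArg (fun T => T fun a => Pi.single (I.2 a) 1) this
  simp only [key]
  rw [ContinuousLinearMap.sum_apply]
  by_cases hx : x ∈ U
  · rw [← mul_assoc, mul_inv_cancel₀ (hB.lorentzian x hx).sqrtNegDet_pos.ne', one_mul]
    rfl
  · have : ∀ I : JetIdx 2, pdI I (coef E Φ f I) x = 0 := fun I =>
      eq_zero_off fun h => hx (((hB.isTest_coef I hf).pdI' I).2.2 h)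
    simp [this]

theorem IsTest.clm_apply {V : Set STPoint} {a : STPoint → Val →L[ℝ] ℝ} {b : STPoint → Val}
    (ha : IsTest V a) (hb : ∀ y ∈ V, SmoothAt b y) : IsTest V fun y => a y (b y) :=
  IsTest.of_zero (fun y hy => ha.contDiffAt.clm_apply (hb y hy)) ha.2.1 ha.2.2 fun y hy => by
    simp [eq_zero_off hy]

/-- Integration by parts against a smooth field on a neighbourhood of the support. -/
theorem integral_pd_right {V : Set STPoint} {c : STPoint → Val →L[ℝ] ℝ} (hV : IsOpen V)
    (hc : IsTest V c) (hh : ContDiffOn ℝ ∞ h V) (μ : Fin 4) :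
    ∫ x, c x (pd μ h x) = -∫ x, pd μ c x (h x) := by
  have hh' : ∀ y ∈ V, SmoothAt h y := fun y hy => hh.contDiffAt (hV.mem_nhds hy)
  have t0 := hc.clm_apply hh'
  have t1 := hc.clm_apply fun y hy => contDiffAt_pd (μ := μ) (hh' y hy)
  have t2 := (hc.pd (μ := μ)).clm_apply hh'
  have e : ∀ x, pd μ (fun y => c y (h y)) x = c x (pd μ h x) + pd μ c x (h x) := by
    intro x
    by_cases hx : x ∈ V
    · simp only [pd]
      rw [fderiv_clm_apply hc.contDiffAt.diff
        (hh' x hx).diff]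
      rfl
    · have z : ∀ {Z : Type} [NormedAddCommGroup Z] [NormedSpace ℝ Z] {a : STPoint → Z},
          IsTest V a → a x = 0 := fun ha =>
        eq_zero_off fun h => hx (ha.2.2 h)
      rw [z t0.pd, z hc, z (hc.pd (μ := μ))]
      simp
  have h0 := integral_pd_eq_zero (μ := μ) t0
  simp only [e] at h0
  rw [integral_add t1.integrable t2.integrable] at h0
  linarith

theorem integral_pdI_right {V : Set STPoint} {c : STPoint → Val →L[ℝ] ℝ} (hV : IsOpen V)
    (hc : IsTest V c) (hh : ContDiffOn ℝ ∞ h V) (I : JetIdx 2) :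
    ∫ x, c x (pdI I h x) = ∫ x, ((-1 : ℝ) ^ (I.1 : ℕ) • pdI I c x) (h x) := by
  have hh' : ∀ y ∈ V, SmoothAt h y := fun y hy => hh.contDiffAt (hV.mem_nhds hy)
  rcases jetIdx_two_cases I with rfl | ⟨α, rfl⟩ | ⟨α, β, rfl⟩
  · simp only [pdI_idx0]
    simp [idx0]
  · simp only [pdI_idx1]
    rw [integral_pd_right hV hc hh, ← integral_neg]
    simp [idx1]
  · have e : ∀ x, c x (pdI (idx2 α β) h x) = c x (pd α (pd β h) x) := by
      intro x
      by_cases hx : x ∈ V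
      · rw [pdI_idx2 α β (hh' x hx)]
      · rw [eq_zero_off fun h => hx (hc.2.2 h)]; simp
    have hh2 : ContDiffOn ℝ ∞ (pd β h) V := fun y hy => (contDiffAt_pd (hh' y hy)).contDiffWithinAt
    simp only [e, pdI_idx2 α β hc.contDiffAt]
    rw [integral_pd_right hV hc hh2, integral_pd_right hV hc.pd hh, neg_neg]
    have : ∀ x, pd β (pd α c) x = pd α (pd β c) x := fun x => pd_comm hc.contDiffAt
    simp [idx2, this]

theorem sum_coef (j : Jet 2) (x : STPoint) : ∑ I, coef E Φ f I x (j I) =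
    sqrtNegDet (Φ x).1 * pair (f x) (𝒟 E (jet 2 Φ x) j) := by
  have : j = ∑ I, Pi.single I (j I) := by funext I; simp
  conv_rhs => rw [this]
  rw [map_sum, ← pairL_apply, map_sum, mul_sum]
  rfl

theorem integral_adjSum (hB : IsBackground E U Φ) {V : Set STPoint} (hV : IsOpen V) (hVU : V ⊆ U)
    (hf : IsTest V f) (hh : ContDiffOn ℝ ∞ h V) :
    ∫ x, adjSum E Φ f x (h x) =
      ∫ x, sqrtNegDet (Φ x).1 * pair (f x) (𝒟 E (jet 2 Φ x) (jet 2 h x)) := by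
  have hB' : IsBackground E V Φ := ⟨hV, hB.smooth.mono hVU, fun x hx => hB.lorentzian x (hVU hx),
    hB.smooth_operator⟩
  have hh' : ∀ y ∈ V, SmoothAt h y := fun y hy => hh.contDiffAt (hV.mem_nhds hy)
  simp only [← sum_coef, adjSum, ContinuousLinearMap.sum_apply]
  rw [integral_finsetSum, integral_finsetSum]
  · exact sum_congr rfl fun I _ => (integral_pdI_right hV (hB'.isTest_coef I hf) hh I).symm
  · exact fun I _ => ((hB'.isTest_coef I hf).clm_apply fun y hy => contDiffAt_pdI I (hh' y hy)).integrable
  · exact fun I _ => ((((hB'.isTest_coef I hf).pdI' I).const_smul _).clm_apply hh').integrable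

end Adjoint

section LinearizedBianchi

variable {k : ℕ} {L : Jet k → ℝ} {E : Jet 2 → Val} {U : Set STPoint} {Φ h : STPoint → Val}
  {ξ : STPoint → STPoint}

/-- `raise` as a function of the values of the fields. -/
def raiseV (v w : Val) : Val := (fun a b => -(invMetric v.1 * of w.1 * invMetric v.1) a b, w.2)

theorem contDiffAt_raiseV {Z : Type*} [NormedAddCommGroup Z] [NormedSpace ℝ Z] {v w : Z → Val}
    {z : Z} (hz : IsLorentzian (v z).1) (hv : SmoothAt v z) (hw : SmoothAt w z) :
    SmoothAt (fun y => raiseV (v y) (w y)) z := by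
  have h1 : ∀ a b, SmoothAt (fun y => invMetric (v y).1 a b) z := fun a b =>
    ContDiffAt.comp (g := fun g => invMetric g a b) z (contDiffAt_invMetric hz a b) hv.fst
  have h2 : ∀ a b, SmoothAt (fun y => (w y).1 a b) z := fun a =>
    contDiffAt_pi.1 (contDiffAt_pi.1 hw.fst a)
  refine ContDiffAt.prodMk (contDiffAt_pi.2 fun a => contDiffAt_pi.2 fun b => ?_) hw.snd
  simp only [mul_apply, of_apply]
  exact (ContDiffAt.sum fun c _ => (ContDiffAt.sum fun d _ => (h1 _ _).mul (h2 _ _)).mul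
    (h1 _ _)).neg

theorem raiseV_zero (v : Val) : raiseV v 0 = 0 := by
  ext <;> simp [raiseV]

theorem isTest_raise (hB : IsBackground E U Φ) (hη : IsTest U h) : IsTest U (raise Φ h) :=
  IsTest.of_zero (fun y hy => contDiffAt_raiseV (hB.lorentzian y hy) (hB.contDiffAt hy)
    hη.contDiffAt) hη.2.1 hη.2.2 fun y hy => by
      change raiseV (Φ y) (h y) = 0
      rw [eq_zero_off hy, raiseV_zero]

theorem lieD_add_smul {x : STPoint} (hΦ : DiffAt Φ x) (hh : DiffAt h x)
    (s : ℝ) : lieD ξ (fun y => Φ y + s • h y) x = lieD ξ Φ x + s • lieD ξ h x := by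
  have h1 : ∀ e, pd e (fun y => Φ y + s • h y) x = pd e Φ x + s • pd e h x := fun e => by
    have := hh.const_smul s
    rw [pd_add (g := fun y => s • h y) hΦ this, pd_const_smul s hh]
  refine Prod.ext ?_ ?_
  · funext μ ν
    simp only [lieD, h1, Prod.fst_add, Prod.smul_fst, Pi.add_apply, Pi.smul_apply, smul_eq_mul,
      mul_sum, ← sum_add_distrib]
    exact sum_congr rfl fun e _ => by ring
  · simp only [lieD, h1, Prod.snd_add, Prod.smul_snd, smul_eq_mul, mul_sum, ← sum_add_distrib]
    exact sum_congr rfl fun e _ => by ring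

theorem isLorentzian_add_smul (hB : IsBackground E U Φ) (hh : IsTest U h)
    (hs : ∀ x a b, (h x).1 a b = (h x).1 b a) :
    ∀ᶠ s in 𝓝 (0 : ℝ), ∀ x ∈ U, IsLorentzian (Φ x + s • h x).1 := by
  have hloc : ∀ y ∈ tsupport h, ∀ᶠ p in 𝓝 ((0 : ℝ), y), IsLorentzian (Φ p.2 + p.1 • h p.2).1 := by
    intro y hy
    have hyU := hh.2.2 hy
    have hc : ContinuousAt (fun p : ℝ × STPoint => (Φ p.2 + p.1 • h p.2).1) (0, y) := by
      have h1 : ContinuousAt (fun p : ℝ × STPoint => Φ p.2) (0, y) :=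
        (hB.contDiffAt hyU).continuousAt.comp (f := Prod.snd) (x := ((0 : ℝ), y)) continuousAt_snd
      have h2 : ContinuousAt (fun p : ℝ × STPoint => h p.2) (0, y) :=
        (hh.contDiffAt).continuousAt.comp (f := Prod.snd) (x := ((0 : ℝ), y)) continuousAt_snd
      exact (h1.add (continuousAt_fst.smul h2)).fst
    have h3 := hc.eventually (by simpa using (hB.lorentzian y hyU).eventually)
    have h4 : ∀ᶠ p in 𝓝 ((0 : ℝ), y), p.2 ∈ U :=
      continuous_snd.continuousAt.eventually (hB.isOpen.mem_nhds hyU)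
    filter_upwards [h3, h4] with p hp hpU
    refine hp fun a b => ?_
    simp only [Prod.fst_add, Prod.smul_fst, Pi.add_apply, Pi.smul_apply, hs p.2 a b,
      (hB.lorentzian _ hpU).symm a b]
  have hall : ∀ᶠ s in 𝓝 (0 : ℝ), ∀ y ∈ tsupport h, IsLorentzian (Φ y + s • h y).1 := by
    refine hh.2.1.isCompact.induction_on (p := fun S => ∀ᶠ s in 𝓝 (0 : ℝ), ∀ y ∈ S,
      IsLorentzian (Φ y + s • h y).1) (by simp) ?_ ?_ ?_
    · exact fun S T hST hT => hT.mono fun s hs y hy => hs y (hST hy)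
    · intro S T h1 h2
      filter_upwards [h1, h2] with s h1 h2 y hy
      exact hy.elim (h1 y) (h2 y)
    · intro y hy
      have := hloc y hy
      rw [nhds_prod_eq, eventually_prod_iff] at this
      obtain ⟨pa, ha, pb, hb, hab⟩ := this
      exact ⟨{y | pb y}, mem_nhdsWithin_of_mem_nhds hb, ha.mono fun s hs z hz => hab hs hz⟩
  filter_upwards [hall] with s h1 x hx
  by_cases hxs : x ∈ tsupport h
  · exact h1 x hxs
  · simpa [eq_zero_off hxs] using hB.lorentzian x hx

theorem IsScalarTensorTheory.bianchi_linearized (hT : IsScalarTensorTheory k L E)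
    (hB : IsBackground E U Φ) (hE : ∀ x ∈ U, E (jet 2 Φ x) = 0) (hξ : IsTest U ξ)
    (hh : IsTest U h) (hs : ∀ x a b, (h x).1 a b = (h x).1 b a) :
    ∫ x, sqrtNegDet (Φ x).1 * pair (raise Φ (lieD ξ Φ) x)
      (𝒟 E (jet 2 Φ x) (jet 2 h x)) = 0 := by
  set G : ℝ → STPoint → ℝ := fun s x => sqrtNegDet (Φ x + s • h x).1 *
    pair (raise (fun y => Φ y + s • h y) (lieD ξ fun y => Φ y + s • h y) x)
      (E (jet 2 (fun y => Φ y + s • h y) x)) with hG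
  have hout : ∀ s y, y ∉ tsupport ξ → G s y = 0 := by
    intro s y hy
    simp only [hG, raise, lieD_eq_zero hy]
    have := raiseV_zero (Φ y + s • h y)
    unfold raiseV at this
    rw [this]
    simp [pair]
  let A : ℝ × STPoint → Val := fun p => sqrtNegDet (Φ p.2 + p.1 • h p.2).1 •
    raiseV (Φ p.2 + p.1 • h p.2) (lieD ξ Φ p.2 + p.1 • lieD ξ h p.2)
  have hGe : ∀ y ∈ U, ∀ s, G s y = pairL (A (s, y)) (E (jet 2 Φ y + s • jet 2 h y)) := by
    intro y hy s
    simp only [hG, A, map_smul, ContinuousLinearMap.smul_apply, smul_eq_mul]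
    rw [jet_add_smul (hB.contDiffAt hy) hh.contDiffAt, ← lieD_add_smul (hB.contDiffAt hy).diff
        hh.contDiffAt.diff]
    rfl
  have hΦp : ∀ y ∈ U, SmoothAt (fun p : ℝ × STPoint => Φ p.2 + p.1 • h p.2) (0, y) := by
    intro y hy
    have h1 : SmoothAt (fun p : ℝ × STPoint => Φ p.2) (0, y) :=
      (hB.contDiffAt hy).comp ((0 : ℝ), y) contDiffAt_snd
    have h2 : SmoothAt (fun p : ℝ × STPoint => h p.2) (0, y) :=
      hh.contDiffAt.comp ((0 : ℝ), y) contDiffAt_snd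
    exact h1.add (contDiffAt_fst.smul h2)
  have hA : ∀ y ∈ U, SmoothAt A (0, y) := by
    intro y hy
    have hl : IsLorentzian (Φ (0, y).2 + ((0 : ℝ), y).1 • h (0, y).2).1 := by
      simpa using hB.lorentzian y hy
    have h1 : SmoothAt (fun p : ℝ × STPoint => lieD ξ Φ p.2) (0, y) :=
      (contDiffAt_lieD hξ.contDiffAt (hB.contDiffAt hy)).comp ((0 : ℝ), y) contDiffAt_snd
    have h2 : SmoothAt (fun p : ℝ × STPoint => lieD ξ h p.2) (0, y) :=
      (contDiffAt_lieD hξ.contDiffAt hh.contDiffAt).comp ((0 : ℝ), y) contDiffAt_snd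
    have a1 : SmoothAt (fun p : ℝ × STPoint => sqrtNegDet (Φ p.2 + p.1 • h p.2).1) (0, y) :=
      ContDiffAt.comp (g := sqrtNegDet) ((0 : ℝ), y) (contDiffAt_sqrtNegDet hl) (hΦp y hy).fst
    exact a1.smul (contDiffAt_raiseV (z := ((0 : ℝ), y))
      (v := fun p : ℝ × STPoint => Φ p.2 + p.1 • h p.2) hl (hΦp y hy)
      (h1.add (contDiffAt_fst.smul h2)))
  have hmain : HasDerivAt (fun s => ∫ y, G s y) (∫ x, sqrtNegDet (Φ x).1 *
      pair (raise Φ (lieD ξ Φ) x) (𝒟 E (jet 2 Φ x) (jet 2 h x))) 0 := by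
    refine hasDerivAt_integral_of_compact (K := tsupport ξ) hξ.2.1 hout ?_ ?_ ?_
    · intro y hy
      have : raise Φ (lieD ξ Φ) y = 0 := by
        change raiseV (Φ y) (lieD ξ Φ y) = 0
        rw [lieD_eq_zero hy, raiseV_zero]
      simp [this, pair]
    · intro y hy
      have hyU := hξ.2.2 hy
      have hev : uncurry G =ᶠ[𝓝 ((0 : ℝ), y)]
          fun p => pairL (A p) (E (jet 2 Φ p.2 + p.1 • jet 2 h p.2)) := by
        have : ∀ᶠ p in 𝓝 ((0 : ℝ), y), p.2 ∈ U :=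
          continuous_snd.continuousAt.eventually (hB.isOpen.mem_nhds hyU)
        filter_upwards [this] with p hp
        exact hGe _ hp _
      refine ContDiffAt.congr_of_eventuallyEq ?_ hev
      have hj : SmoothAt (fun p : ℝ × STPoint => jet 2 Φ p.2) (0, y) :=
        (contDiffAt_jet (hB.contDiffAt hyU)).comp ((0 : ℝ), y) contDiffAt_snd
      have hj' : SmoothAt (fun p : ℝ × STPoint => jet 2 h p.2) (0, y) :=
        (contDiffAt_jet hh.contDiffAt).comp ((0 : ℝ), y) contDiffAt_snd
      refine ContDiffAt.of_le (n := ∞) ?_ (by exact_mod_cast le_top)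
      refine ContDiffAt.clm_apply (pairL.contDiff.contDiffAt.comp _ (hA y hyU)) ?_
      refine ContDiffAt.comp (g := E) ((0 : ℝ), y) ?_ (hj.add (contDiffAt_fst.smul hj'))
      simpa using hB.contDiffAt_operator hyU
    · intro y hy
      have hyU := hξ.2.2 hy
      simp only [hGe y hyU]
      have h1 : HasDerivAt (fun s : ℝ => jet 2 Φ y + s • jet 2 h y) (jet 2 h y) 0 := by
        simpa using ((hasDerivAt_id (0 : ℝ)).smul_const (jet 2 h y)).const_add (jet 2 Φ y)
      have h2 : HasFDerivAt E (𝒟 E (jet 2 Φ y)) (jet 2 Φ y + (0 : ℝ) • jet 2 h y) := by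
        simpa using (hB.contDiffAt_operator hyU).diff.hasFDerivAt
      have h3 := h2.comp_hasDerivAt (f := fun s : ℝ => jet 2 Φ y + s • jet 2 h y) 0 h1
      have h4 : DiffAt (fun s : ℝ => A (s, y)) 0 :=
        (hA y hyU).diff.comp (f := fun s : ℝ => (s, y)) 0
          (differentiableAt_id.prodMk (differentiableAt_const _))
      have h5 : DiffAt (fun s : ℝ => pairL (A (s, y))) 0 :=
        pairL.differentiableAt.comp (f := fun s : ℝ => A (s, y)) 0 h4
      refine (h5.hasDerivAt.clm_apply h3).congr_deriv ?_
      simp only [Function.comp_apply, zero_smul, add_zero, hE y hyU, map_zero, zero_add, A, map_smul,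
        ContinuousLinearMap.smul_apply, smul_eq_mul]
      rfl
  have hzero : (fun s => ∫ y, G s y) =ᶠ[𝓝 0] fun _ => (0 : ℝ) := by
    filter_upwards [isLorentzian_add_smul hB hh hs] with s hlor
    have hsm : ContDiffOn ℝ ∞ (fun y => Φ y + s • h y) U :=
      hB.smooth.add (hh.1.contDiffOn.const_smul s)
    have h1 := hT.bianchi hB.isOpen hsm hlor hξ
    rw [← h1]
    exact (setIntegral_eq_integral_of_forall_compl_eq_zero fun y hy =>
      hout s y fun h => hy (hξ.2.2 h)).symm
  exact hmain.unique ((hasDerivAt_const _ _).congr_of_eventuallyEq hzero)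

/-- The adjoint of the linearized operator annihilates infinitesimal diffeomorphisms. -/
theorem IsScalarTensorTheory.adjSum_lieD (hT : IsScalarTensorTheory k L E)
    (hB : IsBackground E U Φ) (hE : ∀ x ∈ U, E (jet 2 Φ x) = 0) (hξ : IsTest U ξ)
    {v : Val} (hv : ∀ a b, v.1 a b = v.1 b a) (x : STPoint) :
    adjSum E Φ (raise Φ (lieD ξ Φ)) x v = 0 := by
  have ht := isTest_raise hB (isTest_lieD hB.isOpen hB.smooth hξ)
  have htA := hB.isTest_adjSum ht
  have hc : Continuous fun x => adjSum E Φ (raise Φ (lieD ξ Φ)) x v :=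
    htA.1.continuous.clm_apply continuous_const
  have hae : ∀ᵐ x, x ∈ U → adjSum E Φ (raise Φ (lieD ξ Φ)) x v = 0 := by
    refine hB.isOpen.ae_eq_zero_of_integral_contDiff_smul_eq_zero
      (hc.locallyIntegrable.locallyIntegrableOn _) fun g hg hgc hgU => ?_
    have hgv : IsTest U fun y => g y • v :=
      IsTest.of_zero (fun y _ => hg.contDiffAt.smul contDiffAt_const) hgc hgU fun y hy => by
        simp [eq_zero_off hy]
    have h1 := hT.bianchi_linearized hB hE hξ hgv fun x a b => by simp [hv a b]
    rw [← integral_adjSum hB hB.isOpen subset_rfl ht hgv.1.contDiffOn] at h1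
    simpa using h1
  by_cases hx : x ∈ U
  · have h0 := Measure.eqOn_open_of_ae_eq (μ := volume)
      (f := fun x => adjSum E Φ (raise Φ (lieD ξ Φ)) x v) (g := fun _ => 0)
      ((ae_restrict_iff' hB.isOpen.measurableSet).2 hae) hB.isOpen hc.continuousOn continuousOn_const
    exact h0 hx
  · rw [eq_zero_off fun h => hx (htA.2.2 h)]
    simp

end LinearizedBianchi

/-! ### Spatial coordinates -/

section Spatial

/-- The spatial coordinates of a point. -/
def spat (x : STPoint) : E3 := WithLp.toLp 2 ![x 1, x 2, x 3]

/-- Dilation of the spatial coordinates. -/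
def dil (ε : ℝ) (x : STPoint) : STPoint := pt (x 0) (ε • spat x)

@[simp] theorem pt_zero_apply (t : ℝ) (y : E3) : pt t y 0 = t := rfl

theorem pt_succ (t : ℝ) (y : E3) (i : Fin 3) : pt t y i.succ = y i := by fin_cases i <;> rfl

theorem spat_apply (x : STPoint) (i : Fin 3) : spat x i = x i.succ := by fin_cases i <;> rfl

@[simp] theorem spat_pt (t : ℝ) (y : E3) : spat (pt t y) = y := by ext i; rw [spat_apply, pt_succ]

@[simp] theorem pt_spat (x : STPoint) : pt (x 0) (spat x) = x := by
  ext μ; refine Fin.cases rfl (fun i => ?_) μ; rw [pt_succ, spat_apply]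

theorem rad_eq (x : STPoint) : rad x = ‖spat x‖ := by
  rw [EuclideanSpace.norm_eq, Fin.sum_univ_three]
  simp [rad, spat]

@[simp] theorem rad_pt (t : ℝ) (y : E3) : rad (pt t y) = ‖y‖ := by rw [rad_eq, spat_pt]

theorem continuous_spat : Continuous spat := by unfold spat; fun_prop

theorem continuous_rad : Continuous rad := by
  have : rad = fun x => ‖spat x‖ := funext rad_eq
  rw [this]; exact continuous_spat.norm

theorem contDiff_pt : Smooth fun p : ℝ × E3 => pt p.1 p.2 := by
  refine contDiff_pi.2 fun μ => ?_
  refine Fin.cases contDiff_fst (fun i => ?_) μ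
  simp only [pt_succ]
  fun_prop

theorem continuous_pt : Continuous fun p : ℝ × E3 => pt p.1 p.2 := contDiff_pt.continuous

theorem contDiff_spat : Smooth spat := by
  unfold spat
  refine (PiLp.contDiff_toLp (𝕜 := ℝ) (p := 2) (n := ∞) (E := fun _ : Fin 3 => ℝ)).comp ?_
  refine contDiff_pi.2 fun i => ?_
  fin_cases i <;> simp <;> fun_prop

theorem eq_worldline {x : STPoint} (h : rad x = 0) : x = wl (x 0) := by
  rw [rad_eq, norm_eq_zero] at h
  conv_lhs => rw [← pt_spat x, h]
  rfl

theorem rad_nonneg (x : STPoint) : 0 ≤ rad x := Real.sqrt_nonneg _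

end Spatial

/-! ### Derivatives at the boundary of a half space -/

section HalfSpace

variable {X : Type*} [NormedAddCommGroup X] [NormedSpace ℝ X] {O : Set (ℝ × STPoint)}
  {G : ℝ × STPoint → X} {x : STPoint}

/-- The part of `O` where the parameter is nonnegative. -/
def halfOf (O : Set (ℝ × STPoint)) : Set (ℝ × STPoint) := (Ici 0 ×ˢ univ) ∩ O

theorem uniqueDiffOn_halfOf (hO : IsOpen O) : UniqueDiffOn ℝ (halfOf O) :=
  ((uniqueDiffOn_Ici (0 : ℝ)).prod uniqueDiffOn_univ).inter hO

theorem mem_halfOf {l : ℝ} : (l, x) ∈ halfOf O ↔ 0 ≤ l ∧ (l, x) ∈ O := by simp [halfOf]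

theorem contDiffOn_fderivWithin_halfOf (hO : IsOpen O) (hG : ContDiffOn ℝ ∞ G (halfOf O)) :
    ContDiffOn ℝ ∞ (fderivWithin ℝ G (halfOf O)) (halfOf O) :=
  hG.fderivWithin (m := ∞) (uniqueDiffOn_halfOf hO) (by simp)

theorem hasDerivWithinAt_halfOf (hO : IsOpen O) (hG : ContDiffOn ℝ ∞ G (halfOf O))
    (hx : (0, x) ∈ O) :
    HasDerivWithinAt (fun l : ℝ => G (l, x)) (fderivWithin ℝ G (halfOf O) (0, x) (1, 0)) (Ici 0) 0 := by
  have h0 : ((0 : ℝ), x) ∈ halfOf O := mem_halfOf.2 ⟨le_rfl, hx⟩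
  have h1 := ((hG _ h0).differentiableWithinAt (by simp)).hasFDerivWithinAt
  have h2 : HasDerivWithinAt (fun l : ℝ => (l, x)) ((1 : ℝ), (0 : STPoint))
      (Ici 0 ∩ {l | (l, x) ∈ O}) 0 :=
    ((hasDerivAt_id _).prodMk (hasDerivAt_const _ _)).hasDerivWithinAt
  have h3 := h1.comp_hasDerivWithinAt (f := fun l : ℝ => (l, x)) (0 : ℝ) h2 fun l hl =>
    mem_halfOf.2 ⟨hl.1, hl.2⟩
  refine (hasDerivWithinAt_inter ?_).1 h3
  exact (by fun_prop : Continuous fun l : ℝ => (l, x)).continuousAt.preimage_mem_nhds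
    (hO.mem_nhds hx)

theorem derivWithin_halfOf (hO : IsOpen O) (hG : ContDiffOn ℝ ∞ G (halfOf O)) (hx : (0, x) ∈ O) :
    derivWithin (fun l : ℝ => G (l, x)) (Ici 0) 0 = fderivWithin ℝ G (halfOf O) (0, x) (1, 0) :=
  (hasDerivWithinAt_halfOf hO hG hx).derivWithin (uniqueDiffOn_Ici _ _ self_mem_Ici)

theorem hasFDerivAt_slice (hO : IsOpen O) {l : ℝ} (hl : 0 ≤ l) {H : ℝ × STPoint → X}
    (hG : ContDiffOn ℝ ∞ H (halfOf O)) (hx : (l, x) ∈ O) :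
    HasFDerivAt (fun y => H (l, y))
      ((fderivWithin ℝ H (halfOf O) (l, x)).comp (ContinuousLinearMap.inr ℝ ℝ STPoint)) x := by
  have h0 : (l, x) ∈ halfOf O := mem_halfOf.2 ⟨hl, hx⟩
  have h1 := ((hG _ h0).differentiableWithinAt (by simp)).hasFDerivWithinAt
  have h2 : HasFDerivWithinAt (fun y : STPoint => (l, y)) (ContinuousLinearMap.inr ℝ ℝ STPoint)
      {y | (l, y) ∈ O} x := (hasFDerivAt_prodMk_right l x).hasFDerivWithinAt
  have h3 := h1.comp (f := fun y : STPoint => (l, y)) x h2 fun y hy => mem_halfOf.2 ⟨hl, hy⟩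
  refine h3.hasFDerivAt ?_
  exact (by fun_prop : Continuous fun y : STPoint => (l, y)).continuousAt.preimage_mem_nhds
    (hO.mem_nhds hx)

theorem contDiffAt_slice (hO : IsOpen O) {l : ℝ} (hl : 0 ≤ l) {H : ℝ × STPoint → X}
    (hG : ContDiffOn ℝ ∞ H (halfOf O)) (hx : (l, x) ∈ O) :
    SmoothAt (fun y => H (l, y)) x := by
  have h : ContDiffOn ℝ ∞ (fun y => H (l, y)) {y | (l, y) ∈ O} :=
    hG.comp (contDiff_const.prodMk contDiff_id).contDiffOn fun y hy => mem_halfOf.2 ⟨hl, hy⟩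
  exact h.contDiffAt ((by fun_prop : Continuous fun y : STPoint => (l, y)).continuousAt.preimage_mem_nhds
    (hO.mem_nhds hx))

/-- The derivative in the parameter at its boundary value. -/
def bderiv (G : ℝ × STPoint → X) (y : STPoint) : X := derivWithin (fun l : ℝ => G (l, y)) (Ici 0) 0

theorem eventually_slice (hO : IsOpen O) {l : ℝ} (hx : (l, x) ∈ O) : ∀ᶠ y in 𝓝 x, (l, y) ∈ O :=
  (by fun_prop : Continuous fun y : STPoint => (l, y)).continuousAt.preimage_mem_nhds
    (hO.mem_nhds hx)

theorem bderiv_eventuallyEq (hO : IsOpen O) (hG : ContDiffOn ℝ ∞ G (halfOf O)) (hx : (0, x) ∈ O) :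
    bderiv G =ᶠ[𝓝 x] fun y => fderivWithin ℝ G (halfOf O) (0, y) (1, 0) :=
  (eventually_slice hO hx).mono fun _ hy => derivWithin_halfOf hO hG hy

theorem contDiffAt_bderiv (hO : IsOpen O) (hG : ContDiffOn ℝ ∞ G (halfOf O)) (hx : (0, x) ∈ O) :
    SmoothAt (bderiv G) x :=
  (contDiffAt_slice hO le_rfl (((contDiffOn_fderivWithin_halfOf hO hG)).clm_apply
    contDiffOn_const) hx).congr_of_eventuallyEq (bderiv_eventuallyEq hO hG hx)

/-- The partial derivative of the slices. -/
def slicePd (O : Set (ℝ × STPoint)) (μ : Fin 4) (G : ℝ × STPoint → X) (p : ℝ × STPoint) : X :=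
  fderivWithin ℝ G (halfOf O) p (0, Pi.single μ 1)

theorem contDiffOn_slicePd (hO : IsOpen O) (hG : ContDiffOn ℝ ∞ G (halfOf O)) (μ : Fin 4) :
    ContDiffOn ℝ ∞ (slicePd O μ G) (halfOf O) :=
  (contDiffOn_fderivWithin_halfOf hO hG).clm_apply contDiffOn_const

theorem pd_slice (hO : IsOpen O) (hG : ContDiffOn ℝ ∞ G (halfOf O)) {l : ℝ} (hl : 0 ≤ l)
    (hx : (l, x) ∈ O) (μ : Fin 4) : pd μ (fun y => G (l, y)) x = slicePd O μ G (l, x) := by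
  rw [pd, (hasFDerivAt_slice hO hl hG hx).fderiv]
  rfl

theorem pd_bderiv (hO : IsOpen O) (hG : ContDiffOn ℝ ∞ G (halfOf O)) (hx : (0, x) ∈ O) (μ : Fin 4) :
    pd μ (bderiv G) x = bderiv (slicePd O μ G) x := by
  have h0 : ((0 : ℝ), x) ∈ halfOf O := mem_halfOf.2 ⟨le_rfl, hx⟩
  have hD := contDiffOn_fderivWithin_halfOf hO hG
  have hud := uniqueDiffOn_halfOf hO
  have hdd : DifferentiableWithinAt ℝ (fderivWithin ℝ G (halfOf O)) (halfOf O) (0, x) :=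
    (hD _ h0).differentiableWithinAt (by simp)
  have ev : ∀ a b : ℝ × STPoint, fderivWithin ℝ (fun p => fderivWithin ℝ G (halfOf O) p a)
      (halfOf O) (0, x) b = fderivWithin ℝ (fderivWithin ℝ G (halfOf O)) (halfOf O) (0, x) b a := by
    intro a b
    rw [fderivWithin_clm_apply (hud _ h0) hdd (differentiableWithinAt_const _)]
    simp
  rw [pd_congr (bderiv_eventuallyEq hO hG hx),
    pd_slice (G := fun p => fderivWithin ℝ G (halfOf O) p (1, 0)) hO
      (hD.clm_apply contDiffOn_const) le_rfl hx]
  rw [bderiv, derivWithin_halfOf hO (contDiffOn_slicePd hO hG μ) hx]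
  change fderivWithin ℝ (fun p => fderivWithin ℝ G (halfOf O) p (1, 0)) (halfOf O) (0, x) _ =
    fderivWithin ℝ (fun p => fderivWithin ℝ G (halfOf O) p (0, Pi.single μ 1)) (halfOf O) (0, x) _
  rw [ev, ev]
  refine (hG _ h0).isSymmSndFDerivWithinAt (by simpa using two_le_infty) hud ?_ h0 _ _
  have hint : Ioi 0 ×ˢ univ ∩ O ⊆ interior (halfOf O) :=
    interior_maximal (inter_subset_inter_left _ (prod_mono Ioi_subset_Ici_self subset_rfl))
      ((isOpen_Ioi.prod isOpen_univ).inter hO)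
  refine closure_mono hint ?_
  rw [mem_closure_iff_nhds]
  intro V hV
  have hc : Tendsto (fun l : ℝ => (l, x)) (𝓝[>] 0) (𝓝 (0, x)) :=
    ((by fun_prop : Continuous fun l : ℝ => (l, x)).tendsto 0).mono_left nhdsWithin_le_nhds
  have := (hc.eventually (inter_mem hV (hO.mem_nhds hx))).and self_mem_nhdsWithin
  obtain ⟨l, hl, hl0⟩ := this.exists
  exact ⟨(l, x), hl.1, ⟨hl0, mem_univ _⟩, hl.2⟩

theorem hasDerivWithinAt_jet_two {G : ℝ × STPoint → Val} (hO : IsOpen O)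
    (hG : ContDiffOn ℝ ∞ G (halfOf O)) (hx : (0, x) ∈ O) :
    HasDerivWithinAt (fun l : ℝ => jet 2 (fun y => G (l, y)) x) (jet 2 (bderiv G) x) (Ici 0) 0 := by
  have base : ∀ {H : ℝ × STPoint → Val}, ContDiffOn ℝ ∞ H (halfOf O) →
      HasDerivWithinAt (fun l : ℝ => H (l, x)) (bderiv H x) (Ici 0) 0 := fun hH => by
    rw [bderiv, derivWithin_halfOf hO hH hx]
    exact hasDerivWithinAt_halfOf hO hH hx
  have hnn : ∀ᶠ l in 𝓝[Ici 0] (0 : ℝ), 0 ≤ l := self_mem_nhdsWithin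
  have hmem : ∀ᶠ l in 𝓝[Ici 0] (0 : ℝ), 0 ≤ l ∧ (l, x) ∈ O := hnn.and (mem_nhdsWithin_of_mem_nhds
      ((by fun_prop : Continuous fun l : ℝ => (l, x)).continuousAt.preimage_mem_nhds
        (hO.mem_nhds hx)))
  refine hasDerivWithinAt_pi.2 fun I => ?_
  rcases jetIdx_two_cases I with rfl | ⟨α, rfl⟩ | ⟨α, β, rfl⟩
  · simp only [jet, pdI_idx0]
    exact base hG
  · simp only [jet, pdI_idx1]
    rw [pd_bderiv hO hG hx]
    refine (base (contDiffOn_slicePd hO hG α)).congr_of_eventuallyEq_of_mem ?_ self_mem_Ici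
    filter_upwards [hmem] with l hl using pd_slice hO hG hl.1 hl.2 α
  · simp only [jet]
    rw [pdI_idx2 _ _ (contDiffAt_bderiv hO hG hx)]
    have e1 : pd α (pd β (bderiv G)) x = pd α (bderiv (slicePd O β G)) x :=
      pd_congr ((eventually_slice hO hx).mono fun y hy => pd_bderiv hO hG hy β)
    have hβ := contDiffOn_slicePd hO hG β
    rw [e1, pd_bderiv hO hβ hx]
    refine (base (contDiffOn_slicePd hO hβ α)).congr_of_eventuallyEq_of_mem ?_ self_mem_Ici
    filter_upwards [hmem] with l hl
    rw [pdI_idx2 _ _ (contDiffAt_slice hO hl.1 hG hl.2)]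
    have e2 : pd α (pd β fun y => G (l, y)) x = pd α (fun y => slicePd O β G (l, y)) x :=
      pd_congr ((eventually_slice hO hl.2).mono fun y hy => pd_slice hO hG hl.1 hy β)
    rw [e2, pd_slice hO hβ hl.1 hl.2]

end HalfSpace

/-! ### The perturbation of a small-body family -/

section Family

variable {E : Jet 2 → Val} {U : Set STPoint} {R Λ : ℝ} {Φ : ℝ → STPoint → Val}

/-- The set of `(l, x)` with `x` outside the body. -/
def outside (U : Set STPoint) (R Λ : ℝ) : Set (ℝ × STPoint) :=
  {p | p.1 < Λ ∧ p.2 ∈ U ∧ p.1 * R < rad p.2}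

namespace IsSmallBodyFamily

variable (hF : IsSmallBodyFamily E U R Λ Φ)
include hF

theorem isOpen_outside : IsOpen (outside U R Λ) :=
  (isOpen_lt continuous_fst continuous_const).inter ((hF.isOpen.preimage continuous_snd).inter
    (isOpen_lt (continuous_fst.mul continuous_const) (continuous_rad.comp continuous_snd)))

theorem smooth_half : ContDiffOn ℝ ∞ (fun p : ℝ × STPoint => Φ p.1 p.2)
    (halfOf (outside U R Λ)) := by
  refine hF.smooth.mono ?_
  rintro ⟨l, x⟩ ⟨h1, h2⟩
  exact ⟨h1.1, h2⟩

theorem mem_outside {x : STPoint} (hx : x ∈ U) (hr : 0 < rad x) : ((0 : ℝ), x) ∈ outside U R Λ :=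
  ⟨hF.Λ_pos, hx, by simpa using hr⟩

theorem eventually_outside {x : STPoint} (hx : x ∈ U) (hr : 0 < rad x) :
    ∀ᶠ l in 𝓝[Ici 0] (0 : ℝ), 0 ≤ l ∧ l < Λ ∧ l * R < rad x := by
  have hnn : ∀ᶠ l in 𝓝[Ici 0] (0 : ℝ), 0 ≤ l := self_mem_nhdsWithin
  have := (by fun_prop : Continuous fun l : ℝ => (l, x)).continuousAt.preimage_mem_nhds
    (hF.isOpen_outside.mem_nhds (hF.mem_outside hx hr))
  filter_upwards [hnn, mem_nhdsWithin_of_mem_nhds this] with l h1 h2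
  exact ⟨h1, h2.1, h2.2.2⟩

theorem contDiffAt_perturbation {x : STPoint} (hx : x ∈ U) (hr : 0 < rad x) :
    SmoothAt (perturbation Φ) x :=
  contDiffAt_bderiv hF.isOpen_outside hF.smooth_half (hF.mem_outside hx hr)

theorem perturbation_symm {x : STPoint} (hx : x ∈ U) (hr : 0 < rad x) (a b : Fin 4) :
    (perturbation Φ x).1 a b = (perturbation Φ x).1 b a := by
  have h1 := hasDerivWithinAt_halfOf hF.isOpen_outside hF.smooth_half (hF.mem_outside hx hr)
  rw [← derivWithin_halfOf hF.isOpen_outside hF.smooth_half (hF.mem_outside hx hr)] at h1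
  change HasDerivWithinAt (fun l => Φ l x) (perturbation Φ x) (Ici 0) 0 at h1
  have h2 : ∀ c d, HasDerivWithinAt (fun l => (Φ l x).1 c d) ((perturbation Φ x).1 c d) (Ici 0) 0 :=
    fun c d => hasDerivWithinAt_pi.1 (hasDerivWithinAt_pi.1
      ((ContinuousLinearMap.fst ℝ (Tensor) ℝ).hasFDerivAt.comp_hasDerivWithinAt 0 h1) c) d
  refine (uniqueDiffOn_Ici (0 : ℝ) 0 self_mem_Ici).eq_deriv _ (h2 a b) ?_
  refine (h2 b a).congr_of_eventuallyEq_of_mem ?_ self_mem_Ici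
  filter_upwards [hF.eventually_outside hx hr] with l hl
  exact (hF.lorentzian l x hl.1 hl.2.1 hx hl.2.2).symm a b

theorem background (hE : SmoothOnLorentzian E) : IsBackground E U (Φ 0) :=
  ⟨hF.isOpen, hF.smooth_zero, hF.lorentzian_zero, hE⟩

theorem linearized_eq (hE : SmoothOnLorentzian E) {x : STPoint} (hx : x ∈ U) (hr : 0 < rad x) :
    𝒟 E (jet 2 (Φ 0) x) (jet 2 (perturbation Φ) x) = 0 := by
  have h1 := hasDerivWithinAt_jet_two hF.isOpen_outside hF.smooth_half (hF.mem_outside hx hr)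
  change HasDerivWithinAt (fun l => jet 2 (Φ l) x) (jet 2 (perturbation Φ) x) (Ici 0) 0 at h1
  have h2 := (((hF.background hE).contDiffAt_operator hx).differentiableAt
    (by simp)).hasFDerivAt.comp_hasDerivWithinAt (f := fun l => jet 2 (Φ l) x) 0 h1
  refine (uniqueDiffOn_Ici (0 : ℝ) 0 self_mem_Ici).eq_deriv _ h2 ?_
  refine (hasDerivWithinAt_const (0 : ℝ) (Ici 0) (0 : Val)).congr_of_eventuallyEq_of_mem ?_
    self_mem_Ici
  filter_upwards [hF.eventually_outside hx hr] with l hl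
  exact hF.field_eq l x hl.1 hl.2.1 hx hl.2.2

theorem background_eq (hE : SmoothOnLorentzian E)
    {x : STPoint} (hx : x ∈ U) : E (jet 2 (Φ 0) x) = 0 := by
  by_cases hr : 0 < rad x
  · exact hF.field_eq 0 x le_rfl hF.Λ_pos hx (by simpa using hr)
  have hr0 : rad x = 0 := le_antisymm (not_lt.1 hr) (rad_nonneg x)
  have hB := hF.background hE
  have hc : ContinuousAt (fun y => E (jet 2 (Φ 0) y)) x :=
    (ContDiffAt.comp (g := E) x (hB.contDiffAt_operator hx)
      (contDiffAt_jet (hB.contDiffAt hx))).continuousAt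
  set n : E3 := axis 0
  have hcurve : Tendsto (fun ε : ℝ => pt (x 0) (ε • n)) (𝓝[>] 0) (𝓝 x) := by
    have h1 : Continuous fun ε : ℝ => pt (x 0) (ε • n) :=
      continuous_pt.comp (by fun_prop : Continuous fun ε : ℝ => (x 0, ε • n))
    have h2 := h1.tendsto 0
    rw [zero_smul] at h2
    have e : pt (x 0) 0 = x := (eq_worldline hr0).symm
    rw [e] at h2
    exact h2.mono_left nhdsWithin_le_nhds
  refine tendsto_nhds_unique (hc.tendsto.comp hcurve) ?_
  refine tendsto_const_nhds.congr' ?_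
  filter_upwards [hcurve.eventually (hF.isOpen.mem_nhds hx), self_mem_nhdsWithin] with ε h1 h2
  refine (hF.field_eq 0 _ le_rfl hF.Λ_pos h1 ?_).symm
  have : ‖n‖ = 1 := by simp [n]
  rw [rad_pt, norm_smul, this]
  simpa using ne_of_gt (show (0 : ℝ) < ε from h2)

end IsSmallBodyFamily

/-- `F` represents the family near `(α, β) = (0, 0)` at the time `t₀` and direction `n₀`. -/
def IsNearZone (Φ : ℝ → STPoint → Val) (t₀ : ℝ) (n₀ : E3) (F : ℝ × E3 × ℝ × ℝ → Val) : Prop :=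
  SmoothAt F (t₀, n₀, 0, 0) ∧ ∀ᶠ p : ℝ × E3 × ℝ × ℝ in 𝓝 (t₀, n₀, 0, 0),
    ‖p.2.1‖ = 1 → 0 < p.2.2.1 → 0 ≤ p.2.2.2 → Φ (p.2.2.1 * p.2.2.2) (pt p.1 (p.2.2.1 • p.2.1)) = F p

/-- The coefficient of `β` in the expansion of `F`. -/
def betaCoeff (F : ℝ × E3 × ℝ × ℝ → Val) (p : ℝ × E3 × ℝ) : Val :=
  𝒟 F (p.1, p.2.1, p.2.2, 0) (0, 0, 0, 1)

variable {t₀ : ℝ} {n₀ : E3} {F : ℝ × E3 × ℝ × ℝ → Val}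

theorem IsNearZone.contDiffAt_betaCoeff (h : IsNearZone Φ t₀ n₀ F) :
    SmoothAt (betaCoeff F) (t₀, n₀, 0) := by
  refine ContDiffAt.clm_apply ?_ contDiffAt_const
  refine ContDiffAt.comp (g := 𝒟 F) (t₀, n₀, (0 : ℝ)) (h.1.fderiv_right (m := ∞) (by simp)) ?_
  fun_prop

theorem IsNearZone.perturbation_eq (h : IsNearZone Φ t₀ n₀ F) :
    ∀ᶠ p : ℝ × E3 × ℝ in 𝓝 (t₀, n₀, 0), ‖p.2.1‖ = 1 → 0 < p.2.2 →
      perturbation Φ (pt p.1 (p.2.2 • p.2.1)) = p.2.2⁻¹ • betaCoeff F p := by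
  have h1 : ∀ᶠ p in 𝓝 ((t₀, n₀, 0, 0) : ℝ × E3 × ℝ × ℝ), ContDiffAt ℝ 1 F p := h.1.near
  have h2 := (h1.and h.2).eventually_nhds
  have hc : Continuous fun p : ℝ × E3 × ℝ => (p.1, p.2.1, p.2.2, (0 : ℝ)) := by fun_prop
  have h3 := (hc.tendsto (t₀, n₀, (0 : ℝ))).eventually h2
  filter_upwards [h3] with p hp hn hα
  obtain ⟨t, n, α⟩ := p
  simp only at hp hn hα ⊢
  have hd : HasFDerivAt F (𝒟 F (t, n, α, 0)) (t, n, α, α⁻¹ * (0 : ℝ)) := by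
    simpa using hp.self_of_nhds.1.diff.hasFDerivAt
  have hl : HasDerivAt (fun l : ℝ => (t, n, α, α⁻¹ * l)) ((0 : ℝ), (0 : E3), (0 : ℝ), α⁻¹) 0 :=
    (hasDerivAt_const _ _).prodMk ((hasDerivAt_const _ _).prodMk ((hasDerivAt_const _ _).prodMk
      (by simpa using (hasDerivAt_id (0 : ℝ)).const_mul α⁻¹)))
  have hcomp := hd.comp_hasDerivAt (f := fun l : ℝ => (t, n, α, α⁻¹ * l)) 0 hl
  have e1 : 𝒟 F (t, n, α, 0) ((0 : ℝ), (0 : E3), (0 : ℝ), α⁻¹) = α⁻¹ • betaCoeff F (t, n, α) := by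
    rw [betaCoeff, ← map_smul]
    simp
  rw [e1] at hcomp
  have hcl : Tendsto (fun l : ℝ => (t, n, α, α⁻¹ * l)) (𝓝[≥] 0) (𝓝 (t, n, α, 0)) := by
    have h0 : Continuous fun l : ℝ => (t, n, α, α⁻¹ * l) := by fun_prop
    have := h0.tendsto 0
    rw [mul_zero] at this
    exact this.mono_left nhdsWithin_le_nhds
  have hw : HasDerivWithinAt (fun l => Φ l (pt t (α • n))) (α⁻¹ • betaCoeff F (t, n, α)) (Ici 0) 0 := by
    refine hcomp.hasDerivWithinAt.congr_of_eventuallyEq_of_mem ?_ self_mem_Ici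
    filter_upwards [hcl.eventually hp, self_mem_nhdsWithin] with l hl hl0
    have := hl.2 hn hα (mul_nonneg (inv_nonneg.2 hα.le) hl0)
    simp only [← mul_assoc, mul_inv_cancel₀ hα.ne', one_mul] at this
    exact this
  exact hw.derivWithin (uniqueDiffOn_Ici _ _ self_mem_Ici)

/-- The leading part, of order `1/r`, of the perturbation near the worldline. -/
def lead (Φ : ℝ → STPoint → Val) (x : STPoint) : Val :=
  limUnder (𝓝[>] (0 : ℝ)) fun ε => ε • perturbation Φ (dil ε x)

theorem IsNearZone.tendsto_lead (h : IsNearZone Φ t₀ n₀ F) :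
    ∀ᶠ p : ℝ × E3 in 𝓝 (t₀, n₀), ‖p.2‖ = 1 → ∀ ρ : ℝ, 0 < ρ →
      Tendsto (fun ε : ℝ => ε • perturbation Φ (dil ε (pt p.1 (ρ • p.2)))) (𝓝[>] 0)
        (𝓝 (ρ⁻¹ • betaCoeff F (p.1, p.2, 0))) := by
  have hb : ∀ᶠ p in 𝓝 ((t₀, n₀, 0) : ℝ × E3 × ℝ), ContDiffAt ℝ 1 (betaCoeff F) p :=
    h.contDiffAt_betaCoeff.near
  have h2 := (hb.and h.perturbation_eq).eventually_nhds
  have hc : Continuous fun p : ℝ × E3 => (p.1, p.2, (0 : ℝ)) := by fun_prop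
  have h3 := (hc.tendsto (t₀, n₀)).eventually h2
  filter_upwards [h3] with p hp hn ρ hρ
  obtain ⟨t, n⟩ := p
  simp only at hp hn ⊢
  have hcl : Tendsto (fun ε : ℝ => (t, n, ε * ρ)) (𝓝[>] 0) (𝓝 (t, n, 0)) := by
    have h0 : Continuous fun ε : ℝ => (t, n, ε * ρ) := by fun_prop
    have := h0.tendsto 0
    rw [zero_mul] at this
    exact this.mono_left nhdsWithin_le_nhds
  have hlim : Tendsto (fun ε : ℝ => ρ⁻¹ • betaCoeff F (t, n, ε * ρ)) (𝓝[>] 0)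
      (𝓝 (ρ⁻¹ • betaCoeff F (t, n, 0))) :=
    (hp.self_of_nhds.1.continuousAt.tendsto.comp hcl).const_smul _
  refine hlim.congr' ?_
  filter_upwards [hcl.eventually hp, self_mem_nhdsWithin] with ε h1 h2
  have hε : (0 : ℝ) < ε := h2
  have := h1.2 hn (mul_pos hε hρ)
  simp only [dil, pt_zero_apply, spat_pt, smul_smul]
  rw [this, smul_smul, mul_inv, ← mul_assoc, mul_inv_cancel₀ hε.ne', one_mul]

theorem IsNearZone.lead_eq (h : IsNearZone Φ t₀ n₀ F) :
    ∀ᶠ p : ℝ × E3 in 𝓝 (t₀, n₀), ‖p.2‖ = 1 → ∀ ρ : ℝ, 0 < ρ →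
      lead Φ (pt p.1 (ρ • p.2)) = ρ⁻¹ • betaCoeff F (p.1, p.2, 0) :=
  h.tendsto_lead.mono fun _ hp hn ρ hρ => (hp hn ρ hρ).limUnder_eq

theorem exists_unit_smul {y : E3} (hy : y ≠ 0) : ‖‖y‖⁻¹ • y‖ = 1 ∧ ‖y‖ • (‖y‖⁻¹ • y) = y := by
  have := norm_ne_zero_iff.2 hy
  refine ⟨by rw [norm_smul, norm_inv, norm_norm, inv_mul_cancel₀ this], ?_⟩
  rw [smul_smul, mul_inv_cancel₀ this, one_smul]

namespace IsSmallBodyFamily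

variable (hF : IsSmallBodyFamily E U R Λ Φ)
include hF

theorem exists_nearZone (ht : worldline t₀ ∈ U) (hn : ‖n₀‖ = 1) : ∃ F, IsNearZone Φ t₀ n₀ F :=
  hF.uniform t₀ ht n₀ hn

theorem tendsto_lead {t : ℝ} (ht : wl t ∈ U) {y : E3} (hy : y ≠ 0) :
    Tendsto (fun ε : ℝ => ε • perturbation Φ (dil ε (pt t y))) (𝓝[>] 0) (𝓝 (lead Φ (pt t y))) := by
  obtain ⟨h1, h2⟩ := exists_unit_smul hy
  obtain ⟨F, h⟩ := hF.exists_nearZone ht h1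
  have := h.tendsto_lead.self_of_nhds h1 ‖y‖ (norm_pos_iff.2 hy)
  have e := h.lead_eq.self_of_nhds h1 ‖y‖ (norm_pos_iff.2 hy)
  simp only [h2] at this e
  rwa [e]

theorem lead_smul {t : ℝ} (ht : wl t ∈ U) {y : E3} (hy : y ≠ 0) {ρ : ℝ} (hρ : 0 < ρ) :
    lead Φ (pt t (ρ • y)) = ρ⁻¹ • lead Φ (pt t y) := by
  obtain ⟨h1, h2⟩ := exists_unit_smul hy
  obtain ⟨F, h⟩ := hF.exists_nearZone ht h1
  have hy' := norm_pos_iff.2 hy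
  have e1 := h.lead_eq.self_of_nhds h1 ‖y‖ hy'
  have e2 := h.lead_eq.self_of_nhds h1 (ρ * ‖y‖) (mul_pos hρ hy')
  simp only [mul_smul, h2] at e1 e2
  rw [e1, e2, smul_smul, mul_inv]

theorem contDiffAt_lead {t : ℝ} (ht : wl t ∈ U) {y : E3} (hy : y ≠ 0) :
    SmoothAt (fun p : ℝ × E3 => lead Φ (pt p.1 p.2)) (t, y) := by
  obtain ⟨h1, h2⟩ := exists_unit_smul hy
  obtain ⟨F, h⟩ := hF.exists_nearZone ht h1
  have hy' := norm_pos_iff.2 hy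
  have hnorm : SmoothAt (fun p : ℝ × E3 => ‖p.2‖⁻¹) (t, y) :=
    (ContDiffAt.norm ℝ contDiffAt_snd hy).inv hy'.ne'
  have hdir : SmoothAt (fun p : ℝ × E3 => (p.1, ‖p.2‖⁻¹ • p.2)) (t, y) :=
    contDiffAt_fst.prodMk (hnorm.smul contDiffAt_snd)
  have hev : (fun p : ℝ × E3 => lead Φ (pt p.1 p.2)) =ᶠ[𝓝 (t, y)] fun p =>
      ‖p.2‖⁻¹ • betaCoeff F (p.1, ‖p.2‖⁻¹ • p.2, 0) := by
    have hne : ∀ᶠ p : ℝ × E3 in 𝓝 (t, y), p.2 ≠ 0 := continuous_snd.continuousAt.eventually_ne hy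
    filter_upwards [hdir.continuousAt.eventually h.lead_eq, hne] with p hp hp0
    obtain ⟨h1, h2⟩ := exists_unit_smul hp0
    have := hp h1 ‖p.2‖ (norm_pos_iff.2 hp0)
    simpa only [h2] using this
  refine ContDiffAt.congr_of_eventuallyEq (hnorm.smul ?_) hev
  refine ContDiffAt.comp (g := betaCoeff F) (t, y) h.contDiffAt_betaCoeff ?_
  exact contDiffAt_fst.prodMk ((hnorm.smul contDiffAt_snd).prodMk contDiffAt_const)

theorem lead_symm {t : ℝ} (ht : wl t ∈ U) {y : E3} (hy : y ≠ 0) (a b : Fin 4) :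
    (lead Φ (pt t y)).1 a b = (lead Φ (pt t y)).1 b a := by
  have h := hF.tendsto_lead ht hy
  have h2 : ∀ c d, Tendsto (fun ε : ℝ => (ε • perturbation Φ (dil ε (pt t y))).1 c d) (𝓝[>] 0)
      (𝓝 ((lead Φ (pt t y)).1 c d)) := fun c d =>
    (((by fun_prop : Continuous fun v : Val => v.1 c d)).tendsto _).comp h
  refine tendsto_nhds_unique (h2 a b) ((h2 b a).congr' ?_)
  have hcl : Tendsto (fun ε : ℝ => dil ε (pt t y)) (𝓝[>] 0) (𝓝 (wl t)) := by
    have h0 : Continuous fun ε : ℝ => dil ε (pt t y) :=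
      continuous_pt.comp (by fun_prop : Continuous fun ε : ℝ => ((pt t y) 0, ε • spat (pt t y)))
    have := h0.tendsto 0
    simp only [dil, zero_smul, pt_zero_apply] at this
    exact this.mono_left nhdsWithin_le_nhds
  filter_upwards [hcl.eventually (hF.isOpen.mem_nhds ht), self_mem_nhdsWithin] with ε h1 h3
  have hε : (0 : ℝ) < ε := h3
  have hr : 0 < rad (dil ε (pt t y)) := by
    rw [dil, rad_pt, spat_pt, norm_smul, norm_of_nonneg hε.le]
    exact mul_pos hε (norm_pos_iff.2 hy)
  simp only [Prod.smul_fst, Pi.smul_apply, hF.perturbation_symm h1 hr b a]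

/-- The perturbation is `O(1/r)` near the worldline. -/
theorem exists_bound {K : Set STPoint} (hK : IsCompact K) (hKU : K ⊆ U) :
    ∃ C : ℝ, 0 ≤ C ∧ ∀ x ∈ K, 0 < rad x → ‖perturbation Φ x‖ ≤ C * (rad x)⁻¹ := by
  refine hK.induction_on (p := fun S => ∃ C : ℝ, 0 ≤ C ∧ ∀ x ∈ S, 0 < rad x →
    ‖perturbation Φ x‖ ≤ C * (rad x)⁻¹) ⟨0, le_rfl, by simp⟩ ?_ ?_ ?_
  · rintro S T hST ⟨C, h0, hC⟩
    exact ⟨C, h0, fun x hx => hC x (hST hx)⟩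
  · rintro S T ⟨C, h0, hC⟩ ⟨D, h0', hD⟩
    refine ⟨max C D, le_max_of_le_left h0, fun x hx hr => ?_⟩
    have hr' := inv_nonneg.2 hr.le
    rcases hx with hx | hx
    · exact (hC x hx hr).trans (mul_le_mul_of_nonneg_right (le_max_left _ _) hr')
    · exact (hD x hx hr).trans (mul_le_mul_of_nonneg_right (le_max_right _ _) hr')
  intro x hx
  by_cases hr : 0 < rad x
  · have hc : ContinuousAt (fun y => rad y * ‖perturbation Φ y‖) x :=
      continuous_rad.continuousAt.mul (hF.contDiffAt_perturbation (hKU hx) hr).continuousAt.norm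
    have h1 := hc.eventually_lt_const (lt_add_one _)
    refine ⟨_, mem_nhdsWithin_of_mem_nhds h1, rad x * ‖perturbation Φ x‖ + 1, by positivity, ?_⟩
    intro y hy hyr
    rw [← div_eq_mul_inv, le_div_iff₀ hyr, mul_comm]
    exact (show _ < _ from hy).le
  have hx0 : x = wl (x 0) := eq_worldline (le_antisymm (not_lt.1 hr) (rad_nonneg x))
  set t := x 0
  have ht : wl t ∈ U := hx0 ▸ hKU hx
  have hsph : ∃ C : ℝ, 0 ≤ C ∧ ∀ᶠ q : ℝ × ℝ in 𝓝 (t, 0), ∀ n ∈ Metric.sphere (0 : E3) 1,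
      0 < q.2 → ‖perturbation Φ (pt q.1 (q.2 • n))‖ ≤ C * q.2⁻¹ := by
    refine (isCompact_sphere (0 : E3) 1).induction_on (p := fun S => ∃ C : ℝ, 0 ≤ C ∧
      ∀ᶠ q : ℝ × ℝ in 𝓝 (t, 0), ∀ n ∈ S, 0 < q.2 →
        ‖perturbation Φ (pt q.1 (q.2 • n))‖ ≤ C * q.2⁻¹) ⟨0, le_rfl, by simp⟩ ?_ ?_ ?_
    · rintro S T hST ⟨C, h0, hC⟩
      exact ⟨C, h0, hC.mono fun q hq n hn => hq n (hST hn)⟩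
    · rintro S T ⟨C, h0, hC⟩ ⟨D, h0', hD⟩
      refine ⟨max C D, le_max_of_le_left h0, ?_⟩
      filter_upwards [hC, hD] with q h1 h2 n hn hq
      have hr' := inv_nonneg.2 hq.le
      rcases hn with hn | hn
      · exact (h1 n hn hq).trans (mul_le_mul_of_nonneg_right (le_max_left _ _) hr')
      · exact (h2 n hn hq).trans (mul_le_mul_of_nonneg_right (le_max_right _ _) hr')
    · intro n₀ hn₀
      obtain ⟨F, h⟩ := hF.exists_nearZone ht (by simpa using hn₀)
      have hb := h.contDiffAt_betaCoeff.continuousAt.norm.eventually_lt_const (lt_add_one _)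
      have h1 := hb.and h.perturbation_eq
      have hperm : Continuous fun r : E3 × (ℝ × ℝ) => (r.2.1, r.1, r.2.2) := by fun_prop
      have h2 := (hperm.tendsto (n₀, (t, (0 : ℝ)))).eventually h1
      rw [nhds_prod_eq, eventually_prod_iff] at h2
      obtain ⟨pa, ha, pb, hb', hab⟩ := h2
      refine ⟨{n | pa n} ∩ Metric.sphere 0 1, inter_mem (mem_nhdsWithin_of_mem_nhds ha)
        self_mem_nhdsWithin, ‖betaCoeff F (t, n₀, 0)‖ + 1, by positivity, hb'.mono ?_⟩
      intro q hq n hn hq0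
      obtain ⟨h3, h4⟩ := hab hn.1 hq
      have h5 := h4 (by simpa using hn.2) hq0
      simp only at h5 h3
      rw [h5, norm_smul, norm_inv, norm_of_nonneg hq0.le, mul_comm]
      exact mul_le_mul_of_nonneg_right h3.le (inv_nonneg.2 hq0.le)
  obtain ⟨C, h0, hC⟩ := hsph
  have hc : Continuous fun y : STPoint => (y 0, rad y) := (continuous_apply 0).prodMk continuous_rad
  have hr0 : rad x = 0 := le_antisymm (not_lt.1 hr) (rad_nonneg x)
  have h1 : ∀ᶠ y in 𝓝 x, ∀ n ∈ Metric.sphere (0 : E3) 1, 0 < rad y →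
      ‖perturbation Φ (pt (y 0) (rad y • n))‖ ≤ C * (rad y)⁻¹ := by
    have h2 := hc.tendsto x
    rw [hr0] at h2
    exact h2.eventually hC
  refine ⟨_, mem_nhdsWithin_of_mem_nhds h1, C, h0, fun y hy hyr => ?_⟩
  have hy0 : spat y ≠ 0 := by rw [rad_eq] at hyr; exact norm_pos_iff.1 hyr
  obtain ⟨e1, e2⟩ := exists_unit_smul hy0
  have := (show ∀ n ∈ Metric.sphere (0 : E3) 1, _ from hy) _ (by simpa using e1) hyr
  simp only [rad_eq, e2, pt_spat] at this
  rwa [rad_eq]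

end IsSmallBodyFamily

end Family

/-! ### Integration in time and space -/

section Integration

theorem pt_measurePreserving : MeasurePreserving (fun p : ℝ × E3 => pt p.1 p.2) := by
  have h1 := (volume_preserving_piFinSuccAbove (fun _ : Fin 4 => ℝ) 0).symm
  have h2 : MeasurePreserving (Prod.map (id : ℝ → ℝ) (WithLp.ofLp : E3 → Fin 3 → ℝ)) :=
    (MeasurePreserving.id volume).prod (PiLp.volume_preserving_ofLp (Fin 3))
  have h3 := h1.comp h2
  have e : (fun p : ℝ × E3 => pt p.1 p.2) =
      (MeasurableEquiv.piFinSuccAbove (fun _ : Fin 4 => ℝ) 0).symm ∘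
        Prod.map (id : ℝ → ℝ) (WithLp.ofLp : E3 → Fin 3 → ℝ) := by
    funext p
    ext μ
    refine Fin.cases rfl (fun i => ?_) μ
    rw [pt_succ]
    rfl
  rw [e]
  exact h3

theorem pt_measurableEmbedding : MeasurableEmbedding (fun p : ℝ × E3 => pt p.1 p.2) := by
  have hm : Measurable fun x : STPoint => (x 0, spat x) :=
    (measurable_pi_apply 0).prodMk continuous_spat.measurable
  refine MeasurableEmbedding.of_measurable_inverse (g := fun x => (x 0, spat x))
    continuous_pt.measurable ?_ hm ?_
  · have : range (fun p : ℝ × E3 => pt p.1 p.2) = univ :=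
      eq_univ_of_forall fun x => ⟨(x 0, spat x), pt_spat x⟩
    rw [this]; exact MeasurableSet.univ
  · intro p; simp

theorem integral_pt {X : Type*} [NormedAddCommGroup X] [NormedSpace ℝ X] (f : STPoint → X) :
    ∫ p : ℝ × E3, f (pt p.1 p.2) = ∫ x, f x :=
  pt_measurePreserving.integral_comp pt_measurableEmbedding f

theorem integrable_pt {X : Type*} [NormedAddCommGroup X] {f : STPoint → X} :
    Integrable (fun p : ℝ × E3 => f (pt p.1 p.2)) ↔ Integrable f :=
  pt_measurePreserving.integrable_comp_emb pt_measurableEmbedding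

theorem dil_zero (ε : ℝ) (x : STPoint) : dil ε x 0 = x 0 := rfl

theorem dil_succ (ε : ℝ) (x : STPoint) (i : Fin 3) : dil ε x i.succ = ε * x i.succ := by
  rw [dil, pt_succ, PiLp.smul_apply, spat_apply, smul_eq_mul]

theorem spat_dil (ε : ℝ) (x : STPoint) : spat (dil ε x) = ε • spat x := spat_pt _ _

theorem rad_dil {ε : ℝ} (hε : 0 < ε) (x : STPoint) : rad (dil ε x) = ε * rad x := by
  rw [rad_eq, spat_dil, norm_smul, norm_of_nonneg hε.le, rad_eq]

/-- `dil` as a continuous linear map. -/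
def dilL (ε : ℝ) : STPoint →L[ℝ] STPoint :=
  LinearMap.toContinuousLinearMap (Matrix.toLin' (Matrix.diagonal ![1, ε, ε, ε]))

theorem dilL_apply (ε : ℝ) (x : STPoint) : dilL ε x = dil ε x := by
  ext μ
  have : dilL ε x μ = (![1, ε, ε, ε] : Fin 4 → ℝ) μ * x μ := by
    simp [dilL, Matrix.toLin'_apply, Matrix.mulVec_diagonal]
  rw [this]
  refine Fin.cases ?_ (fun i => ?_) μ
  · simp [dil_zero]
  · rw [dil_succ]
    fin_cases i <;> rfl

theorem continuous_dil : Continuous fun p : ℝ × STPoint => dil p.1 p.2 :=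
  continuous_pt.comp (((continuous_apply 0).comp continuous_snd).prodMk
    (continuous_fst.smul (continuous_spat.comp continuous_snd)))

theorem dil_inv {ε : ℝ} (hε : ε ≠ 0) (x : STPoint) : dil ε⁻¹ (dil ε x) = x := by
  rw [dil, dil_zero, spat_dil, smul_smul, inv_mul_cancel₀ hε, one_smul, pt_spat]

theorem integral_dil {ε : ℝ} (hε : 0 < ε) (f : STPoint → ℝ) :
    ∫ x, f x = ε ^ 3 * ∫ x, f (dil ε x) := by
  have hdet : (Matrix.diagonal ![1, ε, ε, ε] : Mat4).det = ε ^ 3 := by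
    rw [Matrix.det_diagonal, Fin.prod_univ_four]
    simp; ring
  have hne : (Matrix.diagonal ![1, ε, ε, ε] : Mat4).det ≠ 0 := by rw [hdet]; positivity
  have hmap := Real.map_matrix_volume_pi_eq_smul_volume_pi hne
  have hm : ∀ a : ℝ, Measurable (dil a) := fun a =>
    (continuous_dil.comp (by fun_prop : Continuous fun x : STPoint => (a, x))).measurable
  have hfun : (Matrix.toLin' (Matrix.diagonal ![1, ε, ε, ε]) : STPoint → STPoint) = dil ε :=
    funext fun x => dilL_apply ε x
  rw [hfun, hdet] at hmap
  have hemb : MeasurableEmbedding (dil ε) := by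
    refine MeasurableEmbedding.of_measurable_inverse (g := dil ε⁻¹) (hm ε) ?_ (hm _)
      (dil_inv hε.ne')
    have : range (dil ε) = univ := eq_univ_of_forall fun x => ⟨dil ε⁻¹ x, by
      have := dil_inv (inv_ne_zero hε.ne') x
      rwa [inv_inv] at this⟩
    rw [this]; exact MeasurableSet.univ
  rw [← hemb.integral_map, hmap, integral_smul_measure, smul_eq_mul, ← mul_assoc,
    ENNReal.toReal_ofReal (abs_nonneg _), abs_of_pos (by positivity), mul_inv_cancel₀ (by positivity),
    one_mul]

theorem integrable_inv_rad {K : Set STPoint} (hK : IsCompact K) :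
    Integrable (K.indicator fun x => (rad x)⁻¹) := by
  obtain ⟨T, hT⟩ : ∃ T : ℝ, ∀ x ∈ K, |x 0| ≤ T ∧ rad x ≤ T := by
    obtain ⟨T₁, h1⟩ := hK.exists_bound_of_continuousOn (f := fun x : STPoint => x 0)
      (continuous_apply 0).continuousOn
    obtain ⟨T₂, h2⟩ := hK.exists_bound_of_continuousOn (f := rad) continuous_rad.continuousOn
    exact ⟨max T₁ T₂, fun x hx => ⟨(h1 x hx).trans (le_max_left _ _),
      (le_abs_self _).trans ((h2 x hx).trans (le_max_right _ _))⟩⟩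
  have hball : Integrable ((Metric.ball (0 : E3) (T + 1)).indicator fun y => ‖y‖⁻¹) := by
    rw [integrable_indicator_iff Metric.isOpen_ball.measurableSet]
    refine (integrableOn_fun_norm_addHaar (μ := volume) (f := fun r : ℝ => r⁻¹)).2 ?_
    have : IntegrableOn (fun r : ℝ => r) (Ioo 0 (T + 1)) :=
      (continuous_id.continuousOn.integrableOn_compact isCompact_Icc).mono_set Ioo_subset_Icc_self
    refine this.congr_fun (fun r hr => ?_) measurableSet_Ioo
    have h0 : r ≠ 0 := hr.1.ne'
    simp only [finrank_euclideanSpace, Fintype.card_fin, smul_eq_mul]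
    field_simp
  have hI : Integrable ((Icc (-T) T).indicator fun _ : ℝ => (1 : ℝ)) := by
    rw [integrable_indicator_iff measurableSet_Icc]
    exact integrableOn_const (by simp)
  have hprod := hI.mul_prod hball
  have h2 : Integrable fun x : STPoint => (Icc (-T) T).indicator (fun _ : ℝ => (1 : ℝ)) (x 0) *
      (Metric.ball (0 : E3) (T + 1)).indicator (fun y => ‖y‖⁻¹) (spat x) := by
    refine integrable_pt.1 ?_
    simp only [pt_zero_apply, spat_pt]
    exact hprod
  refine h2.mono' ?_ (.of_forall fun x => ?_)
  · refine AEStronglyMeasurable.indicator ?_ hK.isClosed.measurableSet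
    exact continuous_rad.measurable.inv.aestronglyMeasurable
  · by_cases hx : x ∈ K
    · have h3 : x 0 ∈ Icc (-T) T := abs_le.1 (hT x hx).1
      have h4 : spat x ∈ Metric.ball (0 : E3) (T + 1) := by
        rw [mem_ball_zero_iff, ← rad_eq]; linarith [(hT x hx).2]
      rw [indicator_of_mem hx, indicator_of_mem h3, indicator_of_mem h4, one_mul, ← rad_eq,
        norm_of_nonneg (inv_nonneg.2 (rad_nonneg x))]
    · rw [indicator_of_notMem hx, norm_zero]
      refine mul_nonneg ?_ ?_
      · exact indicator_nonneg (fun _ _ => zero_le_one) _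
      · exact indicator_nonneg (fun _ _ => inv_nonneg.2 (norm_nonneg _)) _

theorem ae_rad_pos : ∀ᵐ x : STPoint, 0 < rad x := by
  have h : volume {x : STPoint | x 1 = 0} = 0 := by
    have := Measure.addHaar_affineSubspace (volume : Measure STPoint)
      ((LinearMap.ker (LinearMap.proj 1 : STPoint →ₗ[ℝ] ℝ)).toAffineSubspace) (by
        intro h
        have h2 : (Pi.single 1 1 : STPoint) ∈
            (LinearMap.ker (LinearMap.proj 1 : STPoint →ₗ[ℝ] ℝ)).toAffineSubspace := by
          rw [h]; trivial
        simp at h2)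
    refine (congrArg volume ?_).trans this
    ext x; simp
  rw [ae_iff]
  refine measure_mono_null (fun x hx => ?_) h
  have h0 : rad x = 0 := le_antisymm (not_lt.1 hx) (rad_nonneg x)
  have := eq_worldline h0
  rw [this]; rfl

end Integration

/-! ### Spatial cutoffs -/

/-- A smooth function of the spatial coordinates with compact support, equal to `c` near `0`. -/
structure IsCutoff (ρ : STPoint → ℝ) (c : ℝ) : Prop where
  smooth : Smooth ρ
  spatial : ∀ x, ρ (pt 0 (spat x)) = ρ x
  support : ∃ R₁, ∀ x, R₁ ≤ rad x → ρ x = 0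
  near : ∃ δ > 0, ∀ x, rad x < δ → ρ x = c

namespace IsCutoff

variable {ρ : STPoint → ℝ} {c : ℝ} (hρ : IsCutoff ρ c)
include hρ

theorem congr_spat {x y : STPoint} (h : spat x = spat y) : ρ x = ρ y := by
  rw [← hρ.spatial x, h, hρ.spatial]

theorem pd_time (x : STPoint) : pd 0 ρ x = 0 := by
  have h1 : HasDerivAt (fun s : ℝ => ρ (x + s • Pi.single 0 1)) (pd 0 ρ x) 0 := by
    have h2 : HasFDerivAt ρ (𝒟 ρ x) (x + (0 : ℝ) • (Pi.single 0 1 : STPoint)) := by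
      simpa using (hρ.smooth.contDiffAt.differentiableAt (x := x) (by simp)).hasFDerivAt
    have h3 : HasDerivAt (fun s : ℝ => x + s • (Pi.single 0 1 : STPoint)) (Pi.single 0 1) 0 := by
      simpa using ((hasDerivAt_id (0 : ℝ)).smul_const (Pi.single 0 1 : STPoint)).const_add x
    exact h2.comp_hasDerivAt (f := fun s : ℝ => x + s • (Pi.single 0 1 : STPoint)) 0 h3
  have e : (fun s : ℝ => ρ (x + s • Pi.single 0 1)) = fun _ => ρ x := by
    funext s
    refine hρ.congr_spat ?_
    ext i
    simp [spat_apply]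
  rw [e] at h1
  exact h1.unique (hasDerivAt_const _ _)

theorem pd (μ : Fin 4) : IsCutoff (SmallBody.pd μ ρ) 0 where
  smooth := contDiff_iff_contDiffAt.2 fun _ => contDiffAt_pd hρ.smooth.contDiffAt
  spatial x := by
    have e : ρ = fun y => ρ (y + (pt 0 (spat x) - x)) := by
      funext y
      refine hρ.congr_spat ?_
      ext i
      simp [spat_apply, pt_succ]
    conv_rhs => rw [e]
    simp only [SmallBody.pd]
    rw [fderiv_comp_add_right]
    simp
  support := by
    obtain ⟨R₁, h⟩ := hρ.support
    refine ⟨R₁ + 1, fun x hx => ?_⟩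
    have : ρ =ᶠ[𝓝 x] fun _ => 0 := by
      have := continuous_rad.continuousAt.eventually_const_lt (show R₁ < rad x by linarith)
      filter_upwards [this] with y hy using h y hy.le
    rw [pd_congr this, pd_const]
  near := by
    obtain ⟨δ, hδ, h⟩ := hρ.near
    refine ⟨δ, hδ, fun x hx => ?_⟩
    have : ρ =ᶠ[𝓝 x] fun _ => c := by
      filter_upwards [continuous_rad.continuousAt.eventually_lt_const hx] with y hy using h y hy
    rw [pd_congr this, pd_const]

theorem pd_dil (ε : ℝ) (μ : Fin 4) (x : STPoint) :
    SmallBody.pd μ (fun y => ρ (dil ε y)) x = ε * SmallBody.pd μ ρ (dil ε x) := by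
  have h1 : (fun y => ρ (dil ε y)) = fun y => ρ (dilL ε y) := by funext y; rw [dilL_apply]
  have h2 : HasFDerivAt ρ (𝒟 ρ (dil ε x)) (dilL ε x) := by
    rw [dilL_apply]
    exact hρ.smooth.contDiffAt.diff.hasFDerivAt
  have h3 := h2.comp x (dilL ε).hasFDerivAt
  rw [h1, SmallBody.pd, show (fun y => ρ (dilL ε y)) = ρ ∘ dilL ε from rfl, h3.fderiv,
    ContinuousLinearMap.comp_apply]
  refine Fin.cases ?_ (fun i => ?_) μ
  · have h4 : dilL ε (Pi.single 0 1) = Pi.single 0 1 := by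
      rw [dilL_apply]
      ext ν
      refine Fin.cases rfl (fun j => ?_) ν
      rw [dil_succ]; simp
    rw [h4]
    have := hρ.pd_time (dil ε x)
    rw [this]
    rw [SmallBody.pd] at this
    rw [this, mul_zero]
  · have h4 : dilL ε (Pi.single i.succ 1) = ε • Pi.single i.succ 1 := by
      rw [dilL_apply]
      ext ν
      refine Fin.cases ?_ (fun j => ?_) ν
      · rw [dil_zero]; simp [(Fin.succ_ne_zero i).symm]
      · rw [dil_succ]; simp [Pi.single_apply]
    rw [h4, map_smul, smul_eq_mul]
    rfl

theorem smooth_dil (ε : ℝ) : Smooth fun y => ρ (dil ε y) := by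
  have h1 : (fun y => ρ (dil ε y)) = fun y => ρ (dilL ε y) := by funext y; rw [dilL_apply]
  rw [h1]
  exact hρ.smooth.comp (dilL ε).contDiff

theorem exists_abs_le : ∃ M, 0 ≤ M ∧ ∀ x, |ρ x| ≤ M := by
  obtain ⟨R₁, h⟩ := hρ.support
  have hcomp : IsCompact ((fun y : E3 => pt 0 y) '' Metric.closedBall 0 R₁) :=
    (isCompact_closedBall _ _).image
      (continuous_pt.comp (by fun_prop : Continuous fun y : E3 => ((0 : ℝ), y)))
  obtain ⟨M, hM⟩ := hcomp.exists_bound_of_continuousOn hρ.smooth.continuous.continuousOn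
  refine ⟨max M 0, le_max_right _ _, fun x => ?_⟩
  by_cases hx : R₁ ≤ rad x
  · rw [h x hx]; simp
  · rw [← hρ.spatial x]
    refine (hM _ ⟨spat x, ?_, rfl⟩).trans (le_max_left _ _)
    rw [mem_closedBall_zero_iff, ← rad_eq]
    exact (not_le.1 hx).le

end IsCutoff

/-! ### The source of the perturbation -/

section PointSource

variable {E : Jet 2 → Val} {U : Set STPoint} {R Λ : ℝ} {Φ : ℝ → STPoint → Val}
  {f : STPoint → Val} {ρ : STPoint → ℝ} {c : ℝ}

/-- The coefficient of the first derivatives of a cutoff in `adjSum`. -/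
def firstCoef (E : Jet 2 → Val) (Φ f : STPoint → Val) (α : Fin 4) (x : STPoint) : Val →L[ℝ] ℝ :=
  -coef E Φ f (idx1 α) x + ∑ β, (pd β (coef E Φ f (idx2 α β)) x + pd β (coef E Φ f (idx2 β α)) x)

theorem isTest_firstCoef {Φ : STPoint → Val} (hB : IsBackground E U Φ) (hf : IsTest U f)
    (α : Fin 4) : IsTest U (firstCoef E Φ f α) := by
  refine IsTest.of_zero (fun y _ => ?_) hf.2.1 hf.2.2 fun y hy => ?_
  · exact (hB.isTest_coef _ hf).contDiffAt.neg.add (ContDiffAt.sum fun β _ =>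
      (hB.isTest_coef _ hf).pd.contDiffAt.add (hB.isTest_coef _ hf).pd.contDiffAt)
  · have h1 : ∀ I, coef E Φ f I =ᶠ[𝓝 y] fun _ => 0 := fun I => by
      filter_upwards [notMem_tsupport_iff_eventuallyEq.1 hy] with z hz
      simp [coef, hz]
    have h2 : ∀ I β, pd β (coef E Φ f I) y = 0 := fun I β => by rw [pd_congr (h1 I), pd_const]
    simp only [firstCoef, h2, (h1 _).self_of_nhds]
    simp

theorem coef_smul {Φ : STPoint → Val} (g : STPoint → ℝ) (I : JetIdx 2) :
    coef E Φ (fun y => g y • f y) I = fun y => g y • coef E Φ f I y := by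
  funext y
  ext v
  all_goals simp only [coef, map_smul, ContinuousLinearMap.smul_comp, smul_smul, mul_comm]

theorem adjSum_smul {Φ : STPoint → Val} (hB : IsBackground E U Φ) (hf : IsTest U f)
    {g : STPoint → ℝ} (hg : Smooth g) (x : STPoint) :
    adjSum E Φ (fun y => g y • f y) x = g x • adjSum E Φ f x + ∑ α, pd α g x • firstCoef E Φ f α x +
      ∑ α, ∑ β, pd α (pd β g) x • coef E Φ f (idx2 α β) x := by
  have hc : ∀ I, SmoothAt (coef E Φ f I) x := fun I => (hB.isTest_coef I hf).contDiffAt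
  have hg' : SmoothAt g x := hg.contDiffAt
  have d : ∀ {Z : Type} [NormedAddCommGroup Z] [NormedSpace ℝ Z] {a : STPoint → Z},
      SmoothAt a x → DiffAt a x := fun h => h.diff
  have e1 : ∀ I α, pd α (fun y => g y • coef E Φ f I y) x =
      g x • pd α (coef E Φ f I) x + pd α g x • coef E Φ f I x := fun I α =>
    pd_smul (d hg') (d (hc I))
  have e2 : ∀ I α β, pd α (pd β fun y => g y • coef E Φ f I y) x =
      g x • pd α (pd β (coef E Φ f I)) x + pd α g x • pd β (coef E Φ f I) x +
        (pd β g x • pd α (coef E Φ f I) x + pd α (pd β g) x • coef E Φ f I x) := by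
    intro I α β
    have h1 : pd β (fun y => g y • coef E Φ f I y) = fun y =>
        g y • pd β (coef E Φ f I) y + pd β g y • coef E Φ f I y := by
      funext y
      exact pd_smul hg.contDiffAt.diff
        ((hB.isTest_coef I hf).contDiffAt.diff)
    have a1 : SmoothAt (fun y => g y • pd β (coef E Φ f I) y) x := hg'.smul (contDiffAt_pd (hc I))
    have a2 : SmoothAt (fun y => pd β g y • coef E Φ f I y) x := (contDiffAt_pd hg').smul (hc I)
    rw [h1, pd_add (d a1) (d a2), pd_smul (d hg') (d (contDiffAt_pd (hc I))),
      pd_smul (d (contDiffAt_pd hg')) (d (hc I))]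
  have hgc : ∀ I, SmoothAt (fun y => g y • coef E Φ f I y) x := fun I => hg'.smul (hc I)
  simp only [adjSum, coef_smul, sum_jetIdx_two, pdI_idx0, pdI_idx1, pdI_idx2 _ _ (hgc _),
    pdI_idx2 _ _ (hc _), e1, e2]
  have p0 : (-1 : ℝ) ^ (((idx0 2).1 : Fin 3) : ℕ) = 1 := by simp [idx0]
  have p1 : ∀ (α : Fin 4) (T : Val →L[ℝ] ℝ), (-1 : ℝ) ^ (((idx1 α).1 : Fin 3) : ℕ) • T = -T :=
    fun α T => by
      have h : (-1 : ℝ) ^ (((idx1 α).1 : Fin 3) : ℕ) = -1 := by simp [idx1]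
      rw [h]
      exact neg_one_smul ℝ T
  have p2 : ∀ α β, (-1 : ℝ) ^ (((idx2 α β).1 : Fin 3) : ℕ) = 1 := fun α β => by simp [idx2]
  simp only [p0, p1, p2, one_smul, firstCoef, smul_add, smul_neg, sum_neg_distrib, sum_add_distrib, Finset.smul_sum]
  rw [sum_comm (f := fun α β => pd β g x • pd α (coef E Φ f (idx2 α β)) x)]
  abel

namespace IsSmallBodyFamily

variable (hF : IsSmallBodyFamily E U R Λ Φ)
include hF

/-- Products of the perturbation with test fields are integrable. -/
theorem integrable_apply {A : STPoint → Val →L[ℝ] ℝ} (hA : IsTest U A) :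
    Integrable fun x => A x (perturbation Φ x) := by
  obtain ⟨C, hC0, hC⟩ := hF.exists_bound hA.2.1 hA.2.2
  obtain ⟨M, hM⟩ := hA.1.continuous.bounded_above_of_compact_support hA.2.1
  have hbound := (integrable_inv_rad hA.2.1).const_mul (M * C)
  refine hbound.mono' ?_ ?_
  · have hV : IsOpen (U ∩ {x | 0 < rad x}) :=
      hF.isOpen.inter (isOpen_lt continuous_const continuous_rad)
    have h1 : AEStronglyMeasurable (fun x => A x (perturbation Φ x))
        (volume.restrict (U ∩ {x | 0 < rad x})) :=
      ContinuousOn.aestronglyMeasurable (fun x hx => (hA.1.continuous.continuousAt.clm_apply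
        (hF.contDiffAt_perturbation hx.1 hx.2).continuousAt).continuousWithinAt) hV.measurableSet
    have h2 := (aestronglyMeasurable_indicator_iff hV.measurableSet).2 h1
    refine h2.congr ?_
    filter_upwards [ae_rad_pos] with x hx
    by_cases hxU : x ∈ U
    · rw [indicator_of_mem (show x ∈ U ∩ {x | 0 < rad x} from ⟨hxU, hx⟩)]
    · rw [indicator_of_notMem fun h => hxU h.1, eq_zero_off fun h => hxU (hA.2.2 h)]
      rfl
  · filter_upwards [ae_rad_pos] with x hx
    by_cases hxs : x ∈ tsupport A
    · rw [indicator_of_mem hxs, mul_assoc]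
      exact ((A x).le_opNorm _).trans (mul_le_mul (hM x) (hC x hxs hx) (norm_nonneg _)
        ((norm_nonneg _).trans (hM x)))
    · rw [indicator_of_notMem hxs, eq_zero_off hxs]
      simp

theorem continuousAt_lead {x : STPoint} (hx : wl (x 0) ∈ U) (hr : 0 < rad x) :
    ContinuousAt (lead Φ) x := by
  have hy : spat x ≠ 0 := by rw [rad_eq] at hr; exact norm_pos_iff.1 hr
  have h1 := (hF.contDiffAt_lead hx hy).continuousAt
  have h2 : ContinuousAt (fun x : STPoint => (x 0, spat x)) x :=
    ((continuous_apply 0).prodMk continuous_spat).continuousAt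
  have h3 := ContinuousAt.comp (g := fun p : ℝ × E3 => lead Φ (pt p.1 p.2))
    (f := fun x : STPoint => (x 0, spat x)) (x := x) h1 h2
  simpa [Function.comp_def] using h3

/-- The scaled perturbation tends to its leading part, when tested. -/
theorem tendsto_scaled {A : STPoint → Val →L[ℝ] ℝ} (hA : IsTest U A) (hρ : IsCutoff ρ 0) :
    Tendsto (fun ε : ℝ => ∫ x, ρ x * A (dil ε x) (ε • perturbation Φ (dil ε x))) (𝓝[>] 0)
      (𝓝 (∫ x, ρ x * A (wl (x 0)) (lead Φ x))) := by
  obtain ⟨C, hC0, hC⟩ := hF.exists_bound hA.2.1 hA.2.2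
  obtain ⟨M, hM⟩ := hA.1.continuous.bounded_above_of_compact_support hA.2.1
  obtain ⟨N, hN0, hN⟩ := hρ.exists_abs_le
  obtain ⟨R₁, hR₁⟩ := hρ.support
  obtain ⟨δ, hδ, hnear⟩ := hρ.near
  obtain ⟨T, hT⟩ := hA.2.1.exists_bound_of_continuousOn (f := fun x : STPoint => x 0)
    (continuous_apply 0).continuousOn
  set K : Set STPoint := (fun p : ℝ × E3 => pt p.1 p.2) '' (Icc (-T) T ×ˢ Metric.closedBall 0 R₁)
  have hK : IsCompact K := (isCompact_Icc.prod (isCompact_closedBall _ _)).image continuous_pt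
  have hM0 : 0 ≤ M := (norm_nonneg _).trans (hM 0)
  have hδr : ∀ x, ρ x ≠ 0 → δ ≤ rad x := fun x hx => by by_contra h; exact hx (hnear x (not_le.1 h))
  have hd : ∀ ε : ℝ, Continuous (dil ε) := fun ε =>
    continuous_dil.comp (by fun_prop : Continuous fun x : STPoint => (ε, x))
  have hd0 : ∀ x : STPoint, Tendsto (fun ε : ℝ => dil ε x) (𝓝[>] 0) (𝓝 (wl (x 0))) := by
    intro x
    have h0 : Continuous fun ε : ℝ => dil ε x :=
      continuous_dil.comp (by fun_prop : Continuous fun ε : ℝ => (ε, x))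
    have := h0.tendsto 0
    simp only [dil, zero_smul] at this
    exact this.mono_left nhdsWithin_le_nhds
  have hpos : ∀ᶠ ε in 𝓝[>] (0 : ℝ), 0 < ε := self_mem_nhdsWithin
  refine tendsto_integral_filter_of_dominated_convergence
    (K.indicator fun _ => N * (M * (C * δ⁻¹))) ?_ ?_ ?_ ?_
  · filter_upwards [hpos] with ε hε
    refine Continuous.aestronglyMeasurable (continuous_iff_continuousAt.2 fun x => ?_)
    by_cases hx : rad x < δ
    · have : (fun x => ρ x * A (dil ε x) (ε • perturbation Φ (dil ε x))) =ᶠ[𝓝 x] fun _ => 0 := by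
        filter_upwards [continuous_rad.continuousAt.eventually_lt_const hx] with y hy
        rw [hnear y hy, zero_mul]
      exact continuousAt_const.congr this.symm
    by_cases hxs : dil ε x ∈ tsupport A
    · have hr : 0 < rad (dil ε x) := by
        rw [rad_dil hε]; exact mul_pos hε (hδ.trans_le (not_lt.1 hx))
      refine hρ.smooth.continuous.continuousAt.mul (ContinuousAt.clm_apply ?_ ?_)
      · exact (hA.1.continuous.comp (hd ε)).continuousAt
      · exact (ContinuousAt.comp (g := perturbation Φ)
          (hF.contDiffAt_perturbation (hA.2.2 hxs) hr).continuousAt (hd ε).continuousAt).const_smul ε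
    · have : (fun x => ρ x * A (dil ε x) (ε • perturbation Φ (dil ε x))) =ᶠ[𝓝 x] fun _ => 0 := by
        filter_upwards [(hd ε).continuousAt.preimage_mem_nhds
          ((isClosed_tsupport A).isOpen_compl.mem_nhds hxs)] with y hy
        rw [eq_zero_off hy]
        simp
      exact continuousAt_const.congr this.symm
  · filter_upwards [hpos] with ε hε
    refine .of_forall fun x => ?_
    by_cases hx0 : ρ x = 0
    · rw [hx0, zero_mul, norm_zero]
      exact indicator_nonneg (fun _ _ => by positivity) _
    by_cases hxs : dil ε x ∈ tsupport A
    · have hδx := hδr x hx0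
      have hr : 0 < rad (dil ε x) := by rw [rad_dil hε]; exact mul_pos hε (hδ.trans_le hδx)
      have hxK : x ∈ K := by
        refine ⟨(x 0, spat x), ⟨abs_le.1 (hT (dil ε x) hxs), ?_⟩, pt_spat x⟩
        rw [mem_closedBall_zero_iff, ← rad_eq]
        by_contra h
        exact hx0 (hR₁ x (not_le.1 h).le)
      rw [indicator_of_mem hxK, norm_mul]
      have h1 : ‖ε • perturbation Φ (dil ε x)‖ ≤ C * δ⁻¹ := by
        rw [norm_smul, norm_of_nonneg hε.le]
        calc ε * ‖perturbation Φ (dil ε x)‖ ≤ ε * (C * (rad (dil ε x))⁻¹) :=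
              mul_le_mul_of_nonneg_left (hC _ hxs hr) hε.le
          _ = C * (rad x)⁻¹ := by rw [rad_dil hε, mul_inv]; field_simp
          _ ≤ C * δ⁻¹ := mul_le_mul_of_nonneg_left (inv_anti₀ hδ hδx) hC0
      refine mul_le_mul (hN x) (((A _).le_opNorm _).trans (mul_le_mul (hM _) h1 (norm_nonneg _) hM0))
        (norm_nonneg _) hN0
    · rw [eq_zero_off hxs]
      simp only [ContinuousLinearMap.zero_apply, mul_zero, norm_zero]
      exact indicator_nonneg (fun _ _ => by positivity) _
  · rw [integrable_indicator_iff hK.isClosed.measurableSet]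
    exact integrableOn_const hK.measure_lt_top.ne
  · refine .of_forall fun x => ?_
    by_cases hx0 : ρ x = 0
    · simp only [hx0, zero_mul]; exact tendsto_const_nhds
    have hr := hδ.trans_le (hδr x hx0)
    have hy : spat x ≠ 0 := by rw [rad_eq] at hr; exact norm_pos_iff.1 hr
    refine Tendsto.const_mul _ ?_
    by_cases hxU : wl (x 0) ∈ U
    · have h1 := hF.tendsto_lead hxU hy
      rw [pt_spat] at h1
      have h2 : Tendsto (fun ε => A (dil ε x)) (𝓝[>] 0) (𝓝 (A (wl (x 0)))) :=
        (hA.1.continuous.tendsto _).comp (hd0 x)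
      exact (isBoundedBilinearMap_apply.continuous.tendsto (A (wl (x 0)), lead Φ x)).comp
        (h2.prodMk_nhds h1)
    · have hxs : wl (x 0) ∉ tsupport A := fun h => hxU (hA.2.2 h)
      rw [eq_zero_off hxs]
      refine tendsto_const_nhds.congr' ?_
      filter_upwards [(hd0 x).eventually ((isClosed_tsupport A).isOpen_compl.mem_nhds hxs)] with ε h
      rw [eq_zero_off h]
      rfl

theorem pointSource (hE : SmoothOnLorentzian E) (hf : IsTest U f) (hρ : IsCutoff ρ c) :
    c * ∫ x, adjSum E (Φ 0) f x (perturbation Φ x) = ∑ α, ∑ β, ∫ x, pd α (pd β ρ) x *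
      coef E (Φ 0) f (idx2 α β) (wl (x 0)) (lead Φ x) := by
  have hB := hF.background hE
  have hpos : ∀ᶠ ε in 𝓝[>] (0 : ℝ), 0 < ε := self_mem_nhdsWithin
  have hadj := hF.integrable_apply (hB.isTest_adjSum hf)
  have key : ∀ ε : ℝ, 0 < ε → c * ∫ x, adjSum E (Φ 0) f x (perturbation Φ x) =
      (∫ x, ρ (dil ε⁻¹ x) * adjSum E (Φ 0) f x (perturbation Φ x)) +
      ∑ α, ε * (∫ x, pd α ρ x * firstCoef E (Φ 0) f α (dil ε x) (ε • perturbation Φ (dil ε x))) +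
      ∑ α, ∑ β, ∫ x, pd α (pd β ρ) x * coef E (Φ 0) f (idx2 α β) (dil ε x) (ε • perturbation Φ (dil ε x)) := by
    intro ε hε
    set g : STPoint → ℝ := fun x => ρ (dil ε⁻¹ x) - c
    have hρs := hρ.smooth_dil ε⁻¹
    have hg : Smooth g := hρs.sub contDiff_const
    have hV : IsOpen (U ∩ {x | 0 < rad x}) :=
      hF.isOpen.inter (isOpen_lt continuous_const continuous_rad)
    have hgf : IsTest (U ∩ {x | 0 < rad x}) fun x => g x • f x := by
      obtain ⟨δ, hδ, hnear⟩ := hρ.near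
      refine IsTest.of_zero (K := tsupport f ∩ {x | ε * δ ≤ rad x})
        (fun y _ => hg.contDiffAt.smul hf.contDiffAt)
        (hf.2.1.isCompact.inter_right (isClosed_le continuous_const continuous_rad))
        (fun x hx => ⟨hf.2.2 hx.1, (mul_pos hε hδ).trans_le hx.2⟩) fun y hy => ?_
      by_cases hyf : y ∈ tsupport f
      · have hr : rad y < ε * δ := by
          by_contra hc; exact hy ⟨hyf, not_lt.1 hc⟩
        have : ρ (dil ε⁻¹ y) = c := by
          refine hnear _ ?_
          rw [rad_dil (inv_pos.2 hε), inv_mul_lt_iff₀ hε]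
          exact hr
        simp [g, this]
      · rw [eq_zero_off hyf, smul_zero]
    have hzero : ∫ x, adjSum E (Φ 0) (fun x => g x • f x) x (perturbation Φ x) = 0 := by
      rw [integral_adjSum hB hV inter_subset_left hgf fun x hx =>
        (hF.contDiffAt_perturbation hx.1 hx.2).contDiffWithinAt]
      refine integral_eq_zero_of_ae (.of_forall fun x => ?_)
      by_cases hx : x ∈ U ∩ {x | 0 < rad x}
      · simp [hF.linearized_eq hE hx.1 hx.2, pair]
      · simp [eq_zero_off fun h => hx (hgf.2.2 h), pair]
    have hpd1 : ∀ α, pd α g = fun x => ε⁻¹ * pd α ρ (dil ε⁻¹ x) := fun α => by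
      funext x
      rw [← hρ.pd_dil, pd_sub hρs.contDiffAt.diff
        (differentiableAt_const _), pd_const, sub_zero]
    have hpd2 : ∀ α β, pd α (pd β g) = fun x => ε⁻¹ * (ε⁻¹ * pd α (pd β ρ) (dil ε⁻¹ x)) :=
      fun α β => by
        funext x
        rw [hpd1, ← (hρ.pd β).pd_dil, pd_const_mul _ (((hρ.pd β).smooth_dil _).contDiffAt.diff)]
    have hA1 : ∀ α, IsTest U fun x => pd α g x • firstCoef E (Φ 0) f α x := fun α =>
      IsTest.of_zero (fun y _ => (contDiffAt_pd hg.contDiffAt).smul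
        (isTest_firstCoef hB hf α).contDiffAt) (isTest_firstCoef hB hf α).2.1
        (isTest_firstCoef hB hf α).2.2 fun y hy => by rw [eq_zero_off hy, smul_zero]
    have hA2 : ∀ α β, IsTest U fun x => pd α (pd β g) x • coef E (Φ 0) f (idx2 α β) x :=
      fun α β => IsTest.of_zero (fun y _ => (contDiffAt_pd (contDiffAt_pd hg.contDiffAt)).smul
        (hB.isTest_coef _ hf).contDiffAt) (hB.isTest_coef (idx2 α β) hf).2.1
        (hB.isTest_coef _ hf).2.2 fun y hy => by rw [eq_zero_off hy, smul_zero]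
    have hA0 : IsTest U fun x => ρ (dil ε⁻¹ x) • adjSum E (Φ 0) f x :=
      IsTest.of_zero (fun y _ => hρs.contDiffAt.smul (hB.isTest_adjSum hf).contDiffAt)
        (hB.isTest_adjSum hf).2.1 (hB.isTest_adjSum hf).2.2 fun y hy => by
          rw [eq_zero_off hy, smul_zero]
    have hI0 := hF.integrable_apply hA0
    have hI1 := fun α => hF.integrable_apply (hA1 α)
    have hI2 := fun α β => hF.integrable_apply (hA2 α β)
    simp only [ContinuousLinearMap.smul_apply, smul_eq_mul] at hI0 hI1 hI2
    have hexp : ∀ x, adjSum E (Φ 0) (fun x => g x • f x) x (perturbation Φ x) =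
        (ρ (dil ε⁻¹ x) * adjSum E (Φ 0) f x (perturbation Φ x) - c * adjSum E (Φ 0) f x (perturbation Φ x)) +
        ∑ α, pd α g x * firstCoef E (Φ 0) f α x (perturbation Φ x) +
        ∑ α, ∑ β, pd α (pd β g) x * coef E (Φ 0) f (idx2 α β) x (perturbation Φ x) := by
      intro x
      rw [adjSum_smul hB hf hg]
      simp only [ContinuousLinearMap.add_apply, ContinuousLinearMap.sum_apply,
        ContinuousLinearMap.smul_apply, smul_eq_mul, g]
      ring
    simp only [hexp] at hzero
    have hs2 : Integrable fun x => ∑ α, ∑ β, pd α (pd β g) x * coef E (Φ 0) f (idx2 α β) x (perturbation Φ x) :=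
      integrable_finsetSum _ fun α _ => integrable_finsetSum _ fun β _ => hI2 α β
    have hs1 : Integrable fun x => ∑ α, pd α g x * firstCoef E (Φ 0) f α x (perturbation Φ x) :=
      integrable_finsetSum _ fun α _ => hI1 α
    have hs0 : Integrable fun x => ρ (dil ε⁻¹ x) * adjSum E (Φ 0) f x (perturbation Φ x) -
        c * adjSum E (Φ 0) f x (perturbation Φ x) := hI0.sub (hadj.const_mul c)
    have hs01 : Integrable fun x => (ρ (dil ε⁻¹ x) * adjSum E (Φ 0) f x (perturbation Φ x) -
        c * adjSum E (Φ 0) f x (perturbation Φ x)) +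
        ∑ α, pd α g x * firstCoef E (Φ 0) f α x (perturbation Φ x) := hs0.add hs1
    rw [integral_add hs01 hs2, integral_add hs0 hs1, integral_sub hI0 (hadj.const_mul c),
      integral_const_mul, integral_finsetSum _ fun α _ => hI1 α,
      integral_finsetSum _ fun α _ => integrable_finsetSum _ fun β _ => hI2 α β] at hzero
    have t1 : ∀ α, ∫ x, pd α g x * firstCoef E (Φ 0) f α x (perturbation Φ x) =
        ε * ∫ x, pd α ρ x * firstCoef E (Φ 0) f α (dil ε x) (ε • perturbation Φ (dil ε x)) := by
      intro α
      rw [integral_dil hε, hpd1, ← integral_const_mul, ← integral_const_mul]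
      refine integral_congr fun x => ?_
      simp only [dil_inv hε.ne', map_smul, smul_eq_mul]
      field_simp
    have t2 : ∀ α β, ∫ x, pd α (pd β g) x * coef E (Φ 0) f (idx2 α β) x (perturbation Φ x) =
        ∫ x, pd α (pd β ρ) x * coef E (Φ 0) f (idx2 α β) (dil ε x) (ε • perturbation Φ (dil ε x)) := by
      intro α β
      rw [integral_dil hε, hpd2, ← integral_const_mul]
      refine integral_congr fun x => ?_
      simp only [dil_inv hε.ne', map_smul, smul_eq_mul]
      field_simp
    have t3 : ∑ α, ∫ x, ∑ β, pd α (pd β g) x * coef E (Φ 0) f (idx2 α β) x (perturbation Φ x) =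
        ∑ α, ∑ β, ∫ x, pd α (pd β ρ) x * coef E (Φ 0) f (idx2 α β) (dil ε x) (ε • perturbation Φ (dil ε x)) :=
      sum_congr rfl fun α _ => by
        rw [integral_finsetSum _ fun β _ => hI2 α β]
        exact sum_congr rfl fun β _ => t2 α β
    rw [sum_congr rfl fun α _ => t1 α, t3] at hzero
    linarith
  have lim0 : Tendsto (fun ε : ℝ => ∫ x, ρ (dil ε⁻¹ x) * adjSum E (Φ 0) f x (perturbation Φ x)) (𝓝[>] 0)
      (𝓝 0) := by
    obtain ⟨N, hN0, hN⟩ := hρ.exists_abs_le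
    obtain ⟨R₁, hR₁⟩ := hρ.support
    suffices H : Tendsto (fun ε : ℝ => ∫ x, ρ (dil ε⁻¹ x) *
        adjSum E (Φ 0) f x (perturbation Φ x)) (𝓝[>] 0) (𝓝 (∫ _ : STPoint, (0 : ℝ))) by
      simpa using H
    refine tendsto_integral_filter_of_dominated_convergence
      (fun x => N * ‖adjSum E (Φ 0) f x (perturbation Φ x)‖) ?_ ?_ (hadj.norm.const_mul N) ?_
    · exact .of_forall fun ε => ((hρ.smooth_dil ε⁻¹).continuous.aestronglyMeasurable).mul hadj.1
    · refine .of_forall fun ε => .of_forall fun x => ?_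
      rw [norm_mul]
      exact mul_le_mul_of_nonneg_right (hN _) (norm_nonneg _)
    · filter_upwards [ae_rad_pos] with x hx
      refine tendsto_const_nhds.congr' ?_
      have h1 : ∀ᶠ ε in 𝓝[>] (0 : ℝ), R₁ ≤ ε⁻¹ * rad x :=
        (tendsto_inv_nhdsGT_zero.atTop_mul_const hx).eventually_ge_atTop R₁
      filter_upwards [h1, hpos] with ε h1 hε
      rw [hR₁ _ (by rwa [rad_dil (inv_pos.2 hε)]), zero_mul]
  have lim1 : Tendsto (fun ε : ℝ => ∑ α, ε * (∫ x, pd α ρ x *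
      firstCoef E (Φ 0) f α (dil ε x) (ε • perturbation Φ (dil ε x)))) (𝓝[>] 0) (𝓝 0) := by
    have hid : Tendsto (fun ε : ℝ => ε) (𝓝[>] 0) (𝓝 0) := nhdsWithin_le_nhds
    have := tendsto_finsetSum Finset.univ fun α _ =>
      hid.mul (hF.tendsto_scaled (isTest_firstCoef hB hf α) (hρ.pd α))
    simpa using this
  have lim2 := tendsto_finsetSum Finset.univ fun α _ => tendsto_finsetSum Finset.univ fun β _ =>
      hF.tendsto_scaled (hB.isTest_coef (idx2 α β) hf) ((hρ.pd β).pd α)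
  have hlim := (lim0.add lim1).add lim2
  simp only [zero_add] at hlim
  refine tendsto_nhds_unique (tendsto_const_nhds.congr' ?_) hlim
  filter_upwards [hpos] with ε hε using key ε hε

end IsSmallBodyFamily

end PointSource

/-! ### The source as a distribution on the worldline -/

/-- The coordinate times of the points of the worldline in `U`. -/
def times (U : Set STPoint) : Set ℝ := {t | wl t ∈ U}

theorem continuous_worldline : Continuous worldline :=
  continuous_pt.comp (by fun_prop : Continuous fun t : ℝ => (t, (0 : E3)))

theorem isOpen_times {U : Set STPoint} (hU : IsOpen U) : IsOpen (times U) :=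
  hU.preimage continuous_worldline

/-- The integral of the leading part of the perturbation over space, with a spatial weight. -/
def moment (Φ : ℝ → STPoint → Val) (σ : STPoint → ℝ) (t : ℝ) : Val :=
  ∫ y : E3, σ (pt 0 y) • lead Φ (pt t y)

/-- The jet whose second derivatives are the moments of the second derivatives of a cutoff. -/
def sourceJet (Φ : ℝ → STPoint → Val) (ρ : STPoint → ℝ) (t : ℝ) : Jet 2 :=
  ∑ α, ∑ β, Pi.single (idx2 α β) (moment Φ (pd α (pd β ρ)) t)

/-- The source on the worldline, as a density in coordinate time. -/
def source (E : Jet 2 → Val) (Φ : ℝ → STPoint → Val) (ρ : STPoint → ℝ) (t : ℝ) : Val :=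
  sqrtNegDet (Φ 0 (wl t)).1 • 𝒟 E (jet 2 (Φ 0) (wl t)) (sourceJet Φ ρ t)

section

variable {E : Jet 2 → Val} {U : Set STPoint} {R Λ : ℝ} {Φ : ℝ → STPoint → Val}
  {f : STPoint → Val} {ρ σ : STPoint → ℝ} {c : ℝ}

namespace IsSmallBodyFamily

variable (hF : IsSmallBodyFamily E U R Λ Φ)
include hF

theorem continuousAt_weight_smul_lead (hσ : IsCutoff σ 0) {t : ℝ} (ht : t ∈ times U) (y : E3) :
    ContinuousAt (fun p : ℝ × E3 => σ (pt 0 p.2) • lead Φ (pt p.1 p.2)) (t, y) := by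
  obtain ⟨δ, hδ, hnear⟩ := hσ.near
  by_cases hy : ‖y‖ < δ
  · have : (fun p : ℝ × E3 => σ (pt 0 p.2) • lead Φ (pt p.1 p.2)) =ᶠ[𝓝 (t, y)] fun _ => 0 := by
      filter_upwards [(continuous_snd.norm.continuousAt (x := ((t, y) : ℝ × E3))).eventually_lt_const
        hy] with p hp
      rw [hnear _ (by rwa [rad_pt]), zero_smul]
    exact continuousAt_const.congr this.symm
  · have hy0 : y ≠ 0 := norm_pos_iff.1 (hδ.trans_le (not_lt.1 hy))
    exact (hσ.smooth.continuous.comp (continuous_pt.comp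
      (by fun_prop : Continuous fun p : ℝ × E3 => ((0 : ℝ), p.2)))).continuousAt.smul
        (hF.contDiffAt_lead ht hy0).continuousAt

theorem continuousOn_moment (hσ : IsCutoff σ 0) : ContinuousOn (moment Φ σ) (times U) := by
  obtain ⟨R₁, hR₁⟩ := hσ.support
  refine continuousOn_integral_of_compact_support (isCompact_closedBall (0 : E3) R₁)
    (f := fun t y => σ (pt 0 y) • lead Φ (pt t y)) ?_ ?_
  · rintro ⟨t, y⟩ ⟨ht, -⟩
    exact (hF.continuousAt_weight_smul_lead hσ ht y).continuousWithinAt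
  · intro t y _ hy
    rw [mem_closedBall_zero_iff, not_le] at hy
    change σ (pt 0 y) • lead Φ (pt t y) = 0
    rw [hR₁ _ (by rw [rad_pt]; exact hy.le), zero_smul]

theorem integrable_weight_smul_lead (hσ : IsCutoff σ 0) {t : ℝ} (ht : t ∈ times U) :
    Integrable fun y : E3 => σ (pt 0 y) • lead Φ (pt t y) := by
  obtain ⟨R₁, hR₁⟩ := hσ.support
  refine Continuous.integrable_of_hasCompactSupport (continuous_iff_continuousAt.2 fun y =>
    ContinuousAt.comp (g := fun p : ℝ × E3 => σ (pt 0 p.2) • lead Φ (pt p.1 p.2))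
      (f := fun y => (t, y)) (hF.continuousAt_weight_smul_lead hσ ht y) (by fun_prop))
    (HasCompactSupport.intro (isCompact_closedBall (0 : E3) R₁) fun y hy => ?_)
  rw [mem_closedBall_zero_iff, not_le] at hy
  rw [hR₁ _ (by rw [rad_pt]; exact hy.le), zero_smul]

theorem moment_symm (hσ : IsCutoff σ 0) {t : ℝ} (ht : t ∈ times U) (a b : Fin 4) :
    (moment Φ σ t).1 a b = (moment Φ σ t).1 b a := by
  have h : ∀ a b, (moment Φ σ t).1 a b = ∫ y : E3, σ (pt 0 y) * (lead Φ (pt t y)).1 a b := by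
    intro a b
    have := (((ContinuousLinearMap.proj (R := ℝ) (φ := fun _ : Fin 4 => ℝ) b).comp
      (ContinuousLinearMap.proj (R := ℝ) (φ := fun _ : Fin 4 => Fin 4 → ℝ) a)).comp
      (ContinuousLinearMap.fst ℝ (Tensor) ℝ)).integral_comp_comm
      (hF.integrable_weight_smul_lead hσ ht)
    exact this.symm
  rw [h, h]
  refine integral_congr (fun y => ?_)
  by_cases hy : y = 0
  · obtain ⟨δ, hδ, hnear⟩ := hσ.near
    simp only [hnear (pt 0 y) (by rw [rad_pt, hy, norm_zero]; exact hδ), zero_mul]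
  · simp only [hF.lead_symm ht hy a b]

/-- Fubini's theorem for the tested leading part. -/
theorem integral_lead {A : STPoint → Val →L[ℝ] ℝ} (hA : IsTest U A) (hσ : IsCutoff σ 0) :
    Integrable (fun t => A (wl t) (moment Φ σ t)) ∧
    ∫ x, σ x * A (wl (x 0)) (lead Φ x) = ∫ t, A (wl t) (moment Φ σ t) := by
  obtain ⟨R₁, hR₁⟩ := hσ.support
  obtain ⟨T, hT⟩ := hA.2.1.exists_bound_of_continuousOn (f := fun x : STPoint => x 0)
    (continuous_apply 0).continuousOn
  have hwl : Continuous fun x : STPoint => A (wl (x 0)) :=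
    hA.1.continuous.comp (continuous_worldline.comp (continuous_apply 0))
  have hI : Integrable fun x => σ x * A (wl (x 0)) (lead Φ x) := by
    refine Continuous.integrable_of_hasCompactSupport (continuous_iff_continuousAt.2 fun x => ?_)
      (HasCompactSupport.intro (K := (fun p : ℝ × E3 => pt p.1 p.2) ''
        (Icc (-T) T ×ˢ Metric.closedBall 0 R₁))
        ((isCompact_Icc.prod (isCompact_closedBall _ _)).image continuous_pt) fun x hx => ?_)
    · by_cases hxs : wl (x 0) ∈ tsupport A
      · have h1 := hF.continuousAt_weight_smul_lead hσ (hA.2.2 hxs) (spat x)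
        have h2 : ContinuousAt (fun x : STPoint => (x 0, spat x)) x :=
          ((continuous_apply 0).prodMk continuous_spat).continuousAt
        have h3 := hwl.continuousAt.clm_apply (ContinuousAt.comp
          (g := fun p : ℝ × E3 => σ (pt 0 p.2) • lead Φ (pt p.1 p.2))
          (f := fun x : STPoint => (x 0, spat x)) (x := x) h1 h2)
        simpa only [Function.comp_def, pt_spat, hσ.spatial, map_smul, smul_eq_mul] using h3
      · have : (fun x => σ x * A (wl (x 0)) (lead Φ x)) =ᶠ[𝓝 x] fun _ => 0 := by
          have hev : ∀ᶠ y : STPoint in 𝓝 x, wl (y 0) ∈ (tsupport A)ᶜ :=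
            ((isClosed_tsupport A).isOpen_compl.preimage (continuous_worldline.comp
              (continuous_apply (0 : Fin 4)))).mem_nhds hxs
          filter_upwards [hev] with y hy
          have hy' : A (wl (y 0)) = 0 := eq_zero_off hy
          rw [hy']
          simp
        exact continuousAt_const.congr this.symm
    · by_contra h
      refine hx ⟨(x 0, spat x), ⟨abs_le.1 (hT (wl (x 0)) ?_), ?_⟩, pt_spat x⟩
      · by_contra hxs
        rw [eq_zero_off hxs] at h
        simp at h
      · rw [mem_closedBall_zero_iff, ← rad_eq]
        by_contra hr
        rw [hR₁ x (not_le.1 hr).le, zero_mul] at h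
        exact h rfl
  have hI' := integrable_pt.2 hI
  have hin : ∀ t, ∫ y, σ (pt t y) * A (wl t) (lead Φ (pt t y)) = A (wl t) (moment Φ σ t) := by
    intro t
    by_cases ht : t ∈ times U
    · rw [moment, ← (A (wl t)).integral_comp_comm (hF.integrable_weight_smul_lead hσ ht)]
      refine integral_congr (fun y => ?_)
      simp only [map_smul, smul_eq_mul]
      rw [hσ.congr_spat (x := pt t y) (y := pt 0 y) (by simp)]
    · have : A (wl t) = 0 := eq_zero_off fun h => ht (hA.2.2 h)
      simp [this]
  constructor
  · have := hI'.integral_prod_left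
    simpa only [pt_zero_apply, hin] using this
  · rw [← integral_pt, Measure.volume_eq_prod, integral_prod _ hI']
    simp only [pt_zero_apply, hin]

theorem integral_linIntegrand (hE : SmoothOnLorentzian E) (hf : IsTest U f) (hρ : IsCutoff ρ c) :
    Integrable (fun t => pair (f (wl t)) (source E Φ ρ t)) ∧
    c * ∫ x, linIntegrand E (Φ 0) (perturbation Φ) f x = ∫ t, pair (f (wl t)) (source E Φ ρ t) := by
  have hB := hF.background hE
  have key : ∀ t, pair (f (wl t)) (source E Φ ρ t) = ∑ α, ∑ β,
      coef E (Φ 0) f (idx2 α β) (wl t) (moment Φ (pd α (pd β ρ)) t) := by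
    intro t
    simp only [source, sourceJet, coef_apply, map_sum]
    rw [← pairL_apply, map_smul, map_sum, Finset.smul_sum]
    refine sum_congr rfl fun α _ => ?_
    rw [map_sum, Finset.smul_sum]
    rfl
  have h := fun α β => hF.integral_lead (hB.isTest_coef (idx2 α β) hf) ((hρ.pd β).pd α)
  simp only [key]
  refine ⟨integrable_finsetSum _ fun α _ => integrable_finsetSum _ fun β _ => (h α β).1, ?_⟩
  rw [integral_finsetSum _ fun α _ => integrable_finsetSum _ fun β _ => (h α β).1]
  simp only [linIntegrand_eq hB hf]
  rw [hF.pointSource hE hf hρ]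
  refine sum_congr rfl fun α _ => ?_
  rw [integral_finsetSum _ fun β _ => (h α β).1]
  exact sum_congr rfl fun β _ => (h α β).2

theorem integrable_linIntegrand (hE : SmoothOnLorentzian E) (hf : IsTest U f) :
    Integrable (linIntegrand E (Φ 0) (perturbation Φ) f) := by
  have hB := hF.background hE
  have := hF.integrable_apply (hB.isTest_adjSum hf)
  rwa [← funext fun x => linIntegrand_eq hB hf x] at this

theorem continuousOn_source (hE : SmoothOnLorentzian E) (hρ : IsCutoff ρ c) :
    ContinuousOn (source E Φ ρ) (times U) := by
  have hB := hF.background hE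
  have h1 : ContinuousOn (sourceJet Φ ρ) (times U) :=
    continuousOn_finsetSum _ fun α _ => continuousOn_finsetSum _ fun β _ =>
      (ContinuousLinearMap.single ℝ (fun _ : JetIdx 2 => Val) (idx2 α β)).continuous.comp_continuousOn
        (hF.continuousOn_moment ((hρ.pd β).pd α))
  have h2 : ContinuousOn (fun t => 𝒟 E (jet 2 (Φ 0) (wl t))) (times U) := fun t ht =>
    ((hB.contDiffAt_fderiv ht).continuousAt.comp
      continuous_worldline.continuousAt).continuousWithinAt
  have h3 : ContinuousOn (fun t => sqrtNegDet (Φ 0 (wl t)).1) (times U) := fun t ht =>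
    (ContinuousAt.comp (g := fun x => sqrtNegDet (Φ 0 x).1) (hB.contDiffAt_sqrt ht).continuousAt
      continuous_worldline.continuousAt).continuousWithinAt
  exact h3.smul (h2.clm_apply h1)

end IsSmallBodyFamily

/-! ### Test functions on the worldline -/

theorem exists_cutoff_on {K : Set STPoint} (hK : IsCompact K) (hU : IsOpen U) (hKU : K ⊆ U) :
    ∃ χ : STPoint → ℝ, IsTest U χ ∧ ∀ x ∈ K, χ =ᶠ[𝓝 x] fun _ => 1 := by
  obtain ⟨L, hL, hKL, hLU⟩ := exists_compact_between hK hU hKU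
  obtain ⟨f, h1, h0, -⟩ := exists_contMDiffMap_one_nhds_of_subset_interior (n := ⊤)
    (modelWithCornersSelf ℝ STPoint) hK.isClosed hKL
  refine ⟨f, IsTest.of_zero (fun y _ => f.contMDiff.contDiff.contDiffAt) hL hLU h0, fun x hx => ?_⟩
  exact h1.filter_mono (nhds_le_nhdsSet hx)

/-- A smooth function of compact support in an open set of the line. -/
def IsTest1 (T : Set ℝ) (ζ : ℝ → ℝ) : Prop := Smooth ζ ∧ HasCompactSupport ζ ∧ tsupport ζ ⊆ T

theorem isTest_extend {χ : STPoint → ℝ} {ζ : ℝ → ℝ} {X : Type*} [NormedAddCommGroup X]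
    [NormedSpace ℝ X] {p : STPoint → X} (hχ : IsTest U χ) (hζ : Smooth ζ)
    (hp : Smooth p) : IsTest U fun x => (χ x * ζ (x 0)) • p x := by
  refine IsTest.of_zero (fun y _ => ?_) hχ.2.1 hχ.2.2 fun y hy => ?_
  · have h0 : Smooth fun x : STPoint => ζ (x 0) := hζ.comp (contDiff_apply _ _ _)
    exact ((hχ.1.mul h0).smul hp).contDiffAt
  · rw [eq_zero_off hy, zero_mul, zero_smul]

theorem exists_cutoff_worldline {ζ : ℝ → ℝ} (hU : IsOpen U) (hζ : IsTest1 (times U) ζ) :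
    ∃ χ : STPoint → ℝ, IsTest U χ ∧ ∀ t ∈ tsupport ζ, χ =ᶠ[𝓝 (wl t)] fun _ => 1 := by
  obtain ⟨χ, h1, h2⟩ := exists_cutoff_on (hζ.2.1.isCompact.image continuous_worldline) hU
    (image_subset_iff.2 hζ.2.2)
  exact ⟨χ, h1, fun t ht => h2 _ (mem_image_of_mem _ ht)⟩

theorem eqOn_zero_of_integral {T : Set ℝ} (hT : IsOpen T) {a : ℝ → ℝ} (ha : ContinuousOn a T)
    (h : ∀ ζ, IsTest1 T ζ → ∫ t, ζ t * a t = 0) : EqOn a 0 T := by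
  have h1 := hT.ae_eq_zero_of_integral_contDiff_smul_eq_zero (μ := volume)
    (ha.locallyIntegrableOn hT.measurableSet) fun g hg hc hs => h g ⟨hg, hc, hs⟩
  exact Measure.eqOn_open_of_ae_eq (μ := volume)
    ((ae_restrict_iff' hT.measurableSet).2 h1) hT ha continuousOn_const

theorem pair_ext {v w : Val} (h : ∀ u, pair u v = pair u w) : v = w := by
  refine Prod.ext (funext fun a => funext fun b => ?_) ?_
  · have := h (Pi.single a (Pi.single b 1), 0)
    simpa [pair, Pi.single_apply, apply_ite, ite_apply, Finset.sum_ite_eq] using this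
  · have := h (0, 1)
    simpa [pair] using this

theorem source_eqOn (hU : IsOpen U) {S S' : ℝ → Val} (hS : ContinuousOn S (times U))
    (hS' : ContinuousOn S' (times U))
    (hi : ∀ f, IsTest U f → Integrable (fun t => pair (f (wl t)) (S t)) ∧
      Integrable (fun t => pair (f (wl t)) (S' t)))
    (h : ∀ f, IsTest U f → ∫ t, pair (f (wl t)) (S t) = ∫ t, pair (f (wl t)) (S' t)) :
    EqOn S S' (times U) := by
  intro t ht
  refine pair_ext fun u => ?_
  have hc : ∀ {S : ℝ → Val}, ContinuousOn S (times U) →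
      ContinuousOn (fun t => pair u (S t)) (times U) := fun hS =>
    (pairL u).continuous.comp_continuousOn hS
  have key : EqOn (fun t => pair u (S t) - pair u (S' t)) 0 (times U) :=
      eqOn_zero_of_integral (isOpen_times hU) ((hc hS).sub (hc hS')) fun ζ hζ => by
    obtain ⟨χ, hχ, h1⟩ := exists_cutoff_worldline hU hζ
    have hf := isTest_extend hχ hζ.1 (contDiff_const (c := u))
    have e := h _ hf
    have e1 : ∀ t, (ζ t * (pair u (S t) - pair u (S' t))) =
        pair ((χ (wl t) * ζ (wl t 0)) • u) (S t) -
        pair ((χ (wl t) * ζ (wl t 0)) • u) (S' t) := by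
      intro t
      change _ = pair ((χ (wl t) * ζ t) • u) (S t) - pair ((χ (wl t) * ζ t) • u) (S' t)
      by_cases ht : t ∈ tsupport ζ
      · rw [(h1 t ht).self_of_nhds, one_mul, mul_sub, ← pairL_apply (ζ t • u),
          ← pairL_apply (ζ t • u), map_smul]
        rfl
      · have hz : ζ t = 0 := eq_zero_off ht
        rw [hz, mul_zero, zero_smul, ← pairL_apply 0, ← pairL_apply 0, map_zero]
        simp
    simp only [e1]
    rw [integral_sub (hi _ hf).1 (hi _ hf).2, e, sub_self]
  exact sub_eq_zero.1 (key ht)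

theorem IsSmallBodyFamily.source_eq (hF : IsSmallBodyFamily E U R Λ Φ)
    (hE : SmoothOnLorentzian E) (hρ : IsCutoff ρ 1)
    (hσ : IsCutoff σ c) : EqOn (source E Φ σ) (fun t => c • source E Φ ρ t) (times U) := by
  have e : ∀ (f : STPoint → Val) t, pair (f (wl t)) (c • source E Φ ρ t) =
      c * pair (f (wl t)) (source E Φ ρ t) := fun f t => by
    rw [← pairL_apply, map_smul]; rfl
  refine source_eqOn hF.isOpen (hF.continuousOn_source hE hσ)
    ((hF.continuousOn_source hE hρ).const_smul c)
    (fun f hf => ⟨(hF.integral_linIntegrand hE hf hσ).1, ?_⟩) fun f hf => ?_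
  · simp only [e]
    exact (hF.integral_linIntegrand hE hf hρ).1.const_mul c
  · simp only [e]
    rw [integral_const_mul, ← (hF.integral_linIntegrand hE hf hσ).2,
      ← (hF.integral_linIntegrand hE hf hρ).2, one_mul]

/-! ### Cutoffs -/

theorem isCutoff_comp_spat {b : E3 → ℝ} (hb : Smooth b) (hc : HasCompactSupport b)
    (h : ∀ᶠ y in 𝓝 0, b y = c) : IsCutoff (fun x => b (spat x)) c where
  smooth := hb.comp contDiff_spat
  spatial x := by simp
  support := by
    obtain ⟨r, hr⟩ := hc.isCompact.isBounded.subset_ball 0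
    refine ⟨r, fun x hx => eq_zero_off fun h => ?_⟩
    have := hr h
    rw [mem_ball_zero_iff, ← rad_eq] at this
    exact absurd hx (not_le.2 this)
  near := by
    obtain ⟨δ, hδ, h⟩ := Metric.eventually_nhds_iff.1 h
    exact ⟨δ, hδ, fun x hx => h (by rwa [dist_zero_right, ← rad_eq])⟩

theorem exists_isCutoff : ∃ ρ : STPoint → ℝ, IsCutoff ρ 1 := by
  let b : ContDiffBump (0 : E3) := ⟨1, 2, by norm_num, by norm_num⟩
  exact ⟨_, isCutoff_comp_spat b.contDiff b.hasCompactSupport b.eventuallyEq_one⟩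

/-! ### Symmetry of the source -/

theorem fderiv_operator_symm {k : ℕ} {L : Jet k → ℝ} (hT : IsScalarTensorTheory k L E)
    {Φ : STPoint → Val} {x : STPoint} (hΦ : SmoothAt Φ x)
    (hΦL : ∀ᶠ y in 𝓝 x, IsLorentzian (Φ y).1) {H : Fin 4 → Fin 4 → Val}
    (hH : ∀ α β, H α β = H β α) (hHs : ∀ α β a b, (H α β).1 a b = (H α β).1 b a) (a b : Fin 4) :
    (𝒟 E (jet 2 Φ x) (∑ α, ∑ β, Pi.single (idx2 α β) (H α β))).1 a b =
      (𝒟 E (jet 2 Φ x) (∑ α, ∑ β, Pi.single (idx2 α β) (H α β))).1 b a := by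
  set η : STPoint → Val := fun y => ∑ α, ∑ β, ((1 / 2 : ℝ) * ((y α - x α) * (y β - x β))) • H α β
  have hη : Smooth η := by fun_prop
  have hd : ∀ α, Differentiable ℝ fun y : STPoint => y α - x α := fun α => by fun_prop
  have hpd : ∀ μ α y, pd μ (fun y : STPoint => y α - x α) y = if α = μ then 1 else 0 := by
    intro μ α y
    rw [pd_sub (by fun_prop) (by fun_prop), pd_const, sub_zero]
    have := pd_clm (μ := μ) (x := y) (ContinuousLinearMap.proj (R := ℝ) (φ := fun _ : Fin 4 => ℝ) α)
      (f := fun y => y) differentiableAt_id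
    simp only [ContinuousLinearMap.proj_apply] at this
    rw [this]
    simp [pd, Pi.single_apply]
  have h1 : ∀ μ, pd μ η = fun y => ∑ α, (y α - x α) • H α μ := by
    intro μ
    funext y
    have e1 : ∀ α β, pd μ (fun y : STPoint => ((1 / 2 : ℝ) * ((y α - x α) * (y β - x β))) • H α β) y =
        ((1 / 2 : ℝ) * ((y α - x α) * (if β = μ then 1 else 0) +
          (if α = μ then 1 else 0) * (y β - x β))) • H α β := by
      intro α β
      rw [pd_smul (by fun_prop) (by fun_prop), pd_const, smul_zero, zero_add,
        pd_const_mul _ (by fun_prop), pd_mul (by fun_prop) (by fun_prop), hpd, hpd]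
    have e2 : pd μ η y = ∑ α, ∑ β,
        pd μ (fun y : STPoint => ((1 / 2 : ℝ) * ((y α - x α) * (y β - x β))) • H α β) y := by
      rw [pd_sum _ fun _ _ => by fun_prop]
      exact sum_congr rfl fun α _ => pd_sum _ fun _ _ => by fun_prop
    rw [e2]
    simp only [e1, mul_add, add_smul, sum_add_distrib]
    simp only [mul_ite, ite_mul, mul_zero, zero_mul, ite_smul, zero_smul, Finset.sum_ite_eq',
      Finset.mem_univ, if_true, mul_one, one_mul]
    rw [sum_eq_single_of_mem (s := Finset.univ) μ (Finset.mem_univ _)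
      (f := fun α => ∑ β, if α = μ then ((1 / 2 : ℝ) * (y β - x β)) • H α β else 0)
      (fun α _ h => by simp [h])]
    simp only [if_true, ← sum_add_distrib]
    refine sum_congr rfl fun α _ => ?_
    rw [hH μ α, ← add_smul]
    congr 1
    ring
  have h2 : ∀ μ ν, pd μ (pd ν η) x = H μ ν := by
    intro μ ν
    rw [h1, pd_sum _ fun _ _ => by fun_prop]
    have : ∀ α, pd μ (fun y : STPoint => (y α - x α) • H α ν) x = if α = μ then H α ν else 0 := by
      intro α
      rw [pd_smul (by fun_prop) (by fun_prop), pd_const, smul_zero, zero_add, hpd]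
      split_ifs <;> simp
    simp [this]
  have hjet : jet 2 η x = ∑ α, ∑ β, Pi.single (idx2 α β) (H α β) := by
    rw [← Finset.univ_sum_single (jet 2 η x), sum_jetIdx_two]
    have e0 : jet 2 η x (idx0 2) = 0 := by simp [jet_idx0, η]
    have e1 : ∀ α, jet 2 η x (idx1 α) = 0 := fun α => by simp [jet, pdI_idx1, h1]
    have e2 : ∀ α β, jet 2 η x (idx2 α β) = H α β := fun α β => by
      simp [jet, pdI_idx2 α β hη.contDiffAt, h2]
    simp [e0, e1, e2]
  rw [← hjet]
  have hx : IsLorentzian (Φ x).1 := hΦL.self_of_nhds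
  have hsym : ∀ s : ℝ, (E (jet 2 Φ x + s • jet 2 η x)).1 a b =
      (E (jet 2 Φ x + s • jet 2 η x)).1 b a := by
    intro s
    have hsm : SmoothAt (fun y => Φ y + s • η y) x := hΦ.add (hη.contDiffAt.const_smul s)
    rw [← jet_add_smul hΦ hη.contDiffAt]
    refine hT.functional_derivative.1 _ x hsm ?_ a b
    have h0 : (Φ x + s • η x).1 = (Φ x).1 := by simp [η]
    have hc : ContinuousAt (fun y => (Φ y + s • η y).1) x := hsm.continuousAt.fst
    rw [← h0] at hx
    filter_upwards [hc.eventually hx.eventually, hΦL] with y h1 h2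
    refine h1 fun a b => ?_
    have : (η y).1 a b = (η y).1 b a := by
      simp only [η, Prod.fst_sum, Finset.sum_apply, Prod.smul_fst, Pi.smul_apply, hHs]
    simp only [Prod.fst_add, Prod.smul_fst, Pi.add_apply, Pi.smul_apply, h2.symm a b, this]
  have hdiff : DiffAt E (jet 2 Φ x) :=
    (hT.smooth_operator _ (by rw [jet_idx0]; exact hΦL.self_of_nhds)).diff
  have hder : HasDerivAt (fun s : ℝ => E (jet 2 Φ x + s • jet 2 η x))
      (𝒟 E (jet 2 Φ x) (jet 2 η x)) 0 := by
    have e0 : jet 2 Φ x + (0 : ℝ) • jet 2 η x = jet 2 Φ x := by simp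
    have h1 : HasDerivAt (fun s : ℝ => jet 2 Φ x + s • jet 2 η x) (jet 2 η x) 0 := by
      simpa using ((hasDerivAt_id (0 : ℝ)).smul_const (jet 2 η x)).const_add (jet 2 Φ x)
    exact HasFDerivAt.comp_hasDerivAt (0 : ℝ) (by rw [e0]; exact hdiff.hasFDerivAt) h1
  have hcomp : ∀ c d, HasDerivAt (fun s : ℝ => (E (jet 2 Φ x + s • jet 2 η x)).1 c d)
      ((𝒟 E (jet 2 Φ x) (jet 2 η x)).1 c d) 0 := fun c d =>
    hasDerivAt_pi.1 (hasDerivAt_pi.1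
      ((ContinuousLinearMap.fst ℝ (Tensor) ℝ).hasFDerivAt.comp_hasDerivAt 0 hder) c) d
  exact (hcomp a b).unique ((hcomp b a).congr_of_eventuallyEq (.of_forall hsym))

theorem IsSmallBodyFamily.source_symm {k : ℕ} {L : Jet k → ℝ} (hT : IsScalarTensorTheory k L E)
    (hF : IsSmallBodyFamily E U R Λ Φ) (hρ : IsCutoff ρ c) {t : ℝ} (ht : t ∈ times U)
    (a b : Fin 4) : (source E Φ ρ t).1 a b = (source E Φ ρ t).1 b a := by
  have hB := hF.background hT.smooth_operator
  have := fderiv_operator_symm hT (hB.contDiffAt ht)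
    (by filter_upwards [hF.isOpen.mem_nhds ht] with y hy using hB.lorentzian y hy)
    (H := fun α β => moment Φ (pd α (pd β ρ)) t)
    (fun α β => by
      have : pd α (pd β ρ) = pd β (pd α ρ) := funext fun x => pd_comm hρ.smooth.contDiffAt
      simp only [this])
    (fun α β a b => hF.moment_symm ((hρ.pd β).pd α) ht a b) a b
  simp only [source, sourceJet, Prod.smul_fst, Pi.smul_apply]
  rw [this]

end

/-! ### The lemma of du Bois-Reymond -/

section DuBoisReymond

theorem exists_primitive_of_integral_eq_zero {p q : ℝ} {θ : ℝ → ℝ} (hθ : Smooth θ)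
    (hs : tsupport θ ⊆ Icc p q) (h0 : ∫ t, θ t = 0) :
    ∃ ζ : ℝ → ℝ, Smooth ζ ∧ tsupport ζ ⊆ Icc p q ∧ ∀ t, deriv ζ t = θ t := by
  have hz : ∀ t, t ∉ Icc p q → θ t = 0 := fun t ht => eq_zero_off fun h => ht (hs h)
  have hd : ∀ t, HasDerivAt (fun t => ∫ s in p..t, θ s) (θ t) t := fun t =>
    intervalIntegral.integral_hasDerivAt_right (hθ.continuous.intervalIntegrable _ _)
      hθ.continuous.aestronglyMeasurable.stronglyMeasurableAtFilter hθ.continuous.continuousAt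
  have hder : deriv (fun t => ∫ s in p..t, θ s) = θ := funext fun t => (hd t).deriv
  refine ⟨fun t => ∫ s in p..t, θ s, contDiff_infty_iff_deriv.2
    ⟨fun t => (hd t).differentiableAt, by rwa [hder]⟩, ?_, fun t => (hd t).deriv⟩
  refine closure_minimal (fun t ht => ?_) isClosed_Icc
  by_contra hn
  refine ht ?_
  rcases lt_or_ge t p with h | h
  · change ∫ s in p..t, θ s = 0
    rw [intervalIntegral.integral_symm, intervalIntegral.integral_of_le h.le,
      setIntegral_eq_zero_of_ae_eq_zero, neg_zero]
    have : ∀ᵐ s : ℝ, s ≠ p := by simp [ae_iff]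
    filter_upwards [this] with s hs hsI
    exact hz s fun hI => hs (le_antisymm hsI.2 hI.1)
  · have hq : q < t := by
      by_contra hq; exact hn ⟨h, not_lt.1 hq⟩
    change ∫ s in p..t, θ s = 0
    rw [intervalIntegral.integral_eq_integral_of_support_subset, h0]
    intro s hs'
    by_cases hsp : s = p
    · exfalso
      have hacc : p ∈ closure (Iio p) := by rw [closure_Iio]; exact mem_Iic.2 le_rfl
      have : θ p = 0 := by
        have hcl : IsClosed {s | θ s = 0} := isClosed_eq hθ.continuous continuous_const
        exact closure_minimal (fun s hs => hz s fun hI => absurd hI.1 (not_le.2 hs)) hcl hacc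
      exact hs' (by rw [hsp, this])
    · have hI : s ∈ Icc p q := by
        by_contra hI; exact hs' (hz s hI)
      exact ⟨lt_of_le_of_ne hI.1 (Ne.symm hsp), hI.2.trans hq.le⟩

theorem exists_const_of_integral_deriv {p q : ℝ} (hpq : p < q) {a : ℝ → ℝ}
    (ha : ContinuousOn a (Ioo p q))
    (h : ∀ ζ, IsTest1 (Ioo p q) ζ → ∫ t, deriv ζ t * a t = 0) :
    ∃ C, ∀ t ∈ Ioo p q, a t = C := by
  let b : ContDiffBump ((p + q) / 2) := ⟨(q - p) / 8, (q - p) / 4, by linarith, by linarith⟩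
  set ψ : ℝ → ℝ := b.normed volume
  have hψs : tsupport ψ ⊆ Ioo p q := by
    rw [b.tsupport_normed_eq]
    intro t ht
    rw [Metric.mem_closedBall, Real.dist_eq, abs_le] at ht
    change -((q - p) / 4) ≤ _ ∧ _ ≤ (q - p) / 4 at ht
    constructor <;> linarith [ht.1, ht.2]
  have hψ : IsTest1 (Ioo p q) ψ := ⟨b.contDiff_normed, b.hasCompactSupport_normed, hψs⟩
  have hint : ∀ η, IsTest1 (Ioo p q) η → Integrable fun t => η t * a t := by
    intro η hη
    refine Continuous.integrable_of_hasCompactSupport (continuous_iff_continuousAt.2 fun t => ?_)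
      (hη.2.1.mul_right)
    by_cases ht : t ∈ tsupport η
    · exact hη.1.continuous.continuousAt.mul (ha.continuousAt (isOpen_Ioo.mem_nhds (hη.2.2 ht)))
    · have : (fun t => η t * a t) =ᶠ[𝓝 t] fun _ => 0 := by
        filter_upwards [notMem_tsupport_iff_eventuallyEq.1 ht] with s hs
        rw [hs, Pi.zero_apply, zero_mul]
      exact continuousAt_const.congr this.symm
  refine ⟨∫ t, ψ t * a t, fun t ht => sub_eq_zero.1 ?_⟩
  refine eqOn_zero_of_integral isOpen_Ioo (a := fun t => a t - ∫ t, ψ t * a t)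
    (ha.sub continuousOn_const) (fun η hη => ?_) ht
  set m := ∫ t, η t
  have hηi : Integrable η := hη.1.continuous.integrable_of_hasCompactSupport hη.2.1
  have hψi : Integrable ψ := hψ.1.continuous.integrable_of_hasCompactSupport hψ.2.1
  set θ : ℝ → ℝ := fun t => η t - m * ψ t
  have hθ : Smooth θ := hη.1.sub (contDiff_const.mul hψ.1)
  obtain ⟨p', q', hp', hq', hη', hψ'⟩ : ∃ p' q', p < p' ∧ q' < q ∧ tsupport η ⊆ Icc p' q' ∧
      tsupport ψ ⊆ Icc p' q' := by
    have hK : IsCompact (tsupport η ∪ tsupport ψ) := hη.2.1.isCompact.union hψ.2.1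
    have hne : (tsupport η ∪ tsupport ψ).Nonempty := by
      refine Nonempty.inr ?_
      rw [b.tsupport_normed_eq]
      exact Metric.nonempty_closedBall.2 b.rOut_pos.le
    have hKs : tsupport η ∪ tsupport ψ ⊆ Ioo p q := union_subset hη.2.2 hψs
    refine ⟨sInf (tsupport η ∪ tsupport ψ), sSup (tsupport η ∪ tsupport ψ),
      (hKs (hK.sInf_mem hne)).1, (hKs (hK.sSup_mem hne)).2, fun s hs => ?_, fun s hs => ?_⟩
    · exact ⟨csInf_le hK.bddBelow (.inl hs), le_csSup hK.bddAbove (.inl hs)⟩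
    · exact ⟨csInf_le hK.bddBelow (.inr hs), le_csSup hK.bddAbove (.inr hs)⟩
  have hθs : tsupport θ ⊆ Icc p' q' := by
    refine closure_minimal (fun s hs => ?_) isClosed_Icc
    by_contra hn
    refine hs ?_
    simp only [θ]
    rw [eq_zero_off fun h => hn (hη' h),
      eq_zero_off (f := ψ) fun h => hn (hψ' h), mul_zero, sub_zero]
  have hθ0 : ∫ t, θ t = 0 := by
    simp only [θ]
    rw [integral_sub hηi (hψi.const_mul m), integral_const_mul, b.integral_normed, mul_one, sub_self]
  obtain ⟨ζ, hζ, hζs, hζd⟩ := exists_primitive_of_integral_eq_zero hθ hθs hθ0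
  have hζt : IsTest1 (Ioo p q) ζ := ⟨hζ, isCompact_Icc.of_isClosed_subset (isClosed_tsupport _) hζs,
    hζs.trans fun s hs => ⟨hp'.trans_le hs.1, hs.2.trans_lt hq'⟩⟩
  have h1 := h ζ hζt
  simp only [hζd, θ, sub_mul, mul_assoc] at h1
  rw [integral_sub (hint η hη) ((hint ψ hψ).const_mul m), integral_const_mul] at h1
  simp only [mul_sub]
  rw [integral_sub (hint η hη) (hηi.mul_const _), integral_mul_const]
  exact h1

theorem hasDerivAt_of_integral {T : Set ℝ} (hT : IsOpen T) {a b : ℝ → ℝ} (ha : ContinuousOn a T)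
    (hb : ContinuousOn b T) (h : ∀ ζ, IsTest1 T ζ → ∫ t, (deriv ζ t * a t + ζ t * b t) = 0)
    {t₀ : ℝ} (ht₀ : t₀ ∈ T) : HasDerivAt a (b t₀) t₀ := by
  obtain ⟨δ, hδ, hball⟩ := Metric.nhds_basis_closedBall.mem_iff.1 (hT.mem_nhds ht₀)
  rw [Real.closedBall_eq_Icc] at hball
  have hle : t₀ - δ ≤ t₀ + δ := by linarith
  set J := Ioo (t₀ - δ) (t₀ + δ)
  have hJT : J ⊆ T := Ioo_subset_Icc_self.trans hball
  set c : ℝ → ℝ := IccExtend hle (restrict (Icc (t₀ - δ) (t₀ + δ)) b)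
  have hc : Continuous c := (continuousOn_iff_continuous_restrict.1 (hb.mono hball)).Icc_extend'
  have hcb : ∀ t ∈ J, c t = b t := fun t ht => IccExtend_of_mem hle _ (Ioo_subset_Icc_self ht)
  set B : ℝ → ℝ := fun t => ∫ s in t₀..t, c s
  have hB : ∀ t, HasDerivAt B (c t) t := fun t =>
    intervalIntegral.integral_hasDerivAt_right (hc.intervalIntegrable _ _)
      hc.aestronglyMeasurable.stronglyMeasurableAtFilter hc.continuousAt
  have hBc : Continuous B := continuous_iff_continuousAt.2 fun t => (hB t).continuousAt
  have haJ := ha.mono hJT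
  obtain ⟨C, hC⟩ := exists_const_of_integral_deriv (p := t₀ - δ) (q := t₀ + δ) (by linarith)
    (a := fun t => a t - B t) (haJ.sub hBc.continuousOn) fun ζ hζ => by
      have hd : ∀ t, HasDerivAt ζ (deriv ζ t) t := fun t =>
        (hζ.1.differentiable (by simp) t).hasDerivAt
      have hdc : Continuous (deriv ζ) := hζ.1.continuous_deriv (by simp)
      have hds : HasCompactSupport (deriv ζ) := hζ.2.1.deriv
      have i1 : Integrable fun t => ζ t * c t :=
        (hζ.1.continuous.mul hc).integrable_of_hasCompactSupport hζ.2.1.mul_right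
      have i2 : Integrable fun t => deriv ζ t * B t :=
        (hdc.mul hBc).integrable_of_hasCompactSupport hds.mul_right
      have i3 : Integrable fun t => ζ t * B t :=
        (hζ.1.continuous.mul hBc).integrable_of_hasCompactSupport hζ.2.1.mul_right
      have e := integral_mul_deriv_eq_deriv_mul_of_integrable (u := ζ) (v := B)
        (fun t _ => hd t) (fun t _ => hB t) i1 i2 i3
      have h1 := h ζ ⟨hζ.1, hζ.2.1, hζ.2.2.trans hJT⟩
      have e2 : ∀ t, deriv ζ t * (a t - B t) =
          (deriv ζ t * a t + ζ t * b t) - (ζ t * c t + deriv ζ t * B t) := by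
        intro t
        have : ζ t * b t = ζ t * c t := by
          by_cases ht : t ∈ tsupport ζ
          · rw [hcb t (hζ.2.2 ht)]
          · rw [eq_zero_off ht, zero_mul, zero_mul]
        rw [this]
        ring
      have i4 : Integrable fun t => deriv ζ t * a t + ζ t * b t := by
        have hsd : tsupport (deriv ζ) ⊆ tsupport ζ := tsupport_deriv_subset
        refine Continuous.integrable_of_hasCompactSupport (continuous_iff_continuousAt.2 fun t => ?_)
          (hds.mul_right.add hζ.2.1.mul_right)
        by_cases ht : t ∈ tsupport ζ
        · have hTt := hT.mem_nhds (hJT (hζ.2.2 ht))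
          exact (hdc.continuousAt.mul (ha.continuousAt hTt)).add
            (hζ.1.continuous.continuousAt.mul (hb.continuousAt hTt))
        · have : (fun t => deriv ζ t * a t + ζ t * b t) =ᶠ[𝓝 t] fun _ => 0 := by
            filter_upwards [notMem_tsupport_iff_eventuallyEq.1 ht,
              notMem_tsupport_iff_eventuallyEq.1 fun h => ht (hsd h)] with s hs hs'
            rw [hs, hs', Pi.zero_apply, zero_mul, zero_mul, add_zero]
          exact continuousAt_const.congr this.symm
      have i5 : Integrable fun t => ζ t * c t + deriv ζ t * B t := i1.add i2
      simp only [e2]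
      rw [integral_sub i4 i5, h1, integral_add i1 i2, e]
      simp
  have hEq : a =ᶠ[𝓝 t₀] fun t => B t + C := by
    filter_upwards [isOpen_Ioo.mem_nhds (show t₀ ∈ J from ⟨by linarith, by linarith⟩)] with t ht
    have := hC t ht
    linarith
  have := ((hB t₀).add_const C).congr_of_eventuallyEq hEq
  rwa [hcb t₀ ⟨by linarith, by linarith⟩] at this

end DuBoisReymond

/-! ### The laws of motion -/

section Laws

variable {E : Jet 2 → Val} {U : Set STPoint} {R Λ : ℝ} {Φ : ℝ → STPoint → Val}
  {f : STPoint → Val} {ρ : STPoint → ℝ} {k : ℕ} {L : Jet k → ℝ}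

theorem sum_mul_invMetric {g : Tensor} (hg : IsLorentzian g) (a c : Fin 4) :
    ∑ b, g a b * invMetric g b c = if a = c then 1 else 0 := by
  have := congrFun (congrFun (mul_nonsing_inv _ hg.isUnit_det) a) c
  rwa [mul_apply, Matrix.one_apply] at this

theorem sum_invMetric_mul {g : Tensor} (hg : IsLorentzian g) (a c : Fin 4) :
    ∑ b, invMetric g a b * g b c = if a = c then 1 else 0 := by
  have := congrFun (congrFun (nonsing_inv_mul _ hg.isUnit_det) a) c
  rwa [mul_apply, Matrix.one_apply] at this

theorem invMetric_symm {g : Tensor} (hg : ∀ a b, g a b = g b a) (a b : Fin 4) :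
    invMetric g a b = invMetric g b a := by
  have : (of g)ᵀ = of g := by ext i j; exact hg j i
  have h := congrFun (congrFun (Matrix.transpose_nonsing_inv (of g)) b) a
  rw [this] at h
  exact h

/-- The contravariant form of a symmetric tensor. -/
def upper (g : Tensor) (S : Tensor) (c d : Fin 4) : ℝ :=
  ∑ a, ∑ b, invMetric g a c * S a b * invMetric g d b

theorem upper_symm {g S : Tensor} (hg : ∀ a b, g a b = g b a)
    (hS : ∀ a b, S a b = S b a) (c d : Fin 4) : upper g S c d = upper g S d c := by
  unfold upper
  rw [sum_comm]
  refine sum_congr₂ fun b a => ?_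
  rw [hS a b, invMetric_symm hg a c, invMetric_symm hg d b]
  ring

theorem lower_upper {g S : Tensor} (hg : IsLorentzian g) (a b : Fin 4) :
    ∑ c, ∑ d, g c a * upper g S c d * g b d = S a b := by
  have h : (of g)ᵀ * ((of g)⁻¹ᵀ * of S * (of g)⁻¹ᵀ) * (of g)ᵀ = of S := by
    rw [← Matrix.mul_assoc, ← Matrix.mul_assoc, ← transpose_mul,
      nonsing_inv_mul _ hg.isUnit_det, Matrix.mul_assoc, ← transpose_mul,
      mul_nonsing_inv _ hg.isUnit_det]
    simp
  have e : ∀ c d, ((of g)⁻¹ᵀ * of S * (of g)⁻¹ᵀ) c d = upper g S c d := by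
    intro c d
    simp only [mul_apply, transpose_apply, of_apply, upper, sum_mul]
    rw [sum_comm]
    rfl
  have h' := congrFun (congrFun h a) b
  rw [mul_apply] at h'
  simp only [mul_apply (M := (of g)ᵀ), e, sum_mul, transpose_apply, of_apply] at h'
  rw [sum_comm]
  exact h'

theorem pair_raise (Φ η : STPoint → Val) (S : Val) (x : STPoint) : pair (raise Φ η x) S =
      -(∑ c, ∑ d, (η x).1 c d * upper (Φ x).1 S.1 c d) + (η x).2 * S.2 := by
  simp only [pair, raise, mul_apply, of_apply, upper, mul_sum, sum_mul, neg_mul, sum_neg_distrib]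
  congr 2
  simp only [Fin.sum_univ_four]
  ring

theorem hasDerivAt_worldline (t : ℝ) : HasDerivAt wl (Pi.single 0 1) t := by
  refine hasDerivAt_pi.2 fun μ => ?_
  refine Fin.cases ?_ (fun i => ?_) μ
  · rw [Pi.single_eq_same]; exact hasDerivAt_id t
  · simpa [worldline, pt_succ] using hasDerivAt_const t (0 : ℝ)

theorem hasDerivAt_comp_worldline {X : Type*} [NormedAddCommGroup X] [NormedSpace ℝ X]
    {F : STPoint → X} {t : ℝ} (hF : DiffAt F (wl t)) :
    HasDerivAt (fun t => F (wl t)) (pd 0 F (wl t)) t :=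
  hF.hasFDerivAt.comp_hasDerivAt t (hasDerivAt_worldline t)

/-- Upper components of the source. -/
def upSource (E : Jet 2 → Val) (Φ : ℝ → STPoint → Val) (ρ : STPoint → ℝ) (t : ℝ) (c d : Fin 4) : ℝ :=
  upper (Φ 0 (wl t)).1 (source E Φ ρ t).1 c d

/-- The mass of the body, from the source with the cutoff `ρ`. -/
def mass (E : Jet 2 → Val) (Φ : ℝ → STPoint → Val) (ρ : STPoint → ℝ) (t : ℝ) : ℝ :=
  upSource E Φ ρ t 0 0 * speed (Φ 0) wl t / (8 * Real.pi)

/-- The charge of the body, from the source with the cutoff `ρ`. -/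
def charge (E : Jet 2 → Val) (Φ : ℝ → STPoint → Val) (ρ : STPoint → ℝ) (t : ℝ) : ℝ :=
  -(source E Φ ρ t).2 / (16 * Real.pi * speed (Φ 0) wl t)

theorem speed_worldline (Φ : STPoint → Val) (t : ℝ) : speed Φ wl t = √(-(Φ (wl t)).1 0 0) := by
  simp [speed, (hasDerivAt_worldline t).deriv, Pi.single_apply]

namespace IsSmallBodyFamily

variable (hF : IsSmallBodyFamily E U R Λ Φ)
include hF

theorem speed_pos {t : ℝ} (ht : t ∈ times U) : 0 < speed (Φ 0) wl t := by
  rw [speed_worldline]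
  exact Real.sqrt_pos.2 (neg_pos.2 (hF.timelike t ht))

theorem speed_sq {t : ℝ} (ht : t ∈ times U) : speed (Φ 0) wl t ^ 2 = -(Φ 0 (wl t)).1 0 0 := by
  rw [speed_worldline]
  exact Real.sq_sqrt (neg_pos.2 (hF.timelike t ht)).le

theorem differentiableAt_zero {t : ℝ} (ht : t ∈ times U) : DiffAt (Φ 0) (wl t) :=
  (hF.smooth_zero.contDiffAt (hF.isOpen.mem_nhds ht)).diff

theorem hasDerivAt_metric {t : ℝ} (ht : t ∈ times U) (a b : Fin 4) :
    HasDerivAt (fun t => (Φ 0 (wl t)).1 a b) ((pd 0 (Φ 0) (wl t)).1 a b) t :=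
  hasDerivAt_pi.1 (hasDerivAt_pi.1
    ((ContinuousLinearMap.fst ℝ (Tensor) ℝ).hasFDerivAt.comp_hasDerivAt t
      (hasDerivAt_comp_worldline (hF.differentiableAt_zero ht))) a) b

theorem hasDerivAt_speed {t : ℝ} (ht : t ∈ times U) : HasDerivAt (speed (Φ 0) worldline)
    (-(pd 0 (Φ 0) (wl t)).1 0 0 / (2 * speed (Φ 0) wl t)) t := by
  have h := (hF.hasDerivAt_metric ht 0 0).neg.sqrt (neg_pos.2 (hF.timelike t ht)).ne'
  have e : speed (Φ 0) worldline = fun t => √(-(Φ 0 (wl t)).1 0 0) :=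
    funext (speed_worldline (Φ 0))
  rw [e]
  exact h

theorem continuousOn_upSource (hE : SmoothOnLorentzian E)
    (hρ : IsCutoff ρ 1) (c d : Fin 4) : ContinuousOn (fun t => upSource E Φ ρ t c d) (times U) := by
  have h1 : ∀ a b, ContinuousOn (fun t => invMetric (Φ 0 (wl t)).1 a b) (times U) :=
    fun a b t ht => (ContinuousAt.comp (g := fun g => invMetric g a b)
      (f := fun t => (Φ 0 (wl t)).1) (x := t) (contDiffAt_invMetric (hF.lorentzian_zero _ ht) a b).continuousAt
      (hasDerivAt_comp_worldline (hF.differentiableAt_zero ht)).continuousAt.fst).continuousWithinAt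
  have h2 : ∀ a b, ContinuousOn (fun t => (source E Φ ρ t).1 a b) (times U) := fun a b =>
    (by fun_prop : Continuous fun v : Val => v.1 a b).comp_continuousOn
      (hF.continuousOn_source hE hρ)
  unfold upSource upper
  exact continuousOn_finsetSum _ fun a _ => continuousOn_finsetSum _ fun b _ =>
    ((h1 a c).mul (h2 a b)).mul (h1 d b)

end IsSmallBodyFamily

theorem IsScalarTensorTheory.integral_source_lieD (hT : IsScalarTensorTheory k L E)
    (hF : IsSmallBodyFamily E U R Λ Φ) (hρ : IsCutoff ρ 1) {ξ : STPoint → STPoint}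
    (hξ : IsTest U ξ) :
    ∫ t, (-(∑ c, ∑ d, (lieD ξ (Φ 0) (wl t)).1 c d * upSource E Φ ρ t c d) +
      (lieD ξ (Φ 0) (wl t)).2 * (source E Φ ρ t).2) = 0 := by
  have hE := hT.smooth_operator
  have hB := hF.background hE
  have hf := isTest_raise hB (isTest_lieD hB.isOpen hB.smooth hξ)
  have h := (hF.integral_linIntegrand hE hf hρ).2
  simp only [pair_raise] at h
  rw [one_mul] at h
  refine h.symm.trans (integral_eq_zero_of_ae ?_)
  filter_upwards [ae_rad_pos] with x hx
  rw [linIntegrand_eq hB hf]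
  by_cases hxU : x ∈ U
  · exact hT.adjSum_lieD hB (fun x hx => hF.background_eq hE hx) hξ (hF.perturbation_symm hxU hx) x
  · rw [eq_zero_off fun h => hxU ((hB.isTest_adjSum hf).2.2 h)]
    rfl

/-- Values and derivatives on the worldline of a vector field with a cutoff. -/
theorem vector_on_worldline {χ : STPoint → ℝ} {ζ : ℝ → ℝ} {p : STPoint → STPoint}
    (hζ : Smooth ζ) (hχ : ∀ t ∈ tsupport ζ, χ =ᶠ[𝓝 (wl t)] fun _ => 1)
    (hp : Differentiable ℝ p) (t : ℝ) :
    (χ (wl t) * ζ (wl t 0)) • p (wl t) = ζ t • p (wl t) ∧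
    ∀ μ, pd μ (fun x => (χ x * ζ (x 0)) • p x) (wl t) =
      ζ t • pd μ p (wl t) + (if μ = 0 then deriv ζ t else 0) • p (wl t) := by
  have hev : (fun x => (χ x * ζ (x 0)) • p x) =ᶠ[𝓝 (wl t)] fun x => ζ (x 0) • p x := by
    by_cases ht : t ∈ tsupport ζ
    · filter_upwards [hχ t ht] with x hx
      rw [hx, one_mul]
    · have hc : Tendsto (fun x : STPoint => x 0) (𝓝 (wl t)) (𝓝 t) :=
        (continuous_apply (0 : Fin 4)).tendsto (wl t)
      filter_upwards [hc.eventually (notMem_tsupport_iff_eventuallyEq.1 ht)] with x hx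
      rw [hx]
      simp
  refine ⟨hev.self_of_nhds, fun μ => ?_⟩
  have hd : DiffAt (fun x : STPoint => ζ (x 0)) (wl t) := ((hζ.differentiable (by simp)).comp
      (differentiable_apply (𝕜 := ℝ) (0 : Fin 4))).differentiableAt
  rw [pd_congr hev, pd_smul hd (hp _), pd_comp (a := ζ) (f := fun x : STPoint => x 0)
    (hζ.differentiable (by simp) _) (differentiableAt_apply 0 _)]
  have e : pd μ (fun x : STPoint => x 0) (wl t) = if μ = 0 then 1 else 0 := by
    have := pd_clm (μ := μ) (x := wl t) (f := fun y => y)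
      (ContinuousLinearMap.proj (R := ℝ) (φ := fun _ : Fin 4 => ℝ) 0) differentiableAt_id
    simp only [ContinuousLinearMap.proj_apply] at this
    rw [this]
    simp [pd, Pi.single_apply, eq_comm]
  rw [e]
  congr 2
  split_ifs <;> simp [worldline]

theorem IsScalarTensorTheory.upSource_spatial (hT : IsScalarTensorTheory k L E)
    (hF : IsSmallBodyFamily E U R Λ Φ) (hρ : IsCutoff ρ 1) {t : ℝ} (ht : t ∈ times U) (i : Fin 3)
    (d : Fin 4) : upSource E Φ ρ t i.succ d = 0 := by
  have hE := hT.smooth_operator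
  have hg : ∀ t ∈ times U, IsLorentzian (Φ 0 (wl t)).1 := fun t ht => hF.lorentzian_zero _ ht
  have key : ∀ e, ∑ ν, (Φ 0 (wl t)).1 e ν * upSource E Φ ρ t i.succ ν = 0 := by
    intro e
    refine eqOn_zero_of_integral (isOpen_times hF.isOpen)
      (a := fun t => ∑ ν, (Φ 0 (wl t)).1 e ν * upSource E Φ ρ t i.succ ν)
      (continuousOn_finsetSum _ fun ν _ => ContinuousOn.mul
        (fun t ht => (hF.hasDerivAt_metric ht e ν).continuousAt.continuousWithinAt)
        (hF.continuousOn_upSource hE hρ _ _)) (fun ζ hζ => ?_) ht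
    obtain ⟨χ, hχ, hχ1⟩ := exists_cutoff_worldline hF.isOpen hζ
    set p : STPoint → STPoint := fun x => x i.succ • Pi.single e 1
    have hp : Smooth p := by fun_prop
    have hv := vector_on_worldline hζ.1 hχ1 (hp.differentiable (by simp))
    have hp0 : ∀ t, p (wl t) = 0 := fun t => by simp [p, worldline, pt_succ]
    have hpd : ∀ μ t, pd μ p (wl t) = (if μ = i.succ then 1 else 0 : ℝ) • Pi.single e 1 := by
      intro μ t
      have h1 := pd_clm (μ := μ) (x := wl t) (f := fun y => y)
        (ContinuousLinearMap.proj (R := ℝ) (φ := fun _ : Fin 4 => ℝ) i.succ) differentiableAt_id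
      simp only [ContinuousLinearMap.proj_apply] at h1
      simp only [p]
      rw [pd_smul (by fun_prop) (by fun_prop), pd_const, smul_zero, zero_add, h1]
      simp [pd, Pi.single_apply, eq_comm]
    have h : ∫ t, -2 * (ζ t * ∑ ν, (Φ 0 (wl t)).1 e ν * upSource E Φ ρ t i.succ ν) = 0 := by
      refine (integral_congr fun t => Eq.symm ?_).trans
        (hT.integral_source_lieD hF hρ (isTest_extend hχ hζ.1 hp))
      by_cases ht : t ∈ times U
      · have hs : ∀ c d, upSource E Φ ρ t c d = upSource E Φ ρ t d c :=
          upper_symm (hg t ht).symm (hF.source_symm hT hρ ht)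
        simp only [lieD, (hv t).2, hp0, hpd, smul_zero, add_zero, Pi.zero_apply, zero_mul,
          zero_add, Pi.smul_apply, smul_eq_mul, Finset.sum_const_zero, sum_add_distrib,
          add_mul, Pi.single_apply, mul_ite, ite_mul, mul_one, mul_zero, Finset.sum_ite_eq',
          Finset.mem_univ, if_true]
        have a1 : ∑ x, ∑ x_1, (if x = i.succ then ζ t * (Φ 0 (wl t)).1 e x_1 *
            upSource E Φ ρ t x x_1 else 0) =
            ζ t * ∑ ν, (Φ 0 (wl t)).1 e ν * upSource E Φ ρ t i.succ ν := by
          rw [sum_eq_single_of_mem i.succ (Finset.mem_univ _) fun x _ hx => by simp [hx]]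
          simp only [if_true, mul_sum, mul_assoc]
        have a2 : ∑ x, ζ t * (Φ 0 (wl t)).1 x e * upSource E Φ ρ t x i.succ =
            ζ t * ∑ ν, (Φ 0 (wl t)).1 e ν * upSource E Φ ρ t i.succ ν := by
          rw [mul_sum]
          refine sum_congr rfl fun x _ => ?_
          rw [hs x, (hg t ht).symm x, mul_assoc]
        rw [a1, a2]
        ring
      · have hz : ζ t = 0 := eq_zero_off fun h => ht (hζ.2.2 h)
        simp [lieD, (hv t).2, hp0, hz]
    rw [integral_const_mul] at h
    simpa using h
  have hinv := fun e => sum_invMetric_mul (hg t ht) d e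
  calc upSource E Φ ρ t i.succ d = ∑ ν, (if d = ν then 1 else 0) * upSource E Φ ρ t i.succ ν := by simp
    _ = ∑ e, invMetric (Φ 0 (wl t)).1 d e *
        ∑ ν, (Φ 0 (wl t)).1 e ν * upSource E Φ ρ t i.succ ν := by
      simp only [← hinv, mul_sum, sum_mul]
      rw [sum_comm]
      exact sum_congr₂
    _ = 0 := by simp [key]

theorem IsScalarTensorTheory.upSource_eq (hT : IsScalarTensorTheory k L E)
    (hF : IsSmallBodyFamily E U R Λ Φ) (hρ : IsCutoff ρ 1) {t : ℝ} (ht : t ∈ times U)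
    (c d : Fin 4) : upSource E Φ ρ t c d = if c = 0 ∧ d = 0 then upSource E Φ ρ t 0 0 else 0 := by
  have hs : ∀ c d, upSource E Φ ρ t c d = upSource E Φ ρ t d c :=
    upper_symm (hF.lorentzian_zero _ ht).symm (hF.source_symm hT hρ ht)
  refine Fin.cases (Fin.cases ?_ (fun i => ?_) d) (fun i => ?_) c
  · rw [hT.upSource_spatial hF hρ ht]; simp
  · simp
  · rw [hs, hT.upSource_spatial hF hρ ht]; simp

theorem IsScalarTensorTheory.source_eq (hT : IsScalarTensorTheory k L E)
    (hF : IsSmallBodyFamily E U R Λ Φ) (hρ : IsCutoff ρ 1) {t : ℝ} (ht : t ∈ times U)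
    (a b : Fin 4) : (source E Φ ρ t).1 a b =
      (Φ 0 (wl t)).1 a 0 * upSource E Φ ρ t 0 0 * (Φ 0 (wl t)).1 b 0 := by
  rw [← lower_upper (hF.lorentzian_zero _ ht) (S := (source E Φ ρ t).1) a b]
  change ∑ c, ∑ d, _ * upSource E Φ ρ t c d * _ = _
  rw [sum_eq_single_of_mem 0 (Finset.mem_univ _) fun c _ hc => by
      simp [hT.upSource_eq hF hρ ht c, hc],
    sum_eq_single_of_mem 0 (Finset.mem_univ _) fun d _ hd => by
      simp [hT.upSource_eq hF hρ ht 0 d, hd], (hF.lorentzian_zero _ ht).symm 0 a]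

/-- The conservation law of the source. -/
theorem IsScalarTensorTheory.hasDerivAt_upSource (hT : IsScalarTensorTheory k L E)
    (hF : IsSmallBodyFamily E U R Λ Φ) (hρ : IsCutoff ρ 1) {t : ℝ} (ht : t ∈ times U) (e : Fin 4) :
    HasDerivAt (fun t => 2 * upSource E Φ ρ t 0 0 * (Φ 0 (wl t)).1 e 0)
      (upSource E Φ ρ t 0 0 * (pd e (Φ 0) (wl t)).1 0 0 -
        (source E Φ ρ t).2 * (pd e (Φ 0) (wl t)).2) t := by
  have hE := hT.smooth_operator
  have hcT := hF.continuousOn_upSource hE hρ 0 0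
  have hcpd : ContinuousOn (fun t => pd e (Φ 0) (wl t)) (times U) := fun t ht =>
    (ContinuousAt.comp (g := pd e (Φ 0)) (contDiffAt_pd (hF.smooth_zero.contDiffAt
      (hF.isOpen.mem_nhds ht))).continuousAt continuous_worldline.continuousAt).continuousWithinAt
  refine hasDerivAt_of_integral (isOpen_times hF.isOpen)
    (b := fun t => upSource E Φ ρ t 0 0 * (pd e (Φ 0) (wl t)).1 0 0 -
        (source E Φ ρ t).2 * (pd e (Φ 0) (wl t)).2) ?_ ?_ (fun ζ hζ => ?_) ht
  · exact (continuousOn_const.mul hcT).mul fun t ht =>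
      (hF.hasDerivAt_metric ht e 0).continuousAt.continuousWithinAt
  · exact (hcT.mul ((by fun_prop : Continuous fun v : Val => v.1 0 0).comp_continuousOn hcpd)).sub
      ((continuous_snd.comp_continuousOn (hF.continuousOn_source hE hρ)).mul
        (continuous_snd.comp_continuousOn hcpd))
  obtain ⟨χ, hχ, hχ1⟩ := exists_cutoff_worldline hF.isOpen hζ
  set p : STPoint → STPoint := fun _ => Pi.single e 1
  have hp : Smooth p := contDiff_const
  have hv := vector_on_worldline hζ.1 hχ1 (hp.differentiable (by simp))
  have hpd : ∀ μ t, pd μ p (wl t) = 0 := fun μ t => pd_const _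
  have h : ∫ t, -(deriv ζ t * (2 * upSource E Φ ρ t 0 0 * (Φ 0 (wl t)).1 e 0) +
        ζ t * (upSource E Φ ρ t 0 0 * (pd e (Φ 0) (wl t)).1 0 0 -
        (source E Φ ρ t).2 * (pd e (Φ 0) (wl t)).2)) = 0 := by
    refine (integral_congr fun t => Eq.symm ?_).trans
      (hT.integral_source_lieD hF hρ (isTest_extend hχ hζ.1 hp))
    by_cases ht : t ∈ times U
    · have hU := hT.upSource_eq hF hρ ht
      have hsum : ∀ G : Tensor, ∑ c, ∑ d, G c d * upSource E Φ ρ t c d =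
          G 0 0 * upSource E Φ ρ t 0 0 := by
        intro G
        rw [sum_eq_single_of_mem 0 (Finset.mem_univ _) fun c _ hc => by simp [hU c, hc],
          sum_eq_single_of_mem 0 (Finset.mem_univ _) fun d _ hd => by simp [hU 0 d, hd]]
      rw [hsum]
      simp only [lieD, (hv t).1, (hv t).2, hpd]
      simp only [smul_zero, zero_add, p, Pi.smul_apply, smul_eq_mul,
        Pi.single_apply, mul_ite, ite_mul, mul_one, mul_zero, zero_mul, if_true,
        sum_add_distrib, Finset.sum_ite_eq', Finset.mem_univ]
      rw [(hF.lorentzian_zero _ ht).symm 0 e]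
      ring
    · have hz : ζ t = 0 := eq_zero_off fun h => ht (hζ.2.2 h)
      have hz' : deriv ζ t = 0 := eq_zero_off fun h => ht (hζ.2.2 (tsupport_deriv_subset h))
      simp only [lieD, (hv t).1, (hv t).2, hpd, hz, hz']
      simp
  rw [integral_neg, neg_eq_zero] at h
  exact h

theorem jdg_eq (Φ : STPoint → Val) (x : STPoint) (α μ ν : Fin 4) :
    jdg (jet 2 Φ x) α μ ν = (pd α Φ x).1 μ ν := by
  simp [jdg, jet, pdI_idx1]

theorem jg_eq (Φ : STPoint → Val) (x : STPoint) : jg (jet 2 Φ x) = (Φ x).1 := by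
  funext μ ν; simp [jg, jet_idx0]

theorem IsScalarTensorTheory.obeysSmallBodyLaw (hT : IsScalarTensorTheory k L E)
    (hF : IsSmallBodyFamily E U R Λ Φ) (hρ : IsCutoff ρ 1) :
    ObeysSmallBodyLaw E U Φ (mass E Φ ρ) (charge E Φ ρ) := by
  have hE := hT.smooth_operator
  have hTd : ∀ t ∈ times U, DiffAt (fun t => upSource E Φ ρ t 0 0) t := by
    intro t ht
    have h := (hT.hasDerivAt_upSource hF hρ ht 0).differentiableAt.div
      (hF.hasDerivAt_metric ht 0 0).differentiableAt (hF.timelike t ht).ne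
    refine (h.const_mul (1 / 2)).congr_of_eventuallyEq ?_
    filter_upwards [(isOpen_times hF.isOpen).mem_nhds ht] with s hs
    have := (hF.timelike s hs).ne
    simp only [Pi.div_apply]
    field_simp
  have hvd : ∀ t ∈ times U, DiffAt (speed (Φ 0) worldline) t := fun t ht =>
    (hF.hasDerivAt_speed ht).differentiableAt
  have hvc : ContinuousOn (speed (Φ 0) worldline) (times U) := fun t ht =>
    (hvd t ht).continuousAt.continuousWithinAt
  refine ⟨fun t ht => ?_, ?_, ⟨fun f hf => hF.integrable_linIntegrand hE hf, fun f hf => ?_,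
    fun w hw => ?_⟩, fun t ht => ?_⟩
  · exact (((hTd t ht).mul (hvd t ht)).div_const _).differentiableWithinAt
  · exact (continuous_snd.comp_continuousOn (hF.continuousOn_source hE hρ)).neg.div
      (continuousOn_const.mul hvc) fun t ht => by
        have := hF.speed_pos ht
        positivity
  · have hf' : IsTest U fun y => ((f y, 0) : Val) :=
      IsTest.of_zero (fun y _ => hf.contDiffAt.prodMk contDiffAt_const) hf.2.1 hf.2.2
        fun y hy => by rw [eq_zero_off hy]; rfl
    have h := (hF.integral_linIntegrand hE hf' hρ).2
    rw [one_mul] at h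
    rw [h, ← integral_const_mul]
    refine integral_congr (fun t => ?_)
    by_cases ht : t ∈ times U
    · have hv := hF.speed_pos ht
      have hS := hT.source_eq hF hρ ht
      have hl : ∀ a, fourVelLow (Φ 0) wl t a = (Φ 0 (wl t)).1 a 0 / speed (Φ 0) wl t := by
        intro a
        simp [fourVelLow, fourVel, (hasDerivAt_worldline t).deriv, Pi.single_apply, div_eq_mul_inv]
      simp only [pair, hl, hS, mass, zero_mul, add_zero, mul_sum, sum_mul]
      refine sum_congr₂ fun a b => ?_
      field_simp
    · have : f (wl t) = 0 := eq_zero_off fun h => ht (hf.2.2 h)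
      simp [pair, this]
  · have hw' : IsTest U fun y => ((0, w y) : Val) :=
      IsTest.of_zero (fun y _ => contDiffAt_const.prodMk hw.contDiffAt) hw.2.1 hw.2.2
        fun y hy => by rw [eq_zero_off hy]; rfl
    have h := (hF.integral_linIntegrand hE hw' hρ).2
    rw [one_mul] at h
    rw [h, ← integral_const_mul]
    refine integral_congr (fun t => ?_)
    by_cases ht : t ∈ times U
    · have hv := hF.speed_pos ht
      simp only [pair, charge, Pi.zero_apply, zero_mul, Finset.sum_const_zero, zero_add]
      field_simp
    · have : w (wl t) = 0 := eq_zero_off fun h => ht (hw.2.2 h)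
      simp [pair, this]
  · change t ∈ times U at ht
    set g := (Φ 0 (wl t)).1
    set v := speed (Φ 0) wl t with hvdef
    set T := upSource E Φ ρ t 0 0
    set s := (source E Φ ρ t).2
    set T' := deriv (fun t => upSource E Φ ρ t 0 0) t
    set D := fun a => pd a (Φ 0) (wl t)
    have hg : IsLorentzian g := hF.lorentzian_zero _ ht
    have hv : 0 < v := hF.speed_pos ht
    have hv2 : v ^ 2 = -g 0 0 := hF.speed_sq ht
    have hvd' := hF.hasDerivAt_speed ht
    set v' := -(pd 0 (Φ 0) (wl t)).1 0 0 / (2 * speed (Φ 0) wl t)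
    have hD00 : (D 0).1 0 0 = -2 * v * v' := by simp only [v', D, ← hvdef]; field_simp
    clear_value v'
    have hT' : HasDerivAt (fun t => upSource E Φ ρ t 0 0) T' t := (hTd t ht).hasDerivAt
    have law : ∀ e, 2 * T' * g e 0 + 2 * T * (D 0).1 e 0 = T * (D e).1 0 0 - s * (D e).2 := by
      intro e
      exact ((hT'.const_mul 2).mul (hF.hasDerivAt_metric ht e 0)).unique
        (hT.hasDerivAt_upSource hF hρ ht e)
    have hu : ∀ a, fourVel (Φ 0) wl t a = (if a = 0 then 1 else 0) / v := by
      intro a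
      simp [fourVel, (hasDerivAt_worldline t).deriv, Pi.single_apply, hvdef]
    have hu' : ∀ a, deriv (fun s => fourVel (Φ 0) wl s a) t =
        (if a = 0 then 1 else 0) * (-v' / v ^ 2) := by
      intro a
      have e : (fun s => fourVel (Φ 0) wl s a) =
          fun s => (if a = 0 then 1 else 0) * (speed (Φ 0) wl s)⁻¹ := by
        funext s
        simp [fourVel, (hasDerivAt_worldline s).deriv, Pi.single_apply, div_eq_mul_inv]
      rw [e]
      exact ((hvd'.fun_inv hv.ne').const_mul _).deriv
    have hφ : ∀ a, gradPhi (Φ 0) wl t a = (D a).2 := fun a => pd_snd (hF.differentiableAt_zero ht)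
    have hΓ : ∀ a, T * christoffel (jet 2 (Φ 0) (wl t)) a 0 0 =
        -(if a = 0 then 1 else 0) * T' - 1 / 2 * s * ∑ b, invMetric g a b * (D b).2 := by
      intro a
      have e1 : ∑ b, invMetric g a b * (2 * T' * g b 0 + 2 * T * (D 0).1 b 0) =
          ∑ b, invMetric g a b * (T * (D b).1 0 0 - s * (D b).2) :=
        sum_congr rfl fun b _ => by rw [law]
      have e2 := sum_invMetric_mul hg a 0
      rw [← e2]
      simp only [christoffel, jinv, jdg_eq, jg_eq]
      change T * (1 / 2 * ∑ σ, invMetric g a σ * ((D 0).1 σ 0 + (D 0).1 σ 0 - (D σ).1 0 0)) = _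
      simp only [Fin.sum_univ_four] at e1 ⊢
      linear_combination (1 / 2) * e1
    have h0 : s * (D 0).2 = 2 * T' * v ^ 2 + 2 * T * v * v' := by
      have := law 0
      rw [hD00] at this
      rw [hv2]
      linarith
    have hM : mass E Φ ρ t = T * v / (8 * Real.pi) := rfl
    have hq : charge E Φ ρ t = -s / (16 * Real.pi * v) := rfl
    have hM' : deriv (mass E Φ ρ) t = (T' * v + T * v') / (8 * Real.pi) :=
      ((hT'.mul hvd').div_const _).deriv
    constructor
    · intro a
      have hacc : fourAcc (Φ 0) wl t a = (if a = 0 then 1 else 0) * (-v' / v ^ 2) / v +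
          christoffel (jet 2 (Φ 0) (wl t)) a 0 0 / v ^ 2 := by
        simp only [fourAcc, hu', hu, ← hvdef]
        congr 1
        simp [div_eq_mul_inv, Finset.sum_ite_eq']
        ring
      have hsum : ∑ b, (invMetric g a b + fourVel (Φ 0) wl t a *
          fourVel (Φ 0) wl t b) * gradPhi (Φ 0) wl t b =
          (∑ b, invMetric g a b * (D b).2) + (if a = 0 then 1 else 0) / v * ((D 0).2 / v) := by
        simp only [hu, hφ, add_mul, sum_add_distrib]
        congr 1
        simp [Fin.sum_univ_four]
        ring
      rw [hsum, hacc, hM, hq]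
      have hΓa := hΓ a
      generalize (if a = 0 then (1 : ℝ) else 0) = δ at *
      generalize christoffel (jet 2 (Φ 0) (wl t)) a 0 0 = Γ at *
      generalize (∑ b, invMetric g a b * (D b).2) = G at *
      field_simp
      linear_combination 16 * v ^ 2 * hΓa + 8 * δ * h0
    · have hsum : ∑ a, fourVel (Φ 0) wl t a * gradPhi (Φ 0) wl t a = (D 0).2 / v := by
        simp [hu, hφ, Fin.sum_univ_four]
        ring
      rw [hsum, hM', hq]
      rw [← hvdef]
      field_simp
      linear_combination (-8) * h0

end Laws

/-! ### Calculus of the curvature of a jet -/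

section CurvatureCalculus

variable {j : Jet 2} {Φ : STPoint → Val} {x : STPoint}

theorem fderiv_invMetric {g : Tensor} (hg : IsLorentzian g) (h : Tensor)
    (a b : Fin 4) : 𝒟 (fun g => invMetric g a b) g h =
      -∑ c, ∑ d, invMetric g a c * h c d * invMetric g d b := by
  have e0 : g + (0 : ℝ) • h = g := by simp
  have hd : ∀ a b, HasDerivAt (fun s : ℝ => invMetric (g + s • h) a b)
      (𝒟 (fun g => invMetric g a b) g h) 0 := fun a b => by
    refine HasFDerivAt.comp_hasDerivAt (l := fun g => invMetric g a b) (0 : ℝ)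
      (by rw [e0]; exact (contDiffAt_invMetric hg a b).diff.hasFDerivAt) ?_
    simpa using ((hasDerivAt_id (0 : ℝ)).smul_const h).const_add g
  have hl : ∀ a b, HasDerivAt (fun s : ℝ => (g + s • h) a b) (h a b) 0 := fun a b => by
    simpa using ((hasDerivAt_id (0 : ℝ)).mul_const (h a b)).const_add (g a b)
  have hdet : ∀ᶠ s : ℝ in 𝓝 0, (of (g + s • h)).det ≠ 0 := by
    have hc : ContinuousAt (fun s : ℝ => (of (g + s • h)).det) 0 :=
      (contDiff_det.continuous.comp (by fun_prop : Continuous fun s : ℝ => g + s • h)).continuousAt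
    exact hc.eventually_ne (by simpa using hg.det_neg.ne)
  have key : ∀ e, ∑ c, (𝒟 (fun g => invMetric g a c) g h * g c e +
      invMetric g a c * h c e) = 0 := by
    intro e
    have h1 : HasDerivAt (fun s : ℝ => ∑ c, invMetric (g + s • h) a c * (g + s • h) c e)
        (∑ c, (𝒟 (fun g => invMetric g a c) g h * g c e + invMetric g a c * h c e)) 0 := by
      refine HasDerivAt.fun_sum fun c _ => ?_
      have := (hd a c).fun_mul (hl c e)
      rwa [e0] at this
    refine h1.unique ((hasDerivAt_const (0 : ℝ) (if a = e then (1 : ℝ) else 0)).congr_of_eventuallyEq ?_)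
    filter_upwards [hdet] with s hs
    have := congrFun (congrFun (nonsing_inv_mul _ hs.isUnit) a) e
    rwa [mul_apply, Matrix.one_apply] at this
  have h2 : ∑ e, (∑ c, (𝒟 (fun g => invMetric g a c) g h * g c e +
      invMetric g a c * h c e)) * invMetric g e b = 0 := by simp [key]
  simp only [sum_add_distrib, add_mul, sum_mul] at h2
  rw [sum_comm] at h2
  simp only [mul_assoc, ← mul_sum, sum_mul_invMetric hg] at h2
  simp only [mul_ite, mul_one, mul_zero, Finset.sum_ite_eq', Finset.mem_univ, if_true] at h2
  rw [sum_comm]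
  simp only [mul_assoc]
  linarith

theorem fderiv_sqrtNegDet {g : Tensor} (hg : IsLorentzian g) (h : Tensor) : 𝒟 sqrtNegDet g h =
      1 / 2 * sqrtNegDet g * ∑ a, ∑ b, invMetric g a b * h b a := by
  have e0 : g + (0 : ℝ) • h = g := by simp
  have hd : HasDerivAt (fun s : ℝ => sqrtNegDet (g + s • h)) (𝒟 sqrtNegDet g h) 0 := by
    refine HasFDerivAt.comp_hasDerivAt (l := sqrtNegDet) (0 : ℝ)
      (by rw [e0]; exact (contDiffAt_sqrtNegDet hg).diff.hasFDerivAt) ?_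
    simpa using ((hasDerivAt_id (0 : ℝ)).smul_const h).const_add g
  set D := (of g).det
  set M := (of g)⁻¹ * of h
  have hdet : ∀ s : ℝ, (of (g + s • h)).det = D * (1 + s • M).det := by
    intro s
    rw [← det_mul, mul_add, Matrix.mul_smul, ← Matrix.mul_assoc,
      mul_nonsing_inv _ hg.isUnit_det, mul_one, one_mul]
    rfl
  have h1 : HasDerivAt (fun s : ℝ => (1 + s • M).det) M.trace 0 := by
    have hexp := fun r : ℝ => Matrix.det_one_add_smul r M
    set P := (Matrix.det (1 + (Polynomial.X : Polynomial ℝ) • M.map Polynomial.C)).divX.divX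
    have := (((hasDerivAt_id (0 : ℝ)).const_mul M.trace).const_add 1).add
      ((P.hasDerivAt 0).mul (hasDerivAt_pow 2 (0 : ℝ)))
    refine (this.congr_of_eventuallyEq (.of_forall hexp)).congr_deriv ?_
    simp
  have hneg : 0 < -D := neg_pos.2 hg.det_neg
  have h2 : HasDerivAt (fun s : ℝ => sqrtNegDet (g + s • h))
      (-(D * M.trace) / (2 * √(-D))) 0 := by
    have h3 : HasDerivAt (fun s : ℝ => -(D * (1 + s • M).det)) (-(D * M.trace)) 0 :=
      (h1.const_mul D).neg
    have h4 := h3.sqrt (by rw [zero_smul, add_zero, Matrix.det_one, mul_one]; exact hneg.ne')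
    simp only [sqrtNegDet, hdet]
    simpa using h4
  rw [hd.unique h2]
  have htr : M.trace = ∑ a, ∑ b, invMetric g a b * h b a := by
    simp [M, Matrix.trace, mul_apply, invMetric]
  have hs : sqrtNegDet g = √(-D) := rfl
  rw [← htr, hs]
  have hsq := Real.sq_sqrt hneg.le
  field_simp
  rw [hsq]
  ring

theorem contDiff_jdg (α μ ν : Fin 4) : Smooth fun j : Jet 2 => jdg j α μ ν := by
  unfold jdg; fun_prop

theorem contDiff_jddg (α β μ ν : Fin 4) : Smooth fun j : Jet 2 => jddg j α β μ ν := by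
  unfold jddg; fun_prop

theorem contDiff_jdphi (α : Fin 4) : Smooth fun j : Jet 2 => jdphi j α := by unfold jdphi; fun_prop

theorem contDiff_jddphi (α β : Fin 4) : Smooth fun j : Jet 2 => jddphi j α β := by
  unfold jddphi; fun_prop

theorem contDiff_jg : Smooth (jg : Jet 2 → Tensor) := by
  refine contDiff_pi.2 fun μ => contDiff_pi.2 fun ν => ?_
  unfold jg; fun_prop

section JetFunctions

variable (hj : IsLorentzian (jg j))
include hj

theorem contDiffAt_jinv (μ ν : Fin 4) : SmoothAt (fun j : Jet 2 => jinv j μ ν) j :=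
  ContDiffAt.comp (g := fun g => invMetric g μ ν) j (contDiffAt_invMetric hj μ ν)
    contDiff_jg.contDiffAt

theorem contDiffAt_jdinv (ρ μ ν : Fin 4) : SmoothAt (fun j : Jet 2 => jdinv j ρ μ ν) j :=
  (ContDiffAt.sum fun a _ => ContDiffAt.sum fun b _ => ((contDiffAt_jinv hj μ a).mul
    (contDiff_jdg ρ a b).contDiffAt).mul (contDiffAt_jinv hj b ν)).neg

theorem contDiffAt_christoffel (μ α β : Fin 4) :
    SmoothAt (fun j : Jet 2 => christoffel j μ α β) j :=
  contDiffAt_const.mul (ContDiffAt.sum fun σ _ => (contDiffAt_jinv hj μ σ).mul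
    (((contDiff_jdg α σ β).add (contDiff_jdg β σ α)).sub (contDiff_jdg σ α β)).contDiffAt)

theorem contDiffAt_dchristoffel (ρ μ α β : Fin 4) :
    SmoothAt (fun j : Jet 2 => dchristoffel j ρ μ α β) j :=
  contDiffAt_const.mul (ContDiffAt.sum fun σ _ => ((contDiffAt_jdinv hj ρ μ σ).mul
    (((contDiff_jdg α σ β).add (contDiff_jdg β σ α)).sub (contDiff_jdg σ α β)).contDiffAt).add
    ((contDiffAt_jinv hj μ σ).mul (((contDiff_jddg ρ α σ β).add (contDiff_jddg ρ β σ α)).sub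
      (contDiff_jddg ρ σ α β)).contDiffAt))

theorem contDiffAt_ricci (α β : Fin 4) : SmoothAt (fun j : Jet 2 => ricci j α β) j :=
  (ContDiffAt.sum fun μ _ => (contDiffAt_dchristoffel hj μ μ α β).sub
    (contDiffAt_dchristoffel hj β μ μ α)).add
  (ContDiffAt.sum fun μ _ => ContDiffAt.sum fun ν _ =>
    ((contDiffAt_christoffel hj μ μ ν).mul (contDiffAt_christoffel hj ν α β)).sub
      ((contDiffAt_christoffel hj μ β ν).mul (contDiffAt_christoffel hj ν μ α)))

theorem contDiffAt_scalarCurv : SmoothAt scalarCurv j :=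
  ContDiffAt.sum fun α _ => ContDiffAt.sum fun β _ =>
    (contDiffAt_jinv hj α β).mul (contDiffAt_ricci hj α β)

theorem contDiffAt_gradSq : SmoothAt gradSq j :=
  ContDiffAt.sum fun c _ => ContDiffAt.sum fun d _ => ((contDiffAt_jinv hj c d).mul
    (contDiff_jdphi c).contDiffAt).mul (contDiff_jdphi d).contDiffAt

theorem contDiffAt_sqrt_jg : SmoothAt (fun j : Jet 2 => sqrtNegDet (jg j)) j :=
  ContDiffAt.comp (g := sqrtNegDet) j (contDiffAt_sqrtNegDet hj) contDiff_jg.contDiffAt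

theorem contDiffAt_esLagrangian : SmoothAt esLagrangian j := (contDiffAt_sqrt_jg hj).mul
    ((contDiffAt_scalarCurv hj).sub (contDiffAt_const.mul (contDiffAt_gradSq hj)))

theorem contDiffAt_esOperator : SmoothAt esOperator j := by
  have hjg : ∀ a b, SmoothAt (fun j : Jet 2 => jg j a b) j := fun a b =>
    (contDiff_pi.1 (contDiff_pi.1 contDiff_jg a) b).contDiffAt
  refine ContDiffAt.prodMk (contDiffAt_pi.2 fun a => contDiffAt_pi.2 fun b => ?_) ?_
  · exact ((contDiffAt_ricci hj a b).sub
      ((contDiffAt_const.mul (contDiffAt_scalarCurv hj)).mul (hjg a b))).sub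
      (contDiffAt_const.mul (((contDiff_jdphi a).mul (contDiff_jdphi b)).contDiffAt.sub
        ((contDiffAt_const.mul (hjg a b)).mul (contDiffAt_gradSq hj))))
  · exact contDiffAt_const.mul (ContDiffAt.sum fun a _ => ContDiffAt.sum fun b _ =>
      (contDiffAt_jinv hj a b).mul ((contDiff_jddphi a b).contDiffAt.sub
        (ContDiffAt.sum fun c _ => (contDiffAt_christoffel hj c a b).mul
          (contDiff_jdphi c).contDiffAt)))

end JetFunctions

/-! #### Jets of metrics -/

/-- The symmetries of the jet of a metric. -/
structure IsMetricJet (j : Jet 2) : Prop where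
  lorentzian : IsLorentzian (jg j)
  d_symm : ∀ α μ ν, jdg j α μ ν = jdg j α ν μ
  dd_symm : ∀ α β μ ν, jddg j α β μ ν = jddg j α β ν μ
  dd_comm : ∀ α β μ ν, jddg j α β μ ν = jddg j β α μ ν

theorem jddg_eq (hΦ : SmoothAt Φ x) (α β μ ν : Fin 4) :
    jddg (jet 2 Φ x) α β μ ν = (pd α (pd β Φ) x).1 μ ν := by
  simp [jddg, jet, pdI_idx2 _ _ hΦ]

theorem jdphi_eq (α : Fin 4) : jdphi (jet 2 Φ x) α = (pd α Φ x).2 := by simp [jdphi, jet, pdI_idx1]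

theorem jddphi_eq (hΦ : SmoothAt Φ x) (α β : Fin 4) :
    jddphi (jet 2 Φ x) α β = (pd α (pd β Φ) x).2 := by
  simp [jddphi, jet, pdI_idx2 _ _ hΦ]

/-- The components of a value as continuous linear forms. -/
def comp (μ ν : Fin 4) : Val →L[ℝ] ℝ :=
  ((ContinuousLinearMap.proj (R := ℝ) (φ := fun _ : Fin 4 => ℝ) ν).comp
      (ContinuousLinearMap.proj (R := ℝ) (φ := fun _ : Fin 4 => Fin 4 → ℝ) μ)).comp
      (ContinuousLinearMap.fst ℝ (Tensor) ℝ)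

@[simp] theorem comp_apply (μ ν : Fin 4) (v : Val) : comp μ ν v = v.1 μ ν := rfl

theorem pd_component {F : STPoint → Val} (hF : DiffAt F x) (ρ μ ν : Fin 4) :
    pd ρ (fun y => (F y).1 μ ν) x = (pd ρ F x).1 μ ν := pd_clm (comp μ ν) hF

theorem isMetricJet_jet (hΦ : SmoothAt Φ x) (hL : ∀ᶠ y in 𝓝 x, IsLorentzian (Φ y).1) :
    IsMetricJet (jet 2 Φ x) := by
  have hsm : ∀ᶠ y in 𝓝 x, DiffAt Φ y :=
    ((hΦ.of_le two_le_infty).eventually (by simp)).mono fun y hy => hy.diff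
  have h1 : ∀ᶠ y in 𝓝 x, ∀ α μ ν, (pd α Φ y).1 μ ν = (pd α Φ y).1 ν μ := by
    filter_upwards [hL.eventually_nhds, hsm] with y hy hs α μ ν
    rw [← pd_component hs, ← pd_component hs]
    exact pd_congr (hy.mono fun z hz => hz.symm μ ν)
  refine ⟨by rw [jg_eq]; exact hL.self_of_nhds, fun α μ ν => ?_, fun α β μ ν => ?_,
    fun α β μ ν => ?_⟩
  · rw [jdg_eq, jdg_eq, h1.self_of_nhds]
  · rw [jddg_eq hΦ, jddg_eq hΦ, ← pd_component (contDiffAt_pd hΦ).diff,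
      ← pd_component (contDiffAt_pd hΦ).diff]
    exact pd_congr (h1.mono fun z hz => hz β μ ν)
  · rw [jddg_eq hΦ, jddg_eq hΦ, pd_comm hΦ]

theorem IsLorentzian.lower_christoffel (hj : IsLorentzian (jg j)) (a α β : Fin 4) : ∑ ν, jg j a ν * christoffel j ν α β =
    1 / 2 * (jdg j α a β + jdg j β a α - jdg j a α β) := by
  have h := fun σ => sum_mul_invMetric hj a σ
  calc ∑ ν, jg j a ν * christoffel j ν α β = 1 / 2 * ∑ σ, (∑ ν, jg j a ν * jinv j ν σ) *
        (jdg j α σ β + jdg j β σ α - jdg j σ α β) := by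
        simp only [christoffel, mul_sum, sum_mul]
        rw [sum_comm]
        exact sum_congr₂
    _ = _ := by
        simp only [jinv, h]
        simp

namespace IsMetricJet

variable (hj : IsMetricJet j)
include hj

theorem jinv_symm (μ ν : Fin 4) : jinv j μ ν = jinv j ν μ := invMetric_symm hj.lorentzian.symm μ ν

theorem christoffel_symm (μ α β : Fin 4) : christoffel j μ α β = christoffel j μ β α := by
  simp only [christoffel, hj.d_symm _ α β]
  congr 1
  exact sum_congr rfl fun σ _ => by ring

theorem dchristoffel_symm (ρ μ α β : Fin 4) : dchristoffel j ρ μ α β = dchristoffel j ρ μ β α := by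
  simp only [dchristoffel, hj.d_symm _ α β, hj.dd_symm _ _ α β]
  congr 1
  exact sum_congr rfl fun σ _ => by ring

theorem jdinv_symm (ρ μ ν : Fin 4) : jdinv j ρ μ ν = jdinv j ρ ν μ := by
  simp only [jdinv]
  rw [sum_comm]
  congr 1
  refine sum_congr₂ fun a b => ?_
  rw [hj.jinv_symm μ b, hj.jinv_symm a ν, hj.d_symm ρ b a]
  ring

theorem trace_dchristoffel (β α : Fin 4) : ∑ μ, dchristoffel j β μ μ α =
    1 / 2 * ∑ μ, ∑ σ, (jdinv j β μ σ * jdg j α μ σ + jinv j μ σ * jddg j β α μ σ) := by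
  simp only [dchristoffel, ← mul_sum]
  congr 1
  have h : ∀ A : Tensor, (∑ μ, ∑ σ, A μ σ) = 1 / 2 * ∑ μ, ∑ σ, (A μ σ + A σ μ) := by
    intro A
    simp only [sum_add_distrib]
    rw [sum_comm (f := fun μ σ => A σ μ)]
    ring
  rw [h, h fun μ σ => jdinv j β μ σ * jdg j α μ σ + jinv j μ σ * jddg j β α μ σ]
  congr 1
  refine sum_congr₂ fun μ σ => ?_
  rw [hj.jdinv_symm β σ μ, hj.jinv_symm σ μ, hj.d_symm μ σ α, hj.d_symm σ μ α,
    hj.d_symm α σ μ, hj.dd_symm β μ σ α, hj.dd_symm β σ μ α, hj.dd_symm β α σ μ]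
  ring

theorem ricci_symm (α β : Fin 4) : ricci j α β = ricci j β α := by
  have h1 : ∑ μ, dchristoffel j β μ μ α = ∑ μ, dchristoffel j α μ μ β := by
    rw [hj.trace_dchristoffel, hj.trace_dchristoffel]
    congr 1
    have e : ∀ β α, ∑ μ, ∑ σ, jdinv j β μ σ * jdg j α μ σ =
        -∑ μ, ∑ σ, ∑ a, ∑ b, jinv j μ a * jdg j β a b * jinv j b σ * jdg j α μ σ := by
      intro β α
      simp only [jdinv, neg_mul, sum_mul, sum_neg_distrib]
    have e' : ∑ μ, ∑ σ, jdinv j β μ σ * jdg j α μ σ = ∑ μ, ∑ σ, jdinv j α μ σ * jdg j β μ σ := by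
      rw [e, e]
      congr 1
      calc ∑ μ, ∑ σ, ∑ a, ∑ b, jinv j μ a * jdg j β a b * jinv j b σ * jdg j α μ σ
          = ∑ μ, ∑ a, ∑ σ, ∑ b, jinv j μ a * jdg j β a b * jinv j b σ * jdg j α μ σ :=
            sum_congr rfl fun _ _ => sum_comm
        _ = ∑ a, ∑ μ, ∑ b, ∑ σ, jinv j μ a * jdg j β a b * jinv j b σ * jdg j α μ σ := by
            rw [sum_comm]
            exact sum_congr₂ fun _ _ => sum_comm
        _ = ∑ a, ∑ b, ∑ μ, ∑ σ, jinv j μ a * jdg j β a b * jinv j b σ * jdg j α μ σ :=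
            sum_congr rfl fun _ _ => sum_comm
        _ = _ := by
            refine sum_congr₂ fun a b => sum_congr₂ fun μ σ => ?_
            rw [hj.jinv_symm μ a, hj.jinv_symm b σ]
            ring
    simp only [sum_add_distrib, e', hj.dd_comm β α]
  have h2 : ∑ μ, ∑ ν, christoffel j μ β ν * christoffel j ν μ α =
      ∑ μ, ∑ ν, christoffel j μ α ν * christoffel j ν μ β := by
    rw [sum_comm]
    refine sum_congr₂ fun μ ν => ?_
    rw [hj.christoffel_symm ν β μ, hj.christoffel_symm μ ν α]
    ring
  simp only [ricci, sum_sub_distrib, h1, h2, hj.christoffel_symm _ α β,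
    hj.dchristoffel_symm _ _ α β]

theorem lower_christoffel (a α β : Fin 4) : ∑ ν, jg j a ν * christoffel j ν α β =
    1 / 2 * (jdg j α a β + jdg j β a α - jdg j a α β) := hj.lorentzian.lower_christoffel a α β

theorem jdg_eq_christoffel (μ a b : Fin 4) : jdg j μ a b =
    ∑ ν, jg j a ν * christoffel j ν μ b + ∑ ν, jg j b ν * christoffel j ν μ a := by
  rw [hj.lower_christoffel, hj.lower_christoffel, hj.d_symm b, hj.d_symm μ b, hj.d_symm a μ b]
  ring

theorem jdinv_eq_christoffel (μ a b : Fin 4) : jdinv j μ a b =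
    -∑ ν, (christoffel j a μ ν * jinv j ν b + christoffel j b μ ν * jinv j a ν) := by
  have h1 := fun ν => sum_invMetric_mul hj.lorentzian a ν
  have h2 := fun ν => sum_invMetric_mul hj.lorentzian b ν
  simp only [jdinv, hj.jdg_eq_christoffel]
  congr 1
  have e1 : ∑ c, ∑ d, jinv j a c * (∑ ν, jg j c ν * christoffel j ν μ d) * jinv j d b =
      ∑ d, christoffel j a μ d * jinv j d b := by
    rw [sum_comm]
    refine sum_congr rfl fun d _ => ?_
    calc ∑ c, jinv j a c * (∑ ν, jg j c ν * christoffel j ν μ d) * jinv j d b =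
        ∑ ν, (∑ c, jinv j a c * jg j c ν) * christoffel j ν μ d * jinv j d b := by
          simp only [mul_sum, sum_mul]
          rw [sum_comm]
          exact sum_congr₂
      _ = _ := by simp only [jinv, h1]; simp
  have e2 : ∑ c, ∑ d, jinv j a c * (∑ ν, jg j d ν * christoffel j ν μ c) * jinv j d b =
      ∑ c, christoffel j b μ c * jinv j a c := by
    refine sum_congr rfl fun c _ => ?_
    calc ∑ d, jinv j a c * (∑ ν, jg j d ν * christoffel j ν μ c) * jinv j d b =
        ∑ ν, (∑ d, jinv j b d * jg j d ν) * christoffel j ν μ c * jinv j a c := by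
          simp only [mul_sum, sum_mul]
          rw [sum_comm]
          refine sum_congr₂ fun _ d => ?_
          rw [hj.jinv_symm d b]
          ring
      _ = _ := by simp only [jinv, h2]; simp
  simp only [mul_add, add_mul, sum_add_distrib, e1, e2]

theorem trace_jdg (μ : Fin 4) :
    1 / 2 * ∑ a, ∑ b, jinv j a b * jdg j μ b a = ∑ ν, christoffel j ν ν μ := by
  have h1 := fun a ν => sum_invMetric_mul hj.lorentzian a ν
  have e1 : ∀ a, ∑ b, jinv j a b * ∑ ν, jg j b ν * christoffel j ν μ a = christoffel j a μ a := by
    intro a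
    calc ∑ b, jinv j a b * ∑ ν, jg j b ν * christoffel j ν μ a =
        ∑ ν, (∑ b, jinv j a b * jg j b ν) * christoffel j ν μ a := by
          simp only [mul_sum, sum_mul]
          rw [sum_comm]
          exact sum_congr₂
      _ = _ := by simp only [jinv, h1]; simp
  have e2 : ∑ a, ∑ b, jinv j a b * ∑ ν, jg j a ν * christoffel j ν μ b =
      ∑ a, christoffel j a μ a := by
    rw [sum_comm, ← sum_congr rfl fun a _ => e1 a]
    exact sum_congr₂ fun b a => by rw [hj.jinv_symm a b]
  simp only [hj.jdg_eq_christoffel, mul_add, sum_add_distrib, e1, e2]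
  simp only [hj.christoffel_symm _ μ]
  ring

end IsMetricJet

/-! #### Derivatives along a field -/

theorem pd_jdg (hΦ : SmoothAt Φ x) (ρ α μ ν : Fin 4) :
    pd ρ (fun y => jdg (jet 2 Φ y) α μ ν) x = jddg (jet 2 Φ x) ρ α μ ν := by
  simp only [jdg_eq, jddg_eq hΦ]
  exact pd_component (contDiffAt_pd hΦ).diff ρ μ ν

theorem pd_jinv (hΦ : SmoothAt Φ x) (hL : IsLorentzian (Φ x).1) (ρ a b : Fin 4) :
    pd ρ (fun y => jinv (jet 2 Φ y) a b) x = jdinv (jet 2 Φ x) ρ a b := by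
  simp only [jdinv, jinv, jg_eq, jdg_eq]
  rw [pd_comp (a := fun g => invMetric g a b) (f := fun y => (Φ y).1)
    (contDiffAt_invMetric hL a b).diff hΦ.fst.diff, fderiv_invMetric hL,
    pd_fst hΦ.diff]

theorem contDiffAt_jet_comp {X : Type*} [NormedAddCommGroup X] [NormedSpace ℝ X] {F : Jet 2 → X}
    (hF : SmoothAt F (jet 2 Φ x)) (hΦ : SmoothAt Φ x) :
    SmoothAt (fun y => F (jet 2 Φ y)) x :=
  ContDiffAt.comp (g := F) x hF (contDiffAt_jet hΦ)

theorem pd_christoffel (hΦ : SmoothAt Φ x) (hL : IsLorentzian (Φ x).1) (ρ μ α β : Fin 4) :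
    pd ρ (fun y => christoffel (jet 2 Φ y) μ α β) x = dchristoffel (jet 2 Φ x) ρ μ α β := by
  have hL' : IsLorentzian (jg (jet 2 Φ x)) := by rwa [jg_eq]
  have h1 : ∀ σ, DiffAt (fun y => jinv (jet 2 Φ y) μ σ) x := fun σ =>
    ContDiffAt.diff (contDiffAt_jet_comp (contDiffAt_jinv hL' μ σ) hΦ)
  have h2 : ∀ α μ ν, DiffAt (fun y => jdg (jet 2 Φ y) α μ ν) x := fun α μ ν =>
    ContDiffAt.diff (contDiffAt_jet_comp (contDiff_jdg α μ ν).contDiffAt hΦ)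
  have h3 : ∀ σ, DiffAt (fun y => jdg (jet 2 Φ y) α σ β + jdg (jet 2 Φ y) β σ α -
      jdg (jet 2 Φ y) σ α β) x := fun σ => ((h2 _ _ _).add (h2 _ _ _)).sub (h2 _ _ _)
  have h4 : ∀ σ, DiffAt (fun y => jinv (jet 2 Φ y) μ σ * (jdg (jet 2 Φ y) α σ β +
      jdg (jet 2 Φ y) β σ α - jdg (jet 2 Φ y) σ α β)) x := fun σ => (h1 σ).mul (h3 σ)
  simp only [christoffel, dchristoffel]
  rw [pd_const_mul _ (DifferentiableAt.fun_sum fun σ _ => h4 σ), pd_sum _ fun σ _ => h4 σ]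
  congr 1
  refine sum_congr rfl fun σ _ => ?_
  rw [pd_mul (h1 σ) (h3 σ), pd_sub (f := fun y => jdg (jet 2 Φ y) α σ β + jdg (jet 2 Φ y) β σ α)
      ((h2 α σ β).add (h2 β σ α)) (h2 σ α β),
    pd_add (h2 α σ β) (h2 β σ α), pd_jinv hΦ hL, pd_jdg hΦ, pd_jdg hΦ, pd_jdg hΦ]
  ring

end CurvatureCalculus

/-! ### The variation of the Einstein-scalar action -/

section Palatini

variable {ι : Type*} [Fintype ι]

theorem sum_four_swap₁₂ (F : ι → ι → ι → ι → ℝ) :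
    ∑ a, ∑ b, ∑ c, ∑ d, F a b c d = ∑ a, ∑ b, ∑ c, ∑ d, F b a c d := sum_comm

theorem sum_four_swap₂₃ (F : ι → ι → ι → ι → ℝ) :
    ∑ a, ∑ b, ∑ c, ∑ d, F a b c d = ∑ a, ∑ b, ∑ c, ∑ d, F a c b d :=
  sum_congr rfl fun _ _ => sum_comm

theorem sum_four_swap₃₄ (F : ι → ι → ι → ι → ℝ) :
    ∑ a, ∑ b, ∑ c, ∑ d, F a b c d = ∑ a, ∑ b, ∑ c, ∑ d, F a b d c :=
  sum_congr₂ fun _ _ => sum_comm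

/-- The contracted variation of the Ricci tensor is a divergence. -/
theorem contracted_palatini {W : ι → ι → ℝ} {G C dW : ι → ι → ι → ℝ}
    (dC : ι → ι → ι → ι → ℝ) (hW : ∀ a b, W a b = W b a) (hG : ∀ m a b, G m a b = G m b a)
    (hC : ∀ m a b, C m a b = C m b a)
    (hdW : ∀ m a b, dW m a b =
      -(∑ n, (G a m n * W n b + G b m n * W a n)) + (∑ n, G n n m) * W a b) :
    ∑ m, ((∑ a, ∑ b, (dW m a b * C m a b + W a b * dC m m a b)) -
      ∑ a, (dW m a m * (∑ n, C n n a) + W a m * ∑ n, dC m n n a)) =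
    ∑ a, ∑ b, W a b * (∑ m, (dC m m a b - dC b m m a) +
      ∑ m, ∑ n, ((C m m n * G n a b + G m m n * C n a b) -
        (C m b n * G n m a + G m b n * C n m a))) := by
  have e1 : ∑ m, ∑ a, ∑ b, dW m a b * C m a b = ∑ a, ∑ b, ∑ m, ∑ n, W a b * (G m m n * C n a b) -
      ∑ a, ∑ b, ∑ m, ∑ n, W a b * (C m b n * G n m a) -
      ∑ a, ∑ b, ∑ m, ∑ n, W a b * (G m b n * C n m a) := by
    have h : ∑ m, ∑ a, ∑ b, dW m a b * C m a b = ∑ m, ∑ a, ∑ b, ∑ n, G n n m * W a b * C m a b -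
        ∑ m, ∑ a, ∑ b, ∑ n, G a m n * W n b * C m a b -
        ∑ m, ∑ a, ∑ b, ∑ n, G b m n * W a n * C m a b := by
      simp only [hdW, ← sum_sub_distrib]
      refine sum_congr₂ fun m a => sum_congr rfl fun b _ => ?_
      rw [add_mul, neg_mul, sum_mul, sum_mul, sum_mul, neg_add_eq_sub, ← sum_sub_distrib]
      exact sum_congr rfl fun n _ => by ring
    rw [h]
    congr 1
    congr 1
    · rw [sum_four_swap₁₂, sum_four_swap₂₃, sum_four_swap₃₄]
      exact sum_congr₂ fun _ _ => sum_congr₂ fun _ _ => by ring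
    · rw [sum_four_swap₃₄, sum_four_swap₂₃, sum_four_swap₁₂, sum_four_swap₃₄, sum_four_swap₂₃]
      refine sum_congr₂ fun a b => sum_congr₂ fun m n => ?_
      rw [hC m b n]
      ring
    · rw [sum_four_swap₁₂, sum_four_swap₂₃, sum_four_swap₃₄, sum_four_swap₂₃]
      refine sum_congr₂ fun a b => sum_congr₂ fun m n => ?_
      rw [hC n m a, hG m b n]
      ring
  have e2 : ∑ m, ∑ a, dW m a m * (∑ n, C n n a) =
      -∑ a, ∑ b, ∑ m, ∑ n, W a b * (C m m n * G n a b) := by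
    have h0 : ∑ m, ∑ a, (∑ n, G n n m) * W a m * (∑ n, C n n a) =
        ∑ m, ∑ a, (∑ n, G m m n * W a n) * (∑ n, C n n a) := by
      rw [sum_comm, sum_comm (f := fun m a => (∑ n, G m m n * W a n) * _)]
      refine sum_congr rfl fun a _ => ?_
      rw [← sum_mul, ← sum_mul]
      congr 1
      simp only [sum_mul]
      exact sum_comm
    have h1 : ∑ m, ∑ a, dW m a m * (∑ n, C n n a) =
        -∑ m, ∑ a, (∑ n, G a m n * W n m) * (∑ n, C n n a) := by
      have : ∀ m a, dW m a m * (∑ n, C n n a) = (∑ n, G n n m) * W a m * (∑ n, C n n a) -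
          (∑ n, G m m n * W a n) * (∑ n, C n n a) - (∑ n, G a m n * W n m) * (∑ n, C n n a) := by
        intro m a
        rw [hdW, sum_add_distrib]
        ring
      simp only [this, sum_sub_distrib, h0, sub_self, zero_sub]
    rw [h1]
    congr 1
    simp only [Finset.sum_mul_sum]
    rw [sum_four_swap₂₃, sum_four_swap₃₄]
    refine sum_congr₂ fun a b => sum_congr₂ fun m n => ?_
    rw [hW b a]
    ring
  have e3 : ∑ m, ∑ a, ∑ b, W a b * dC m m a b = ∑ a, ∑ b, ∑ m, W a b * dC m m a b := by
    rw [sum_comm]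
    exact sum_congr rfl fun _ _ => sum_comm
  have e4 : ∑ m, ∑ a, W a m * ∑ n, dC m n n a = ∑ a, ∑ b, ∑ m, W a b * dC b m m a := by
    rw [sum_comm]
    simp only [mul_sum]
  simp only [mul_sum] at e2 e4
  simp only [sum_sub_distrib, sum_add_distrib, mul_add, mul_sub, mul_sum, e1, e2, e3, e4]
  ring
end Palatini

section Variation

variable {Φ η : STPoint → Val} {x : STPoint}

/-- The metric part of a jet as a linear map. -/
def jgL : Jet 2 →L[ℝ] (Tensor) := (ContinuousLinearMap.fst ℝ (Tensor) ℝ).comp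
    (ContinuousLinearMap.proj (R := ℝ) (φ := fun _ : JetIdx 2 => Val) (idx0 2))

theorem hasDerivAt_line {V X : Type*} [NormedAddCommGroup V] [NormedSpace ℝ V]
    [NormedAddCommGroup X] [NormedSpace ℝ X] {F : V → X} {v : V} (hF : DiffAt F v)
    (w : V) : HasDerivAt (fun s : ℝ => F (v + s • w)) (𝒟 F v w) 0 := by
  have e0 : v + (0 : ℝ) • w = v := by simp
  refine HasFDerivAt.comp_hasDerivAt (l := F) (0 : ℝ) (by rw [e0]; exact hF.hasFDerivAt) ?_
  simpa using ((hasDerivAt_id (0 : ℝ)).smul_const w).const_add v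

theorem fderiv_jinv {j : Jet 2} (hj : IsLorentzian (jg j)) (k : Jet 2) (a b : Fin 4) :
    𝒟 (fun j : Jet 2 => jinv j a b) j k = -∑ c, ∑ d, jinv j a c * jg k c d * jinv j d b := by
  have h : HasFDerivAt (fun j : Jet 2 => jinv j a b) _ j :=
    HasFDerivAt.comp (g := fun g => invMetric g a b) j
    (contDiffAt_invMetric hj a b).diff.hasFDerivAt jgL.hasFDerivAt
  rw [h.fderiv]
  exact fderiv_invMetric hj _ a b

theorem fderiv_sqrt_jg {j : Jet 2} (hj : IsLorentzian (jg j)) (k : Jet 2) :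
    𝒟 (fun j : Jet 2 => sqrtNegDet (jg j)) j k =
      1 / 2 * sqrtNegDet (jg j) * ∑ a, ∑ b, jinv j a b * jg k b a := by
  have h : HasFDerivAt (fun j : Jet 2 => sqrtNegDet (jg j)) _ j :=
    HasFDerivAt.comp (g := sqrtNegDet) j
    (contDiffAt_sqrtNegDet hj).diff.hasFDerivAt jgL.hasFDerivAt
  rw [h.fderiv]
  exact fderiv_sqrtNegDet hj _

/-- `√(-g) g^{ab}`. -/
def jden (j : Jet 2) (a b : Fin 4) : ℝ := sqrtNegDet (jg j) * jinv j a b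

theorem contDiffAt_jden {j : Jet 2} (hj : IsLorentzian (jg j)) (a b : Fin 4) :
    SmoothAt (fun j : Jet 2 => jden j a b) j :=
  (contDiffAt_sqrt_jg hj).mul (contDiffAt_jinv hj a b)

theorem esLagrangian_eq (j : Jet 2) : esLagrangian j =
    ∑ a, ∑ b, jden j a b * (ricci j a b - 2 * (jdphi j a * jdphi j b)) := by
  simp only [esLagrangian, scalarCurv, gradSq, jden, mul_sum, ← sum_sub_distrib]
  exact sum_congr₂

theorem fderiv_jden {j : Jet 2} (hj : IsLorentzian (jg j)) (k : Jet 2) (a b : Fin 4) :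
    𝒟 (fun j : Jet 2 => jden j a b) j k =
      sqrtNegDet (jg j) * (-∑ c, ∑ d, jinv j a c * jg k c d * jinv j d b) +
      1 / 2 * sqrtNegDet (jg j) * (∑ a, ∑ b, jinv j a b * jg k b a) * jinv j a b := by
  unfold jden
  rw [fderiv_fun_mul (contDiffAt_sqrt_jg hj).diff
    (contDiffAt_jinv hj a b).diff]
  simp only [ContinuousLinearMap.add_apply, ContinuousLinearMap.smul_apply, fderiv_jinv hj,
    fderiv_sqrt_jg hj, smul_eq_mul]
  ring

theorem pd_jden (hΦ : SmoothAt Φ x) (hj : IsMetricJet (jet 2 Φ x)) (m a b : Fin 4) :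
    pd m (fun y => jden (jet 2 Φ y) a b) x =
      -(∑ n, (christoffel (jet 2 Φ x) a m n * jden (jet 2 Φ x) n b +
        christoffel (jet 2 Φ x) b m n * jden (jet 2 Φ x) a n)) +
      (∑ n, christoffel (jet 2 Φ x) n n m) * jden (jet 2 Φ x) a b := by
  have hL : IsLorentzian (Φ x).1 := by rw [← jg_eq]; exact hj.lorentzian
  have h1 : pd m (fun y => sqrtNegDet (jg (jet 2 Φ y))) x =
      sqrtNegDet (jg (jet 2 Φ x)) * ∑ n, christoffel (jet 2 Φ x) n n m := by
    rw [← hj.trace_jdg]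
    simp only [jg_eq, jinv, jdg_eq]
    rw [pd_comp (a := sqrtNegDet) (f := fun y => (Φ y).1)
      (contDiffAt_sqrtNegDet hL).diff hΦ.fst.diff,
      fderiv_sqrtNegDet hL, pd_fst hΦ.diff]
    ring
  unfold jden
  rw [pd_mul (contDiffAt_jet_comp (contDiffAt_sqrt_jg hj.lorentzian) hΦ).diff
    (contDiffAt_jet_comp (contDiffAt_jinv hj.lorentzian a b) hΦ).diff, h1,
    pd_jinv hΦ hL, hj.jdinv_eq_christoffel, mul_neg, mul_sum]
  congr 1
  · congr 1
    exact sum_congr rfl fun n _ => by ring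
  · ring

/-- The variation of the Christoffel symbols. -/
def varChr (Φ η : STPoint → Val) (m a b : Fin 4) (y : STPoint) : ℝ :=
  𝒟 (fun j => christoffel j m a b) (jet 2 Φ y) (jet 2 η y)

theorem contDiffAt_varChr (hΦ : SmoothAt Φ x) (hL : IsLorentzian (Φ x).1)
    (hη : SmoothAt η x) (m a b : Fin 4) : SmoothAt (varChr Φ η m a b) x :=
  (contDiffAt_jet_comp (F := 𝒟 fun j : Jet 2 => christoffel j m a b)
    ((contDiffAt_christoffel (by rwa [jg_eq]) m a b).fderiv_right (by simp)) hΦ).clm_apply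
    (contDiffAt_jet hη)

/-- The divergence in the variation of the Lagrangian. -/
def current (Φ η : STPoint → Val) (m : Fin 4) (y : STPoint) : ℝ :=
  (∑ a, ∑ b, jden (jet 2 Φ y) a b * varChr Φ η m a b y) -
    (∑ a, jden (jet 2 Φ y) a m * ∑ n, varChr Φ η n n a y) -
    4 * ((∑ c, jden (jet 2 Φ y) c m * jdphi (jet 2 Φ y) c) * (η y).2)

theorem contDiffAt_current (hΦ : SmoothAt Φ x) (hL : IsLorentzian (Φ x).1)
    (hη : SmoothAt η x) (m : Fin 4) : SmoothAt (current Φ η m) x := by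
  have h1 := fun a b => contDiffAt_jet_comp (contDiffAt_jden (by rwa [jg_eq]) a b) hΦ
  have h2 := fun m a b => contDiffAt_varChr hΦ hL hη m a b
  have h3 := fun c => contDiffAt_jet_comp (contDiff_jdphi c).contDiffAt hΦ
  exact ((ContDiffAt.sum fun a _ => ContDiffAt.sum fun b _ => (h1 a b).mul (h2 m a b)).sub
    (ContDiffAt.sum fun a _ => (h1 a m).mul (ContDiffAt.sum fun n _ => h2 n n a))).sub
    (contDiffAt_const.mul ((ContDiffAt.sum fun c _ => (h1 c m).mul (h3 c)).mul hη.snd))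

section

variable (hΦ : ∀ᶠ y in 𝓝 x, SmoothAt Φ y) (hη : Smooth η)
  (hL : ∀ᶠ y in 𝓝 x, IsLorentzian (Φ y).1) (hs : ∀ y a b, (η y).1 a b = (η y).1 b a)
include hΦ hη hL hs

theorem eventually_isMetricJet :
    ∀ᶠ s : ℝ in 𝓝 0, IsMetricJet (jet 2 Φ x + s • jet 2 η x) ∧ ∀ ρ m a b,
      pd ρ (fun y => christoffel (jet 2 Φ y + s • jet 2 η y) m a b) x =
        dchristoffel (jet 2 Φ x + s • jet 2 η x) ρ m a b := by
  have hc : ContinuousAt (fun p : ℝ × STPoint => (Φ p.2).1 + p.1 • (η p.2).1) ((0 : ℝ), x) := by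
    have h1 : ContinuousAt (fun p : ℝ × STPoint => (Φ p.2).1) ((0 : ℝ), x) :=
      ContinuousAt.comp (g := fun y => (Φ y).1) (f := Prod.snd)
        hΦ.self_of_nhds.continuousAt.fst continuousAt_snd
    exact h1.add (continuousAt_fst.smul
      (hη.continuous.fst.comp continuous_snd).continuousAt)
  have h0 : (Φ x).1 + (0 : ℝ) • (η x).1 = (Φ x).1 := by simp
  have hev := hc.eventually (by
    change ∀ᶠ g in 𝓝 ((Φ x).1 + (0 : ℝ) • (η x).1), (∀ a b, g a b = g b a) → IsLorentzian g
    rw [h0]; exact hL.self_of_nhds.eventually)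
  have hL2 : ∀ᶠ p : ℝ × STPoint in 𝓝 ((0 : ℝ), x), IsLorentzian (Φ p.2).1 :=
    (continuous_snd.tendsto ((0 : ℝ), x)).eventually hL
  have hev2 := hev.and hL2
  rw [nhds_prod_eq] at hev2
  filter_upwards [hev2.curry] with s hs'
  have hsm : SmoothAt (fun y => Φ y + s • η y) x := hΦ.self_of_nhds.add (hη.contDiffAt.const_smul s)
  have hl : ∀ᶠ y in 𝓝 x, IsLorentzian (Φ y + s • η y).1 := by
    filter_upwards [hs'] with y hy
    refine hy.1 fun a b => ?_
    simp only [Pi.add_apply, Pi.smul_apply, hy.2.symm a b, hs y a b]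
  have hjet : ∀ᶠ y in 𝓝 x, jet 2 (fun y => Φ y + s • η y) y = jet 2 Φ y + s • jet 2 η y := by
    filter_upwards [hΦ] with y hy using jet_add_smul hy hη.contDiffAt s
  rw [← hjet.self_of_nhds]
  refine ⟨isMetricJet_jet hsm hl, fun ρ m a b => ?_⟩
  rw [← pd_christoffel hsm hl.self_of_nhds]
  exact pd_congr (hjet.mono fun y hy => by simp only [hy])

theorem varChr_symm (m a b : Fin 4) : varChr Φ η m a b x = varChr Φ η m b a x := by
  have hj : IsLorentzian (jg (jet 2 Φ x)) := by rw [jg_eq]; exact hL.self_of_nhds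
  have h := fun a b => hasDerivAt_line
    (contDiffAt_christoffel hj m a b).diff (jet 2 η x)
  refine (h a b).unique ((h b a).congr_of_eventuallyEq ?_)
  filter_upwards [eventually_isMetricJet hΦ hη hL hs] with s hs'
  exact hs'.1.christoffel_symm m a b

theorem hasDerivAt_dchristoffel (ρ m a b : Fin 4) :
    HasDerivAt (fun s : ℝ => dchristoffel (jet 2 Φ x + s • jet 2 η x) ρ m a b)
      (pd ρ (varChr Φ η m a b) x) 0 := by
  have hj : IsLorentzian (jg (jet 2 Φ x)) := by rw [jg_eq]; exact hL.self_of_nhds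
  set F : ℝ × STPoint → ℝ := fun p => christoffel (jet 2 Φ p.2 + p.1 • jet 2 η p.2) m a b
  have hinner : SmoothAt (fun p : ℝ × STPoint => jet 2 Φ p.2 + p.1 • jet 2 η p.2)
      ((0 : ℝ), x) :=
    (ContDiffAt.comp (g := jet 2 Φ) ((0 : ℝ), x) (contDiffAt_jet hΦ.self_of_nhds)
      contDiffAt_snd).add (contDiffAt_fst.smul (ContDiffAt.comp (g := jet 2 η) ((0 : ℝ), x)
        (contDiffAt_jet hη.contDiffAt) contDiffAt_snd))
  have hF : SmoothAt F ((0 : ℝ), x) :=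
    ContDiffAt.comp (g := fun j : Jet 2 => christoffel j m a b) ((0 : ℝ), x)
      (by simpa using contDiffAt_christoffel hj m a b) hinner
  have h := hasDerivAt_iteratedFDeriv 1 (fun _ => Pi.single ρ 1) hF
  simp only [iteratedFDeriv_one_apply] at h
  have e : (fun y => 𝒟 F (0, y) (1, 0)) =ᶠ[𝓝 x] varChr Φ η m a b := by
    filter_upwards [hΦ, hL] with y hy hLy
    have hjy : IsLorentzian (jg (jet 2 Φ y)) := by rwa [jg_eq]
    have hd : DiffAt F ((0 : ℝ), y) := by
      refine DifferentiableAt.comp (g := fun j : Jet 2 => christoffel j m a b) ((0 : ℝ), y)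
        (by simpa using (contDiffAt_christoffel hjy m a b).diff) ?_
      exact (DifferentiableAt.comp (g := jet 2 Φ) ((0 : ℝ), y)
        (contDiffAt_jet hy).diff differentiableAt_snd).add
        (differentiableAt_fst.smul (DifferentiableAt.comp (g := jet 2 η) ((0 : ℝ), y)
        (contDiffAt_jet hη.contDiffAt).diff differentiableAt_snd))
    have h1 : HasDerivAt (fun s : ℝ => F (s, y)) (𝒟 F (0, y) (1, 0)) 0 :=
      HasFDerivAt.comp_hasDerivAt (l := F) (f := fun s : ℝ => (s, y)) (0 : ℝ) hd.hasFDerivAt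
        ((hasDerivAt_id' (0 : ℝ)).prodMk (hasDerivAt_const (0 : ℝ) y))
    exact h1.unique (hasDerivAt_line
      (contDiffAt_christoffel hjy m a b).diff (jet 2 η y))
  have h2 : HasDerivAt (fun s : ℝ => pd ρ (fun y => F (s, y)) x) (pd ρ (varChr Φ η m a b) x) 0 := by
    rw [← pd_congr e]; exact h
  refine h2.congr_of_eventuallyEq ?_
  filter_upwards [eventually_isMetricJet hΦ hη hL hs] with s hs'
  exact (hs'.2 ρ m a b).symm

theorem fderiv_esLagrangian : 𝒟 esLagrangian (jet 2 Φ x) (jet 2 η x) =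
    sqrtNegDet (Φ x).1 * pair (raise Φ η x) (esOperator (jet 2 Φ x)) +
      ∑ m, pd m (current Φ η m) x := by
  have hΦx := hΦ.self_of_nhds
  have hLx := hL.self_of_nhds
  have hj : IsMetricJet (jet 2 Φ x) := isMetricJet_jet hΦx hL
  have hjL := hj.lorentzian
  set j := jet 2 Φ x
  set k := jet 2 η x
  set G := christoffel j
  set C : Fin 4 → Tensor := fun m a b => varChr Φ η m a b x
  set dC : Fin 4 → Fin 4 → Tensor := fun ρ m a b => pd ρ (varChr Φ η m a b) x
  set W := jden j
  have hWs : ∀ a b, W a b = W b a := fun a b => by simp only [W, jden, hj.jinv_symm a b]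
  have hG : ∀ m a b, HasDerivAt (fun s : ℝ => christoffel (j + s • k) m a b) (C m a b) 0 :=
    fun m a b => hasDerivAt_line (contDiffAt_christoffel hjL m a b).diff k
  have hG0 : ∀ m a b, christoffel (j + (0 : ℝ) • k) m a b = G m a b := fun m a b => by simp [G]
  have hdG := hasDerivAt_dchristoffel hΦ hη hL hs
  have hric : ∀ a b, HasDerivAt (fun s : ℝ => ricci (j + s • k) a b)
      (∑ m, (dC m m a b - dC b m m a) + ∑ m, ∑ n, ((C m m n * G n a b + G m m n * C n a b) -
        (C m b n * G n m a + G m b n * C n m a))) 0 := by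
    intro a b
    refine (HasDerivAt.fun_sum fun m _ => (hdG m m a b).sub (hdG b m m a)).add
      (HasDerivAt.fun_sum fun m _ => HasDerivAt.fun_sum fun n _ => ?_)
    have h1 := ((hG m m n).mul (hG n a b)).sub ((hG m b n).mul (hG n m a))
    simp only [hG0] at h1
    exact h1
  have hφ : ∀ a, HasDerivAt (fun s : ℝ => jdphi (j + s • k) a) (jdphi k a) 0 := fun a => by
    simpa [jdphi] using ((hasDerivAt_id (0 : ℝ)).mul_const (jdphi k a)).const_add (jdphi j a)
  have hW := fun a b => hasDerivAt_line
    (contDiffAt_jden hjL a b).diff k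
  simp only [fderiv_jden hjL] at hW
  set δ : Tensor := fun a b => -∑ c, ∑ d, jinv j a c * jg k c d * jinv j d b
  set τ := ∑ a, ∑ b, jinv j a b * jg k b a
  change ∀ a b, HasDerivAt (fun s : ℝ => jden (j + s • k) a b)
    (sqrtNegDet (jg j) * δ a b + 1 / 2 * sqrtNegDet (jg j) * τ * jinv j a b) 0 at hW
  have hlag := (hasDerivAt_line (contDiffAt_esLagrangian hjL).diff
    k).unique (by
      simp only [esLagrangian_eq]
      exact HasDerivAt.fun_sum fun a _ => HasDerivAt.fun_sum fun b _ =>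
        (hW a b).mul ((hric a b).sub (((hφ a).mul (hφ b)).const_mul 2)))
  have hcur : ∀ m, pd m (current Φ η m) x =
      ((∑ a, ∑ b, (pd m (fun y => jden (jet 2 Φ y) a b) x * C m a b + W a b * dC m m a b)) -
      ∑ a, (pd m (fun y => jden (jet 2 Φ y) a m) x * (∑ n, C n n a) + W a m * ∑ n, dC m n n a)) -
      4 * ((∑ c, (pd m (fun y => jden (jet 2 Φ y) c m) x * jdphi j c + W c m * jddphi j m c)) *
        (η x).2 + (∑ c, W c m * jdphi j c) * jdphi k m) := by
    intro m
    have lW := fun a b => hasDerivAt_line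
      (contDiffAt_jet_comp (contDiffAt_jden hjL a b) hΦx).diff (Pi.single m (1 : ℝ))
    have lC := fun n a b => hasDerivAt_line
      (contDiffAt_varChr hΦx hLx hη.contDiffAt n a b).diff (Pi.single m (1 : ℝ))
    have lφ := fun c => hasDerivAt_line
      (contDiffAt_jet_comp (contDiff_jdphi c).contDiffAt hΦx).diff
      (Pi.single m (1 : ℝ))
    have lω := hasDerivAt_line (ContDiffAt.diff hη.contDiffAt.snd (x := x)) (Pi.single m (1 : ℝ))
    have h := (hasDerivAt_line (contDiffAt_current hΦx hLx hη.contDiffAt m).diff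
      (Pi.single m (1 : ℝ))).unique
      (((HasDerivAt.fun_sum fun a _ => HasDerivAt.fun_sum fun b _ => (lW a b).mul (lC m a b)).sub
        (HasDerivAt.fun_sum fun a _ => (lW a m).mul (HasDerivAt.fun_sum fun n _ => lC n n a))).sub
        (((HasDerivAt.fun_sum fun c _ => (lW c m).mul (lφ c)).mul lω).const_mul 4))
    simp only [zero_smul, add_zero, Pi.mul_apply] at h
    have h1 : ∀ c, pd m (fun y => jdphi (jet 2 Φ y) c) x = jddphi j m c := fun c => by
      simp only [jdphi_eq, j, jddphi_eq hΦx]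
      exact pd_snd (contDiffAt_pd hΦx).diff
    have h2 : pd m (fun y => (η y).2) x = jdphi k m := by
      simp only [k, jdphi_eq]
      exact pd_snd hη.contDiffAt.diff
    refine Eq.trans h ?_
    simp only [← h1, ← h2]
    rfl
  have hdW := fun m a b => pd_jden (m := m) (a := a) (b := b) hΦx hj
  have hpal := contracted_palatini dC hWs hj.christoffel_symm
    (varChr_symm hΦ hη hL hs) hdW
  have hdiv : ∑ m, ∑ c, (pd m (fun y => jden (jet 2 Φ y) c m) x * jdphi j c + W c m * jddphi j m c) =
      ∑ a, ∑ b, W a b * (jddphi j a b - ∑ c, G c a b * jdphi j c) := by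
    have h1 : ∀ c, ∑ m, pd m (fun y => jden (jet 2 Φ y) c m) x = -∑ m, ∑ n, G c m n * W n m := by
      intro c
      have h2 : ∑ m, ∑ n, christoffel j m m n * jden j c n =
          ∑ m, (∑ n, christoffel j n n m) * jden j c m := by
        rw [sum_comm]
        simp only [sum_mul]
      simp only [hdW, sum_add_distrib, sum_neg_distrib]
      change -(_ + ∑ m, ∑ n, christoffel j m m n * jden j c n) +
        ∑ m, (∑ n, christoffel j n n m) * jden j c m = _
      rw [h2]
      ring
    have h3 : ∑ m, ∑ c, W c m * jddphi j m c = ∑ a, ∑ b, W a b * jddphi j a b :=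
      sum_congr₂ fun a b => by rw [hWs]
    have h4 : ∑ m, ∑ c, pd m (fun y => jden (jet 2 Φ y) c m) x * jdphi j c =
        -∑ a, ∑ b, ∑ c, W a b * (G c a b * jdphi j c) := by
      rw [sum_comm]
      simp only [← sum_mul, h1, neg_mul, sum_neg_distrib]
      congr 1
      simp only [sum_mul]
      rw [sum_comm]
      refine sum_congr rfl fun m _ => ?_
      rw [sum_comm]
      exact sum_congr₂ fun n c => by rw [hWs n m]; ring
    simp only [sum_add_distrib, h3, h4, mul_sub, sum_sub_distrib, mul_sum]
    ring
  have hraise : ∀ a b, (raise Φ η x).1 a b = δ a b := by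
    intro a b
    simp only [raise, δ, mul_apply, sum_mul, jinv, j, k, jg_eq, of_apply]
    rw [sum_comm]
  have hτ : ∑ a, ∑ b, jg j a b * δ a b = -τ := by
    have e1 : ∀ a b, δ a b = -((of (jg j))⁻¹ * of (jg k) * (of (jg j))⁻¹) a b := by
      intro a b
      simp only [δ, mul_apply, sum_mul, jinv, of_apply, invMetric]
      rw [sum_comm]
    have e2 : τ = ((of (jg j))⁻¹ * of (jg k)).trace := by
      simp only [τ, Matrix.trace, Matrix.diag, mul_apply, jinv, of_apply, invMetric]
    have e3 : of (jg j) * ((of (jg j))⁻¹ * of (jg k) * (of (jg j))⁻¹) =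
        of (jg k) * (of (jg j))⁻¹ := by
      rw [← Matrix.mul_assoc, ← Matrix.mul_assoc, mul_nonsing_inv _ hjL.isUnit_det, one_mul]
    rw [e2, Matrix.trace_mul_comm, ← e3]
    simp only [e1, Matrix.trace, Matrix.diag, mul_apply (M := of (jg j)),
      of_apply, mul_neg, sum_neg_distrib]
    rw [sum_comm]
    congr 1
    exact sum_congr₂ fun b a => by rw [hjL.symm a b]
  have hE1 : ∑ a, ∑ b, (sqrtNegDet (jg j) * δ a b + 1 / 2 * sqrtNegDet (jg j) * τ * jinv j a b) *
      (ricci j a b - 2 * (jdphi j a * jdphi j b)) =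
      sqrtNegDet (jg j) * ∑ a, ∑ b, δ a b * (esOperator j).1 a b := by
    have e1 : ∑ a, ∑ b, jinv j a b * (ricci j a b - 2 * (jdphi j a * jdphi j b)) =
        scalarCurv j - 2 * gradSq j := by
      simp only [scalarCurv, gradSq, mul_sum, ← sum_sub_distrib]
      exact sum_congr₂
    have e2 : ∑ a, ∑ b, δ a b * (esOperator j).1 a b =
        ∑ a, ∑ b, δ a b * (ricci j a b - 2 * (jdphi j a * jdphi j b)) -
        1 / 2 * (scalarCurv j - 2 * gradSq j) * ∑ a, ∑ b, jg j a b * δ a b := by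
      simp only [esOperator, mul_sum, ← sum_sub_distrib]
      exact sum_congr₂
    rw [e2, hτ, ← e1]
    have e3 : ∀ a b, (sqrtNegDet (jg j) * δ a b + 1 / 2 * sqrtNegDet (jg j) * τ * jinv j a b) *
        (ricci j a b - 2 * (jdphi j a * jdphi j b)) =
        sqrtNegDet (jg j) * (δ a b * (ricci j a b - 2 * (jdphi j a * jdphi j b))) +
        1 / 2 * sqrtNegDet (jg j) * τ *
          (jinv j a b * (ricci j a b - 2 * (jdphi j a * jdphi j b))) := fun a b => by ring
    simp only [e3, sum_add_distrib, ← mul_sum]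
    ring
  have hφφ : ∑ a, ∑ b, W a b * (jdphi k a * jdphi j b + jdphi j a * jdphi k b) =
      2 * ∑ m, (∑ c, W c m * jdphi j c) * jdphi k m := by
    have h1 : ∑ a, ∑ b, W a b * (jdphi k a * jdphi j b) =
        ∑ m, (∑ c, W c m * jdphi j c) * jdphi k m := by
      simp only [sum_mul]
      exact sum_congr₂ fun a b => by rw [hWs]; ring
    have h2 : ∑ a, ∑ b, W a b * (jdphi j a * jdphi k b) =
        ∑ m, (∑ c, W c m * jdphi j c) * jdphi k m := by
      rw [sum_comm]
      simp only [sum_mul]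
      exact sum_congr₂ fun a b => by ring
    simp only [mul_add, sum_add_distrib, h1, h2]
    ring
  have hE2 : (esOperator j).2 * sqrtNegDet (jg j) =
      4 * ∑ a, ∑ b, W a b * (jddphi j a b - ∑ c, G c a b * jdphi j c) := by
    simp only [esOperator, W, jden, mul_assoc, ← mul_sum, G]
    ring
  have hsplit : 𝒟 esLagrangian j k =
      ∑ a, ∑ b, (sqrtNegDet (jg j) * δ a b + 1 / 2 * sqrtNegDet (jg j) * τ * jinv j a b) *
        (ricci j a b - 2 * (jdphi j a * jdphi j b)) +
      ∑ a, ∑ b, W a b * (∑ m, (dC m m a b - dC b m m a) +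
        ∑ m, ∑ n, ((C m m n * G n a b + G m m n * C n a b) -
          (C m b n * G n m a + G m b n * C n m a))) -
      2 * ∑ a, ∑ b, W a b * (jdphi k a * jdphi j b + jdphi j a * jdphi k b) := by
    have haux : ∀ A R S : Tensor, ∑ a, ∑ b, (A a b + W a b * (R a b - 2 * S a b)) =
        ∑ a, ∑ b, A a b + ∑ a, ∑ b, W a b * R a b - 2 * ∑ a, ∑ b, W a b * S a b := by
      intro A R S
      simp only [mul_sum, ← sum_add_distrib, ← sum_sub_distrib]
      exact sum_congr₂ fun a b => by ring
    rw [hlag]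
    simp only [zero_smul, add_zero]
    exact haux _ _ _
  have hpair : sqrtNegDet (Φ x).1 * pair (raise Φ η x) (esOperator j) =
      sqrtNegDet (jg j) * ∑ a, ∑ b, δ a b * (esOperator j).1 a b +
        (esOperator j).2 * sqrtNegDet (jg j) * (η x).2 := by
    simp only [pair, hraise]
    simp only [raise, j, jg_eq]
    ring
  rw [hsplit, hE1, hφφ, hpair, hE2, ← hdiv, ← hpal]
  simp only [hcur, sum_sub_distrib, ← mul_sum, sum_add_distrib, ← sum_mul]
  ring

end

theorem isFunctionalDerivative_es : IsFunctionalDerivative 2 esLagrangian esOperator := by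
  refine ⟨fun Φ x hΦ hL a b => ?_, fun W Φ η hW hΦ hL hη hs => ?_⟩
  · have hj := isMetricJet_jet hΦ hL
    simp only [esOperator, hj.ricci_symm a b, hj.lorentzian.symm a b, mul_comm (jdphi _ a)]
  · have h := hasDerivAt_action (L := esLagrangian) (k := 2)
      (fun j hj => contDiffAt_esLagrangian hj) hW hΦ hL hη
    have hΦW : ∀ y ∈ W, ∀ᶠ z in 𝓝 y, SmoothAt Φ z := fun y hy =>
      (hW.eventually_mem hy).mono fun z hz => hΦ.contDiffAt (hW.mem_nhds hz)
    have hLW : ∀ y ∈ W, ∀ᶠ z in 𝓝 y, IsLorentzian (Φ z).1 := fun y hy =>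
      (hW.eventually_mem hy).mono fun z hz => hL z hz
    have hzero : ∀ y, y ∉ tsupport η → jet 2 η y = 0 := fun y hy => by
      rw [jet_congr (notMem_tsupport_iff_eventuallyEq.1 hy)]
      exact funext fun I => pdI_zero_fun I
    have hcur : ∀ m, IsTest W (current Φ η m) := fun m =>
      IsTest.of_zero (fun y hy => contDiffAt_current (hΦW y hy).self_of_nhds (hL y hy)
        hη.1.contDiffAt m) hη.2.1 hη.2.2 fun y hy => by
          simp [current, varChr, hzero y hy, eq_zero_off hy]
    have hout : ∀ y, y ∉ W → sqrtNegDet (Φ y).1 * pair (raise Φ η y) (esOperator (jet 2 Φ y)) = 0 := by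
      intro y hy
      have h0 : η y = 0 := eq_zero_off fun h => hy (hη.2.2 h)
      simp [pair, raise, h0, mul_apply]
    have e : ∀ y, sqrtNegDet (Φ y).1 * pair (raise Φ η y) (esOperator (jet 2 Φ y)) =
        𝒟 esLagrangian (jet 2 Φ y) (jet 2 η y) - ∑ m, pd m (current Φ η m) y := by
      intro y
      by_cases hy : y ∈ W
      · rw [fderiv_esLagrangian (hΦW y hy) hη.1 (hLW y hy) hs, add_sub_cancel_right]
      · have hy' : y ∉ tsupport η := fun h => hy (hη.2.2 h)
        rw [hout y hy, hzero y hy', map_zero, zero_sub, eq_comm, neg_eq_zero]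
        refine sum_eq_zero fun m _ => pd_eq_zero_of_notMem fun h => hy ((hcur m).2.2 h)
    have hL' : IsTest W fun y => 𝒟 esLagrangian (jet 2 Φ y) (jet 2 η y) :=
      IsTest.of_zero (fun y hy => (contDiffAt_jet_comp (F := 𝒟 esLagrangian)
        ((contDiffAt_esLagrangian (by rw [jg_eq]; exact hL y hy)).fderiv_right (by simp))
        (hΦW y hy).self_of_nhds).clm_apply (contDiffAt_jet hη.1.contDiffAt)) hη.2.1 hη.2.2
        fun y hy => by simp [hzero y hy]
    convert h using 1
    change ∫ x in W, sqrtNegDet (Φ x).1 * pair (raise Φ η x) (esOperator (jet 2 Φ x)) = _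
    rw [setIntegral_eq_integral_of_forall_compl_eq_zero hout]
    simp only [e]
    rw [integral_sub hL'.integrable (integrable_finsetSum _ fun m _ => (hcur m).pd.integrable),
      integral_finsetSum _ fun m _ => (hcur m).pd.integrable]
    simp only [integral_pd_eq_zero (hcur _), Finset.sum_const_zero, sub_zero]

end Variation

/-! ### Covariance of the Einstein-scalar Lagrangian -/

section Covariance

variable {Φ : STPoint → Val} {ψ : STPoint → STPoint} {x y : STPoint}

/-- The bilinear form with components `g`. -/
def form (g : Tensor) : STPoint →ₗ[ℝ] STPoint →ₗ[ℝ] ℝ :=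
  LinearMap.mk₂ ℝ (fun v w => ∑ a, ∑ b, g a b * v a * w b)
    (fun v v' w => by simp only [Pi.add_apply, mul_add, add_mul, sum_add_distrib])
    (fun c v w => by
      simp only [Pi.smul_apply, smul_eq_mul, mul_sum]
      exact sum_congr₂)
    (fun v w w' => by simp only [Pi.add_apply, mul_add, sum_add_distrib])
    (fun c v w => by
      simp only [Pi.smul_apply, smul_eq_mul, mul_sum]
      exact sum_congr₂)

theorem form_apply (g : Tensor) (v w : STPoint) : form g v w = ∑ a, ∑ b, g a b * v a * w b := rfl

theorem form_single (g : Tensor) (a b : Fin 4) :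
    form g (Pi.single a 1) (Pi.single b 1) = g a b := by
  rw [form_apply, sum_eq_single a, sum_eq_single b] <;> simp +contextual

theorem form_symm {g : Tensor} (hg : ∀ a b, g a b = g b a) (v w : STPoint) :
    form g v w = form g w v := by
  rw [form_apply, form_apply, sum_comm]
  exact sum_congr₂ fun a b => by rw [hg b a]; ring

theorem hasDerivAt_form {g : ℝ → Tensor} {v w : ℝ → STPoint} {g' : Tensor}
    {v' w' : STPoint} {s : ℝ} (hg : HasDerivAt g g' s) (hv : HasDerivAt v v' s)
    (hw : HasDerivAt w w' s) : HasDerivAt (fun s => form (g s) (v s) (w s))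
      (form g' (v s) (w s) + form (g s) v' (w s) + form (g s) (v s) w') s := by
  simp only [form_apply, ← sum_add_distrib]
  refine HasDerivAt.fun_sum fun a _ => HasDerivAt.fun_sum fun b _ => ?_
  refine ((((hasDerivAt_pi.1 (hasDerivAt_pi.1 hg a) b).fun_mul (hasDerivAt_pi.1 hv a)).fun_mul
    (hasDerivAt_pi.1 hw b))).congr_deriv ?_
  ring

/-- The vector-valued bilinear map with components `Γ`. -/
def conn (Γ : Fin 4 → Tensor) : STPoint →ₗ[ℝ] STPoint →ₗ[ℝ] STPoint :=
  LinearMap.mk₂ ℝ (fun v w μ => form (Γ μ) v w)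
    (fun v v' w => by ext; simp) (fun c v w => by ext; simp)
    (fun v v' w => by ext; simp) (fun c v w => by ext; simp)

theorem conn_apply (Γ : Fin 4 → Tensor) (v w : STPoint) (μ : Fin 4) :
    conn Γ v w μ = form (Γ μ) v w := rfl

theorem conn_symm {Γ : Fin 4 → Tensor} (hΓ : ∀ m a b, Γ m a b = Γ m b a)
    (v w : STPoint) : conn Γ v w = conn Γ w v :=
  funext fun m => form_symm (hΓ m) v w

theorem hasDerivAt_conn {Γ : ℝ → Fin 4 → Tensor} {v w : ℝ → STPoint}
    {Γ' : Fin 4 → Tensor} {v' w' : STPoint} {s : ℝ} (hΓ : HasDerivAt Γ Γ' s)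
    (hv : HasDerivAt v v' s) (hw : HasDerivAt w w' s) :
    HasDerivAt (fun s => conn (Γ s) (v s) (w s))
      (conn Γ' (v s) (w s) + conn (Γ s) v' (w s) + conn (Γ s) (v s) w') s :=
  hasDerivAt_pi.2 fun μ => hasDerivAt_form (hasDerivAt_pi.1 hΓ μ) hv hw

/-- The Koszul formula. -/
theorem form_christoffel {j : Jet 2} (hj : IsLorentzian (jg j)) (v w z : STPoint) :
    form (jg j) (conn (christoffel j) v w) z =
      1 / 2 * (form (∑ α, v α • jdg j α) z w + form (∑ α, w α • jdg j α) z v -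
        form (∑ α, z α • jdg j α) v w) := by
  have hD : ∀ u v w : STPoint, form (∑ α, u α • jdg j α) v w =
      ∑ α, ∑ a, ∑ b, jdg j α a b * u α * v a * w b := by
    intro u v w
    simp only [form_apply, Finset.sum_apply, Pi.smul_apply, smul_eq_mul, sum_mul]
    rw [sum_congr rfl fun a _ => sum_comm, sum_comm]
    exact sum_congr₂ fun _ _ => sum_congr rfl fun _ _ => by ring
  have h1 : form (jg j) (conn (christoffel j) v w) z =
      ∑ σ, ∑ a, ∑ b, (∑ ν, jg j σ ν * christoffel j ν a b) * v a * w b * z σ := by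
    rw [form_apply, sum_comm]
    refine sum_congr rfl fun σ _ => ?_
    simp only [conn_apply, form_apply, mul_sum, sum_mul]
    rw [sum_comm]
    refine sum_congr rfl fun a _ => ?_
    rw [sum_comm]
    exact sum_congr₂ fun b ν => by rw [hj.symm ν σ]; ring
  have h2 : ∑ α, ∑ a, ∑ b, jdg j α a b * v α * z a * w b =
      ∑ σ, ∑ a, ∑ b, jdg j a σ b * v a * w b * z σ := by
    rw [sum_comm]
    exact sum_congr₂ fun _ _ => sum_congr rfl fun _ _ => by ring
  have h3 : ∑ α, ∑ a, ∑ b, jdg j α a b * w α * z a * v b =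
      ∑ σ, ∑ a, ∑ b, jdg j b σ a * v a * w b * z σ := by
    rw [sum_comm]
    refine sum_congr rfl fun σ _ => ?_
    rw [sum_comm]
    exact sum_congr₂
  rw [h1, hD, hD, hD, h2, h3]
  simp only [hj.lower_christoffel, mul_sum, ← sum_add_distrib, ← sum_sub_distrib]
  exact sum_congr₂ fun _ _ => sum_congr rfl fun _ _ => by ring

theorem sum_smul_jdg (v : STPoint) : ∑ α, v α • jdg (jet 2 Φ y) α = (𝒟 Φ y v).1 := by
  rw [fderiv_eq_sum_pd]
  ext μ ν
  simp only [Finset.sum_apply, Pi.smul_apply, Prod.fst_sum, Prod.smul_fst, jdg_eq]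

theorem form_pullback (v w : STPoint) :
    form (pullback ψ Φ y).1 v w = form (Φ (ψ y)).1 (𝒟 ψ y v) (𝒟 ψ y w) := by
  have h : ∀ a b, (pullback ψ Φ y).1 a b = form (Φ (ψ y)).1 (pd a ψ y) (pd b ψ y) := by
    intro a b
    simp only [pullback, form_apply]
    exact sum_congr₂
  rw [fderiv_eq_sum_pd v, fderiv_eq_sum_pd w]
  simp only [map_sum, map_smul, LinearMap.sum_apply, LinearMap.smul_apply, ← h, smul_eq_mul]
  rw [form_apply, sum_comm]
  simp only [mul_sum]
  exact sum_congr₂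

theorem contDiffAt_pullback (n : ℕ∞) (hψ : ContDiffAt ℝ (n + 1) ψ y) (hΦ : ContDiffAt ℝ n Φ (ψ y)) :
    ContDiffAt ℝ n (pullback ψ Φ) y := by
  have hψn : ContDiffAt ℝ n ψ y := hψ.of_le le_self_add
  have h1 : ∀ μ, ContDiffAt ℝ n (pd μ ψ) y := fun μ =>
    (hψ.fderiv_right (m := n) le_rfl).clm_apply contDiffAt_const
  have h2 : ContDiffAt ℝ n (fun y => Φ (ψ y)) y := ContDiffAt.comp y hΦ hψn
  refine ContDiffAt.prodMk (contDiffAt_pi.2 fun μ => contDiffAt_pi.2 fun ν =>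
    ContDiffAt.sum fun ρ _ => ContDiffAt.sum fun σ _ => ?_) h2.snd
  exact ((contDiffAt_pi.1 (h1 μ) ρ).mul (contDiffAt_pi.1 (h1 ν) σ)).mul
    (contDiffAt_pi.1 (contDiffAt_pi.1 h2.fst ρ) σ)

theorem IsLorentzian.congr {g : Tensor} (hg : IsLorentzian g)
    {P : Mat4} (hP : IsUnit P.det) : IsLorentzian (Pᵀ * of g * P) := by
  obtain ⟨Q, hQ, h⟩ := hg
  refine ⟨P⁻¹ * Q, ?_, ?_⟩
  · rw [det_mul]
    exact (P.isUnit_nonsing_inv_det hP).mul hQ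
  · rw [← h, transpose_mul]
    have e1 : P * (P⁻¹ * Q) = Q := by rw [← Matrix.mul_assoc, P.mul_nonsing_inv hP, one_mul]
    have e2 : Qᵀ * P⁻¹ᵀ * Pᵀ = Qᵀ := by
      rw [Matrix.mul_assoc, ← transpose_mul, P.mul_nonsing_inv hP, Matrix.transpose_one, mul_one]
    calc Qᵀ * P⁻¹ᵀ * (Pᵀ * of g * P) * (P⁻¹ * Q) =
        (Qᵀ * P⁻¹ᵀ * Pᵀ) * of g * (P * (P⁻¹ * Q)) := by simp only [Matrix.mul_assoc]
      _ = _ := by rw [e1, e2]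

/-- The Jacobian matrix. -/
def jac (ψ : STPoint → STPoint) (x : STPoint) : Mat4 := of fun ρ μ => pd μ ψ x ρ

theorem det_jac : (jac ψ x).det = jacobian ψ x := by rw [← det_transpose]; rfl

theorem jac_mulVec (v : STPoint) : jac ψ x *ᵥ v = 𝒟 ψ x v := by
  rw [fderiv_eq_sum_pd]
  ext ρ
  simp [Matrix.mulVec, dotProduct, jac, mul_comm]

theorem pullback_eq : of (pullback ψ Φ x).1 = (jac ψ x)ᵀ * of (Φ (ψ x)).1 * jac ψ x := by
  ext μ ν
  simp only [pullback, mul_apply, of_apply, jac, transpose_apply, sum_mul]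
  rw [sum_comm]
  exact sum_congr₂

theorem fderiv_pullback (hψ : ContDiffAt ℝ 2 ψ y) (hΦ : ContDiffAt ℝ 1 Φ (ψ y))
    (u v w : STPoint) : form (𝒟 (pullback ψ Φ) y u).1 v w =
      form (𝒟 Φ (ψ y) (𝒟 ψ y u)).1 (𝒟 ψ y v) (𝒟 ψ y w) +
      form (Φ (ψ y)).1 (𝒟 (𝒟 ψ) y u v) (𝒟 ψ y w) +
      form (Φ (ψ y)).1 (𝒟 ψ y v) (𝒟 (𝒟 ψ) y u w) := by
  have hP : DiffAt (pullback ψ Φ) y :=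
    (contDiffAt_pullback 1 (by exact_mod_cast hψ) (by exact_mod_cast hΦ)).diff
  have h1 := hasDerivAt_line hP u
  have h2 := hasDerivAt_line hψ.diff u
  have h3 := hasDerivAt_line (hψ.fderiv_right (m := 1) (by norm_num)).diff u
  have h4 : HasDerivAt (fun s : ℝ => Φ (ψ (y + s • u))) (𝒟 Φ (ψ y) (𝒟 ψ y u)) 0 :=
    HasFDerivAt.comp_hasDerivAt (l := Φ) (f := fun s : ℝ => ψ (y + s • u)) (0 : ℝ)
      (by simpa using hΦ.diff.hasFDerivAt) h2
  have h3' := fun v : STPoint => h3.clm_apply (hasDerivAt_const (0 : ℝ) v)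
  have hl := hasDerivAt_form h1.fst (hasDerivAt_const (0 : ℝ) v) (hasDerivAt_const (0 : ℝ) w)
  have hr := hasDerivAt_form h4.fst (h3' v) (h3' w)
  simp only [form_pullback] at hl
  have := hl.unique hr
  simpa using this

theorem form_nondegenerate {g : Tensor} (hg : IsLorentzian g) {v : STPoint}
    (h : ∀ z, form g v z = 0) : v = 0 := by
  have h1 : of g *ᵥ v = 0 := by
    ext b
    have := h (Pi.single b 1)
    rw [form_apply, sum_comm, sum_eq_single b] at this
    · simpa [Matrix.mulVec, dotProduct, hg.symm b] using this
    · exact fun c _ hc => by simp [hc]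
    · simp
  have h2 := congrArg ((of g)⁻¹ *ᵥ ·) h1
  simpa [Matrix.mulVec_mulVec, nonsing_inv_mul _ hg.isUnit_det] using h2

theorem isLorentzian_pullback (hJ : 0 < jacobian ψ y) (hL : IsLorentzian (Φ (ψ y)).1) :
    IsLorentzian (pullback ψ Φ y).1 := by
  have h := hL.congr (P := jac ψ y) (by rw [det_jac]; exact hJ.ne'.isUnit)
  rwa [← pullback_eq] at h

/-- The transformation law of the Christoffel symbols. -/
theorem fderiv_christoffel_pullback (hψ : ContDiffAt ℝ 2 ψ y) (hΦ : ContDiffAt ℝ 1 Φ (ψ y))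
    (hJ : 0 < jacobian ψ y) (hL : IsLorentzian (Φ (ψ y)).1) (v w : STPoint) :
    𝒟 ψ y (conn (christoffel (jet 2 (pullback ψ Φ) y)) v w) =
      conn (christoffel (jet 2 Φ (ψ y))) (𝒟 ψ y v) (𝒟 ψ y w) + 𝒟 (𝒟 ψ) y v w := by
  have hL' := isLorentzian_pullback hJ hL
  have hH : ∀ u v, 𝒟 (𝒟 ψ) y u v = 𝒟 (𝒟 ψ) y v u := fun u v => hψ.isSymmSndFDerivAt (by simp) u v
  have hU : IsUnit (jac ψ y).det := by rw [det_jac]; exact hJ.ne'.isUnit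
  rw [← sub_eq_zero]
  refine form_nondegenerate hL fun z => ?_
  obtain ⟨z, rfl⟩ : ∃ z', 𝒟 ψ y z' = z := ⟨(jac ψ y)⁻¹ *ᵥ z, by
    rw [← jac_mulVec, Matrix.mulVec_mulVec, mul_nonsing_inv _ hU, Matrix.one_mulVec]⟩
  have h1 := form_christoffel (j := jet 2 (pullback ψ Φ) y) (by rwa [jg_eq]) v w z
  have h2 := form_christoffel (j := jet 2 Φ (ψ y)) (by rwa [jg_eq]) (𝒟 ψ y v)
    (𝒟 ψ y w) (𝒟 ψ y z)
  simp only [sum_smul_jdg, jg_eq] at h1 h2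
  rw [form_pullback] at h1
  simp only [map_sub, map_add, LinearMap.sub_apply, LinearMap.add_apply, h1, h2,
    fderiv_pullback hψ hΦ, hH w v, hH z v, hH z w]
  rw [form_symm hL.symm (𝒟 (𝒟 ψ) y v w), form_symm hL.symm (𝒟 (𝒟 ψ) y v z) (𝒟 ψ y w),
    form_symm hL.symm (𝒟 (𝒟 ψ) y w z) (𝒟 ψ y v)]
  ring

/-- The Riemann tensor. -/
def riem (j : Jet 2) (u v w : STPoint) : STPoint :=
  conn (∑ ρ, u ρ • dchristoffel j ρ) v w - conn (∑ ρ, v ρ • dchristoffel j ρ) u w +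
    conn (christoffel j) u (conn (christoffel j) v w) -
    conn (christoffel j) v (conn (christoffel j) u w)

theorem sum_smul_dchristoffel (hΦ : SmoothAt Φ x) (hL : IsLorentzian (Φ x).1) (u : STPoint) :
    ∑ ρ, u ρ • dchristoffel (jet 2 Φ x) ρ = 𝒟 (fun y => christoffel (jet 2 Φ y)) x u := by
  have hd : DiffAt (fun y => christoffel (jet 2 Φ y)) x :=
    differentiableAt_pi.2 fun μ => differentiableAt_pi.2 fun α => differentiableAt_pi.2 fun β =>
      ContDiffAt.diff (contDiffAt_jet_comp (contDiffAt_christoffel (by rwa [jg_eq]) μ α β) hΦ)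
  rw [fderiv_eq_sum_pd]
  ext μ α β
  simp only [Finset.sum_apply, Pi.smul_apply]
  refine sum_congr rfl fun ρ _ => ?_
  rw [← pd_christoffel hΦ hL, pd_pi (differentiableAt_pi.1 (differentiableAt_pi.1 hd μ) α),
    pd_pi (differentiableAt_pi.1 hd μ), pd_pi hd]

theorem eventually_jacobian_pos (hψ : SmoothAt ψ x) (hJ : 0 < jacobian ψ x) :
    ∀ᶠ y in 𝓝 x, 0 < jacobian ψ y := by
  have hc : ContinuousAt (jacobian ψ) x :=
    (Continuous.matrix_det continuous_id).continuousAt.comp (f := fun x =>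
      (of fun μ ρ => pd μ ψ x ρ : Mat4))
      (continuousAt_pi.2 fun μ => (contDiffAt_pd hψ).continuousAt)
  exact hc.eventually (lt_mem_nhds hJ)

theorem fderiv_riem_pullback (hψ : SmoothAt ψ x) (hΦ : SmoothAt Φ (ψ x))
    (hJ : 0 < jacobian ψ x) (hL : ∀ᶠ y in 𝓝 (ψ x), IsLorentzian (Φ y).1) (u v w : STPoint) :
    𝒟 ψ x (riem (jet 2 (pullback ψ Φ) x) u v w) =
      riem (jet 2 Φ (ψ x)) (𝒟 ψ x u) (𝒟 ψ x v) (𝒟 ψ x w) := by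
  have hLx := hL.self_of_nhds
  have hΦ' : SmoothAt (pullback ψ Φ) x := contDiffAt_pullback ⊤ (by simpa using hψ) hΦ
  have hJc := eventually_jacobian_pos hψ hJ
  have hev : ∀ᶠ y in 𝓝 x, ∀ v w, 𝒟 ψ y (conn (christoffel (jet 2 (pullback ψ Φ) y)) v w) =
      conn (christoffel (jet 2 Φ (ψ y))) (𝒟 ψ y v) (𝒟 ψ y w) + 𝒟 (𝒟 ψ) y v w := by
    filter_upwards [(hψ.of_le two_le_infty).eventually (by simp),
      hψ.continuousAt.eventually ((hΦ.of_le two_le_infty).eventually (by simp)),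
      hψ.continuousAt.eventually hL, hJc] with y h1 h2 h3 h4
    exact fderiv_christoffel_pullback h1 (h2.of_le (by norm_num)) h4 h3
  have hd : ∀ {Ψ : STPoint → Val} {p : STPoint}, SmoothAt Ψ p → IsLorentzian (Ψ p).1 →
      DiffAt (fun y => christoffel (jet 2 Ψ y)) p := fun h1 h2 =>
    differentiableAt_pi.2 fun μ => differentiableAt_pi.2 fun α => differentiableAt_pi.2 fun β =>
      ContDiffAt.diff (contDiffAt_jet_comp (contDiffAt_christoffel (by rwa [jg_eq]) μ α β) h1)
  have hL' := isLorentzian_pullback hJ hLx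
  have hψ1 : SmoothAt (𝒟 ψ) x := hψ.fderiv_right (by simp)
  have hψ2 : SmoothAt (𝒟 (𝒟 ψ)) x := hψ1.fderiv_right (by simp)
  set Γ' := fun y => christoffel (jet 2 (pullback ψ Φ) y)
  set Γ := fun y => christoffel (jet 2 Φ y)
  set J := 𝒟 ψ x
  set H := 𝒟 (𝒟 ψ) x
  set T := 𝒟 (𝒟 (𝒟 ψ)) x
  have hH : ∀ u v, H u v = H v u := fun u v =>
    (hψ.of_le two_le_infty).isSymmSndFDerivAt (by simp) u v
  have hT : ∀ u v, T u v = T v u := fun u v =>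
    (hψ1.of_le two_le_infty).isSymmSndFDerivAt (by simp) u v
  have key : ∀ u v w, H u (conn (Γ' x) v w) + J (conn (𝒟 Γ' x u) v w) =
      conn (𝒟 Γ (ψ x) (J u)) (J v) (J w) + conn (Γ (ψ x)) (H u v) (J w) +
        conn (Γ (ψ x)) (J v) (H u w) + T u v w := by
    intro u v w
    have c0 := fun v : STPoint => hasDerivAt_const (0 : ℝ) v
    have h1 := hasDerivAt_line hψ.diff u
    have h2 := hasDerivAt_line hψ1.diff u
    have h3 := hasDerivAt_line hψ2.diff u
    have h4 := hasDerivAt_line (hd hΦ' hL') u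
    have h5 : HasDerivAt (fun s : ℝ => Γ (ψ (x + s • u))) (𝒟 Γ (ψ x) (J u)) 0 :=
      HasFDerivAt.comp_hasDerivAt (l := Γ) (f := fun s : ℝ => ψ (x + s • u)) (0 : ℝ)
        (by simpa using (hd hΦ hLx).hasFDerivAt) h1
    have hl := h2.clm_apply (hasDerivAt_conn h4 (c0 v) (c0 w))
    have hr := (hasDerivAt_conn h5 (h2.clm_apply (c0 v)) (h2.clm_apply (c0 w))).add
      ((h3.clm_apply (c0 v)).clm_apply (c0 w))
    have hline : Tendsto (fun s : ℝ => x + s • u) (𝓝 0) (𝓝 x) := by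
      have : Continuous fun s : ℝ => x + s • u := by fun_prop
      simpa using this.tendsto 0
    have := hl.unique (hr.congr_of_eventuallyEq ((hline.eventually hev).mono fun s hs => hs v w))
    simpa using this
  have law := fun v w => hev.self_of_nhds v w
  have hΓs : ∀ v w, conn (Γ (ψ x)) v w = conn (Γ (ψ x)) w v :=
    conn_symm (isMetricJet_jet hΦ hL).christoffel_symm
  have k1 := key u v w
  have k2 := key v u w
  rw [hH v u, hT v u] at k2
  simp only [riem, sum_smul_dchristoffel hΦ hLx, sum_smul_dchristoffel hΦ' hL']
  change J (conn (𝒟 Γ' x u) v w - conn (𝒟 Γ' x v) u w +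
    conn (Γ' x) u (conn (Γ' x) v w) - conn (Γ' x) v (conn (Γ' x) u w)) =
    conn (𝒟 Γ (ψ x) (J u)) (J v) (J w) - conn (𝒟 Γ (ψ x) (J v)) (J u) (J w) +
    conn (Γ (ψ x)) (J u) (conn (Γ (ψ x)) (J v) (J w)) -
    conn (Γ (ψ x)) (J v) (conn (Γ (ψ x)) (J u) (J w))
  have e : ∀ u v w, J (conn (Γ' x) u (conn (Γ' x) v w)) =
      conn (Γ (ψ x)) (J u) (conn (Γ (ψ x)) (J v) (J w)) + conn (Γ (ψ x)) (J u) (H v w) +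
        H u (conn (Γ' x) v w) := by
    intro u v w
    refine (law _ _).trans ?_
    rw [law v w, map_add]
  rw [map_sub, map_add, map_sub, e, e, eq_sub_of_add_eq' k1, eq_sub_of_add_eq' k2]
  abel

theorem form_sum_smul {ι : Type*} [Fintype ι] (c : ι → ℝ) (g : ι → Tensor) (v w : STPoint) :
    form (∑ i, c i • g i) v w = ∑ i, c i * form (g i) v w := by
  simp only [form_apply, Finset.sum_apply, Pi.smul_apply, smul_eq_mul, sum_mul, mul_sum]
  rw [sum_congr rfl fun a _ => sum_comm, sum_comm]
  exact sum_congr₂ fun _ _ => sum_congr rfl fun _ _ => by ring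

theorem conn_sum_smul (c : STPoint) (Γ : Fin 4 → Fin 4 → Tensor) (v w : STPoint) :
    conn (∑ ρ, c ρ • Γ ρ) v w = ∑ ρ, c ρ • conn (Γ ρ) v w := by
  ext μ
  simp only [conn_apply, Finset.sum_apply, Pi.smul_apply, smul_eq_mul, form_sum_smul]

theorem conn_sum_single (j : Jet 2) (a : Fin 4) (v w : STPoint) :
    conn (∑ ρ, (Pi.single a 1 : STPoint) ρ • dchristoffel j ρ) v w = conn (dchristoffel j a) v w := by
  rw [conn_sum_smul, sum_eq_single a] <;> simp +contextual

theorem riem_sum (j : Jet 2) (u v w : STPoint) :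
    riem j u v w = ∑ a, u a • riem j (Pi.single a 1) v w := by
  have hu : u = ∑ a, u a • (Pi.single a 1 : STPoint) := by
    ext b; simp [Finset.sum_apply, Pi.single_apply]
  simp only [riem, conn_sum_single, smul_sub, smul_add, sum_sub_distrib, sum_add_distrib]
  conv_lhs => rw [conn_sum_smul]
  conv_lhs => enter [1, 1, 2]; rw [hu]
  conv_lhs => enter [1, 2]; rw [hu]
  conv_lhs => enter [2]; rw [hu]
  simp only [map_sum, map_smul, LinearMap.sum_apply, LinearMap.smul_apply]

theorem sum_riem {j : Jet 2} (hj : IsMetricJet j) (v w : STPoint) :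
    ∑ μ, riem j (Pi.single μ 1) v w μ = form (ricci j) w v := by
  have hs : ∀ (g : Tensor) (a : Fin 4) (w : STPoint),
      form g (Pi.single a 1) w = ∑ b, g a b * w b := fun g a w => by
    rw [form_apply, sum_eq_single a] <;> simp +contextual
  have e1 : ∑ μ, form (dchristoffel j μ μ) v w =
      ∑ α, ∑ β, ∑ μ, dchristoffel j μ μ α β * w α * v β := by
    simp only [form_symm (hj.dchristoffel_symm _ _) v w, form_apply]
    rw [sum_comm]
    exact sum_congr rfl fun _ _ => sum_comm
  have e2 : ∑ μ, ∑ ρ, v ρ * ∑ b, dchristoffel j ρ μ μ b * w b =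
      ∑ α, ∑ β, ∑ μ, dchristoffel j β μ μ α * w α * v β := by
    simp only [mul_sum]
    rw [sum_comm, sum_congr rfl fun ρ _ => sum_comm, sum_comm]
    exact sum_congr₂ fun _ _ => sum_congr rfl fun _ _ => by ring
  have e3 : ∑ μ, ∑ ν, christoffel j μ μ ν * form (christoffel j ν) v w =
      ∑ α, ∑ β, ∑ μ, ∑ ν, christoffel j μ μ ν * christoffel j ν α β * w α * v β := by
    simp only [form_symm (hj.christoffel_symm _) v w, form_apply, mul_sum]
    rw [sum_four_swap₂₃, sum_four_swap₁₂, sum_four_swap₃₄, sum_four_swap₂₃]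
    exact sum_congr₂ fun _ _ => sum_congr₂ fun _ _ => by ring
  have e4 : ∑ μ, ∑ β, ∑ ν, christoffel j μ β ν * v β * ∑ α, christoffel j ν μ α * w α =
      ∑ α, ∑ β, ∑ μ, ∑ ν, christoffel j μ β ν * christoffel j ν μ α * w α * v β := by
    simp only [mul_sum]
    rw [sum_four_swap₃₄, sum_four_swap₂₃, sum_four_swap₁₂, sum_four_swap₂₃]
    exact sum_congr₂ fun _ _ => sum_congr₂ fun _ _ => by ring
  have h2 : ∀ μ, conn (∑ ρ, v ρ • dchristoffel j ρ) (Pi.single μ 1) w μ =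
      ∑ ρ, v ρ * ∑ b, dchristoffel j ρ μ μ b * w b := fun μ => by
    simp only [conn_apply, hs, Finset.sum_apply, Pi.smul_apply, smul_eq_mul, sum_mul, mul_sum]
    rw [sum_comm]
    exact sum_congr₂
  simp only [riem, Pi.add_apply, Pi.sub_apply, conn_sum_single, h2, sum_add_distrib,
    sum_sub_distrib]
  simp only [conn_apply, hs, e1, e2, e3]
  simp only [form_apply (christoffel j _) v, conn_apply, hs, e4]
  have haux : ∀ A B C D : Tensor, ∑ a, ∑ b, A a b - ∑ a, ∑ b, B a b + ∑ a, ∑ b, C a b -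
      ∑ a, ∑ b, D a b = ∑ a, ∑ b, (A a b - B a b + C a b - D a b) := fun A B C D => by
    simp only [sum_add_distrib, sum_sub_distrib]
  rw [haux, form_apply]
  refine sum_congr₂ fun α β => ?_
  simp only [ricci, sum_sub_distrib, ← sum_mul]
  ring

theorem ricci_pullback (hψ : SmoothAt ψ x) (hΦ : SmoothAt Φ (ψ x))
    (hJ : 0 < jacobian ψ x) (hL : ∀ᶠ y in 𝓝 (ψ x), IsLorentzian (Φ y).1) (hL' : ∀ᶠ y in 𝓝 x,
      IsLorentzian (pullback ψ Φ y).1) (v w : STPoint) :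
    form (ricci (jet 2 (pullback ψ Φ) x)) v w =
      form (ricci (jet 2 Φ (ψ x))) (𝒟 ψ x v) (𝒟 ψ x w) := by
  have hΦ' : SmoothAt (pullback ψ Φ) x := contDiffAt_pullback ⊤ (by simpa using hψ) hΦ
  have hU : IsUnit (jac ψ x).det := by rw [det_jac]; exact hJ.ne'.isUnit
  rw [← sum_riem (isMetricJet_jet hΦ' hL'), ← sum_riem (isMetricJet_jet hΦ hL)]
  set P := jac ψ x
  set M' : Mat4 := of fun μ a => riem (jet 2 (pullback ψ Φ) x) (Pi.single a 1) w v μ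
  set M : Mat4 := of fun μ a => riem (jet 2 Φ (ψ x)) (Pi.single a 1) (𝒟 ψ x w) (𝒟 ψ x v) μ
  have h : P * M' = M * P := by
    ext μ a
    have h1 : (P *ᵥ riem (jet 2 (pullback ψ Φ) x) (Pi.single a 1) w v) μ =
        ∑ b, pd a ψ x b * M μ b := by
      rw [jac_mulVec, fderiv_riem_pullback hψ hΦ hJ hL, riem_sum, Finset.sum_apply]
      rfl
    refine h1.trans ?_
    rw [mul_apply]
    exact sum_congr rfl fun ρ _ => mul_comm _ _
  have h2 : M'.trace = M.trace := by
    have h3 : M' = P⁻¹ * (M * P) := by rw [← h, ← Matrix.mul_assoc, nonsing_inv_mul _ hU, one_mul]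
    rw [h3, Matrix.trace_mul_comm, Matrix.mul_assoc, mul_nonsing_inv _ hU, mul_one]
  exact h2

theorem form_eq_of_pullback {B B' : Tensor} {P : Mat4}
    (h : ∀ v w, form B' v w = form B (P *ᵥ v) (P *ᵥ w)) :
    of B' = Pᵀ * of B * P := by
  ext a b
  have := h (Pi.single a 1) (Pi.single b 1)
  rw [form_single] at this
  rw [of_apply, this, form_apply]
  simp only [mul_apply, of_apply, transpose_apply, sum_mul,
    Matrix.mulVec_single_one, Matrix.col_apply]
  rw [sum_comm]
  exact sum_congr₂

theorem isCovariantDensity_es : IsCovariantDensity 2 esLagrangian := by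
  intro ψ Φ x hψ hJ hΦ hL
  have hLx := hL.self_of_nhds
  have hΦ' : SmoothAt (pullback ψ Φ) x := contDiffAt_pullback ⊤ (by simpa using hψ) hΦ
  have hLx' := isLorentzian_pullback hJ hLx
  have hL' : ∀ᶠ y in 𝓝 x, IsLorentzian (pullback ψ Φ y).1 := by
    filter_upwards [eventually_jacobian_pos hψ hJ, hψ.continuousAt.eventually hL] with y h1 h2
    exact isLorentzian_pullback h1 h2
  set P := jac ψ x
  have hU : IsUnit P.det := by rw [det_jac]; exact hJ.ne'.isUnit
  have hφ : ∀ v, 𝒟 (fun y => (pullback ψ Φ y).2) x v = 𝒟 (fun y => (Φ y).2) (ψ x) (P *ᵥ v) := by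
    intro v
    rw [jac_mulVec]
    have := fderiv_comp (g := fun y => (Φ y).2) x hΦ.snd.diff hψ.diff
    exact congrArg (· v) this
  have hdφ : ∀ {Ψ : STPoint → Val} {p : STPoint} (v : STPoint), SmoothAt Ψ p →
      𝒟 (fun y => (Ψ y).2) p v = ∑ a, v a * jdphi (jet 2 Ψ p) a := by
    intro Ψ p v hΨ
    rw [fderiv_eq_sum_pd]
    simp only [jdphi_eq, ← pd_snd hΨ.diff, smul_eq_mul]
  set B : Jet 2 → Tensor := fun j a b => ricci j a b - 2 * (jdphi j a * jdphi j b)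
  have hBform : ∀ {Ψ : STPoint → Val} {p : STPoint} (v w : STPoint), SmoothAt Ψ p →
      form (B (jet 2 Ψ p)) v w = form (ricci (jet 2 Ψ p)) v w -
        2 * (𝒟 (fun y => (Ψ y).2) p v * 𝒟 (fun y => (Ψ y).2) p w) := by
    intro Ψ p v w hΨ
    rw [hdφ v hΨ, hdφ w hΨ, Finset.sum_mul_sum]
    simp only [form_apply, B, mul_sum, ← sum_sub_distrib]
    exact sum_congr₂
  have hB : of (B (jet 2 (pullback ψ Φ) x)) = Pᵀ * of (B (jet 2 Φ (ψ x))) * P :=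
    form_eq_of_pullback fun v w => by
      rw [hBform v w hΦ', hBform _ _ hΦ, hφ, hφ, ricci_pullback hψ hΦ hJ hL hL', jac_mulVec,
        jac_mulVec]
  have hes : ∀ {Ψ : STPoint → Val} {p : STPoint}, IsLorentzian (Ψ p).1 →
      esLagrangian (jet 2 Ψ p) = sqrtNegDet (Ψ p).1 *
        ((of (Ψ p).1)⁻¹ * of (B (jet 2 Ψ p))).trace := by
    intro Ψ p hΨ
    simp only [esLagrangian_eq, jden, jg_eq, Matrix.trace, Matrix.diag, mul_apply,
      mul_sum, of_apply]
    rw [sum_comm]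
    refine sum_congr₂ fun a b => ?_
    rw [mul_assoc, jinv, jg_eq, invMetric_symm hΨ.symm]
    rfl
  have hg := pullback_eq (ψ := ψ) (Φ := Φ) (x := x)
  rw [hes hLx', hes hLx, hB, hg]
  have h1 : sqrtNegDet (pullback ψ Φ x).1 = jacobian ψ x * sqrtNegDet (Φ (ψ x)).1 := by
    rw [sqrtNegDet, hg, det_mul, det_mul, det_transpose, det_jac,
      show -(jacobian ψ x * (of (Φ (ψ x)).1).det * jacobian ψ x) =
        jacobian ψ x ^ 2 * -(of (Φ (ψ x)).1).det by ring, Real.sqrt_mul (sq_nonneg _),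
      Real.sqrt_sq hJ.le]
    rfl
  have hUT : IsUnit Pᵀ.det := by rwa [det_transpose]
  have h2 : ((Pᵀ * of (Φ (ψ x)).1 * P)⁻¹ * (Pᵀ * of (B (jet 2 Φ (ψ x))) * P)).trace =
      ((of (Φ (ψ x)).1)⁻¹ * of (B (jet 2 Φ (ψ x)))).trace := by
    rw [Matrix.mul_inv_rev, Matrix.mul_inv_rev, Matrix.trace_mul_comm]
    have : Pᵀ * of (B (jet 2 Φ (ψ x))) * P * (P⁻¹ * ((of (Φ (ψ x)).1)⁻¹ * Pᵀ⁻¹)) =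
        Pᵀ * (of (B (jet 2 Φ (ψ x))) * (P * P⁻¹) * (of (Φ (ψ x)).1)⁻¹ * Pᵀ⁻¹) := by
      simp only [Matrix.mul_assoc]
    rw [this, mul_nonsing_inv _ hU, mul_one, Matrix.trace_mul_comm, Matrix.mul_assoc _ Pᵀ⁻¹,
      nonsing_inv_mul _ hUT, mul_one, Matrix.trace_mul_comm]
  rw [h1, h2, mul_assoc]

theorem isScalarTensorTheory_es : IsScalarTensorTheory 2 esLagrangian esOperator where
  smooth_lagrangian _ hj := contDiffAt_esLagrangian hj
  covariant := isCovariantDensity_es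
  smooth_operator _ hj := contDiffAt_esOperator hj
  functional_derivative := isFunctionalDerivative_es

end Covariance

/-! ### Motions with a prescribed charge -/

section Motion

open scoped NNReal

theorem exists_solution {X : Type*} [NormedAddCommGroup X] [NormedSpace ℝ X] [CompleteSpace X]
    {A B : X → X} {x₀ : X} (hA : ContDiffAt ℝ 1 A x₀) (hB : ContDiffAt ℝ 1 B x₀) {q : ℝ → ℝ}
    (hq : Continuous q) {V : Set X} (hV : V ∈ 𝓝 x₀) :
    ∃ (ε : ℝ) (α : ℝ → X), 0 < ε ∧ α 0 = x₀ ∧ ∀ τ ∈ Ioo (-ε) ε, α τ ∈ V ∧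
      HasDerivAt α (A (α τ) + q τ • B (α τ)) τ := by
  obtain ⟨KA, tA, hA0, hA1⟩ := hA.exists_lipschitzOnWith
  obtain ⟨KB, tB, hB0, hB1⟩ := hB.exists_lipschitzOnWith
  obtain ⟨a, ha, hball⟩ := Metric.nhds_basis_closedBall.mem_iff.1 (inter_mem hA0 hB0)
  obtain ⟨Q, hQ⟩ := (isCompact_Icc (a := (-1 : ℝ)) (b := 1)).exists_bound_of_continuousOn
    hq.continuousOn
  have hQ0 : 0 ≤ Q := (norm_nonneg _).trans (hQ 0 (by simp))
  lift Q to ℝ≥0 using hQ0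
  lift a to ℝ≥0 using ha.le
  set L : ℝ≥0 := (‖A x₀‖₊ + KA * a) + Q * (‖B x₀‖₊ + KB * a) + 1
  have hL : 0 < L := by positivity
  set δ : ℝ := min 1 (a / L)
  have hδ : 0 < δ := lt_min one_pos (div_pos ha hL)
  have hδ1 : ∀ t ∈ Icc (-δ) δ, ‖q t‖ ≤ Q := fun t ht =>
    hQ t ⟨by linarith [ht.1, min_le_left 1 ((a : ℝ) / L)], ht.2.trans (min_le_left _ _)⟩
  have hbound : ∀ {F : X → X} {K : ℝ≥0} {t : Set X}, LipschitzOnWith K F t →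
      Metric.closedBall x₀ a ⊆ t → ∀ x ∈ Metric.closedBall x₀ a, ‖F x‖ ≤ ‖F x₀‖ + K * a := by
    intro F K t hF ht x hx
    have h1 := hF.dist_le_mul x (ht hx) x₀ (ht (Metric.mem_closedBall_self ha.le))
    rw [dist_eq_norm] at h1
    have h2 : (K : ℝ) * dist x x₀ ≤ K * a := by gcongr; exact hx
    linarith [norm_le_norm_add_norm_sub' (F x) (F x₀)]
  have hp : IsPicardLindelof (fun t x => A x + q t • B x)
      (⟨0, by simp [hδ.le]⟩ : Icc (-δ) δ) x₀ a 0 L (KA + Q * KB) := by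
    refine ⟨fun t ht => ?_, fun x _ => ?_, fun t ht x hx => ?_, ?_⟩
    · refine (hA1.mono fun x hx => (hball hx).1).add ?_
      refine LipschitzOnWith.of_dist_le_mul fun x hx y hy => ?_
      rw [dist_smul₀, NNReal.coe_mul, mul_assoc]
      have := hB1.dist_le_mul x (hball hx).2 y (hball hy).2
      exact mul_le_mul (hδ1 t ht) this dist_nonneg Q.coe_nonneg
    · exact (continuous_const.add (hq.smul continuous_const)).continuousOn
    · have h1 := hbound hA1 (fun x hx => (hball hx).1) x hx
      have h2 := hbound hB1 (fun x hx => (hball hx).2) x hx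
      have h3 : ‖q t • B x‖ ≤ Q * (‖B x₀‖ + KB * a) := by
        rw [norm_smul]
        exact mul_le_mul (hδ1 t ht) h2 (norm_nonneg _) Q.coe_nonneg
      have h4 : (L : ℝ) = (‖A x₀‖ + KA * a) + Q * (‖B x₀‖ + KB * a) + 1 := by simp [L]
      linarith [norm_add_le (A x) (q t • B x)]
    · simp only [sub_zero, zero_sub, neg_neg, max_self, NNReal.coe_zero]
      calc (L : ℝ) * δ ≤ L * (a / L) := by gcongr; exact min_le_right _ _
        _ = a := by field_simp
  obtain ⟨α, h0, hα⟩ := hp.exists_eq_forall_mem_Icc_hasDerivWithinAt₀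
  have hder : ∀ τ ∈ Ioo (-δ) δ, HasDerivAt α (A (α τ) + q τ • B (α τ)) τ := fun τ hτ =>
    (hα τ (Ioo_subset_Icc_self hτ)).hasDerivAt (Icc_mem_nhds hτ.1 hτ.2)
  have hc : ∀ᶠ τ in 𝓝 (0 : ℝ), α τ ∈ V := by
    refine (hder 0 ⟨by linarith, hδ⟩).continuousAt.eventually ?_
    change V ∈ 𝓝 (α 0)
    have h0' : α 0 = x₀ := h0
    rwa [h0']
  obtain ⟨ε, hε, hεV⟩ := Metric.eventually_nhds_iff.1 hc
  refine ⟨min ε δ, α, lt_min hε hδ, h0, fun τ hτ => ⟨hεV ?_, hder τ ⟨?_, ?_⟩⟩⟩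
  · rw [Real.dist_0_eq_abs, abs_lt]
    exact ⟨by linarith [hτ.1, min_le_left ε δ], by linarith [hτ.2, min_le_left ε δ]⟩
  · linarith [hτ.1, min_le_right ε δ]
  · linarith [hτ.2, min_le_right ε δ]

variable {Φ : STPoint → Val} {z u : STPoint} {M : ℝ}

/-- The gradient of `φ` in the direction `u`. -/
def dphi (Φ : STPoint → Val) (z u : STPoint) : ℝ := ∑ a, u a * pd a (fun y => (Φ y).2) z

/-- `(g^{ab} + u^a u^b) ∇_b φ`. -/
def scalarForce (Φ : STPoint → Val) (z u : STPoint) (a : Fin 4) : ℝ :=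
  ∑ b, (invMetric (Φ z).1 a b + u a * u b) * pd b (fun y => (Φ y).2) z

theorem form_scalarForce (hL : IsLorentzian (Φ z).1) :
    form (Φ z).1 u (scalarForce Φ z u) = (1 + form (Φ z).1 u u) * dphi Φ z u := by
  have h1 : scalarForce Φ z u = (fun a => ∑ b, invMetric (Φ z).1 a b * pd b (fun y => (Φ y).2) z) +
      dphi Φ z u • u := by
    ext a
    simp only [scalarForce, dphi, Pi.add_apply, Pi.smul_apply, smul_eq_mul, add_mul,
      sum_add_distrib, sum_mul]
    congr 1
    exact sum_congr rfl fun _ _ => by ring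
  rw [h1, map_add, map_smul, smul_eq_mul, one_add_mul, mul_comm (dphi Φ z u)]
  congr 1
  have h2 := fun a c => sum_mul_invMetric hL a c
  rw [form_apply, dphi]
  refine sum_congr rfl fun a _ => ?_
  calc ∑ b, (Φ z).1 a b * u a * ∑ c, invMetric (Φ z).1 b c * pd c (fun y => (Φ y).2) z =
      ∑ c, (∑ b, (Φ z).1 a b * invMetric (Φ z).1 b c) * (u a * pd c (fun y => (Φ y).2) z) := by
        simp only [mul_sum, sum_mul]
        rw [sum_comm]
        exact sum_congr₂
    _ = _ := by simp [h2]

theorem exists_motion {U : Set STPoint} (hU : IsOpen U) (hΦ : ContDiffOn ℝ ∞ Φ U)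
    (hL : ∀ x ∈ U, IsLorentzian (Φ x).1) {q : ℝ → ℝ} (hq : Continuous q) {z₀ u₀ : STPoint}
    {M₀ : ℝ} (hz₀ : z₀ ∈ U) (hM₀ : M₀ ≠ 0) :
    ∃ (ε : ℝ) (z u : ℝ → STPoint) (M : ℝ → ℝ), 0 < ε ∧ z 0 = z₀ ∧ u 0 = u₀ ∧ M 0 = M₀ ∧
      ∀ τ ∈ Ioo (-ε) ε, z τ ∈ U ∧ M τ ≠ 0 ∧ HasDerivAt z (u τ) τ ∧
        HasDerivAt u ((q τ / M τ) • scalarForce Φ (z τ) (u τ) -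
          conn (christoffel (jet 2 Φ (z τ))) (u τ) (u τ)) τ ∧
        HasDerivAt M (-q τ * dphi Φ (z τ) (u τ)) τ := by
  set A : STPoint × STPoint × ℝ → STPoint × STPoint × ℝ := fun p =>
    (p.2.1, -conn (christoffel (jet 2 Φ p.1)) p.2.1 p.2.1, 0)
  set B : STPoint × STPoint × ℝ → STPoint × STPoint × ℝ := fun p =>
    (0, p.2.2⁻¹ • scalarForce Φ p.1 p.2.1, -dphi Φ p.1 p.2.1)
  have hΦ0 : SmoothAt Φ z₀ := hΦ.contDiffAt (hU.mem_nhds hz₀)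
  have hfst : ∀ {Y : Type} [NormedAddCommGroup Y] [NormedSpace ℝ Y] {F : STPoint → Y},
      SmoothAt F z₀ → SmoothAt (fun p : STPoint × STPoint × ℝ => F p.1) (z₀, u₀, M₀) :=
    fun {Y _ _ F} hF => ContDiffAt.comp (g := F) (z₀, u₀, M₀) hF contDiffAt_fst
  have hu : ∀ a, SmoothAt (fun p : STPoint × STPoint × ℝ => p.2.1 a) (z₀, u₀, M₀) := fun a =>
    contDiffAt_pi.1 (contDiff_fst.comp contDiff_snd).contDiffAt a
  have hM : SmoothAt (fun p : STPoint × STPoint × ℝ => p.2.2) (z₀, u₀, M₀) :=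
    (contDiff_snd.comp contDiff_snd).contDiffAt
  have hdφ : ∀ a, SmoothAt (fun p : STPoint × STPoint × ℝ => pd a (fun y => (Φ y).2) p.1)
      (z₀, u₀, M₀) := fun a => hfst (contDiffAt_pd hΦ0.snd)
  have hA : SmoothAt A (z₀, u₀, M₀) := by
    refine ContDiffAt.prodMk (contDiff_fst.comp contDiff_snd).contDiffAt
      (ContDiffAt.prodMk (contDiffAt_pi.2 fun μ => ?_) contDiffAt_const)
    change SmoothAt (fun p : STPoint × STPoint × ℝ =>
      -∑ a, ∑ b, christoffel (jet 2 Φ p.1) μ a b * p.2.1 a * p.2.1 b) _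
    exact (ContDiffAt.sum fun a _ => ContDiffAt.sum fun b _ =>
      ((hfst (contDiffAt_jet_comp (contDiffAt_christoffel (by rw [jg_eq]; exact hL _ hz₀) μ a b)
        hΦ0)).mul (hu a)).mul (hu b)).neg
  have hB : SmoothAt B (z₀, u₀, M₀) := by
    refine ContDiffAt.prodMk contDiffAt_const (ContDiffAt.prodMk
      ((hM.inv hM₀).smul (contDiffAt_pi.2 fun a => ?_))
      (ContDiffAt.sum fun a _ => (hu a).mul (hdφ a)).neg)
    exact ContDiffAt.sum fun b _ => (((hfst (ContDiffAt.comp (g := fun g => invMetric g a b)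
      (f := fun y => (Φ y).1) z₀ (contDiffAt_invMetric (hL _ hz₀) a b) hΦ0.fst)).add
      ((hu a).mul (hu b)))).mul (hdφ b)
  have hV : {p : STPoint × STPoint × ℝ | p.1 ∈ U ∧ p.2.2 ≠ 0} ∈ 𝓝 (z₀, u₀, M₀) :=
    ((hU.preimage continuous_fst).inter (isOpen_compl_singleton.preimage
      (continuous_snd.comp continuous_snd))).mem_nhds ⟨hz₀, hM₀⟩
  obtain ⟨ε, α, hε, h0, h⟩ := exists_solution (hA.of_le (by simp)) (hB.of_le (by simp)) hq hV
  refine ⟨ε, fun τ => (α τ).1, fun τ => (α τ).2.1, fun τ => (α τ).2.2, hε, by simp [h0],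
    by simp [h0], by simp [h0], fun τ hτ => ?_⟩
  obtain ⟨⟨h1, h2⟩, h3⟩ := h τ hτ
  have k1 : HasDerivAt (fun τ => (α τ).1) _ τ := h3.fst
  have k2 : HasDerivAt (fun τ => (α τ).2.1) _ τ := h3.snd.fst
  have k3 : HasDerivAt (fun τ => (α τ).2.2) _ τ := h3.snd.snd
  refine ⟨h1, h2, k1.congr_deriv (by simp [A, B]), k2.congr_deriv ?_,
    k3.congr_deriv (by simp [A, B])⟩
  simp only [A, B, Prod.snd_add, Prod.smul_snd, Prod.fst_add, Prod.smul_fst, smul_smul]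
  rw [div_eq_mul_inv, neg_add_eq_sub]

theorem form_velocity {U : Set STPoint} (hU : IsOpen U) (hΦ : ContDiffOn ℝ ∞ Φ U)
    (hL : ∀ x ∈ U, IsLorentzian (Φ x).1) {q : ℝ → ℝ} {ε : ℝ} {z u : ℝ → STPoint} {M : ℝ → ℝ}
    (h0' : ∑ a, ∑ b, (Φ (z 0)).1 a b * u 0 a * u 0 b = -1)
    (h : ∀ τ ∈ Ioo (-ε) ε, z τ ∈ U ∧ M τ ≠ 0 ∧ HasDerivAt z (u τ) τ ∧
        HasDerivAt u ((q τ / M τ) • scalarForce Φ (z τ) (u τ) -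
          conn (christoffel (jet 2 Φ (z τ))) (u τ) (u τ)) τ ∧
        HasDerivAt M (-q τ * dphi Φ (z τ) (u τ)) τ) :
    ∀ τ ∈ Ioo (-ε) ε, form (Φ (z τ)).1 (u τ) (u τ) = -1 := by
  have hΦz : ∀ τ ∈ Ioo (-ε) ε, SmoothAt Φ (z τ) := fun τ hτ =>
    hΦ.contDiffAt (hU.mem_nhds (h τ hτ).1)
  have hN : ∀ τ ∈ Ioo (-ε) ε,
      HasDerivAt (fun τ => M τ ^ 2 * (1 + form (Φ (z τ)).1 (u τ) (u τ))) 0 τ := by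
    intro τ hτ
    obtain ⟨hzU, hMτ, hz, hu, hM⟩ := h τ hτ
    have hg : HasDerivAt (fun τ => (Φ (z τ)).1) (𝒟 Φ (z τ) (u τ)).1 τ :=
      (HasFDerivAt.comp_hasDerivAt (l := Φ) τ (hΦz τ hτ).diff.hasFDerivAt hz).fst
    have hLz := hL _ hzU
    have hk := form_christoffel (j := jet 2 Φ (z τ)) (by rwa [jg_eq]) (u τ) (u τ) (u τ)
    rw [sum_smul_jdg, jg_eq] at hk
    have hf := form_scalarForce (u := u τ) hLz
    refine ((hM.fun_pow 2).fun_mul ((hasDerivAt_form hg hu hu).const_add 1)).congr_deriv ?_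
    simp only [map_sub, LinearMap.sub_apply, map_smul, LinearMap.smul_apply, smul_eq_mul,
      form_symm hLz.symm (scalarForce Φ (z τ) (u τ)), hf,
      form_symm hLz.symm (u τ) (conn _ _ _), hk]
    field_simp
    ring
  intro τ hτ
  have h0 : (0 : ℝ) ∈ Ioo (-ε) ε := ⟨by linarith [hτ.1, hτ.2], by linarith [hτ.1, hτ.2]⟩
  have hc := (convex_Ioo (-ε) ε).is_const_of_fderivWithin_eq_zero (𝕜 := ℝ)
    (f := fun τ => M τ ^ 2 * (1 + form (Φ (z τ)).1 (u τ) (u τ)))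
    (fun t ht => (hN t ht).differentiableAt.differentiableWithinAt) (fun t ht => by
      rw [fderivWithin_of_isOpen isOpen_Ioo ht]
      ext
      simp [(hN t ht).deriv]) hτ h0
  rw [form_apply (Φ (z 0)).1, h0'] at hc
  have := (mul_eq_zero.1 (hc.trans (by ring))).resolve_left (pow_ne_zero 2 (h τ hτ).2.1)
  linarith

theorem exists_motion_of_charge {U : Set STPoint} (hU : IsOpen U) (hΦ : ContDiffOn ℝ ∞ Φ U)
    (hL : ∀ x ∈ U, IsLorentzian (Φ x).1) {q : ℝ → ℝ} (hq : Continuous q) {z₀ u₀ : STPoint}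
    {M₀ : ℝ} (hz₀ : z₀ ∈ U) (hu₀ : ∑ a, ∑ b, (Φ z₀).1 a b * u₀ a * u₀ b = -1) (hM₀ : M₀ ≠ 0) :
    ∃ (ε : ℝ) (z : ℝ → STPoint) (M : ℝ → ℝ), 0 < ε ∧ z 0 = z₀ ∧ deriv z 0 = u₀ ∧ M 0 = M₀ ∧
      ContDiffOn ℝ 2 z (Ioo (-ε) ε) ∧ ContDiffOn ℝ 1 M (Ioo (-ε) ε) ∧
      ∀ τ ∈ Ioo (-ε) ε, z τ ∈ U ∧ (∑ a, ∑ b, (Φ (z τ)).1 a b * deriv z τ a * deriv z τ b = -1) ∧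
        ObeysMotionLaw Φ z M q τ := by
  obtain ⟨ε, z, u, M, hε, hz0, hu0, hM0, h⟩ := exists_motion (u₀ := u₀) hU hΦ hL hq hz₀ hM₀
  have h0 : (0 : ℝ) ∈ Ioo (-ε) ε := ⟨by linarith, hε⟩
  have hΦz : ∀ τ ∈ Ioo (-ε) ε, SmoothAt Φ (z τ) := fun τ hτ =>
    hΦ.contDiffAt (hU.mem_nhds (h τ hτ).1)
  have hunit := form_velocity hU hΦ hL (by rw [hz0, hu0]; exact hu₀) h
  have hdz : ∀ τ ∈ Ioo (-ε) ε, deriv z τ = u τ := fun τ hτ => (h τ hτ).2.2.1.deriv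
  have hspeed : ∀ τ ∈ Ioo (-ε) ε, speed Φ z τ = 1 := fun τ hτ => by
    have := hunit τ hτ
    rw [form_apply] at this
    rw [speed, hdz τ hτ, this, neg_neg, Real.sqrt_one]
  have hvel : ∀ τ ∈ Ioo (-ε) ε, fourVel Φ z τ = u τ := fun τ hτ => by
    ext a
    rw [fourVel, hspeed τ hτ, hdz τ hτ, div_one]
  have hzc : ContinuousOn z (Ioo (-ε) ε) := fun τ hτ => (h τ hτ).2.2.1.continuousAt.continuousWithinAt
  have huc : ContinuousOn u (Ioo (-ε) ε) := fun τ hτ =>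
    (h τ hτ).2.2.2.1.continuousAt.continuousWithinAt
  have hMc : ContinuousOn M (Ioo (-ε) ε) := fun τ hτ =>
    (h τ hτ).2.2.2.2.continuousAt.continuousWithinAt
  have hcomp : ∀ {Y : Type} [TopologicalSpace Y] {F : STPoint → Y},
      (∀ τ ∈ Ioo (-ε) ε, ContinuousAt F (z τ)) → ContinuousOn (fun τ => F (z τ)) (Ioo (-ε) ε) :=
    fun {Y _ F} hF τ hτ => (hF τ hτ).comp_continuousWithinAt (hzc τ hτ)
  have huca : ∀ a, ContinuousOn (fun τ => u τ a) (Ioo (-ε) ε) := fun a => continuousOn_pi.1 huc a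
  have hdφc : ∀ b, ContinuousOn (fun τ => pd b (fun y => (Φ y).2) (z τ)) (Ioo (-ε) ε) := fun b =>
    hcomp fun τ hτ => (contDiffAt_pd (hΦz τ hτ).snd).continuousAt
  have hM1 : ContDiffOn ℝ 1 M (Ioo (-ε) ε) := by
    rw [show (1 : WithTop ℕ∞) = 0 + 1 from rfl, contDiffOn_succ_iff_deriv_of_isOpen isOpen_Ioo]
    refine ⟨fun τ hτ => (h τ hτ).2.2.2.2.differentiableAt.differentiableWithinAt, by simp, ?_⟩
    rw [contDiffOn_zero]
    refine ContinuousOn.congr ?_ fun τ hτ => (h τ hτ).2.2.2.2.deriv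
    exact hq.continuousOn.neg.mul (continuousOn_finsetSum _ fun a _ => (huca a).mul (hdφc a))
  have hu1 : ContDiffOn ℝ 1 u (Ioo (-ε) ε) := by
    rw [show (1 : WithTop ℕ∞) = 0 + 1 from rfl, contDiffOn_succ_iff_deriv_of_isOpen isOpen_Ioo]
    refine ⟨fun τ hτ => (h τ hτ).2.2.2.1.differentiableAt.differentiableWithinAt, by simp, ?_⟩
    rw [contDiffOn_zero]
    refine ContinuousOn.congr ?_ fun τ hτ => (h τ hτ).2.2.2.1.deriv
    have k1 : ContinuousOn (fun τ => scalarForce Φ (z τ) (u τ)) (Ioo (-ε) ε) := by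
      refine continuousOn_pi.2 fun a => continuousOn_finsetSum _ fun b _ =>
        ((hcomp (F := fun y => invMetric (Φ y).1 a b) fun τ hτ => ?_).add ((huca a).mul (huca b))).mul (hdφc b)
      exact ContinuousAt.comp (g := fun g => invMetric g a b) (f := fun y => (Φ y).1)
        (contDiffAt_invMetric (hL _ (h τ hτ).1) a b).continuousAt (hΦz τ hτ).fst.continuousAt
    have k2 : ContinuousOn (fun τ => conn (christoffel (jet 2 Φ (z τ))) (u τ) (u τ))
        (Ioo (-ε) ε) := by
      refine continuousOn_pi.2 fun μ => ?_
      change ContinuousOn (fun τ => ∑ a, ∑ b, christoffel (jet 2 Φ (z τ)) μ a b * u τ a * u τ b) _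
      refine continuousOn_finsetSum _ fun a _ => continuousOn_finsetSum _ fun b _ =>
        ((hcomp (F := fun y => christoffel (jet 2 Φ y) μ a b) fun τ hτ => ?_).mul
          (huca a)).mul (huca b)
      exact (contDiffAt_jet_comp (contDiffAt_christoffel (by
        rw [jg_eq]; exact hL _ (h τ hτ).1) μ a b) (hΦz τ hτ)).continuousAt
    exact ((hq.continuousOn.div hMc fun τ hτ => (h τ hτ).2.1).smul k1).sub k2
  refine ⟨ε, z, M, hε, hz0, by rw [hdz 0 h0, hu0], hM0, ?_, hM1, fun τ hτ => ⟨(h τ hτ).1, ?_, ?_⟩⟩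
  · rw [show (2 : WithTop ℕ∞) = 1 + 1 from by norm_num,
      contDiffOn_succ_iff_deriv_of_isOpen isOpen_Ioo]
    exact ⟨fun τ hτ => (h τ hτ).2.2.1.differentiableAt.differentiableWithinAt, by simp,
      hu1.congr hdz⟩
  · rw [hdz τ hτ, ← form_apply, hunit τ hτ]
  · obtain ⟨hzU, hMτ, hz, hu, hM⟩ := h τ hτ
    refine ⟨fun a => ?_, ?_⟩
    · have hd : deriv (fun s => fourVel Φ z s a) τ = deriv (fun s => u s a) τ :=
        Filter.EventuallyEq.deriv_eq ((isOpen_Ioo.eventually_mem hτ).mono fun s hs =>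
          congrFun (hvel s hs) a)
      rw [fourAcc, hd, (hasDerivAt_pi.1 hu a).deriv, hspeed τ hτ, div_one]
      simp only [hvel τ hτ, gradPhi]
      change M τ * (q τ / M τ * scalarForce Φ (z τ) (u τ) a - form _ (u τ) (u τ) + _) =
        q τ * scalarForce Φ (z τ) (u τ) a
      rw [form_apply, sub_add_cancel]
      field_simp
    · rw [hM.deriv, hspeed τ hτ, div_one, hvel τ hτ]
      rfl

end Motion

/-! ### Integration on three-space -/

section Polar

theorem integral_polar (f : E3 → ℝ) (u : ℝ → ℝ) (w : E3 → ℝ)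
    (h : ∀ r > 0, ∀ n : E3, ‖n‖ = 1 → f (r • n) = u r * w n) :
    ∫ y, f y = (∫ r in Ioi (0 : ℝ), r ^ 2 * u r) *
      ∫ n : Metric.sphere (0 : E3) 1, w n ∂(volume : Measure E3).toSphere := by
  have hd : Module.finrank ℝ E3 - 1 = 2 := by simp
  have h1 : ∫ y, f y = ∫ y : ({0}ᶜ : Set E3), f y ∂((volume : Measure E3).comap (↑)) := by
    rw [integral_subtype_comap (measurableSet_singleton _).compl f, restrict_compl_singleton]
  have h2 := (volume : Measure E3).measurePreserving_homeomorphUnitSphereProd.integral_comp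
    (Homeomorph.measurableEmbedding _) (fun p : Metric.sphere (0 : E3) 1 × Ioi (0 : ℝ) =>
      w p.1 * u p.2)
  rw [h1, mul_comm, ← hd]
  have h3 : ∫ r in Ioi (0 : ℝ), r ^ (Module.finrank ℝ E3 - 1) * u r =
      ∫ r : Ioi (0 : ℝ), u r ∂(Measure.volumeIoiPow (Module.finrank ℝ E3 - 1)) := by
    rw [Measure.volumeIoiPow, integral_withDensity_eq_integral_toReal_smul (by fun_prop) (by simp),
      integral_subtype_comap measurableSet_Ioi fun a : ℝ =>
        (ENNReal.ofReal (a ^ (Module.finrank ℝ E3 - 1))).toReal • u a]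
    refine setIntegral_congr_fun measurableSet_Ioi fun r hr => ?_
    rw [ENNReal.toReal_ofReal (pow_nonneg (le_of_lt hr) _), smul_eq_mul]
  rw [h3, ← integral_prod_mul, ← h2]
  refine integral_congr (fun y => ?_)
  have hy : (y : E3) ≠ 0 := y.2
  obtain ⟨e1, e2⟩ := exists_unit_smul hy
  have := h ‖(y : E3)‖ (norm_pos_iff.2 hy) _ e1
  rw [e2] at this
  simp [this, mul_comm]

/-- The cutoff profile: `1` up to `1` and `0` from `2` on. -/
def profile (s : ℝ) : ℝ := Real.smoothTransition (2 - s)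

theorem contDiff_profile : Smooth profile :=
  Real.smoothTransition.contDiff.comp (contDiff_const.sub contDiff_id)

theorem profile_of_le {s : ℝ} (h : s ≤ 1) : profile s = 1 :=
  Real.smoothTransition.one_of_one_le (by linarith)

theorem profile_of_ge {s : ℝ} (h : 2 ≤ s) : profile s = 0 :=
  Real.smoothTransition.zero_of_nonpos (by linarith)

theorem integral_radial {κ : ℝ → ℝ} {a : ℝ} (hκ : Smooth κ) (h1 : ∀ s, a ≤ s → κ s = 0) {w : E3 → ℝ}
    (hw : ∀ r > 0, ∀ n : E3, ‖n‖ = 1 → w (r • n) = r⁻¹ * w n) :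
    ∫ y, 2 * deriv κ (‖y‖ ^ 2) * w y =
      -κ 0 * ∫ n : Metric.sphere (0 : E3) 1, w n ∂(volume : Measure E3).toSphere := by
  rw [integral_polar _ (fun r => 2 * deriv κ (r ^ 2) * r⁻¹) w fun r hr n hn => by
    rw [hw r hr n hn, norm_smul, hn, mul_one, norm_of_nonneg (le_of_lt hr)]; ring]
  congr 1
  have hd : ∀ r : ℝ, HasDerivAt (fun r => κ (r ^ 2)) (2 * r * deriv κ (r ^ 2)) r := fun r => by
    have e1 := (hκ.differentiable (by simp) (r ^ 2)).hasDerivAt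
    have e2 := HasDerivAt.comp (h := fun r : ℝ => r ^ 2) r e1 (hasDerivAt_pow 2 r)
    refine e2.congr_deriv ?_
    simp; ring
  have hzero : ∀ r : ℝ, max 1 a < r → deriv κ (r ^ 2) = 0 := fun r hr => by
    have h2 : a < r ^ 2 := by nlinarith [(le_max_left 1 a).trans_lt hr, (le_max_right 1 a).trans_lt hr]
    have : κ =ᶠ[𝓝 (r ^ 2)] fun _ => 0 := (eventually_gt_nhds h2).mono fun s hs => h1 s hs.le
    rw [this.deriv_eq, deriv_const]
  have hcont : Continuous fun r : ℝ => 2 * r * deriv κ (r ^ 2) :=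
    (continuous_const.mul continuous_id).mul ((hκ.continuous_deriv (by simp)).comp (continuous_pow 2))
  have e : ∫ r in Ioi (0 : ℝ), r ^ 2 * (2 * deriv κ (r ^ 2) * r⁻¹) =
      ∫ r in Ioi (0 : ℝ), 2 * r * deriv κ (r ^ 2) :=
    setIntegral_congr_fun measurableSet_Ioi fun r hr => by
      have : r ≠ 0 := ne_of_gt hr
      field_simp
  rw [e, integral_Ioi_of_hasDerivAt_of_tendsto' (m := 0) (fun r _ => hd r)]
  · simp
  · rw [← Ioc_union_Ioi_eq_Ioi (show (0 : ℝ) ≤ max 1 a from zero_le_one.trans (le_max_left _ _))]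
    refine (hcont.integrableOn_Ioc).union ?_
    exact IntegrableOn.congr_fun (f := fun _ : ℝ => (0 : ℝ))
      (g := fun r => 2 * r * deriv κ (r ^ 2)) integrableOn_zero
      (fun r hr => by simp [hzero r hr]) measurableSet_Ioi
  · refine tendsto_const_nhds.congr' ?_
    filter_upwards [eventually_gt_atTop (max 1 a)] with r hr
    exact (h1 _ (by nlinarith [(le_max_left 1 a).trans_lt hr, (le_max_right 1 a).trans_lt hr])).symm

theorem integral_fderiv_eq_zero {f : E3 → ℝ} (hf : ContDiff ℝ 1 f) (hc : HasCompactSupport f)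
    (v : E3) : ∫ y, 𝒟 f y v = 0 := by
  have := integral_bilinear_hasFDerivAt_right_eq_neg_left_of_integrable (μ := volume)
    (f := fun _ : E3 => (1 : ℝ)) (f' := fun _ => 0) (g := f) (g' := 𝒟 f)
    (v := v) (B := ContinuousLinearMap.lsmul ℝ ℝ) (by simp)
    (by
      simp only [ContinuousLinearMap.lsmul_apply, one_smul]
      exact ((hf.continuous_fderiv (by simp)).clm_apply continuous_const).integrable_of_hasCompactSupport
        (hc.fderiv_apply (𝕜 := ℝ) v))
    (by
      simp only [ContinuousLinearMap.lsmul_apply, one_smul]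
      exact hf.continuous.integrable_of_hasCompactSupport hc)
    (fun x _ => hasFDerivAt_const _ _)
    (fun x _ => (hf.differentiable (by simp) x).hasFDerivAt)
  simpa using this

/-- Integration by parts against a function that is singular where the weight vanishes. -/
theorem integral_mul_fderiv {u h : E3 → ℝ} (hu : Smooth u) (hc : HasCompactSupport u)
    (hu0 : ∀ᶠ y in 𝓝 0, u y = 0) (hh : ∀ y ≠ 0, SmoothAt h y) (v : E3) :
    Integrable (fun y => 𝒟 u y v * h y) ∧ Integrable (fun y => u y * 𝒟 h y v) ∧
    ∫ y, 𝒟 u y v * h y = -∫ y, u y * 𝒟 h y v := by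
  have hsmooth : ∀ {a b : E3 → ℝ}, Smooth a → (∀ᶠ y in 𝓝 0, a y = 0) →
      (∀ y ≠ 0, SmoothAt b y) → Smooth fun y => a y * b y := by
    intro a b ha ha0 hb
    refine contDiff_iff_contDiffAt.2 fun y => ?_
    by_cases hy : y = 0
    · subst hy
      exact contDiffAt_const.congr_of_eventuallyEq
        (ha0.mono fun z hz => show a z * b z = (0 : ℝ) by rw [hz, zero_mul])
    · exact ha.contDiffAt.mul (hb y hy)
  have hu' : ∀ᶠ y in 𝓝 0, 𝒟 u y v = 0 := by
    filter_upwards [hu0.eventually_nhds] with y hy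
    have : u =ᶠ[𝓝 y] fun _ => 0 := hy
    rw [this.fderiv_eq]
    simp
  have s1 : Smooth fun y => 𝒟 u y v * h y :=
    hsmooth ((hu.fderiv_right (m := ∞) (by simp)).clm_apply contDiff_const) hu' hh
  have s2 : Smooth fun y => u y * 𝒟 h y v :=
    hsmooth hu hu0 fun y hy => ((hh y hy).fderiv_right (m := ∞) (by simp)).clm_apply contDiffAt_const
  have i1 : Integrable fun y => 𝒟 u y v * h y :=
    s1.continuous.integrable_of_hasCompactSupport (hc.fderiv_apply (𝕜 := ℝ) v).mul_right
  have i2 : Integrable fun y => u y * 𝒟 h y v :=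
    s2.continuous.integrable_of_hasCompactSupport hc.mul_right
  refine ⟨i1, i2, ?_⟩
  have h0 := integral_fderiv_eq_zero ((hsmooth hu hu0 hh).of_le (by simp)) (hc.mul_right (f' := h)) v
  have e : ∀ y, 𝒟 (fun y => u y * h y) y v = 𝒟 u y v * h y + u y * 𝒟 h y v := by
    intro y
    by_cases hy : y = 0
    · subst hy
      have e1 : (fun y => u y * h y) =ᶠ[𝓝 0] fun _ => (0 : ℝ) := hu0.mono fun z hz => by simp [hz]
      rw [e1.fderiv_eq, hu'.self_of_nhds, hu0.self_of_nhds]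
      simp
    · rw [fderiv_fun_mul (hu.differentiable (by simp) y) (hh y hy).diff]
      simp
      ring
  have h0' : ∫ y, 𝒟 (fun y => u y * h y) y v = 0 := h0
  simp only [e] at h0'
  rw [integral_add i1 i2] at h0'
  linarith

end Polar

/-! ### The source of Einstein-scalar theory -/

section EinsteinSource

theorem idx2_injective {α β α' β' : Fin 4} (h : idx2 α β = idx2 α' β') : α = α' ∧ β = β' := by
  have h1 : (fun a : Fin 2 => if (a : ℕ) = 0 then α else β) =
    fun a : Fin 2 => if (a : ℕ) = 0 then α' else β' := eq_of_heq (Sigma.mk.inj h).2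
  exact ⟨by simpa using congrFun h1 0, by simpa using congrFun h1 1⟩

theorem sum_single_idx2 (H : Fin 4 → Fin 4 → Val) (α β : Fin 4) :
    (∑ a, ∑ b, Pi.single (idx2 a b) (H a b) : Jet 2) (idx2 α β) = H α β := by
  simp only [Finset.sum_apply]
  rw [sum_eq_single α, sum_eq_single β]
  · simp
  · intro b _ hb
    exact Pi.single_eq_of_ne (fun h => hb (idx2_injective h).2.symm) _
  · simp
  · intro a _ ha
    exact sum_eq_zero fun b _ => Pi.single_eq_of_ne (fun h => ha (idx2_injective h).1.symm) _
  · simp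

theorem sum_single_idx2_of_ne (H : Fin 4 → Fin 4 → Val) {I : JetIdx 2} (hI : I.1 ≠ 2) :
    (∑ a, ∑ b, Pi.single (idx2 a b) (H a b) : Jet 2) I = 0 := by
  simp only [Finset.sum_apply]
  refine sum_eq_zero fun a _ => sum_eq_zero fun b _ => Pi.single_eq_of_ne ?_ _
  rintro rfl
  exact hI rfl

/-- The integrand of the part of the Ricci tensor with second derivatives. -/
def ricciTop (k : Fin 4 → Fin 4 → Tensor) (μ σ α β : Fin 4) : ℝ :=
  1 / 2 * (k μ α σ β + k μ β σ α - k μ σ α β - (k β μ σ α + k β α σ μ - k β σ μ α))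

theorem fderiv_esOperator {j k : Jet 2} (hj : IsLorentzian (jg j)) (h0 : k (idx0 2) = 0)
    (h1 : ∀ α, k (idx1 α) = 0) : 𝒟 esOperator j k =
      (fun a b => (∑ μ, ∑ σ, jinv j μ σ * ricciTop (jddg k) μ σ a b) -
        1 / 2 * (∑ c, ∑ d, jinv j c d * ∑ μ, ∑ σ, jinv j μ σ * ricciTop (jddg k) μ σ c d) * jg j a b,
      4 * ∑ a, ∑ b, jinv j a b * jddphi k a b) := by
  have hl := hasDerivAt_line (contDiffAt_esOperator hj).diff k
  have e1 : ∀ s : ℝ, jg (j + s • k) = jg j := fun s => by ext; simp [jg, h0]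
  have e2 : ∀ s : ℝ, jinv (j + s • k) = jinv j := fun s => by ext; simp [jinv, e1]
  have e3 : ∀ s : ℝ, jdg (j + s • k) = jdg j := fun s => by ext; simp [jdg, h1]
  have e4 : ∀ s : ℝ, jdphi (j + s • k) = jdphi j := fun s => by ext; simp [jdphi, h1]
  have e5 : ∀ (s : ℝ) α β μ ν, jddg (j + s • k) α β μ ν = jddg j α β μ ν + s * jddg k α β μ ν :=
    fun s α β μ ν => by simp [jddg]
  have e6 : ∀ (s : ℝ) α β, jddphi (j + s • k) α β = jddphi j α β + s * jddphi k α β :=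
    fun s α β => by simp [jddphi]
  have e7 : ∀ s : ℝ, christoffel (j + s • k) = christoffel j := fun s => by
    ext; simp [christoffel, e2, e3]
  have e8 : ∀ (s : ℝ) α β, ricci (j + s • k) α β = ricci j α β +
      s * ∑ μ, ∑ σ, jinv j μ σ * ricciTop (jddg k) μ σ α β := by
    intro s α β
    have h2 : ∀ ρ μ α β, dchristoffel (j + s • k) ρ μ α β = dchristoffel j ρ μ α β +
        s * (1 / 2 * ∑ σ, jinv j μ σ * (jddg k ρ α σ β + jddg k ρ β σ α - jddg k ρ σ α β)) := by
      intro ρ μ α β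
      simp only [dchristoffel, jdinv, e2, e3, e5, mul_sum, ← sum_add_distrib]
      exact sum_congr rfl fun _ _ => by ring
    have h3 : ∑ μ, ∑ σ, jinv j μ σ * ricciTop (jddg k) μ σ α β =
        ∑ μ, (1 / 2 * ∑ σ, jinv j μ σ * (jddg k μ α σ β + jddg k μ β σ α - jddg k μ σ α β) -
          1 / 2 * ∑ σ, jinv j μ σ * (jddg k β μ σ α + jddg k β α σ μ - jddg k β σ μ α)) := by
      simp only [ricciTop, mul_sum, ← sum_sub_distrib]
      exact sum_congr₂
    rw [h3]
    simp only [ricci, e7, h2, sum_sub_distrib, sum_add_distrib, ← mul_sum]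
    ring
  set D : Val := _
  change _ = D
  refine hl.unique ?_
  have h9 : ∀ s : ℝ, scalarCurv (j + s • k) = scalarCurv j +
      s * ∑ c, ∑ d, jinv j c d * ∑ μ, ∑ σ, jinv j μ σ * ricciTop (jddg k) μ σ c d := by
    intro s
    have : ∀ a b X, jinv j a b * (ricci j a b + s * X) = jinv j a b * ricci j a b +
      s * (jinv j a b * X) := fun a b X => by ring
    simp only [scalarCurv, e2, e8, this, sum_add_distrib, ← mul_sum]
  have h10 : ∀ s : ℝ, esOperator (j + s • k) = esOperator j + s • D := by
    intro s
    refine Prod.ext (funext fun a => funext fun b => ?_) ?_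
    · simp only [esOperator, e1, e8, h9, e4, gradSq, e2, D, Prod.fst_add, Prod.smul_fst,
        Pi.add_apply, Pi.smul_apply, smul_eq_mul]
      ring
    · simp only [esOperator, e2, e4, e6, e7, D, Prod.snd_add, Prod.smul_snd, smul_eq_mul]
      have : ∀ a b, jinv j a b * (jddphi j a b + s * jddphi k a b - ∑ c, christoffel j c a b * jdphi j c) =
          jinv j a b * (jddphi j a b - ∑ c, christoffel j c a b * jdphi j c) +
          s * (jinv j a b * jddphi k a b) := fun a b => by ring
      simp only [this, sum_add_distrib, ← mul_sum]
      ring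
  simp only [h10]
  simpa using ((hasDerivAt_id (0 : ℝ)).smul_const D).const_add (esOperator j)

section Frame

variable {b : Tensor} {A : Mat4}

/-- The components of a tensor in the frame of the columns of `A`. -/
def frame4 (A : Mat4) (T : Fin 4 → Fin 4 → Tensor) (a b c d : Fin 4) : ℝ :=
  ∑ α, ∑ β, ∑ μ, ∑ ν, A α a * A β b * A μ c * A ν d * T α β μ ν

/-- The Minkowski metric. -/
def mink : Fin 4 → ℝ := ![-1, 1, 1, 1]

variable (hA : IsInertialFrame b A)
include hA

theorem IsInertialFrame.inv_eq (μ σ : Fin 4) : invMetric b μ σ = ∑ c, mink c * (A μ c * A σ c) := by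
  set η : Mat4 := Matrix.diagonal mink
  have hη : η * η = 1 := by
    rw [Matrix.diagonal_mul_diagonal, ← Matrix.diagonal_one]
    congr 1
    ext i; fin_cases i <;> simp [mink]
  have h1 : (η * Aᵀ * of b) * A = 1 := by
    rw [Matrix.mul_assoc, Matrix.mul_assoc, ← Matrix.mul_assoc Aᵀ, hA.1]
    exact hη
  have h2 := mul_eq_one_comm.1 h1
  have h3 : (A * η * Aᵀ) * of b = 1 := by rw [← h2]; simp only [Matrix.mul_assoc]
  rw [invMetric, Matrix.inv_eq_left_inv h3, mul_apply]
  simp only [η, Matrix.mul_diagonal, transpose_apply]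
  exact sum_congr rfl fun c _ => by ring

theorem IsInertialFrame.b00 : A 0 0 ^ 2 * b 0 0 = -1 := by
  have := congrFun (congrFun hA.1 0) 0
  rw [mul_apply] at this
  simp only [mul_apply, transpose_apply, of_apply, Fin.sum_univ_succ] at this
  simp [hA.2] at this
  linarith

theorem IsInertialFrame.trace (S : Tensor) : ∑ μ, ∑ σ, invMetric b μ σ * S μ σ =
    ∑ c, mink c * ∑ μ, ∑ σ, A μ c * A σ c * S μ σ := by
  simp only [hA.inv_eq, sum_mul, mul_sum]
  rw [sum_congr rfl fun μ _ => sum_comm, sum_comm]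
  exact sum_congr₂ fun _ _ => sum_congr rfl fun _ _ => by ring

theorem IsInertialFrame.frame_trace (T : Fin 4 → Fin 4 → Tensor) (c d : Fin 4) :
    ∑ α, ∑ β, A α c * A β d * ∑ μ, ∑ σ, invMetric b μ σ * T μ σ α β =
      ∑ e, mink e * frame4 A T e e c d := by
  have h : ∀ α β, A α c * A β d * ∑ μ, ∑ σ, invMetric b μ σ * T μ σ α β =
      ∑ μ, ∑ σ, invMetric b μ σ * (A α c * A β d * T μ σ α β) := fun α β => by
    simp only [mul_sum]
    exact sum_congr₂
  simp only [h]
  rw [sum_four_swap₂₃, sum_four_swap₁₂, sum_four_swap₃₄, sum_four_swap₂₃]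
  have h2 := hA.trace fun μ σ => ∑ α, ∑ β, A α c * A β d * T μ σ α β
  simp only [mul_sum] at h2
  refine h2.trans (sum_congr rfl fun e _ => ?_)
  simp only [frame4, mul_sum]
  exact sum_congr₂ fun _ _ => sum_congr₂ fun _ _ => by ring

omit hA in
theorem frame4_ricciTop (k : Fin 4 → Fin 4 → Tensor) (c d e f : Fin 4) :
    frame4 A (ricciTop k) c d e f = ricciTop (frame4 A k) c d e f := by
  have h1 : ∑ α, ∑ β, ∑ μ, ∑ ν, A α c * A β d * A μ e * A ν f * k α μ β ν = frame4 A k c e d f := by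
    rw [sum_four_swap₂₃]; simp only [frame4]
    exact sum_congr₂ fun _ _ => sum_congr₂ fun _ _ => by ring
  have h2 : ∑ α, ∑ β, ∑ μ, ∑ ν, A α c * A β d * A μ e * A ν f * k α ν β μ = frame4 A k c f d e := by
    rw [sum_four_swap₃₄, sum_four_swap₂₃]; simp only [frame4]
    exact sum_congr₂ fun _ _ => sum_congr₂ fun _ _ => by ring
  have h4 : ∑ α, ∑ β, ∑ μ, ∑ ν, A α c * A β d * A μ e * A ν f * k ν α β μ = frame4 A k f c d e := by
    rw [sum_four_swap₃₄, sum_four_swap₂₃, sum_four_swap₁₂]; simp only [frame4]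
    exact sum_congr₂ fun _ _ => sum_congr₂ fun _ _ => by ring
  have h5 : ∑ α, ∑ β, ∑ μ, ∑ ν, A α c * A β d * A μ e * A ν f * k ν μ β α = frame4 A k f e d c := by
    rw [sum_four_swap₃₄, sum_four_swap₂₃, sum_four_swap₁₂, sum_four_swap₃₄, sum_four_swap₂₃,
      sum_four_swap₃₄]
    simp only [frame4]
    exact sum_congr₂ fun _ _ => sum_congr₂ fun _ _ => by ring
  have h6 : ∑ α, ∑ β, ∑ μ, ∑ ν, A α c * A β d * A μ e * A ν f * k ν β α μ = frame4 A k f d c e := by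
    rw [sum_four_swap₃₄, sum_four_swap₂₃, sum_four_swap₁₂, sum_four_swap₂₃]; simp only [frame4]
    exact sum_congr₂ fun _ _ => sum_congr₂ fun _ _ => by ring
  have h7 : ∀ α β μ ν, A α c * A β d * A μ e * A ν f * ricciTop k α β μ ν =
      1 / 2 * (A α c * A β d * A μ e * A ν f * k α μ β ν) +
      1 / 2 * (A α c * A β d * A μ e * A ν f * k α ν β μ) -
      1 / 2 * (A α c * A β d * A μ e * A ν f * k α β μ ν) -
      1 / 2 * (A α c * A β d * A μ e * A ν f * k ν α β μ) -
      1 / 2 * (A α c * A β d * A μ e * A ν f * k ν μ β α) +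
      1 / 2 * (A α c * A β d * A μ e * A ν f * k ν β α μ) := fun α β μ ν => by
    simp only [ricciTop]; ring
  rw [frame4]
  simp only [h7, sum_add_distrib, sum_sub_distrib, ← mul_sum, h1, h2, h4, h5, h6]
  rw [ricciTop]
  simp only [frame4]
  ring

/-- The Hamiltonian component of the linearized Einstein tensor in an inertial frame. -/
theorem IsInertialFrame.einstein_top (k : Fin 4 → Fin 4 → Tensor)
    (h0 : ∀ b c d, frame4 A k 0 b c d = 0) (h1 : ∀ a c d, frame4 A k a 0 c d = 0) :
    A 0 0 ^ 2 * ((∑ μ, ∑ σ, invMetric b μ σ * ricciTop k μ σ 0 0) -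
      1 / 2 * (∑ c, ∑ d, invMetric b c d * ∑ μ, ∑ σ, invMetric b μ σ * ricciTop k μ σ c d) * b 0 0) =
    1 / 2 * ∑ i : Fin 3, ∑ l : Fin 3, (frame4 A k l.succ i.succ l.succ i.succ -
      frame4 A k l.succ l.succ i.succ i.succ) := by
  have e1 := hA.frame_trace (ricciTop k)
  have e2 : A 0 0 ^ 2 * ∑ μ, ∑ σ, invMetric b μ σ * ricciTop k μ σ 0 0 =
      ∑ e, mink e * frame4 A (ricciTop k) e e 0 0 := by
    refine Eq.trans ?_ (e1 0 0)
    conv_rhs => rw [sum_eq_single 0 (by exact fun i _ hi => by simp [hA.2 i hi]) (by simp),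
      sum_eq_single 0 (by exact fun i _ hi => by simp [hA.2 i hi]) (by simp)]
    ring
  rw [hA.trace fun c d => ∑ μ, ∑ σ, invMetric b μ σ * ricciTop k μ σ c d]
  simp only [e1]
  have e3 := hA.b00
  rw [show ∀ X Y : ℝ, A 0 0 ^ 2 * (X - 1 / 2 * Y * b 0 0) =
    A 0 0 ^ 2 * X - 1 / 2 * Y * (A 0 0 ^ 2 * b 0 0) from fun X Y => by ring, e2, e3]
  simp only [frame4_ricciTop]
  set K := frame4 A k
  simp only [ricciTop, Fin.sum_univ_succ (n := 3), h0, h1, mink]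
  simp [Fin.sum_univ_three]
  ring

end Frame

end EinsteinSource

/-! ### The source in an inertial frame -/

section FrameSource

variable {b : Tensor} {A : Mat4}

/-- The spatial block of `A`. -/
def spaceMap (A : Mat4) : E3 →L[ℝ] E3 :=
  LinearMap.toContinuousLinearMap (Matrix.toEuclideanLin (A.submatrix Fin.succ Fin.succ))

theorem spaceMap_apply (y : E3) (i : Fin 3) : spaceMap A y i = ∑ k : Fin 3, A i.succ k.succ * y k := by
  simp [spaceMap, Matrix.toLpLin_apply, Matrix.mulVec, dotProduct]

/-- The values of the fields in the frame of the columns of `A`. -/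
def frameV (A : Mat4) : Val →L[ℝ] Val := LinearMap.toContinuousLinearMap
    { toFun := fun v => (fun e f => ∑ μ, ∑ ν, A μ e * A ν f * v.1 μ ν, v.2)
      map_add' := fun v w => by ext <;> simp [mul_add, sum_add_distrib]
      map_smul' := fun s v => by ext <;> simp [mul_sum, mul_left_comm] }

theorem frameV_fst (v : Val) (e f : Fin 4) :
    (frameV A v).1 e f = ∑ μ, ∑ ν, A μ e * A ν f * v.1 μ ν := rfl

/-- The metric components in the frame. -/
def frameMetric (A : Mat4) (e f : Fin 4) : Val →L[ℝ] ℝ :=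
  (ContinuousLinearMap.proj f ∘L ContinuousLinearMap.proj e ∘L ContinuousLinearMap.fst ℝ _ _) ∘L
    frameV A

theorem frameMetric_apply (e f : Fin 4) (v : Val) : frameMetric A e f v = (frameV A v).1 e f := rfl

/-- The spatial coordinates as a linear map. -/
def spatL : STPoint →L[ℝ] E3 := 𝒟 spat 0

theorem spatL_apply (x : STPoint) : spatL x = spat x := by
  have h : IsLinearMap ℝ spat := ⟨fun x y => by ext i; simp [spat_apply],
    fun c x => by ext i; simp [spat_apply]⟩
  have := (h.mk' spat).toContinuousLinearMap.fderiv (x := 0)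
  exact congrArg (· x) this

variable (hA : IsInertialFrame b A)
include hA

theorem IsInertialFrame.spat_mulVec (x : STPoint) : spat (A *ᵥ x) = spaceMap A (spat x) := by
  ext i
  rw [spat_apply, spaceMap_apply, Matrix.mulVec, dotProduct, Fin.sum_univ_succ,
    hA.2 _ (Fin.succ_ne_zero i), zero_mul, zero_add]
  simp only [spat_apply]

theorem IsInertialFrame.det : |A 0 0| * sqrtNegDet b * |(A.submatrix Fin.succ Fin.succ).det| = 1 := by
  have h1 : A.det = A 0 0 * (A.submatrix Fin.succ Fin.succ).det := by
    rw [Matrix.det_succ_column_zero, sum_eq_single 0]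
    · simp [Fin.succAbove_zero]
    · intro i _ hi; simp [hA.2 i hi]
    · simp
  have h2 := congrArg Matrix.det hA.1
  rw [det_mul, det_mul, det_transpose, Matrix.det_diagonal, h1] at h2
  simp [Fin.prod_univ_succ] at h2
  set β := (A.submatrix Fin.succ Fin.succ).det
  have h4 : (A 0 0 * β) ^ 2 * -(of b).det = 1 := by linear_combination -h2
  have h3 : √((A 0 0 * β) ^ 2 * -(of b).det) = 1 := by rw [h4, Real.sqrt_one]
  rw [Real.sqrt_mul (sq_nonneg _), Real.sqrt_sq_eq_abs, abs_mul] at h3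
  rw [sqrtNegDet, ← h3]; ring

theorem IsInertialFrame.exists_equiv : ∃ e : E3 ≃L[ℝ] E3, (∀ y, e y = spaceMap A y) ∧
    ∀ f : E3 → ℝ, ∫ y, f y = |(A.submatrix Fin.succ Fin.succ).det| * ∫ y, f (e y) := by
  have hβ : (A.submatrix Fin.succ Fin.succ).det ≠ 0 := fun h => by simpa [h] using hA.det
  have hd : LinearMap.det (Matrix.toEuclideanLin (A.submatrix Fin.succ Fin.succ)) =
      (A.submatrix Fin.succ Fin.succ).det := by
    change LinearMap.det (Matrix.toLpLin 2 2 _) = _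
    rw [Matrix.toLpLin_eq_toLin, LinearMap.det_toLin]
  rw [← hd] at hβ ⊢
  set S := Matrix.toEuclideanLin (A.submatrix Fin.succ Fin.succ)
  refine ⟨(LinearEquiv.ofIsUnitDet (f := S) (v := PiLp.basisFun 2 ℝ (Fin 3))
    (v' := PiLp.basisFun 2 ℝ (Fin 3)) ?_).toContinuousLinearEquiv, fun y => rfl, fun f => ?_⟩
  · rw [LinearMap.det_toMatrix]; exact hβ.isUnit
  · set e := (LinearEquiv.ofIsUnitDet (f := S) (v := PiLp.basisFun 2 ℝ (Fin 3))
      (v' := PiLp.basisFun 2 ℝ (Fin 3)) _).toContinuousLinearEquiv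
    have h1 := Measure.map_linearMap_addHaar_eq_smul_addHaar (volume : Measure E3) hβ
    have h2 := e.toHomeomorph.measurableEmbedding.integral_map (μ := volume) f
    change ∫ y, f y ∂(Measure.map S volume) = ∫ y, f (e y) at h2
    rw [h1, integral_smul_measure, ENNReal.toReal_ofReal (abs_nonneg _)] at h2
    rw [← h2, smul_eq_mul, ← mul_assoc, ← abs_mul, mul_inv_cancel₀ hβ, abs_one, one_mul]

end FrameSource

theorem pd_comp_clm {f : E3 → ℝ} (hf : Differentiable ℝ f) (L : STPoint →L[ℝ] E3) (β : Fin 4) :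
    pd β (fun x => f (L x)) = fun x => 𝒟 f (L x) (L (Pi.single β 1)) := by
  funext x
  have := ((hf (L x)).hasFDerivAt.comp x L.hasFDerivAt).fderiv
  rw [pd, show (fun x => f (L x)) = f ∘ L from rfl, this]
  rfl

theorem pd_pd_comp_clm {f : E3 → ℝ} (hf : Smooth f) (L : STPoint →L[ℝ] E3) (α β : Fin 4)
    (x : STPoint) : pd α (pd β fun x => f (L x)) x =
      𝒟 (𝒟 f) (L x) (L (Pi.single α 1)) (L (Pi.single β 1)) := by
  have hd : Smooth (𝒟 f) := hf.fderiv_right (by simp)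
  have hd' := hd.differentiable (by simp)
  rw [pd_comp_clm (hf.differentiable (by simp)),
    pd_comp_clm (f := fun y => 𝒟 f y (L (Pi.single β 1))) (by fun_prop)]
  change 𝒟 (fun y => 𝒟 f y (L (Pi.single β 1))) (L x) _ = _
  rw [fderiv_clm_apply (hd' _) (by fun_prop)]
  simp

theorem bilin_expand (D : E3 →L[ℝ] E3 →L[ℝ] ℝ) (L : STPoint →L[ℝ] E3) (v w : STPoint) :
    ∑ α, ∑ β, v α * w β * D (L (Pi.single α 1)) (L (Pi.single β 1)) = D (L v) (L w) := by
  conv_rhs => rw [pi_eq_sum_univ' v, pi_eq_sum_univ' w]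
  simp only [map_sum, map_smul, ContinuousLinearMap.sum_apply, ContinuousLinearMap.smul_apply,
    smul_eq_mul, mul_sum]
  rw [sum_comm]
  exact sum_congr₂

section

variable {U : Set STPoint} {R Λ : ℝ} {Φ : ℝ → STPoint → Val} {ρ : STPoint → ℝ} {c t : ℝ}
  {E : Jet 2 → Val} {g : Tensor} {A : Mat4} {b : E3 → ℝ}

/-- The leading field on three-space, in the spatial coordinates of the frame. -/
def leadS (A : Mat4) (Φ : ℝ → STPoint → Val) (t : ℝ) (y : E3) : Val := lead Φ (pt t (spaceMap A y))

theorem IsSmallBodyFamily.contDiffAt_leadS (hF : IsSmallBodyFamily E U R Λ Φ) (ht : t ∈ times U)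
    (hA : IsInertialFrame g A) {y : E3} (hy : y ≠ 0) : SmoothAt (leadS A Φ t) y := by
  obtain ⟨e, he, -⟩ := hA.exists_equiv
  have hy' : spaceMap A y ≠ 0 := by rw [← he]; simpa using hy
  have h2 : SmoothAt (fun y => (t, spaceMap A y)) y :=
    contDiffAt_const.prodMk (spaceMap A).contDiff.contDiffAt
  exact ContDiffAt.comp (g := fun p : ℝ × E3 => lead Φ (pt p.1 p.2)) (f := fun y => (t, spaceMap A y)) y
    (hF.contDiffAt_lead ht hy') h2

theorem IsSmallBodyFamily.frame_moment (hF : IsSmallBodyFamily E U R Λ Φ) (ht : t ∈ times U)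
    (hA : IsInertialFrame g A) {L : STPoint →L[ℝ] E3} (hL : ∀ x, spaceMap A (L x) = spat x)
    (hb : Smooth b) (hρ : IsCutoff (fun x => b (L x)) c) (ℓ : Val →L[ℝ] ℝ) (γ δ : Fin 4) :
    ∑ α, ∑ β, A α γ * A β δ * ℓ (moment Φ (pd α (pd β fun x => b (L x))) t) =
      |(A.submatrix Fin.succ Fin.succ).det| * ∫ y, 𝒟 (𝒟 b) y
        (spat (Pi.single γ 1)) (spat (Pi.single δ 1)) * ℓ (leadS A Φ t y) := by
  obtain ⟨e, he, hc⟩ := hA.exists_equiv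
  have hLe : ∀ x, L x = e.symm (spat x) := fun x => by rw [← hL, ← he, e.symm_apply_apply]
  have hLA : ∀ γ, L (fun α => A α γ) = spat (Pi.single γ 1) := fun γ => by
    rw [hLe, e.symm_apply_eq, he, ← hA.spat_mulVec]
    congr 1
    ext α; simp
  have hi := fun α β => hF.integrable_weight_smul_lead ((hρ.pd β).pd α) ht
  have h1 : ∀ α β, A α γ * A β δ * ℓ (moment Φ (pd α (pd β fun x => b (L x))) t) =
      ∫ y, A α γ * A β δ * (pd α (pd β fun x => b (L x)) (pt 0 y) * ℓ (lead Φ (pt t y))) := by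
    intro α β
    rw [moment, ← ℓ.integral_comp_comm (hi α β), integral_const_mul]
    simp only [map_smul, smul_eq_mul]
  have hi' : ∀ α β, Integrable fun y : E3 =>
      A α γ * A β δ * (pd α (pd β fun x => b (L x)) (pt 0 y) * ℓ (lead Φ (pt t y))) := fun α β => by
    have := (ℓ.integrable_comp (hi α β)).const_mul (A α γ * A β δ)
    simpa only [map_smul, smul_eq_mul] using this
  simp only [h1]
  simp only [← integral_finsetSum _ fun β _ => hi' _ β]
  rw [← integral_finsetSum _ fun α _ => integrable_finsetSum _ fun β _ => hi' α β, hc]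
  congr 1
  refine integral_congr (fun y => ?_)
  simp only [pd_pd_comp_clm hb]
  rw [← hLA, ← hLA, ← bilin_expand]
  simp only [sum_mul, leadS, he]
  refine sum_congr₂ fun _ _ => ?_
  rw [hLe (pt 0 _), spat_pt, ← he, e.symm_apply_apply]
  ring

theorem spat_single_zero : spat (Pi.single 0 1) = 0 := by ext i; simp [spat_apply]

theorem spat_single_succ (i : Fin 3) : spat (Pi.single i.succ 1) = axis i := by
  ext k; simp [spat_apply, Pi.single_apply]

theorem IsSmallBodyFamily.integral_fderiv_fderiv (hF : IsSmallBodyFamily E U R Λ Φ)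
    (ht : t ∈ times U) (hA : IsInertialFrame g A) (hb : Smooth b) (hc : HasCompactSupport b)
    (h0 : ∀ᶠ y in 𝓝 0, b y = c) (ℓ : Val →L[ℝ] ℝ) (v w : E3) :
    Integrable (fun y => 𝒟 b y w * 𝒟 (fun y => ℓ (leadS A Φ t y)) y v) ∧
    ∫ y, 𝒟 (𝒟 b) y v w * ℓ (leadS A Φ t y) =
      -∫ y, 𝒟 b y w * 𝒟 (fun y => ℓ (leadS A Φ t y)) y v := by
  have hd : Smooth (𝒟 b) := hb.fderiv_right (by simp)
  have hd' := hd.differentiable (by simp)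
  have := integral_mul_fderiv (u := fun y => 𝒟 b y w) (h := fun y => ℓ (leadS A Φ t y))
    (by fun_prop) (hc.fderiv_apply (𝕜 := ℝ) w) (by
      filter_upwards [h0.eventually_nhds] with y hy
      have : b =ᶠ[𝓝 y] fun _ => c := hy
      rw [this.fderiv_eq]
      simp) (fun y hy => ℓ.contDiff.contDiffAt.comp y (hF.contDiffAt_leadS ht hA hy)) v
  refine ⟨this.2.1, ?_⟩
  rw [← this.2.2]
  refine integral_congr (fun y => ?_)
  rw [fderiv_clm_apply (hd' _) (by fun_prop)]
  simp

/-- The mass and the charge of a family of Einstein-scalar theory as integrals over three-space. -/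
theorem IsSmallBodyFamily.mass_charge_eq (hF : IsSmallBodyFamily esOperator U R Λ Φ)
    (hρ : IsCutoff ρ 1) (ht : t ∈ times U) (hA : IsInertialFrame (Φ 0 (wl t)).1 A)
    (hb : Smooth b) (hc : HasCompactSupport b) (h0 : ∀ᶠ y in 𝓝 0, b y = c) :
    c * (16 * Real.pi * mass esOperator Φ ρ t) = -∑ i : Fin 3, ∑ l : Fin 3, ∫ y, 𝒟 b y (axis i) *
        (𝒟 (fun y => frameMetric A l.succ i.succ (leadS A Φ t y)) y (axis l) -
          𝒟 (fun y => frameMetric A l.succ l.succ (leadS A Φ t y)) y (axis i)) ∧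
    c * (4 * Real.pi * charge esOperator Φ ρ t) = ∑ l : Fin 3, ∫ y, 𝒟 b y (axis l) *
        𝒟 (fun y => (leadS A Φ t y).2) y (axis l) := by
  have hT := isScalarTensorTheory_es
  obtain ⟨e, he, -⟩ := hA.exists_equiv
  set L : STPoint →L[ℝ] E3 := (e.symm : E3 →L[ℝ] E3) ∘L spatL
  have hLx : ∀ x, L x = e.symm (spat x) := fun x => by simp [L, spatL_apply]
  have hL : ∀ x, spaceMap A (L x) = spat x := fun x => by rw [← he, hLx, e.apply_symm_apply]
  have hσ : IsCutoff (fun x => b (L x)) c := by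
    simp only [hLx]
    refine isCutoff_comp_spat (b := fun y => b (e.symm y)) (by fun_prop)
      (hc.comp_homeomorph e.symm.toHomeomorph) ?_
    have : Tendsto e.symm (𝓝 0) (𝓝 0) := by simpa using e.symm.continuous.tendsto 0
    exact this.eventually h0
  have hS := hF.source_eq hT.smooth_operator hρ hσ ht
  simp only at hS
  set σ := fun x => b (L x)
  set β := |(A.submatrix Fin.succ Fin.succ).det|
  set B := (Φ 0 (wl t)).1
  have hgj : jg (jet 2 (Φ 0) (wl t)) = B := rfl
  have hlor : IsLorentzian B := hF.lorentzian_zero _ ht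
  set k := sourceJet Φ σ t
  have hk : ∀ α β, k (idx2 α β) = moment Φ (pd α (pd β σ)) t := fun α β => by
    simp only [k, sourceJet]
    rw [sum_single_idx2 fun α β => moment Φ (pd α (pd β σ)) t]
  have hder := fderiv_esOperator (j := jet 2 (Φ 0) (wl t)) (k := k) hlor
    (sum_single_idx2_of_ne _ (by simp [idx0])) (fun α => sum_single_idx2_of_ne _ (by simp [idx1]))
  have hmom := fun ℓ γ δ => hF.frame_moment ht hA hL hb hσ ℓ γ δ
  have hparts := fun ℓ v w => hF.integral_fderiv_fderiv (A := A) ht hA hb hc h0 ℓ v w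
  set N : (Val →L[ℝ] ℝ) → Fin 3 → Fin 3 → ℝ := fun ℓ i l =>
    ∫ y, 𝒟 b y (axis l) * 𝒟 (fun y => ℓ (leadS A Φ t y)) y (axis i) with hN
  have hmom' : ∀ ℓ (i l : Fin 3), ∑ α, ∑ β, A α i.succ * A β l.succ *
      ℓ (moment Φ (pd α (pd β σ)) t) = -β * N ℓ i l := fun ℓ i l => by
    rw [hmom, spat_single_succ, spat_single_succ, (hparts ℓ _ _).2]; ring
  have hf4 : ∀ γ δ μ ν, frame4 A (jddg k) γ δ μ ν =
      ∑ α, ∑ β, A α γ * A β δ * frameMetric A μ ν (moment Φ (pd α (pd β σ)) t) := by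
    intro γ δ μ ν
    simp only [frame4, jddg, hk, frameMetric_apply, frameV_fst, mul_sum]
    exact sum_congr₂ fun _ _ => sum_congr₂ fun _ _ => by ring
  have htop := hA.einstein_top (jddg k)
    (fun δ μ ν => by rw [hf4, hmom]; simp [spat_single_zero])
    (fun γ μ ν => by rw [hf4, hmom]; simp [spat_single_zero])
  simp only [hf4, hmom'] at htop
  have hdet := hA.det
  have hb00 := hA.b00
  set v := speed (Φ 0) wl t with hv
  have hv2 : v ^ 2 = -B 0 0 := hF.speed_sq ht
  have hv0 : 0 < v := hF.speed_pos ht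
  have hAv : |A 0 0| * v = 1 := by
    have : (|A 0 0| * v) ^ 2 = 1 := by rw [mul_pow, sq_abs, hv2]; linarith
    nlinarith [mul_nonneg (abs_nonneg (A 0 0)) hv0.le]
  have hfst : c * (source esOperator Φ ρ t).1 0 0 = sqrtNegDet B *
      (𝒟 esOperator (jet 2 (Φ 0) (wl t)) k).1 0 0 := by
    have := congrArg (fun w : Val => w.1 0 0) hS
    exact this.symm
  have hsnd : c * (source esOperator Φ ρ t).2 = sqrtNegDet B *
      (𝒟 esOperator (jet 2 (Φ 0) (wl t)) k).2 := by
    have := congrArg (fun w : Val => w.2) hS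
    exact this.symm
  rw [hder] at hfst hsnd
  have hpi := Real.pi_ne_zero
  constructor
  · have hU : (source esOperator Φ ρ t).1 0 0 = B 0 0 * upSource esOperator Φ ρ t 0 0 * B 0 0 :=
      hT.source_eq hF hρ ht 0 0
    have hX : ∀ i l : Fin 3, ∫ y, 𝒟 b y (axis i) *
        (𝒟 (fun y => frameMetric A l.succ i.succ (leadS A Φ t y)) y (axis l) -
          𝒟 (fun y => frameMetric A l.succ l.succ (leadS A Φ t y)) y (axis i)) =
        N (frameMetric A l.succ i.succ) l i - N (frameMetric A l.succ l.succ) i i := fun i l => by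
      rw [hN]
      simp only
      rw [← integral_sub (hparts _ _ _).1 (hparts _ _ _).1]
      simp only [mul_sub]
    simp only [hX]
    have hsw : ∑ i : Fin 3, ∑ l : Fin 3, N (frameMetric A l.succ l.succ) i i =
        ∑ i : Fin 3, ∑ l : Fin 3, N (frameMetric A i.succ i.succ) l l := sum_comm
    simp only [sum_sub_distrib, ← mul_sum] at htop ⊢
    rw [hsw]
    set X₁ := ∑ i : Fin 3, ∑ l : Fin 3, N (frameMetric A l.succ i.succ) l i
    set X₂ := ∑ i : Fin 3, ∑ l : Fin 3, N (frameMetric A i.succ i.succ) l l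
    rw [hU] at hfst
    simp only [jinv, hgj] at hfst
    set Y := upSource esOperator Φ ρ t 0 0
    rw [mass, ← hv]
    change c * (16 * Real.pi * (Y * v / (8 * Real.pi))) = _
    have h5 : c * Y * v ^ 2 = sqrtNegDet B * (1 / 2 * (-β * X₁ + β * X₂)) := by
      rw [← sub_neg_eq_add, ← neg_mul]
      rw [← htop, mul_left_comm, ← hfst, hv2]
      linear_combination (-c * Y * B 0 0) * hb00
    have h6 : c * (16 * Real.pi * (Y * v / (8 * Real.pi))) = 2 * (c * Y * v) := by field_simp; ring
    rw [h6]
    calc 2 * (c * Y * v) = 2 * (c * Y * v ^ 2) * |A 0 0| := by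
          linear_combination (-2 * c * Y * v) * hAv
      _ = (|A 0 0| * sqrtNegDet B * β) * (-X₁ + X₂) := by rw [h5]; ring
      _ = _ := by rw [hdet]; ring
  · have h3 := hA.trace fun α β => jddphi k α β
    have h4 : ∀ γ, ∑ α, ∑ β, A α γ * A β γ * jddphi k α β = ∑ α, ∑ β, A α γ * A β γ *
        ContinuousLinearMap.snd ℝ (Tensor) ℝ (moment Φ (pd α (pd β σ)) t) := fun γ => by
      simp only [jddphi, hk]; rfl
    simp only [h4] at h3
    have h5 : ∀ i : Fin 3, mink i.succ = 1 := fun i => by fin_cases i <;> rfl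
    simp only [jinv, hgj] at hsnd
    rw [h3, Fin.sum_univ_succ (n := 3), hmom, spat_single_zero] at hsnd
    simp only [hmom', map_zero, zero_mul, integral_zero, mul_zero, zero_add, h5, one_mul,
      ← mul_sum] at hsnd
    rw [charge, ← hv]
    set Y := (source esOperator Φ ρ t).2
    change _ = ∑ l, N (ContinuousLinearMap.snd ℝ (Tensor) ℝ) l l
    set X := ∑ l, N (ContinuousLinearMap.snd ℝ (Tensor) ℝ) l l
    have h6 : c * (4 * Real.pi * (-Y / (16 * Real.pi * v))) = -(1 / 4) * (c * Y) / v := by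
      field_simp
      ring
    rw [h6, hsnd, div_eq_iff hv0.ne']
    linear_combination X * (v * hdet - sqrtNegDet B * β * hAv)

end

/-! ### The body exterior fields at large distances -/

section Decay

variable {W : Type*} [NormedAddCommGroup W] [NormedSpace ℝ W] {n₀ : E3}

theorem exists_norm_le_mul_sq {f : ℝ × E3 → W} (hf : SmoothAt f (0, n₀))
    (h0 : ∀ᶠ p : ℝ × E3 in 𝓝 (0, n₀), f (0, p.2) = 0 ∧ 𝒟 f (0, p.2) (1, 0) = 0) :
    ∃ C, 0 ≤ C ∧ ∀ᶠ p : ℝ × E3 in 𝓝 (0, n₀), ‖f p‖ ≤ C * p.1 ^ 2 := by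
  have hg : ContDiffAt ℝ 1 (fun p => 𝒟 f p (1, 0)) (0, n₀) :=
    ((hf.fderiv_right (m := ∞) (by simp)).of_le (by exact_mod_cast le_top)).clm_apply contDiffAt_const
  obtain ⟨C, T, hT, hC⟩ := hg.exists_lipschitzOnWith
  have hd : ∀ᶠ p in 𝓝 ((0, n₀) : ℝ × E3), DiffAt f p :=
    ((hf.of_le (by exact_mod_cast le_top : (1 : WithTop ℕ∞) ≤ ∞)).eventually (by simp)).mono
      fun p hp => hp.diff
  obtain ⟨ε, hε, hball⟩ := Metric.eventually_nhds_iff_ball.1 ((eventually_mem_set.2 hT).and (hd.and h0))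
  refine ⟨C, C.2, ?_⟩
  filter_upwards [Metric.ball_mem_nhds _ hε] with p hp
  have hin : ∀ τ ∈ Icc (0 : ℝ) 1, (τ * p.1, p.2) ∈ Metric.ball ((0, n₀) : ℝ × E3) ε := by
    intro τ hτ
    rw [← ball_prod_same] at hp ⊢
    refine ⟨?_, hp.2⟩
    have := hp.1
    rw [mem_ball_zero_iff] at this ⊢
    simp only [norm_mul, norm_of_nonneg hτ.1]
    exact (mul_le_of_le_one_left (norm_nonneg _) hτ.2).trans_lt this
  have h1 := norm_image_sub_le_of_norm_deriv_le_segment_01' (f := fun τ : ℝ => f (τ * p.1, p.2))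
    (f' := fun τ => p.1 • 𝒟 f (τ * p.1, p.2) (1, 0)) (C := C * p.1 ^ 2) (fun τ hτ => by
      have e1 : HasDerivAt (fun τ : ℝ => (τ * p.1, p.2)) (p.1, 0) τ :=
        (by simpa using (hasDerivAt_id τ).mul_const p.1 : HasDerivAt (fun τ : ℝ => τ * p.1) p.1 τ).prodMk
          (hasDerivAt_const _ _)
      have e2 := (hball _ (hin τ hτ)).2.1.hasFDerivAt.comp_hasDerivAt τ e1
      rw [show ((p.1, 0) : ℝ × E3) = p.1 • ((1, 0) : ℝ × E3) by simp, map_smul] at e2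
      exact e2.hasDerivWithinAt) (fun τ hτ => by
      have hτ' := Ico_subset_Icc_self hτ
      have h2 := hC.dist_le_mul _ (hball _ (hin τ hτ')).1 _
        (hball _ (hin 0 (by simp))).1
      have h3 := (hball _ (hin 0 (by simp))).2.2.2
      simp only [zero_mul] at h3 h2
      rw [h3, dist_zero_right, Prod.dist_eq, dist_self, dist_zero_right,
        max_eq_left (norm_nonneg _), norm_mul, norm_of_nonneg hτ.1] at h2
      rw [norm_smul, ← sq_abs, ← Real.norm_eq_abs]
      have h4 : τ * ‖p.1‖ ≤ ‖p.1‖ := mul_le_of_le_one_left (norm_nonneg _) hτ.2.le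
      have h5 := h2.trans (mul_le_mul_of_nonneg_left h4 C.2)
      nlinarith [mul_le_mul_of_nonneg_left h5 (norm_nonneg p.1)])
  have h6 := (hball _ (hin 0 (by simp))).2.2.1
  simp only at h6
  simpa only [one_mul, zero_mul, h6, sub_zero] using h1

theorem exists_decay {e : E3 → ℝ} {f : ℝ × E3 → ℝ} (hf : SmoothAt f (0, n₀))
    (h0 : ∀ᶠ p : ℝ × E3 in 𝓝 (0, n₀), f (0, p.2) = 0 ∧ 𝒟 f (0, p.2) (1, 0) = 0)
    (he : ∀ᶠ p : ℝ × E3 in 𝓝 (0, n₀), 0 < p.1 → e (p.1⁻¹ • p.2) = f p) :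
    ∃ C, 0 ≤ C ∧ ∀ᶠ p : ℝ × E3 in 𝓝 (0, n₀), 0 < p.1 → DiffAt e (p.1⁻¹ • p.2) ∧
      ‖e (p.1⁻¹ • p.2)‖ ≤ C * p.1 ^ 2 ∧ ‖𝒟 e (p.1⁻¹ • p.2)‖ ≤ C * p.1 ^ 3 := by
  obtain ⟨C₁, hC₁, h1⟩ := exists_norm_le_mul_sq hf h0
  set inr := ContinuousLinearMap.inr ℝ ℝ E3
  have hf2 : ContDiffAt ℝ 2 f (0, n₀) := hf.of_le two_le_infty
  have h2 := hf2.eventually (by simp)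
  have hpair : ∀ z : E3, HasFDerivAt (fun z : E3 => ((0 : ℝ), z)) inr z := fun z =>
    (hasFDerivAt_const 0 z).prodMk (hasFDerivAt_id z)
  have hg := exists_norm_le_mul_sq (f := fun p => (𝒟 f p).comp inr)
    ((hf.fderiv_right (m := ∞) (by simp)).clm_comp contDiffAt_const) (by
    have hcont : Continuous fun p : ℝ × E3 => ((0 : ℝ), p.2) := by fun_prop
    filter_upwards [h0.eventually_nhds, (hcont.tendsto (0, n₀)).eventually h2] with p hp hp2
    have hz : Tendsto (fun z : E3 => (p.1, z)) (𝓝 p.2) (𝓝 p) :=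
      (by fun_prop : Continuous fun z : E3 => (p.1, z)).tendsto p.2
    have hp' : ∀ᶠ z in 𝓝 p.2, f (0, z) = 0 ∧ 𝒟 f (0, z) (1, 0) = 0 := hz.eventually hp
    have hfd : DiffAt (𝒟 f) (0, p.2) := (hp2.fderiv_right (m := 1) (by norm_num)).diff
    constructor
    · have e1 := hp2.diff.hasFDerivAt.comp p.2 (hpair p.2)
      have e2 : (f ∘ fun z : E3 => ((0 : ℝ), z)) =ᶠ[𝓝 p.2] fun _ => 0 := hp'.mono fun z hz => hz.1
      exact (e1.congr_of_eventuallyEq e2.symm).unique (hasFDerivAt_const _ _)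
    · ext w
      have e0 : 𝒟 (fun p => (𝒟 f p).comp inr) (0, p.2) =
          (ContinuousLinearMap.compL ℝ E3 (ℝ × E3) ℝ).flip inr ∘L 𝒟 (𝒟 f) (0, p.2) :=
        (((ContinuousLinearMap.compL ℝ E3 (ℝ × E3) ℝ).flip inr).hasFDerivAt.comp _
          hfd.hasFDerivAt).fderiv
      rw [e0]
      change 𝒟 (𝒟 f) (0, p.2) (1, 0) (0, w) = 0
      rw [(hp2.isSymmSndFDerivAt (by simp)).eq]
      have e1 := (hfd.hasFDerivAt.comp p.2 (hpair p.2)).clm_apply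
        (hasFDerivAt_const ((1, 0) : ℝ × E3) p.2)
      have e2 : (fun z => (𝒟 f ∘ fun z : E3 => ((0 : ℝ), z)) z (1, 0)) =ᶠ[𝓝 p.2] fun _ => 0 :=
        hp'.mono fun z hz => hz.2
      have e3 := congrArg (· w) ((e1.congr_of_eventuallyEq e2.symm).unique (hasFDerivAt_const _ _))
      simpa [inr] using e3)
  obtain ⟨C₂, hC₂, h3⟩ := hg
  refine ⟨max C₁ C₂, le_max_of_le_left hC₁, ?_⟩
  filter_upwards [h1, h3, h2, he.eventually_nhds] with p hp1 hp3 hp2 hpe hs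
  have hs' := hs.ne'
  have e1 : HasFDerivAt (fun y : E3 => (p.1, p.1 • y)) (p.1 • inr) (p.1⁻¹ • p.2) := by
    have := (hasFDerivAt_const p.1 (p.1⁻¹ • p.2)).prodMk
      ((hasFDerivAt_id (𝕜 := ℝ) (p.1⁻¹ • p.2)).const_smul p.1)
    refine this.congr_fderiv ?_
    ext w <;> simp [inr]
  have e0 : ((p.1, p.1 • p.1⁻¹ • p.2) : ℝ × E3) = p := by rw [smul_inv_smul₀ hs']
  have e2 : HasFDerivAt (fun y : E3 => f (p.1, p.1 • y)) ((𝒟 f p).comp (p.1 • inr)) (p.1⁻¹ • p.2) := by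
    refine HasFDerivAt.comp (g := f) (f := fun y : E3 => (p.1, p.1 • y)) _ ?_ e1
    rw [e0]; exact hp2.diff.hasFDerivAt
  have e3 : e =ᶠ[𝓝 (p.1⁻¹ • p.2)] fun y : E3 => f (p.1, p.1 • y) := by
    have hc : Tendsto (fun y : E3 => (p.1, p.1 • y)) (𝓝 (p.1⁻¹ • p.2)) (𝓝 p) := by
      have := e1.continuousAt.tendsto
      rwa [e0] at this
    filter_upwards [hc.eventually hpe] with y hy
    have := hy hs
    rwa [inv_smul_smul₀ hs'] at this
  have e4 := e2.congr_of_eventuallyEq e3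
  refine ⟨e4.differentiableAt, ?_, ?_⟩
  · rw [hpe.self_of_nhds hs]
    exact hp1.trans (mul_le_mul_of_nonneg_right (le_max_left _ _) (sq_nonneg _))
  · rw [e4.fderiv, ContinuousLinearMap.comp_smul, norm_smul, norm_of_nonneg hs.le]
    calc p.1 * ‖(𝒟 f p).comp inr‖ ≤ p.1 * (max C₁ C₂ * p.1 ^ 2) :=
          mul_le_mul_of_nonneg_left
            (hp3.trans (mul_le_mul_of_nonneg_right (le_max_right _ _) (sq_nonneg _))) hs.le
      _ = _ := by ring

theorem exists_forall_cobounded {P : ℝ → E3 → Prop} (hmono : ∀ C C' z, C ≤ C' → P C z → P C' z)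
    (h : ∀ n₀ : E3, ‖n₀‖ = 1 → ∃ C, ∀ᶠ p : ℝ × E3 in 𝓝 (0, n₀), ‖p.2‖ = 1 → 0 < p.1 →
      P C (p.1⁻¹ • p.2)) : ∃ C, ∀ᶠ z in Bornology.cobounded E3, P C z := by
  have hsph : ∃ C : ℝ, ∀ᶠ s : ℝ in 𝓝 0, ∀ n ∈ Metric.sphere (0 : E3) 1, 0 < s → P C (s⁻¹ • n) := by
    refine (isCompact_sphere (0 : E3) 1).induction_on (p := fun S => ∃ C : ℝ,
      ∀ᶠ s : ℝ in 𝓝 0, ∀ n ∈ S, 0 < s → P C (s⁻¹ • n)) ⟨0, by simp⟩ ?_ ?_ ?_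
    · rintro S T hST ⟨C, hC⟩
      exact ⟨C, hC.mono fun q hq n hn => hq n (hST hn)⟩
    · rintro S T ⟨C, hC⟩ ⟨D, hD⟩
      refine ⟨max C D, ?_⟩
      filter_upwards [hC, hD] with q h1 h2 n hn hq
      rcases hn with hn | hn
      · exact hmono _ _ _ (le_max_left _ _) (h1 n hn hq)
      · exact hmono _ _ _ (le_max_right _ _) (h2 n hn hq)
    · intro n₀ hn₀
      obtain ⟨C, hC⟩ := h n₀ (by simpa using hn₀)
      rw [nhds_prod_eq, eventually_prod_iff] at hC
      obtain ⟨pa, ha, pb, hb, hab⟩ := hC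
      refine ⟨{n | pb n} ∩ Metric.sphere 0 1, inter_mem (mem_nhdsWithin_of_mem_nhds hb)
        self_mem_nhdsWithin, C, ha.mono fun s hs n hn hs0 => ?_⟩
      exact hab hs hn.1 (by simpa using hn.2) hs0
  obtain ⟨C, hC⟩ := hsph
  refine ⟨C, ?_⟩
  filter_upwards [(tendsto_inv_atTop_zero.comp tendsto_norm_cobounded_atTop).eventually hC,
    tendsto_norm_cobounded_atTop.eventually_gt_atTop 0] with z hz hz0
  obtain ⟨e1, e2⟩ := exists_unit_smul (norm_pos_iff.1 hz0)
  have := hz (‖z‖⁻¹ • z) (by simpa using e1) (inv_pos.2 hz0)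
  simpa only [Function.comp_apply, inv_inv, e2] using this

end Decay

section Exterior

variable {U : Set STPoint} {R Λ : ℝ} {Φ : ℝ → STPoint → Val} {t₀ : ℝ} {n₀ : E3}
  {F : ℝ × E3 × ℝ × ℝ → Val} {Ψ : STPoint → Val} {E : Jet 2 → Val}

theorem scaledField_eq {l : ℝ} (hl : l ≠ 0) (τ : ℝ) (y : E3) :
    scaledField Φ t₀ l (pt τ y) = Φ l (pt (t₀ + l * τ) (l • y)) := by
  have e1 : scaleMap t₀ l = fun x => worldline t₀ + l • x := rfl
  have e2 : ∀ μ x, pd μ (scaleMap t₀ l) x = l • Pi.single μ 1 := fun μ x => by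
    rw [e1, pd, fderiv_const_add, fderiv_fun_const_smul differentiableAt_fun_id]
    simp
  have e3 : scaleMap t₀ l (pt τ y) = pt (t₀ + l * τ) (l • y) := by
    ext μ
    refine Fin.cases rfl (fun i => ?_) μ
    simp [e1, worldline, pt_succ]
  refine Prod.ext ?_ (by rw [← e3]; rfl)
  ext μ ν
  simp only [scaledField, pullback, e2, e3, Pi.smul_apply, smul_eq_mul, Pi.single_apply]
  simp
  field_simp

theorem IsNearZone.exterior_eq (h : IsNearZone Φ t₀ n₀ F) (hR : 0 < R) (hΨ : IsBodyExterior R Φ t₀ Ψ) :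
    ∀ᶠ p : ℝ × E3 in 𝓝 (0, n₀), ‖p.2‖ = 1 → 0 < p.1 → ∀ τ, Ψ (pt τ (p.1⁻¹ • p.2)) = F (t₀, p.2, 0, p.1) := by
  have h1 : ∀ᶠ p in 𝓝 ((t₀, n₀, 0, 0) : ℝ × E3 × ℝ × ℝ), ContDiffAt ℝ 1 F p := h.1.near
  have hc : Continuous fun p : ℝ × E3 => (t₀, p.2, (0 : ℝ), p.1) := by fun_prop
  filter_upwards [(hc.tendsto ((0 : ℝ), n₀)).eventually (h1.and h.2).eventually_nhds,
    continuousAt_fst.eventually_lt_const (inv_pos.2 hR)] with p hp hpR hn hs τ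
  have hs' := hs.ne'
  have hcl : Tendsto (fun l : ℝ => (t₀ + l * τ, p.2, l * p.1⁻¹, p.1)) (𝓝[>] 0) (𝓝 (t₀, p.2, 0, p.1)) := by
    have : Continuous fun l : ℝ => (t₀ + l * τ, p.2, l * p.1⁻¹, p.1) := by fun_prop
    have := this.tendsto 0
    simp only [zero_mul, add_zero] at this
    exact this.mono_left nhdsWithin_le_nhds
  have hx : R < rad (pt τ (p.1⁻¹ • p.2)) := by
    rw [rad_pt, norm_smul, hn, mul_one, norm_inv, norm_of_nonneg hs.le]
    exact (lt_inv_comm₀ hs hR).1 hpR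
  refine tendsto_nhds_unique (hΨ _ hx) ((hp.self_of_nhds.1.continuousAt.tendsto.comp hcl).congr' ?_)
  filter_upwards [hcl.eventually hp, self_mem_nhdsWithin] with l hl hl0
  have hl0' : (0 : ℝ) < l := hl0
  have := hl.2 hn (mul_pos hl0' (inv_pos.2 hs)) hs.le
  simp only [inv_mul_cancel_right₀ hs'] at this
  rw [scaledField_eq hl0'.ne', smul_smul, this]
  rfl

theorem IsNearZone.apply_zero (h : IsNearZone Φ t₀ n₀ F) (hΦ : ContinuousAt (Φ 0) (worldline t₀)) :
    ∀ᶠ n in 𝓝 n₀, ‖n‖ = 1 → F (t₀, n, 0, 0) = Φ 0 (worldline t₀) := by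
  have h1 : ∀ᶠ p in 𝓝 ((t₀, n₀, 0, 0) : ℝ × E3 × ℝ × ℝ), ContDiffAt ℝ 1 F p := h.1.near
  have hc : Continuous fun n : E3 => (t₀, n, (0 : ℝ), (0 : ℝ)) := by fun_prop
  filter_upwards [(hc.tendsto n₀).eventually (h1.and h.2).eventually_nhds] with n hp hn
  have hcl : Tendsto (fun l : ℝ => (t₀, n, l, (0 : ℝ))) (𝓝[>] 0) (𝓝 (t₀, n, 0, 0)) :=
    ((by fun_prop : Continuous fun l : ℝ => (t₀, n, l, (0 : ℝ))).tendsto 0).mono_left nhdsWithin_le_nhds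
  have hcw : Tendsto (fun l : ℝ => pt t₀ (l • n)) (𝓝[>] 0) (𝓝 (worldline t₀)) := by
    have := (continuous_pt.comp (by fun_prop : Continuous fun l : ℝ => (t₀, l • n))).tendsto 0
    simp only [Function.comp_apply, zero_smul] at this
    exact this.mono_left nhdsWithin_le_nhds
  refine tendsto_nhds_unique ((hp.self_of_nhds.1.continuousAt.tendsto.comp hcl).congr' ?_)
    (hΦ.tendsto.comp hcw)
  filter_upwards [hcl.eventually hp, self_mem_nhdsWithin] with l hl hl0
  have := hl.2 hn hl0 le_rfl
  simp only [mul_zero] at this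
  exact this.symm

/-- The body exterior fields are stationary and agree with the leading fields of the perturbation
up to second order in the inverse distance. -/
theorem IsSmallBodyFamily.exterior_expansion (hF : IsSmallBodyFamily E U R Λ Φ) (ht : t₀ ∈ times U)
    {b : Tensor} {A : Mat4} (hA : IsInertialFrame b A)
    (hΨ : IsBodyExterior R Φ t₀ Ψ) (ℓ : Val →L[ℝ] ℝ) :
    ∃ C, ∀ᶠ z in Bornology.cobounded E3, 0 ≤ C ∧
      (∀ τ, Ψ (pt τ (spaceMap A z)) = Ψ (pt 0 (spaceMap A z))) ∧
      DiffAt (fun z => ℓ (Ψ (pt 0 (spaceMap A z)) - Φ 0 (worldline t₀) - leadS A Φ t₀ z)) z ∧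
      ‖ℓ (Ψ (pt 0 (spaceMap A z)) - Φ 0 (worldline t₀) - leadS A Φ t₀ z)‖ ≤ C * (‖z‖ ^ 2)⁻¹ ∧
      ‖𝒟 (fun z => ℓ (Ψ (pt 0 (spaceMap A z)) - Φ 0 (worldline t₀) - leadS A Φ t₀ z)) z‖ ≤
        C * (‖z‖ ^ 3)⁻¹ := by
  obtain ⟨e, he, -⟩ := hA.exists_equiv
  refine exists_forall_cobounded ?_ fun n₀ hn₀ => ?_
  · rintro C C' z hC ⟨h0, h1, h2, h3, h4⟩
    exact ⟨h0.trans hC, h1, h2, h3.trans (mul_le_mul_of_nonneg_right hC (by positivity)),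
      h4.trans (mul_le_mul_of_nonneg_right hC (by positivity))⟩
  have hS : ∀ z : E3, z ≠ 0 → spaceMap A z ≠ 0 := fun z hz => by rw [← he]; simpa using hz
  have hn₀' : n₀ ≠ 0 := fun h => by simp [h] at hn₀
  set N : E3 → E3 := fun z => ‖spaceMap A z‖⁻¹ • spaceMap A z with hN
  have hN1 : ∀ z, z ≠ 0 → ‖N z‖ = 1 := fun z hz => (exists_unit_smul (hS z hz)).1
  have hN2 : ∀ z, z ≠ 0 → ‖spaceMap A z‖ • N z = spaceMap A z := fun z hz =>
    (exists_unit_smul (hS z hz)).2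
  obtain ⟨F, h⟩ := hF.exists_nearZone ht (hN1 n₀ hn₀')
  have hnorm : ∀ z : E3, z ≠ 0 → SmoothAt (fun z => ‖spaceMap A z‖⁻¹) z := fun z hz =>
    (ContDiffAt.norm ℝ (spaceMap A).contDiff.contDiffAt (hS z hz)).inv (norm_ne_zero_iff.2 (hS z hz))
  have hNs : ∀ z : E3, z ≠ 0 → SmoothAt N z := fun z hz =>
    (hnorm z hz).smul (spaceMap A).contDiff.contDiffAt
  set q : ℝ × E3 → ℝ × E3 × ℝ × ℝ := fun p => (t₀, N p.2, 0, p.1 * ‖spaceMap A p.2‖⁻¹) with hq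
  have hqs : SmoothAt q (0, n₀) := by
    have h1 : SmoothAt (fun p : ℝ × E3 => N p.2) (0, n₀) :=
      ContDiffAt.comp (g := N) (0, n₀) (hNs n₀ hn₀') contDiffAt_snd
    have h2 : SmoothAt (fun p : ℝ × E3 => ‖spaceMap A p.2‖⁻¹) (0, n₀) :=
      ContDiffAt.comp (g := fun z => ‖spaceMap A z‖⁻¹) (0, n₀) (hnorm n₀ hn₀') contDiffAt_snd
    exact contDiffAt_const.prodMk (h1.prodMk (contDiffAt_const.prodMk (contDiffAt_fst.mul h2)))
  have hq0 : q (0, n₀) = (t₀, N n₀, 0, 0) := by simp [hq]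
  set f : ℝ × E3 → ℝ := fun p => ℓ (F (q p) - Φ 0 (worldline t₀) - p.1 • leadS A Φ t₀ p.2) with hf
  have hKs : SmoothAt (fun p => F (q p)) (0, n₀) :=
    ContDiffAt.comp (g := F) (0, n₀) (by rw [hq0]; exact h.1) hqs
  have hls : SmoothAt (fun p : ℝ × E3 => leadS A Φ t₀ p.2) (0, n₀) :=
    ContDiffAt.comp (g := leadS A Φ t₀) (0, n₀) (hF.contDiffAt_leadS ht hA hn₀') contDiffAt_snd
  have hfs : SmoothAt f (0, n₀) :=
    ℓ.contDiff.contDiffAt.comp _ ((hKs.sub contDiffAt_const).sub (contDiffAt_fst.smul hls))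
  have hne : ∀ᶠ p : ℝ × E3 in 𝓝 (0, n₀), p.2 ≠ 0 := continuousAt_snd.eventually_ne hn₀'
  have hNc : ContinuousAt (fun p : ℝ × E3 => N p.2) (0, n₀) :=
    ContinuousAt.comp (g := N) (hNs n₀ hn₀').continuousAt continuousAt_snd
  have hzero : ∀ᶠ p : ℝ × E3 in 𝓝 (0, n₀), f (0, p.2) = 0 ∧ 𝒟 f (0, p.2) (1, 0) = 0 := by
    have hΦc := (hF.smooth_zero.contDiffAt (hF.isOpen.mem_nhds ht)).continuousAt
    have hlead := (continuousAt_const (y := t₀)).prodMk hNc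
    have h1 : ∀ᶠ p in 𝓝 ((t₀, N n₀, 0, 0) : ℝ × E3 × ℝ × ℝ), ContDiffAt ℝ 1 F p := h.1.near
    have hf1 : ∀ᶠ p in 𝓝 ((0, n₀) : ℝ × E3), ContDiffAt ℝ 1 f p := hfs.near
    have hc0 : Tendsto (fun p : ℝ × E3 => ((0 : ℝ), p.2)) (𝓝 (0, n₀)) (𝓝 (0, n₀)) :=
      (by fun_prop : Continuous fun p : ℝ × E3 => ((0 : ℝ), p.2)).tendsto (0, n₀)
    have hq1 := hqs.continuousAt.tendsto
    rw [hq0] at hq1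
    filter_upwards [hne, hNc.tendsto.eventually (h.apply_zero hΦc), hlead.tendsto.eventually h.lead_eq,
      (hq1.comp hc0).eventually h1, hc0.eventually hf1] with p hp0 hp1 hp2 hp3 hp4
    simp only [Function.comp_apply, hq, zero_mul] at hp3
    have k1 := hp1 (hN1 _ hp0)
    refine ⟨by simp [hf, hq, k1], ?_⟩
    have k2 := hp2 (hN1 _ hp0) ‖spaceMap A p.2‖ (norm_pos_iff.2 (hS _ hp0))
    simp only [hN2 _ hp0] at k2
    have k3 := hasDerivAt_line hp4.diff (1, 0)
    refine k3.unique ?_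
    have k4 := hasDerivAt_line hp3.diff (0, 0, 0, ‖spaceMap A p.2‖⁻¹)
    have k5 : 𝒟 F (t₀, N p.2, 0, 0) (0, 0, 0, ‖spaceMap A p.2‖⁻¹) = leadS A Φ t₀ p.2 := by
      rw [leadS, k2, betaCoeff, ← map_smul]
      simp
    rw [k5] at k4
    have k6 := ℓ.hasFDerivAt.comp_hasDerivAt (0 : ℝ) ((k4.sub_const (Φ 0 (worldline t₀))).sub
      ((hasDerivAt_id (0 : ℝ)).smul_const (leadS A Φ t₀ p.2)))
    rw [one_smul, sub_self, map_zero] at k6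
    refine k6.congr_of_eventuallyEq (.of_forall fun s => ?_)
    simp [hf, hq]
  have hext : ∀ᶠ p : ℝ × E3 in 𝓝 (0, n₀), 0 < p.1 → ∀ τ, Ψ (pt τ (spaceMap A (p.1⁻¹ • p.2))) = F (q p) := by
    have hc : Tendsto (fun p : ℝ × E3 => (p.1 * ‖spaceMap A p.2‖⁻¹, N p.2)) (𝓝 (0, n₀)) (𝓝 (0, N n₀)) := by
      have h2 : ContinuousAt (fun p : ℝ × E3 => ‖spaceMap A p.2‖⁻¹) (0, n₀) :=
        ContinuousAt.comp (g := fun z => ‖spaceMap A z‖⁻¹) (hnorm n₀ hn₀').continuousAt continuousAt_snd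
      have := ((continuousAt_fst.mul h2).prodMk hNc).tendsto
      simpa using this
    filter_upwards [hne, hc.eventually (h.exterior_eq hF.R_pos hΨ)] with p hp0 hp hs τ
    have hpos := norm_pos_iff.2 (hS _ hp0)
    have := hp (hN1 _ hp0) (mul_pos hs (inv_pos.2 hpos)) τ
    rwa [mul_inv, inv_inv, mul_smul, hN2 _ hp0, ← map_smul] at this
  obtain ⟨C, hC, hdecay⟩ := exists_decay
    (e := fun z => ℓ (Ψ (pt 0 (spaceMap A z)) - Φ 0 (worldline t₀) - leadS A Φ t₀ z)) hfs hzero (by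
      filter_upwards [hext, hne] with p hp hp0 hs
      have e1 : leadS A Φ t₀ (p.1⁻¹ • p.2) = p.1 • leadS A Φ t₀ p.2 := by
        rw [leadS, map_smul, hF.lead_smul ht (hS _ hp0) (inv_pos.2 hs), inv_inv]; rfl
      simp only [hp hs 0, e1, hf])
  refine ⟨C, ?_⟩
  filter_upwards [hext, hdecay] with p hp1 hp2 hn hs
  have hnz : ‖p.1⁻¹ • p.2‖ = p.1⁻¹ := by rw [norm_smul, hn, mul_one, norm_inv, norm_of_nonneg hs.le]
  refine ⟨hC, fun τ => by rw [hp1 hs, hp1 hs], ?_⟩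
  rw [hnz, inv_pow, inv_inv, inv_pow, inv_inv]
  exact hp2 hs

end Exterior

/-! ### Homogeneous functions on three-space -/

section Homogeneous

theorem clm_eq_sum (L : E3 →L[ℝ] ℝ) (v : E3) : L v = ∑ l : Fin 3, v l * L (axis l) := by
  have : v = ∑ l : Fin 3, v l • axis l := by ext i; simp [Pi.single_apply]
  conv_lhs => rw [this]
  simp

variable {f : E3 → ℝ} {k : ℕ}

theorem fderiv_homogeneous (hf : ∀ r > 0, ∀ y ≠ 0, f (r • y) = (r ^ k)⁻¹ * f y) {y : E3} (hy : y ≠ 0)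
    (hd : DiffAt f y) {r : ℝ} (hr : 0 < r) :
    𝒟 f (r • y) = (r ^ (k + 1))⁻¹ • 𝒟 f y := by
  have h1 : (fun y => f (r • y)) =ᶠ[𝓝 y] fun y => (r ^ k)⁻¹ * f y := by
    filter_upwards [eventually_ne_nhds hy] with z hz using hf r hr z hz
  have h2 := h1.fderiv_eq (𝕜 := ℝ)
  rw [fderiv_comp_smul, fderiv_const_mul hd] at h2
  rw [← inv_smul_smul₀ hr.ne' (𝒟 f (r • y)), h2, smul_smul, pow_succ, mul_inv, mul_comm]

theorem fderiv_self (hf : ∀ r > 0, ∀ y ≠ 0, f (r • y) = (r ^ k)⁻¹ * f y) {y : E3} (hy : y ≠ 0)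
    (hd : DiffAt f y) : 𝒟 f y y = -(k * f y) := by
  have h1 := hasDerivAt_line hd y
  have h2 : HasDerivAt (fun s : ℝ => ((1 + s) ^ k)⁻¹ * f y) (-(k * f y)) 0 := by
    have e1 : HasDerivAt (fun s : ℝ => (1 + s) ^ k) (k : ℝ) 0 := by
      simpa using ((hasDerivAt_id (0 : ℝ)).const_add 1).fun_pow k
    have e2 := (e1.fun_inv (by simp)).mul_const (f y)
    simpa using e2
  refine h1.unique (h2.congr_of_eventuallyEq ?_)
  filter_upwards [eventually_gt_nhds (show (-1 : ℝ) < 0 by norm_num)] with s hs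
  rw [← hf (1 + s) (by linarith) y hy, add_smul, one_smul]

theorem isBigO_homogeneous (hf : ∀ r > 0, ∀ y ≠ 0, f (r • y) = (r ^ k)⁻¹ * f y)
    (hc : ∀ y ≠ 0, ContinuousAt f y) : f =O[Bornology.cobounded E3] fun z => (‖z‖ ^ k)⁻¹ := by
  obtain ⟨C, hC⟩ := (isCompact_sphere (0 : E3) 1).exists_bound_of_continuousOn (f := f) fun n hn =>
    (hc n (fun h => by simp [h] at hn)).continuousWithinAt
  refine Asymptotics.IsBigO.of_bound C ?_
  filter_upwards [tendsto_norm_cobounded_atTop.eventually_gt_atTop 0] with z hz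
  obtain ⟨e1, e2⟩ := exists_unit_smul (norm_pos_iff.1 hz)
  have h1 := hf ‖z‖ hz (‖z‖⁻¹ • z) (fun h => by simp [h] at e1)
  rw [e2] at h1
  rw [h1, norm_mul, mul_comm]
  exact mul_le_mul_of_nonneg_right (hC _ (by simpa using e1)) (norm_nonneg _)

theorem integrable_sphere (hc : ∀ y ≠ 0, ContinuousAt f y) :
    Integrable (fun n : Metric.sphere (0 : E3) 1 => f n) (volume : Measure E3).toSphere := by
  refine Continuous.integrable_of_hasCompactSupport (continuous_iff_continuousAt.2 fun n => ?_)
    (HasCompactSupport.of_compactSpace _)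
  exact ContinuousAt.comp (g := f) (hc n (ne_zero_of_mem_unit_sphere n)) continuous_subtype_val.continuousAt

theorem tendsto_integral_sphere {G : E3 → ℝ} (hG : (fun z => G z - f z) =O[Bornology.cobounded E3]
    fun z => (‖z‖ ^ 2)⁻¹) (hf : ∀ r > 0, ∀ y ≠ 0, f (r • y) = (r ^ 1)⁻¹ * f y)
    (hc : ∀ y ≠ 0, ContinuousAt f y) (hm : Measurable G) :
    Tendsto (fun ρ : ℝ => ∫ n : Metric.sphere (0 : E3) 1, ρ * G (ρ • (n : E3))
      ∂(volume : Measure E3).toSphere) atTop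
      (𝓝 (∫ n : Metric.sphere (0 : E3) 1, f n ∂(volume : Measure E3).toSphere)) := by
  obtain ⟨C, hC, hb⟩ := hG.exists_pos
  obtain ⟨r₀, -, hr⟩ := (hasBasis_cobounded_norm (E := E3)).eventually_iff.1 hb.bound
  have key : ∀ ρ : ℝ, max r₀ 1 ≤ ρ → ∀ n : Metric.sphere (0 : E3) 1,
      ‖ρ * G (ρ • (n : E3)) - f n‖ ≤ C * ρ⁻¹ := by
    intro ρ hρ n
    have h0 : 0 < ρ := by linarith [le_max_right r₀ 1]
    have hn : ‖(n : E3)‖ = 1 := by simpa using n.2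
    have hnorm : ‖ρ • (n : E3)‖ = ρ := by rw [norm_smul, hn, mul_one, norm_of_nonneg h0.le]
    have h1 := hr (show r₀ ≤ ‖ρ • (n : E3)‖ by rw [hnorm]; exact (le_max_left _ _).trans hρ)
    rw [hnorm, hf ρ h0 n (ne_zero_of_mem_unit_sphere n)] at h1
    have e : ρ * G (ρ • (n : E3)) - f n = ρ * (G (ρ • (n : E3)) - (ρ ^ 1)⁻¹ * f n) := by field_simp
    rw [e, norm_mul, norm_of_nonneg h0.le]
    refine (mul_le_mul_of_nonneg_left h1 h0.le).trans (le_of_eq ?_)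
    rw [norm_of_nonneg (by positivity)]
    field_simp
  refine tendsto_integral_filter_of_dominated_convergence (fun n : Metric.sphere (0 : E3) 1 => ‖f n‖ + C)
    (.of_forall fun ρ => ?_) ?_ ((integrable_sphere hc).norm.add (integrable_const C)) ?_
  · exact ((hm.comp (by fun_prop : Measurable fun n : Metric.sphere (0 : E3) 1 =>
      ρ • (n : E3))).const_mul ρ).aestronglyMeasurable
  · filter_upwards [eventually_ge_atTop (max r₀ 1)] with ρ hρ
    refine .of_forall fun n => ?_
    have h1 := key ρ hρ n
    have h2 : ρ⁻¹ ≤ 1 := inv_le_one_of_one_le₀ ((le_max_right _ _).trans hρ)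
    have h3 := norm_le_insert' (ρ * G (ρ • (n : E3))) (f n)
    nlinarith
  · refine .of_forall fun n => ?_
    rw [tendsto_iff_norm_sub_tendsto_zero]
    refine squeeze_zero' (.of_forall fun _ => norm_nonneg _)
      ((eventually_ge_atTop (max r₀ 1)).mono fun ρ hρ => key ρ hρ n) ?_
    simpa using tendsto_inv_atTop_zero.const_mul C

theorem fderiv_radial {κ : ℝ → ℝ} (hκ : Smooth κ) (y w : E3) :
    𝒟 (fun y : E3 => κ (‖y‖ ^ 2)) y w = 2 * deriv κ (‖y‖ ^ 2) * inner ℝ y w := by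
  have e1 := (hκ.differentiable (by simp) (‖y‖ ^ 2)).hasDerivAt
  have e2 := e1.comp_hasFDerivAt (f := fun y : E3 => ‖y‖ ^ 2) y (hasStrictFDerivAt_norm_sq y).hasFDerivAt
  rw [show (fun y : E3 => κ (‖y‖ ^ 2)) = κ ∘ fun y : E3 => ‖y‖ ^ 2 from rfl, e2.fderiv]
  simp
  ring

theorem fderiv_radial_single {κ : ℝ → ℝ} (hκ : Smooth κ) (y : E3) (l : Fin 3) :
    𝒟 (fun y : E3 => κ (‖y‖ ^ 2)) y (axis l) = 2 * deriv κ (‖y‖ ^ 2) * y l := by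
  rw [fderiv_radial hκ]
  simp [EuclideanSpace.inner_single_right]

theorem contDiff_radial {κ : ℝ → ℝ} (hκ : Smooth κ) : Smooth fun y : E3 => κ (‖y‖ ^ 2) :=
  hκ.comp (contDiff_norm_sq ℝ)

theorem hasCompactSupport_radial {κ : ℝ → ℝ} {a : ℝ} (h : ∀ s, a ≤ s → κ s = 0) :
    HasCompactSupport fun y : E3 => κ (‖y‖ ^ 2) := by
  refine HasCompactSupport.intro (isCompact_closedBall (0 : E3) (max a 1)) fun y hy => h _ ?_
  rw [mem_closedBall_zero_iff, not_le] at hy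
  nlinarith [le_max_left a 1, le_max_right a 1]

theorem eventually_radial {κ : ℝ → ℝ} {c : ℝ} (h : ∀ᶠ s in 𝓝 0, κ s = c) :
    ∀ᶠ y : E3 in 𝓝 0, κ (‖y‖ ^ 2) = c := by
  have : Tendsto (fun y : E3 => ‖y‖ ^ 2) (𝓝 0) (𝓝 0) := by
    simpa using (by fun_prop : Continuous fun y : E3 => ‖y‖ ^ 2).tendsto 0
  exact this.eventually h

theorem continuous_mul_of_vanish {u h : E3 → ℝ} (hu : Continuous u) (h0 : ∀ᶠ y in 𝓝 0, u y = 0)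
    (hh : ∀ y ≠ 0, ContinuousAt h y) : Continuous fun y => u y * h y := by
  refine continuous_iff_continuousAt.2 fun y => ?_
  by_cases hy : y = 0
  · subst hy
    exact continuousAt_const.congr (h0.mono fun z hz => show (0 : ℝ) = u z * h z by rw [hz, zero_mul])
  · exact hu.continuousAt.mul (hh y hy)

/-- A function that is homogeneous of degree `-1` and weakly harmonic is a Coulomb potential. -/
theorem eq_coulomb {h : E3 → ℝ} (hs : ∀ y ≠ 0, SmoothAt h y)
    (hom : ∀ r > 0, ∀ y ≠ 0, h (r • y) = (r ^ 1)⁻¹ * h y)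
    (hw : ∀ b : E3 → ℝ, Smooth b → HasCompactSupport b → (∀ᶠ y in 𝓝 0, b y = 0) →
      ∑ l : Fin 3, ∫ y, 𝒟 b y (axis l) * 𝒟 h y (axis l) = 0) :
    ∃ q, ∀ y ≠ 0, h y = q / ‖y‖ := by
  have hd : ∀ y ≠ 0, DiffAt h y := fun y hy => (hs y hy).diff
  have hds : ∀ y ≠ 0, SmoothAt (𝒟 h) y := fun y hy => (hs y hy).fderiv_right (by simp)
  set v : E3 → ℝ := fun y => ‖y‖ * h y with hv
  have hvs : ∀ y ≠ 0, SmoothAt v y := fun y hy => (contDiffAt_norm ℝ hy).mul (hs y hy)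
  have hvd : ∀ y ≠ 0, ∀ l : Fin 3, 𝒟 v y (axis l) = ‖y‖ * 𝒟 h y (axis l) + h y * (y l / ‖y‖) := by
    intro y hy l
    have hn : HasFDerivAt (fun y : E3 => ‖y‖) ((1 / (2 * ‖y‖)) • (2 • innerSL ℝ y)) y := by
      have := ((hasStrictFDerivAt_norm_sq y).hasFDerivAt).sqrt (by simpa using hy)
      simpa only [Real.sqrt_sq (norm_nonneg _)] using this
    rw [(hn.fun_mul (hd y hy).hasFDerivAt).fderiv]
    have : ‖y‖ ≠ 0 := norm_ne_zero_iff.2 hy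
    simp [EuclideanSpace.inner_single_right]
    field_simp
    simp
  set G : E3 → ℝ := fun y => ‖y‖ * ∑ l : Fin 3, 𝒟 h y (axis l) ^ 2 -
    h y ^ 2 / ‖y‖ with hG
  have hGv : ∀ y ≠ 0, ‖y‖ * G y = ∑ l : Fin 3, 𝒟 v y (axis l) ^ 2 := by
    intro y hy
    have hn : ‖y‖ ≠ 0 := norm_ne_zero_iff.2 hy
    have e1 := fderiv_self hom hy (hd y hy)
    rw [clm_eq_sum] at e1
    have e2 := EuclideanSpace.real_norm_sq_eq y
    simp only [hvd y hy, add_sq, mul_pow, div_pow, sum_add_distrib, ← mul_sum,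
      ← Finset.sum_div, ← e2]
    have e3 : ∑ l : Fin 3, 2 * (‖y‖ * 𝒟 h y (axis l)) * (h y * (y l / ‖y‖)) =
        2 * h y * ∑ l : Fin 3, y l * 𝒟 h y (axis l) := by
      rw [mul_sum]
      refine sum_congr rfl fun l _ => ?_
      field_simp
    rw [e3, e1, hG]
    simp only
    field_simp
    push_cast
    ring
  have hG0 : ∀ y ≠ 0, 0 ≤ G y := fun y hy => by
    have h1 : 0 ≤ ‖y‖ * G y := by rw [hGv y hy]; exact Finset.sum_nonneg fun l _ => sq_nonneg _
    exact nonneg_of_mul_nonneg_right h1 (norm_pos_iff.2 hy)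
  have hGc : ∀ y ≠ 0, ContinuousAt G y := fun y hy => by
    have e1 : ∀ l : Fin 3, ContinuousAt (fun y => 𝒟 h y (axis l)) y := fun l =>
      (hds y hy).continuousAt.clm_apply continuousAt_const
    have e2 : ContinuousAt (fun y => ∑ l : Fin 3, 𝒟 h y (axis l) ^ 2) y :=
      tendsto_finsetSum _ fun l _ => (e1 l).pow 2
    exact (continuous_norm.continuousAt.mul e2).sub (((hs y hy).continuousAt.pow 2).div
      continuous_norm.continuousAt (norm_ne_zero_iff.2 hy))
  set κ : ℝ → ℝ := fun s => profile s * (1 - profile (4 * s)) with hκ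
  have hκs : Smooth κ := contDiff_profile.mul
    (contDiff_const.sub (contDiff_profile.comp (contDiff_const.mul contDiff_id)))
  have hκ2 : ∀ s, 2 ≤ s → κ s = 0 := fun s h => by simp [hκ, profile_of_ge h]
  have hκ0 : ∀ᶠ s in 𝓝 0, κ s = 0 := by
    filter_upwards [eventually_lt_nhds (show (0 : ℝ) < 1 / 4 by norm_num)] with s h
    simp [hκ, profile_of_le (show 4 * s ≤ 1 by linarith)]
  have hκn : ∀ s, 0 ≤ κ s := fun s => mul_nonneg (Real.smoothTransition.nonneg _)
    (sub_nonneg.2 (Real.smoothTransition.le_one _))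
  have hκ1 : κ 1 = 1 := by simp [hκ, profile_of_le le_rfl, profile_of_ge (show (2 : ℝ) ≤ 4 by norm_num)]
  have hκ' : ∀ᶠ s in 𝓝 0, deriv κ s = 0 := by
    filter_upwards [hκ0.eventually_nhds] with s hs
    have : κ =ᶠ[𝓝 s] fun _ => 0 := hs
    rw [this.deriv_eq]; simp
  have hR := contDiff_radial hκs
  have hRc := hasCompactSupport_radial hκ2
  have hR0 := eventually_radial hκ0
  set b : E3 → ℝ := fun y => κ (‖y‖ ^ 2) * v y with hb
  have hbs : Smooth b := by
    refine contDiff_iff_contDiffAt.2 fun y => ?_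
    by_cases hy : y = 0
    · subst hy
      exact contDiffAt_const.congr_of_eventuallyEq
        (hR0.mono fun z hz => show b z = (0 : ℝ) by simp only [hb, hz, zero_mul])
    · exact hR.contDiffAt.mul (hvs y hy)
  have hbc : HasCompactSupport b := hRc.mul_right
  have hb0 : ∀ᶠ y in 𝓝 0, b y = 0 := hR0.mono fun z hz => by simp only [hb, hz, zero_mul]
  have hint : ∀ l : Fin 3, Integrable fun y => 𝒟 b y (axis l) * 𝒟 h y (axis l) := fun l =>
    (integral_mul_fderiv (u := fun y => 𝒟 b y (axis l))
      ((hbs.fderiv_right (m := ∞) (by simp)).clm_apply contDiff_const) (hbc.fderiv_apply (𝕜 := ℝ) _) (by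
        filter_upwards [hb0.eventually_nhds] with y hy
        have : b =ᶠ[𝓝 y] fun _ => 0 := hy
        rw [this.fderiv_eq]
        simp) hs _).2.1
  have hpt : ∀ y, ∑ l : Fin 3, 𝒟 b y (axis l) * 𝒟 h y (axis l) =
      -(2 * deriv κ (‖y‖ ^ 2) * (‖y‖ * h y ^ 2)) + κ (‖y‖ ^ 2) * G y := by
    intro y
    by_cases hy : y = 0
    · subst hy
      have : b =ᶠ[𝓝 0] fun _ => 0 := hb0
      rw [this.fderiv_eq]
      have h1 := hκ0.self_of_nhds
      simp [h1]
    · have hn : ‖y‖ ≠ 0 := norm_ne_zero_iff.2 hy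
      have e1 := fderiv_self hom hy (hd y hy)
      rw [clm_eq_sum] at e1
      have e2 : ∀ l : Fin 3, 𝒟 b y (axis l) * 𝒟 h y (axis l) =
          (2 * deriv κ (‖y‖ ^ 2) * v y + κ (‖y‖ ^ 2) * h y / ‖y‖) * (y l * 𝒟 h y (axis l)) +
          κ (‖y‖ ^ 2) * ‖y‖ * 𝒟 h y (axis l) ^ 2 := fun l => by
        rw [hb, fderiv_fun_mul (hR.differentiable (by simp) y) (hvs y hy).diff]
        simp only [ContinuousLinearMap.add_apply, ContinuousLinearMap.smul_apply, smul_eq_mul,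
          fderiv_radial_single hκs, hvd y hy l]
        ring
      simp only [e2, sum_add_distrib, ← mul_sum, e1, hG, hv]
      field_simp
      push_cast
      ring
  have hi1 : Integrable fun y : E3 => 2 * deriv κ (‖y‖ ^ 2) * (‖y‖ * h y ^ 2) := by
    have hκd : Continuous (deriv κ) := hκs.continuous_deriv (by simp)
    refine Continuous.integrable_of_hasCompactSupport (continuous_mul_of_vanish (by fun_prop) ?_ ?_) ?_
    · exact (eventually_radial hκ').mono fun y hy => by rw [hy, mul_zero]
    · exact fun y hy => continuous_norm.continuousAt.mul ((hs y hy).continuousAt.pow 2)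
    · have hk3 : ∀ s, 3 ≤ s → deriv κ s = 0 := fun s hs => by
        have : κ =ᶠ[𝓝 s] fun _ => 0 :=
          (eventually_gt_nhds (show (2 : ℝ) < s by linarith)).mono fun z hz => hκ2 z hz.le
        rw [this.deriv_eq]; simp
      exact (HasCompactSupport.mul_left (f := fun _ => 2) (hasCompactSupport_radial hk3)).mul_right
  have hGcont : Continuous fun y : E3 => κ (‖y‖ ^ 2) * G y :=
    continuous_mul_of_vanish hR.continuous hR0 hGc
  have hGsupp : HasCompactSupport fun y : E3 => κ (‖y‖ ^ 2) * G y := hRc.mul_right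
  have hzero : ∫ y : E3, κ (‖y‖ ^ 2) * G y = 0 := by
    have h1 := hw b hbs hbc hb0
    rw [← integral_finsetSum _ fun l _ => hint l] at h1
    simp only [hpt] at h1
    rw [integral_add (f := fun y : E3 => -(2 * deriv κ (‖y‖ ^ 2) * (‖y‖ * h y ^ 2))) hi1.neg (hGcont.integrable_of_hasCompactSupport hGsupp), integral_neg,
      integral_radial hκs hκ2 fun r hr n hn => ?_, hκ0.self_of_nhds] at h1
    · simpa using h1
    · rw [hom r hr n (fun h => by simp [h] at hn), norm_smul, hn, norm_of_nonneg hr.le]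
      field_simp
  have hnn : 0 ≤ fun y : E3 => κ (‖y‖ ^ 2) * G y := fun y => by
    by_cases hy : y = 0
    · simp [hy, hκ0.self_of_nhds]
    · exact mul_nonneg (hκn _) (hG0 y hy)
  have hunit : ∀ n : E3, ‖n‖ = 1 → 𝒟 v n = 0 := by
    intro n hn
    have hn0 : n ≠ 0 := fun h => by simp [h] at hn
    have h1 : G n = 0 := by
      by_contra hne
      have := hGcont.integral_pos_of_hasCompactSupport_nonneg_nonzero (μ := volume) (x := n) hGsupp hnn
        (by simpa [hn, hκ1] using hne)
      exact this.ne' hzero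
    have h2 := hGv n hn0
    rw [h1, mul_zero, eq_comm, Finset.sum_eq_zero_iff_of_nonneg fun l _ => sq_nonneg _] at h2
    ext w
    rw [clm_eq_sum]
    refine sum_eq_zero fun l hl => ?_
    rw [pow_eq_zero_iff (by norm_num) |>.1 (h2 l hl), mul_zero]
  have hvhom : ∀ r > 0, ∀ y ≠ 0, v (r • y) = (r ^ 0)⁻¹ * v y := fun r hr y hy => by
    simp only [hv, hom r hr y hy, norm_smul, norm_of_nonneg hr.le]
    field_simp
  have hall : ∀ y ≠ 0, 𝒟 v y = 0 := fun y hy => by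
    obtain ⟨e1, e2⟩ := exists_unit_smul hy
    have h0 : ‖y‖⁻¹ • y ≠ 0 := fun h => by simp [h] at e1
    have := fderiv_homogeneous hvhom h0 (hvs _ h0).diff (norm_pos_iff.2 hy)
    rw [e2, hunit _ e1, smul_zero] at this
    exact this
  have hconn : IsConnected ({0}ᶜ : Set E3) :=
    isConnected_compl_singleton_of_one_lt_rank (by rw [← Module.finrank_eq_rank]; simp) 0
  obtain ⟨q, hq⟩ := isOpen_compl_singleton.exists_is_const_of_fderiv_eq_zero hconn.isPreconnected
    (fun y hy => (hvs y hy).diff.differentiableWithinAt) hall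
  refine ⟨q, fun y hy => ?_⟩
  rw [eq_div_iff (norm_ne_zero_iff.2 hy), ← hq y hy, mul_comm]

end Homogeneous

/-! ### The mass and the charge of the body exterior fields -/

section ExteriorMass

variable {U : Set STPoint} {R Λ : ℝ} {Φ : ℝ → STPoint → Val} {t₀ : ℝ} {ρ : STPoint → ℝ}
  {Ψ : STPoint → Val} {E : Jet 2 → Val} {b : Tensor} {A : Mat4}

theorem pullback_mulVec (A : Mat4) (Ψ : STPoint → Val) (x : STPoint) :
    pullback (fun y => A *ᵥ y) Ψ x = frameV A (Ψ (A *ᵥ x)) := by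
  have h : ∀ μ ρ, pd μ (fun y => A *ᵥ y) x ρ = A ρ μ := fun μ ρ => by
    have : 𝒟 (fun y => A *ᵥ y) x = LinearMap.toContinuousLinearMap A.mulVecLin :=
      (LinearMap.toContinuousLinearMap A.mulVecLin).fderiv
    rw [pd, this]
    simp
  refine Prod.ext ?_ rfl
  ext μ ν
  simp only [pullback, h, frameV_fst]

theorem IsSmallBodyFamily.exterior_asymptotics (hF : IsSmallBodyFamily E U R Λ Φ) (ht : t₀ ∈ times U)
    (hA : IsInertialFrame b A) (hΨ : IsBodyExterior R Φ t₀ Ψ) (ℓ : Val →L[ℝ] ℝ) :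
    (fun z : E3 => ℓ (Ψ (A *ᵥ pt 0 z)) - ℓ (Φ 0 (worldline t₀)) - ℓ (leadS A Φ t₀ z))
      =O[Bornology.cobounded E3] (fun z => (‖z‖ ^ 2)⁻¹) ∧
    ∀ α, (fun z : E3 => pd α (fun x => ℓ (Ψ (A *ᵥ x))) (pt 0 z) -
      𝒟 (fun y => ℓ (leadS A Φ t₀ y)) z (spat (Pi.single α 1)))
      =O[Bornology.cobounded E3] (fun z => (‖z‖ ^ 3)⁻¹) := by
  obtain ⟨C, hC⟩ := hF.exterior_expansion ht hA hΨ ℓ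
  obtain ⟨r₀, -, hr⟩ := (hasBasis_cobounded_norm (E := E3)).eventually_iff.1 hC
  have hstat : ∀ x, r₀ ≤ ‖spat x‖ → Ψ (A *ᵥ x) = Ψ (pt 0 (spaceMap A (spat x))) := fun x hx => by
    rw [← pt_spat (A *ᵥ x), hA.spat_mulVec]
    exact (hr hx).2.1 _
  constructor
  · refine Asymptotics.IsBigO.of_bound C ?_
    filter_upwards [hC, tendsto_norm_cobounded_atTop.eventually_ge_atTop r₀] with z hz hz0
    rw [hstat _ (by rwa [spat_pt]), spat_pt, ← map_sub, ← map_sub,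
      norm_of_nonneg (by positivity : 0 ≤ (‖z‖ ^ 2)⁻¹)]
    exact hz.2.2.2.1
  · intro α
    refine Asymptotics.IsBigO.of_bound (C * ‖spat (Pi.single α 1)‖) ?_
    filter_upwards [hC, tendsto_norm_cobounded_atTop.eventually_gt_atTop r₀,
      tendsto_norm_cobounded_atTop.eventually_gt_atTop 0] with z hz hz0 hz1
    set err : E3 → ℝ := fun z => ℓ (Ψ (pt 0 (spaceMap A z)) - Φ 0 (worldline t₀) - leadS A Φ t₀ z)
    have h1 : (fun x => ℓ (Ψ (A *ᵥ x))) =ᶠ[𝓝 (pt 0 z)]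
        fun x => err (spatL x) + ℓ (Φ 0 (worldline t₀)) + ℓ (leadS A Φ t₀ (spatL x)) := by
      have h2 : ∀ᶠ x in 𝓝 (pt 0 z), r₀ < ‖spat x‖ :=
        continuous_spat.norm.continuousAt.eventually_const_lt (by simpa only [spat_pt] using hz0)
      filter_upwards [h2] with x hx
      rw [hstat x hx.le, spatL_apply]
      simp only [err, map_sub]
      ring
    have h3 : DiffAt (fun y => ℓ (leadS A Φ t₀ y)) z := ℓ.differentiableAt.comp z
        (hF.contDiffAt_leadS ht hA (norm_pos_iff.1 hz1)).diff
    have h4 : HasFDerivAt (fun y => err y + ℓ (Φ 0 (worldline t₀)) + ℓ (leadS A Φ t₀ y))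
        (𝒟 err z + 𝒟 (fun y => ℓ (leadS A Φ t₀ y)) z) (spatL (pt 0 z)) := by
      rw [spatL_apply, spat_pt]
      exact (hz.2.2.1.hasFDerivAt.add_const _).add h3.hasFDerivAt
    have h5 : HasFDerivAt (fun x => err (spatL x) + ℓ (Φ 0 (worldline t₀)) + ℓ (leadS A Φ t₀ (spatL x))) _
      (pt 0 z) := h4.comp (pt 0 z) spatL.hasFDerivAt
    rw [pd_congr h1, pd, h5.fderiv]
    simp only [ContinuousLinearMap.comp_apply, ContinuousLinearMap.add_apply, spatL_apply, add_sub_cancel_right]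
    refine (ContinuousLinearMap.le_opNorm _ _).trans ?_
    rw [norm_of_nonneg (by positivity : 0 ≤ (‖z‖ ^ 3)⁻¹), mul_right_comm]
    exact mul_le_mul_of_nonneg_right hz.2.2.2.2 (norm_nonneg _)

theorem isBigO_inv_pow {k m : ℕ} (h : k ≤ m) :
    (fun z : E3 => (‖z‖ ^ m)⁻¹) =O[Bornology.cobounded E3] fun z => (‖z‖ ^ k)⁻¹ := by
  refine Asymptotics.IsBigO.of_bound 1 ?_
  filter_upwards [tendsto_norm_cobounded_atTop.eventually_ge_atTop 1] with z hz
  rw [one_mul, norm_of_nonneg (by positivity), norm_of_nonneg (by positivity)]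
  exact inv_anti₀ (by positivity) (pow_le_pow_right₀ hz h)

/-- The mass and the charge of a family of Einstein-scalar theory are the ADM mass and the scalar
charge of its body exterior fields. -/
theorem IsSmallBodyFamily.hasADMMass_hasScalarCharge (hF : IsSmallBodyFamily esOperator U R Λ Φ)
    (hρ : IsCutoff ρ 1) (ht : t₀ ∈ times U) (hA : IsInertialFrame (Φ 0 (worldline t₀)).1 A)
    (hΨ : IsBodyExterior R Φ t₀ Ψ) :
    HasADMMass (fun x => (pullback (fun y => A *ᵥ y) Ψ x).1) (mass esOperator Φ ρ t₀) ∧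
    HasScalarCharge (fun x => (pullback (fun y => A *ᵥ y) Ψ x).2) (Φ 0 (worldline t₀)).2
      (charge esOperator Φ ρ t₀) := by
  have hsm : ∀ (ℓ : Val →L[ℝ] ℝ), ∀ y ≠ 0, SmoothAt (fun y => ℓ (leadS A Φ t₀ y)) y :=
    fun ℓ y hy => ℓ.contDiff.contDiffAt.comp y (hF.contDiffAt_leadS ht hA hy)
  have hd : ∀ (ℓ : Val →L[ℝ] ℝ), ∀ y ≠ 0, DiffAt (fun y => ℓ (leadS A Φ t₀ y)) y :=
    fun ℓ y hy => (hsm ℓ y hy).diff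
  have hdc : ∀ (ℓ : Val →L[ℝ] ℝ) (w : E3), ∀ y ≠ 0,
      ContinuousAt (fun y => 𝒟 (fun y => ℓ (leadS A Φ t₀ y)) y w) y := fun ℓ w y hy =>
    ((hsm ℓ y hy).fderiv_right (m := ∞) (by simp)).continuousAt.clm_apply continuousAt_const
  obtain ⟨e, he, -⟩ := hA.exists_equiv
  have hom : ∀ (ℓ : Val →L[ℝ] ℝ), ∀ r > 0, ∀ y ≠ 0, ℓ (leadS A Φ t₀ (r • y)) =
      (r ^ 1)⁻¹ * ℓ (leadS A Φ t₀ y) := fun ℓ r hr y hy => by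
    rw [leadS, map_smul, hF.lead_smul ht (by rw [← he]; simpa using hy) hr, map_smul, smul_eq_mul, pow_one]
    rfl
  have homd : ∀ (ℓ : Val →L[ℝ] ℝ) (w : E3), ∀ r > 0, ∀ y ≠ 0,
      𝒟 (fun y => ℓ (leadS A Φ t₀ y)) (r • y) w =
        (r ^ 2)⁻¹ * 𝒟 (fun y => ℓ (leadS A Φ t₀ y)) y w := fun ℓ w r hr y hy => by
    rw [fderiv_homogeneous (hom ℓ) hy (hd ℓ y hy) hr]; rfl
  have hp0 : ∀ᶠ s in 𝓝 (0 : ℝ), profile s = 1 :=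
    (eventually_lt_nhds one_pos).mono fun s hs => profile_of_le (le_of_lt hs)
  have hmaster := hF.mass_charge_eq (A := A) hρ ht hA (contDiff_radial contDiff_profile)
    (hasCompactSupport_radial fun s => profile_of_ge) (eventually_radial hp0)
  have hrad : ∀ w : E3 → ℝ, (∀ r > 0, ∀ n : E3, ‖n‖ = 1 → w (r • n) = r⁻¹ * w n) →
      ∫ y, 2 * deriv profile (‖y‖ ^ 2) * w y =
        -∫ n : Metric.sphere (0 : E3) 1, w n ∂(volume : Measure E3).toSphere := fun w hw => by
    rw [integral_radial contDiff_profile (fun s => profile_of_ge) hw, hp0.self_of_nhds]; ring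
  simp only [one_mul] at hmaster
  have hexp := fun ℓ => hF.exterior_asymptotics ht hA hΨ ℓ
  simp only [pullback_mulVec]
  refine ⟨⟨fun e f => ?_, fun α e f => ?_, ?_⟩, ?_⟩
  · have hb : frameMetric A e f (Φ 0 (worldline t₀)) =
        (Matrix.diagonal ![-1, 1, 1, 1] : Mat4) e f := by
      rw [← hA.1, frameMetric_apply, frameV_fst, mul_apply]
      simp only [mul_apply, transpose_apply, of_apply, sum_mul]
      rw [sum_comm]
      exact sum_congr₂
    have h1 := ((hexp (frameMetric A e f)).1.trans (isBigO_inv_pow one_le_two)).add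
      (isBigO_homogeneous (hom (frameMetric A e f)) fun y hy => (hsm _ y hy).continuousAt)
    simp only [pow_one, sub_add_cancel, hb] at h1
    exact h1
  · have h1 := (((hexp (frameMetric A e f)).2 α).trans (isBigO_inv_pow (Nat.le_succ 2))).add
      (isBigO_homogeneous (homd (frameMetric A e f) (spat (Pi.single α 1))) (hdc _ _))
    simp only [sub_add_cancel] at h1
    exact h1
  · have hsymm : ∀ (e f : Fin 4), ∀ y ≠ 0, 𝒟 (fun y => frameMetric A e f (leadS A Φ t₀ y)) y =
        𝒟 (fun y => frameMetric A f e (leadS A Φ t₀ y)) y := fun e f y hy => by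
      refine Filter.EventuallyEq.fderiv_eq ?_
      filter_upwards [eventually_ne_nhds hy] with z hz
      have hz' : spaceMap A z ≠ 0 := by rw [← he]; simpa using hz
      rw [frameMetric_apply, frameMetric_apply, frameV_fst, frameV_fst, sum_comm]
      refine sum_congr₂ fun μ ν => ?_
      rw [leadS, hF.lead_symm ht hz' ν μ, mul_comm (A ν e)]
    set w : Fin 3 → Fin 3 → E3 → ℝ := fun i l y =>
      (𝒟 (fun y => frameMetric A i.succ l.succ (leadS A Φ t₀ y)) y (axis l) -
        𝒟 (fun y => frameMetric A l.succ l.succ (leadS A Φ t₀ y)) y (axis i)) * y i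
      with hw
    have hwhom : ∀ i l, ∀ r > 0, ∀ y ≠ 0, w i l (r • y) = (r ^ 1)⁻¹ * w i l y := fun i l r hr y hy => by
      simp only [hw, homd _ _ r hr y hy, PiLp.smul_apply, smul_eq_mul]
      field_simp
    have hwc : ∀ i l, ∀ y ≠ 0, ContinuousAt (w i l) y := fun i l y hy =>
      ((hdc _ _ y hy).sub (hdc _ _ y hy)).mul (by fun_prop : ContinuousAt (fun y : E3 => y i) y)
    have hm : ∀ i l : Fin 3, ∫ y, 𝒟 (fun y : E3 => profile (‖y‖ ^ 2)) y (axis i) *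
        (𝒟 (fun y => frameMetric A l.succ i.succ (leadS A Φ t₀ y)) y (axis l) -
          𝒟 (fun y => frameMetric A l.succ l.succ (leadS A Φ t₀ y)) y (axis i)) =
        -∫ n : Metric.sphere (0 : E3) 1, w i l n ∂(volume : Measure E3).toSphere := fun i l => by
      rw [← hrad (w i l) fun r hr n hn => by
        rw [hwhom i l r hr n (fun h => by simp [h] at hn), pow_one]]
      refine integral_congr (fun y => ?_)
      simp only [fderiv_radial_single contDiff_profile, hw]
      by_cases hy : y = 0
      · simp [hy]
      · rw [hsymm l.succ i.succ y hy]; ring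
    have hmass := hmaster.1
    simp only [hm, sum_neg_distrib, neg_neg] at hmass
    set G : E3 → ℝ := fun z => ∑ i : Fin 3, ∑ k : Fin 3,
      (pd k.succ (fun y => frameMetric A i.succ k.succ (Ψ (A *ᵥ y))) (pt 0 z) -
        pd i.succ (fun y => frameMetric A k.succ k.succ (Ψ (A *ᵥ y))) (pt 0 z)) * z i with hG
    have hGw : (fun z => G z - ∑ i, ∑ k, w i k z) =O[Bornology.cobounded E3] fun z => (‖z‖ ^ 2)⁻¹ := by
      have hc : ∀ i : Fin 3, (fun z : E3 => z i) =O[Bornology.cobounded E3] fun z => ‖z‖ := fun i =>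
        Asymptotics.IsBigO.of_bound 1 (.of_forall fun z => by simpa using PiLp.norm_apply_le z i)
      have h1 : ∀ i k : Fin 3, (fun z =>
          (pd k.succ (fun y => frameMetric A i.succ k.succ (Ψ (A *ᵥ y))) (pt 0 z) -
            pd i.succ (fun y => frameMetric A k.succ k.succ (Ψ (A *ᵥ y))) (pt 0 z)) * z i - w i k z)
          =O[Bornology.cobounded E3] fun z => (‖z‖ ^ 2)⁻¹ := fun i k => by
        have h2 := (((hexp (frameMetric A i.succ k.succ)).2 k.succ).sub
          ((hexp (frameMetric A k.succ k.succ)).2 i.succ)).mul (hc i)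
        simp only [spat_single_succ] at h2
        refine h2.congr' (.of_forall fun z => by simp only [hw]; ring) ?_
        filter_upwards [tendsto_norm_cobounded_atTop.eventually_gt_atTop 0] with z hz
        field_simp
      simp only [hG, ← sum_sub_distrib]
      exact Asymptotics.IsBigO.fun_sum fun i _ => Asymptotics.IsBigO.fun_sum fun k _ => h1 i k
    have hGm : Measurable G := by
      have hpt : Measurable fun z : E3 => pt 0 z :=
        (continuous_pt.comp (by fun_prop : Continuous fun z : E3 => ((0 : ℝ), z))).measurable
      exact Finset.measurable_sum _ fun i _ => Finset.measurable_sum _ fun k _ =>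
        (((measurable_fderiv_apply_const ℝ _ _).comp hpt).sub
          ((measurable_fderiv_apply_const ℝ _ _).comp hpt)).mul (by fun_prop)
    have hlim := tendsto_integral_sphere hGw (fun r hr y hy => by
      simp only [mul_sum, hwhom _ _ r hr y hy]) (fun y hy => tendsto_finsetSum _ fun i _ =>
        tendsto_finsetSum _ fun k _ => hwc i k y hy) hGm
    rw [integral_finsetSum _ fun i _ => integrable_finsetSum _ fun k _ => integrable_sphere (hwc i k)] at hlim
    simp only [integral_finsetSum _ fun k _ => integrable_sphere (hwc _ k)] at hlim
    rw [← hmass] at hlim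
    have h3 := hlim.const_mul (1 / (16 * Real.pi))
    rw [show 1 / (16 * Real.pi) * (16 * Real.pi * mass esOperator Φ ρ t₀) = mass esOperator Φ ρ t₀ by
      have := Real.pi_ne_zero
      field_simp] at h3
    refine h3.congr fun r => ?_
    congr 1
    refine integral_congr (fun n => ?_)
    simp only [hG, PiLp.smul_apply, smul_eq_mul, mul_sum]
    refine sum_congr₂ fun i k => ?_
    simp only [frameMetric_apply]
    ring
  · set ℓ := ContinuousLinearMap.snd ℝ (Tensor) ℝ with hℓ
    obtain ⟨q, hq⟩ := eq_coulomb (hsm ℓ) (hom ℓ) fun b hb hc h0 =>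
      (hF.mass_charge_eq hρ ht hA hb hc h0).2.symm.trans (zero_mul _)
    have hwc : ∀ l : Fin 3, ∀ y ≠ 0, ContinuousAt (fun y : E3 => y l *
        𝒟 (fun y => ℓ (leadS A Φ t₀ y)) y (axis l)) y := fun l y hy =>
      (by fun_prop : ContinuousAt (fun y : E3 => y l) y).mul (hdc _ _ y hy)
    have hm : ∀ l : Fin 3, ∫ y, 𝒟 (fun y : E3 => profile (‖y‖ ^ 2)) y (axis l) *
        𝒟 (fun y => (leadS A Φ t₀ y).2) y (axis l) =
        -∫ n : Metric.sphere (0 : E3) 1, (n : E3) l * 𝒟 (fun y => ℓ (leadS A Φ t₀ y)) n (axis l)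
            ∂(volume : Measure E3).toSphere := fun l => by
      rw [← hrad (fun y => y l * 𝒟 (fun y => ℓ (leadS A Φ t₀ y)) y (axis l)) fun r hr n hn => by
          rw [homd _ _ r hr n (fun h => by simp [h] at hn), PiLp.smul_apply, smul_eq_mul]
          field_simp]
      refine integral_congr (fun y => ?_)
      simp only [fderiv_radial_single contDiff_profile]
      exact mul_assoc _ _ _
    have hcharge := hmaster.2
    simp only [hm, sum_neg_distrib] at hcharge
    rw [← integral_finsetSum _ fun l _ => integrable_sphere (hwc l)] at hcharge
    have hn : ∀ n : Metric.sphere (0 : E3) 1, ∑ l : Fin 3, (n : E3) l *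
        𝒟 (fun y => ℓ (leadS A Φ t₀ y)) n (axis l) = -q := fun n => by
      have hn0 := ne_zero_of_mem_unit_sphere n
      rw [← clm_eq_sum, fderiv_self (hom ℓ) hn0 (hd ℓ _ hn0), hq _ hn0]
      simp
    have hvol : (volume : Measure E3).toSphere.real univ = 4 * Real.pi := by
      rw [Measure.toSphere_real_apply_univ, Measure.real, EuclideanSpace.volume_ball_fin_three]
      have := Real.pi_pos
      simp [ENNReal.toReal_ofReal (by positivity : 0 ≤ Real.pi * 4 / 3)]
      ring
    simp only [hn, integral_const, hvol, smul_eq_mul, mul_neg, neg_neg] at hcharge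
    have hqc : q = charge esOperator Φ ρ t₀ := mul_left_cancel₀ (by positivity) hcharge.symm
    refine (hexp ℓ).1.congr' ?_ (.of_forall fun _ => rfl)
    filter_upwards [tendsto_norm_cobounded_atTop.eventually_gt_atTop 0] with z hz
    rw [hq z (norm_pos_iff.1 hz), hqc]
    rfl

end ExteriorMass

end

end SmallBody

theorem mainTheorem2 :
    -- Einstein-scalar theory is a second-order diffeomorphism-covariant scalar-tensor theory
    IsScalarTensorTheory 2 esLagrangian esOperator ∧
    -- the small-body law in a general theory
    (∀ (k : ℕ) (L : Jet k → ℝ) (E : Jet 2 → Val), IsScalarTensorTheory k L E →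
      ∀ (U : Set STPoint) (R Λ : ℝ) (Φ : ℝ → STPoint → Val), IsSmallBodyFamily E U R Λ Φ →
        ∃ M q : ℝ → ℝ, ObeysSmallBodyLaw E U Φ M q) ∧
    -- in Einstein-scalar theory `M` and `q` are the ADM mass and the scalar charge of the body
    -- exterior fields, read off in any asymptotically inertial frame at rest with the body
    (∀ (U : Set STPoint) (R Λ : ℝ) (Φ : ℝ → STPoint → Val), IsSmallBodyFamily esOperator U R Λ Φ →
      ∃ M q : ℝ → ℝ, ObeysSmallBodyLaw esOperator U Φ M q ∧
        ∀ t₀, worldline t₀ ∈ U → ∀ Ψ : STPoint → Val, IsBodyExterior R Φ t₀ Ψ →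
          ∀ A : Matrix (Fin 4) (Fin 4) ℝ, IsInertialFrame (Φ 0 (worldline t₀)).1 A →
            HasADMMass (fun x => (pullback (fun y => A *ᵥ y) Ψ x).1) (M t₀) ∧
            HasScalarCharge (fun x => (pullback (fun y => A *ᵥ y) Ψ x).2)
              (Φ 0 (worldline t₀)).2 (q t₀)) ∧
    -- the laws of motion leave `q` free: every continuous function of proper time is the charge of
    -- a motion with arbitrary initial position, four-velocity and nonzero mass
    (∀ (U : Set STPoint) (Φ : STPoint → Val), IsOpen U → ContDiffOn ℝ ∞ Φ U →
      (∀ x ∈ U, IsLorentzian (Φ x).1) →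
      ∀ (q : ℝ → ℝ), Continuous q → ∀ (z₀ u₀ : STPoint) (M₀ : ℝ), z₀ ∈ U →
        (∑ a, ∑ b, (Φ z₀).1 a b * u₀ a * u₀ b = -1) → M₀ ≠ 0 →
        ∃ (ε : ℝ) (z : ℝ → STPoint) (M : ℝ → ℝ), 0 < ε ∧
          z 0 = z₀ ∧ deriv z 0 = u₀ ∧ M 0 = M₀ ∧
          ContDiffOn ℝ 2 z (Ioo (-ε) ε) ∧ ContDiffOn ℝ 1 M (Ioo (-ε) ε) ∧
          ∀ τ ∈ Ioo (-ε) ε, z τ ∈ U ∧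
            (∑ a, ∑ b, (Φ (z τ)).1 a b * deriv z τ a * deriv z τ b = -1) ∧
            ObeysMotionLaw Φ z M q τ) := by
  refine ⟨isScalarTensorTheory_es, fun k L E hT U R Λ Φ hF => ?_, fun U R Λ Φ hF => ?_,
    fun U Φ hU hΦ hL q hq z₀ u₀ M₀ hz₀ hu₀ hM₀ => exists_motion_of_charge hU hΦ hL hq hz₀ hu₀ hM₀⟩
  · obtain ⟨ρ, hρ⟩ := exists_isCutoff
    exact ⟨_, _, hT.obeysSmallBodyLaw hF hρ⟩
  · obtain ⟨ρ, hρ⟩ := exists_isCutoff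
    exact ⟨_, _, isScalarTensorTheory_es.obeysSmallBodyLaw hF hρ, fun t₀ ht Ψ hΨ A hA =>
      hF.hasADMMass_hasScalarCharge hρ ht hA hΨ⟩
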